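/- **Setup.** Let $k$ be a field with $\mathrm{char}(k)\neq 2$, and let $F$ be a finite separable commutative $k$-algebra with a $k$-algebra automorphism $\zeta$ of finite order $n$ such that $F^{\zeta}=k$. Let $V$ be a finitely generated $F$-module, and let $\theta$ be a $\zeta$-semilinear automorphism of $V$ with $\theta^{m}=\beta\cdot \mathrm{id}_V$, where $\beta\in k^\times$, $n\mid m$, and $m/n$ is invertible in $k$. Let $\sigma$ be a ring automorphism of $F$ with $\sigma^2=\mathrm{id}$ and $\sigma\zeta=\zeta\sigma$; it restricts to $k$. Let $\epsilon=\pm1$, and let $\langle\cdot,\cdot\rangle:V\times V\to F$ be a non-degenerate pairing, $F$-linear in the first variable, with $\langle x,y\rangle=\epsilon\,\sigma\langle y,x\rangle$ and $\langle\theta x,\theta y\rangle=c\,\zeta\langle x,y\rangle$, where $c\in F^\times$, $\sigma(c)=c$ and $\mathrm{Nm}_{F/k}(c)^{m/n}=\beta\sigma(\beta)$. Let $\xi\in F^\times$ with $\sigma(\xi)=\xi$ and $\mathrm{Nm}_{F/k}(\xi)^{m/n}=1$. Let $H$ be the algebraic group over $k^\sigma$ whose $R$-points are the $R\otimes_{k^\sigma}F$-linear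 automorphisms of $R\otimes_{k^\sigma}V$ that commute with $\theta$ and preserve the pairing. It acts by conjugation on the $k^\sigma$-vector space $$\mathfrak g(\xi)=\{\varphi\in \mathrm{End}_F(V):\ \theta\varphi\theta^{-1}=\xi\varphi,\ \langle\varphi x,y\rangle+\langle x,\varphi y\rangle=0\ \ \forall x,y\in V\}.$$ **The algebra and the quiver.** Let $A_\beta=F\langle\boldsymbol\theta\rangle/(\boldsymbol\theta^m-\beta)$, where $\boldsymbol\theta a=\zeta(a)\boldsymbol\theta$ for $a\in F$; $V$ is an $A_\beta$-module. Let $L_\beta=k[b]\cong k[\mathbf b]/(\mathbf b^{m/n}-\beta)$ be its center, $b=\boldsymbol\theta^n$, and write $L_\beta=\prod_{i\in I}L_i$ as a product of fields, $I=\mathrm{Spec}\,L_\beta$. Let $\bar\xi$ be the permutation of $I$ obtained by pulling back prime ideals along the $k$-automorphism $b\mapsto \mathrm{Nm}_{F/k}(\xi)b$ of $L_\beta$, and let $i\mapsto i^\dagger$ be the involution of $I$ induced by the automorphism $\sigma_c$ of $L_\beta$ that is $\sigma$ on $k$ and sends $b\mapsto\mathrm{Nm}_{F/k}(c)b^{-1}$.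 The directed graph $Q_\xi$ has vertex set $I$ and one arrow $i\to\bar\xi(i)$ for each $i\in I$; the involution reverses arrows, and $e^\dagger:\bar\xi(i)^\dagger\to i^\dagger$ denotes the dual of $e:i\to\bar\xi(i)$. Let $\underline\Pi$ be the set of orbits of $\dagger$ on the set of connected components of $Q_\xi$, and for $\alpha\in\underline\Pi$ let $Q_\xi^\alpha$ be the union of the components in $\alpha$. Let $V_i$ be the part of $V$ on which $L_\beta$ acts through $L_i$, so that $V=\bigoplus_iV_i$. Let $H^\alpha\subset H$ be the subgroup acting as the identity on $V_i$ for all $i\notin\alpha$, and let $\mathfrak g(\xi)^\alpha\subset\mathfrak g(\xi)$ be the subspace of the elements that vanish on $V_i$ for all $i\notin\alpha$. **Choices.** For each $i$ let $S_i$ be a simple $A_\beta$-module on which $L_\beta$ acts through $L_i$. Put $D_i=\mathrm{End}_{A_\beta}(S_i)^{\mathrm{opp}}$, an $L_i$-algebra acting on $S_i$ from the right, and $M_i=\mathrm{Hom}_{A_\beta}(S_i,V)$, a left $D_i$-module by $(dx)(u)=x(ud)$. A pairing $B:P\times Q\to F$ of $A_\beta$-modules is *admissible* if it is $F$-linear in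 the first and $\sigma$-semilinear in the second variable and $B(\boldsymbol\theta u,\boldsymbol\theta v)=c\,\zeta B(u,v)$. Choose perfect admissible pairings $\langle\cdot,\cdot\rangle_i:S_i\times S_{i^\dagger}\to F$ and signs $\epsilon_i$ with $\langle v,u\rangle_{i^\dagger}=\epsilon_i\sigma\langle u,v\rangle_i$, where $\epsilon_i=1$ unless $i=i^\dagger$ and $S_i$ has no perfect Hermitian admissible pairing. Let $S_i^\xi$ be the $F$-module $S_i$ on which $\boldsymbol\theta$ acts as $\xi\boldsymbol\theta$. For each arrow $e:i\to j$ choose an $A_\beta$-linear isomorphism $\eta_e:S_i^\xi\to S_j$ and a sign $\epsilon_e$ with $\sigma\langle v,\eta_e(u)\rangle_{j^\dagger}=\epsilon_e\langle u,\eta_{e^\dagger}(v)\rangle_i$ for all $u\in S_i$, $v\in S_{j^\dagger}$, where $\epsilon_e=1$ unless $e=e^\dagger$ and there is no isomorphism $\eta:S_i^\xi\to S_{i^\dagger}$ with $\langle u,\eta(v)\rangle_i=\sigma\langle v,\eta(u)\rangle_i$ for all $u,v\in S_i$. Let $\eta_e^\flat:D_i\cong D_j$ be given by $\eta_e(ud)=\eta_e(u)\eta_e^\flat(d)$;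 $\mathrm{Hom}_{D_i}(M_i,M_j)$ is formed with $D_i$ acting on $M_j$ through $\eta_e^\flat$. For $x\in M_i$, $y\in M_{i^\dagger}$ let $\{x,y\}'_i\in D_i$ be the unique element with $\langle x(u),y(v)\rangle=\langle u\{x,y\}'_i,v\rangle_i$ for all $u\in S_i$, $v\in S_{i^\dagger}$, and put $\{x,y\}_i=\mathrm{Trd}_{D_i/L_i}\{x,y\}'_i\in L_i$. Let $\mathrm{GL}_{D_i/k^\sigma}(M_i)$ be the algebraic group over $k^\sigma$ with $R$-points the $R\otimes_{k^\sigma} D_i$-linear automorphisms of $R\otimes_{k^\sigma} M_i$, and for $i=i^\dagger$ let $\mathbf{Aut}_{D_i/k^\sigma}(M_i,\{\cdot,\cdot\}_i)$ be its subgroup preserving $\{\cdot,\cdot\}_i$. For an arrow $e=e^\dagger:i\to i^\dagger$ and a sign $\epsilon'$ let $$\mathfrak h^{\epsilon'}(M_i,M_{i^\dagger})=\{\varphi\in\mathrm{Hom}_{D_i}(M_i,M_{i^\dagger}):\ \{y,\varphi(x)\}_i=\epsilon'\sigma_{c\xi^{-1}}(\{x,\varphi(y)\}_i)\ \ \forall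 x,y\in M_i\},$$ where $\sigma_{c\xi^{-1}}$ is the automorphism of $L_i$ induced by the automorphism of $L_\beta$ that is $\sigma$ on $k$ and sends $b\mapsto\mathrm{Nm}_{F/k}(c\xi^{-1})b^{-1}$. The contragredient $g^{*,-1}$ on $M_{i^\dagger}$ of an automorphism $g$ of $M_i$ is defined by $\{gx,g^{*,-1}y\}_i=\{x,y\}_i$. **Theorem.** (a) The isomorphism type of the directed graph $Q_\xi$ together with its involution $\dagger$ depends only on $k$, $\sigma|_k$, $m/n$, $\beta$, $\mathrm{Nm}_{F/k}(c)$ and $\mathrm{Nm}_{F/k}(\xi)$. (b) $H=\prod_{\alpha\in\underline\Pi}H^\alpha$ and $\mathfrak g(\xi)=\bigoplus_{\alpha\in\underline\Pi}\mathfrak g(\xi)^\alpha$. Choices as above exist. For every $\alpha\in\underline\Pi$ the graph $Q_\xi^\alpha$ with its involution has one of the shapes below. For all choices as above and for every labelling of $Q_\xi^\alpha$ as in one of the shapes, there are an isomorphism of algebraic groups over $k^\sigma$ from $H^\alpha$ and a compatible $k^\sigma$-linear isomorphism from $\mathfrak g(\xi)^\alpha$ onto the following; they are given by $g(x(u))=(g_ix)(u)$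 and $\varphi(x(u))=(\varphi_e x)(\eta_e(u))$ for all labelled vertices $i$ and all arrows $e:i\to j$ that occur, and all $u\in S_i$, $x\in M_i$. 1. (CC-$\ell$), $\ell\ge1$: two disjoint directed cycles, $1\to2\to\cdots\to\ell\to1$ and its dual, exchanged by $\dagger$. Then $H^\alpha\cong\prod_{i=1}^\ell\mathrm{GL}_{D_i/k^\sigma}(M_i)$ and $\mathfrak g(\xi)^\alpha\cong\bigoplus_{i=1}^\ell\mathrm{Hom}_{D_i}(M_i,M_{i+1})$, with $M_{\ell+1}=M_1$. 2. (VV-$\ell$), $\ell\ge1$: one directed cycle $0\to1\to\cdots\to\ell\to(\ell-1)^\dagger\to\cdots\to1^\dagger\to0$ of $2\ell$ vertices, of which exactly $0$ and $\ell$ are self-dual. Then $H^\alpha\cong\mathbf{Aut}_{D_0/k^\sigma}(M_0,\{\cdot,\cdot\}_0)\times\prod_{i=1}^{\ell-1}\mathrm{GL}_{D_i/k^\sigma}(M_i)\times\mathbf{Aut}_{D_\ell/k^\sigma}(M_\ell,\{\cdot,\cdot\}_\ell)$ and $\mathfrak g(\xi)^\alpha\cong\bigoplus_{i=0}^{\ell-1}\mathrm{Hom}_{D_i}(M_i,M_{i+1})$.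 3. (VE-$\ell$), $\ell\ge0$: one directed cycle $0\to1\to\cdots\to\ell\to\ell^\dagger\to\cdots\to1^\dagger\to0$ of $2\ell+1$ vertices, of which exactly $0$ is self-dual; the arrow $e:\ell\to\ell^\dagger$ is self-dual. Then $H^\alpha\cong\mathbf{Aut}_{D_0/k^\sigma}(M_0,\{\cdot,\cdot\}_0)\times\prod_{i=1}^{\ell}\mathrm{GL}_{D_i/k^\sigma}(M_i)$ and $\mathfrak g(\xi)^\alpha\cong\bigoplus_{i=0}^{\ell-1}\mathrm{Hom}_{D_i}(M_i,M_{i+1})\oplus\mathfrak h^{-\epsilon\epsilon_e}(M_\ell,M_{\ell^\dagger})$. 4. (EE-$\ell$), $\ell\ge1$: one directed cycle $1\to\cdots\to\ell\to\ell^\dagger\to\cdots\to1^\dagger\to1$ of $2\ell$ vertices, none of them self-dual; the arrows $e:1^\dagger\to1$ and $e':\ell\to\ell^\dagger$ are self-dual. Then $H^\alpha\cong\prod_{i=1}^{\ell}\mathrm{GL}_{D_i/k^\sigma}(M_i)$ and $\mathfrak g(\xi)^\alpha\cong\mathfrak h^{-\epsilon\epsilon_e}(M_{1^\dagger},M_1)\oplus\bigoplus_{i=1}^{\ell-1}\mathrm{Hom}_{D_i}(M_i,M_{i+1})\oplus\mathfrak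 h^{-\epsilon\epsilon_{e'}}(M_\ell,M_{\ell^\dagger})$. In all cases the conjugation action of $H^\alpha$ on $\mathfrak g(\xi)^\alpha$ corresponds to the action $\varphi\mapsto g_{i+1}\varphi g_i^{-1}$ on $\mathrm{Hom}_{D_i}(M_i,M_{i+1})$, and on the spaces $\mathfrak h^{\pm}$ to the action induced by $g_i$ on $M_i$ ($i$ a label) and by its contragredient $g_i^{*,-1}$ on $M_{i^\dagger}$. -/

import Mathlib

open scoped TensorProduct

universe u

namespace CyclicGrading

noncomputable section

/-! ### General notions: points of linear groups, reduced trace -/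

section General

variable (k₀ : Type u) [Field k₀]

/-- The extension of a `k₀`-bilinear pairing `M × N → P` to an `R`-bilinear pairing
`(R ⊗ M) × (R ⊗ N) → R ⊗ P`, `(r ⊗ x, r' ⊗ y) ↦ r r' ⊗ B x y`. -/
def extPair (R : Type u) [CommRing R] [Algebra k₀ R] {M N P : Type u}
    [AddCommGroup M] [Module k₀ M] [AddCommGroup N] [Module k₀ N] [AddCommGroup P] [Module k₀ P]
    (B : M →ₗ[k₀] N →ₗ[k₀] P) : R ⊗[k₀] M →ₗ[k₀] R ⊗[k₀] N →ₗ[k₀] R ⊗[k₀] P :=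
  TensorProduct.map₂ (LinearMap.mul k₀ R) B

@[simp] theorem extPair_tmul (R : Type u) [CommRing R] [Algebra k₀ R] {M N P : Type u}
    [AddCommGroup M] [Module k₀ M] [AddCommGroup N] [Module k₀ N] [AddCommGroup P] [Module k₀ P]
    (B : M →ₗ[k₀] N →ₗ[k₀] P) (r r' : R) (x : M) (y : N) :
    extPair k₀ R B (r ⊗ₜ x) (r' ⊗ₜ y) = (r * r') ⊗ₜ B x y := by
  simp [extPair]

/-- The map induced on `R ⊗ M` by the action of an element of a ring `D` that acts `k₀`-linearly
on `M`. -/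
def extAct (R : Type u) [CommRing R] [Algebra k₀ R] {D M : Type u} [Ring D] [AddCommGroup M]
    [Module k₀ M] [Module D M] [SMulCommClass D k₀ M] (d : D) : R ⊗[k₀] M →ₗ[R] R ⊗[k₀] M :=
  (DistribSMul.toLinearMap k₀ M d).baseChange R

/-- The `R`-points of `GL_{D/k₀}(M)`: the `R ⊗ D`-linear automorphisms of `R ⊗ M`, i.e. the
`R`-linear automorphisms that commute with the action of `D`. -/
def GLPts (D M : Type u) [Ring D] [AddCommGroup M] [Module k₀ M] [Module D M]
    [SMulCommClass D k₀ M] (R : Type u) [CommRing R] [Algebra k₀ R] :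
    Subgroup (R ⊗[k₀] M ≃ₗ[R] R ⊗[k₀] M) where
  carrier := {g | ∀ (d : D) (x : R ⊗[k₀] M), g (extAct k₀ R d x) = extAct k₀ R d (g x)}
  one_mem' _ _ := rfl
  mul_mem' {g h} hg hh d x := by
    change g (h _) = extAct k₀ R d (g (h x))
    rw [hh, hg]
  inv_mem' {g} hg d x := by
    change g.symm _ = extAct k₀ R d (g.symm x)
    apply g.injective
    rw [hg]
    simp

/-- The `R`-points of the group of `k₀`-linear automorphisms of `M` preserving a `k₀`-bilinear
pairing `M × M → P`. -/
def isometryPts {M P : Type u} [AddCommGroup M] [Module k₀ M] [AddCommGroup P] [Module k₀ P]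
    (B : M →ₗ[k₀] M →ₗ[k₀] P) (R : Type u) [CommRing R] [Algebra k₀ R] :
    Subgroup (R ⊗[k₀] M ≃ₗ[R] R ⊗[k₀] M) where
  carrier := {g | ∀ x y : R ⊗[k₀] M, extPair k₀ R B (g x) (g y) = extPair k₀ R B x y}
  one_mem' _ _ := rfl
  mul_mem' {g h} hg hh x y := by
    change extPair k₀ R B (g (h x)) (g (h y)) = _
    rw [hg, hh]
  inv_mem' {g} hg x y := by
    change extPair k₀ R B (g.symm x) (g.symm y) = _
    rw [← hg]
    simp

/-- For a linear map `p : W → Hom(M, N)`, the `R`-linear map `R ⊗ M → R ⊗ N` defined by an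
element of `R ⊗ W`. -/
def extHom (R : Type u) [CommRing R] [Algebra k₀ R] {W M N : Type u} [AddCommGroup W]
    [Module k₀ W] [AddCommGroup M] [Module k₀ M] [AddCommGroup N] [Module k₀ N]
    (p : W →ₗ[k₀] (M →ₗ[k₀] N)) : R ⊗[k₀] W →ₗ[R] (R ⊗[k₀] M →ₗ[R] R ⊗[k₀] N) :=
  LinearMap.tensorProduct k₀ R M N ∘ₗ p.baseChange R

/-- `g'` is the image of `g` under the base change along `f : R → R'`. -/
def IsBaseChangeAlong {M R R' : Type u} [AddCommGroup M] [Module k₀ M]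
    [CommRing R] [Algebra k₀ R] [CommRing R'] [Algebra k₀ R'] (f : R →ₐ[k₀] R')
    (g : R ⊗[k₀] M ≃ₗ[R] R ⊗[k₀] M) (g' : R' ⊗[k₀] M ≃ₗ[R'] R' ⊗[k₀] M) : Prop :=
  ∀ x, g' (f.toLinearMap.rTensor M x) = f.toLinearMap.rTensor M (g x)

/-- `t` is the reduced trace of the central simple `L`-algebra `D`: it is computed as the matrix
trace after every splitting of `D` over the algebraic closure of `L`. -/
def IsReducedTrace (L D : Type u) [Field L] [Ring D] [Algebra L D] (t : D →ₗ[L] L) : Prop :=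
  ∀ (n : ℕ) (e : AlgebraicClosure L ⊗[L] D ≃ₐ[AlgebraicClosure L]
      Matrix (Fin n) (Fin n) (AlgebraicClosure L)) (d : D),
    algebraMap L (AlgebraicClosure L) (t d) = (e (1 ⊗ₜ d)).trace

open Classical in
/-- The reduced trace `Trd_{D/L}` (the zero map if `D` has no reduced trace, which never happens
for central simple algebras). -/
def reducedTrace (L D : Type u) [Field L] [Ring D] [Algebra L D] : D →ₗ[L] L :=
  if h : ∃ t : D →ₗ[L] L, IsReducedTrace L D t then h.choose else 0

end General

/-- The subfield `k^σ`. -/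
abbrev fixedField {k : Type u} [Field k] (σk : k ≃+* k) : Subfield k :=
  (σk : k →+* k).eqLocusField (RingHom.id k)

/-- The standing data: the base field `k` with `σ|_k`; a finite separable `k`-algebra `F` with an
automorphism `ζ` of order `n` such that `k = F^ζ`; a finite type `F`-module `V` with a
`ζ`-semilinear automorphism `θ` such that `θ ^ m = β` where `m = n * r` and `r = m/n` is invertible
in `k`; an involution `σ` of `F` commuting with `ζ`; an `ε`-Hermitian non-degenerate pairing on `V`
with respect to which `θ` is a `ζ`-semilinear similitude of multiplier `c`; and an
element `ξ` of `F^σ` whose norm is an `m/n`-th root of unity. -/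
structure Datum (k : Type u) [Field k] (σk : k ≃+* k) where
  F : Type u
  [commRingF : CommRing F]
  [algebraF : Algebra k F]
  [finiteF : Module.Finite k F]
  [separableF : Algebra.IsSeparable k F]
  ζ : F ≃ₐ[k] F
  algebraMap_injective : Function.Injective (algebraMap k F)
  isOfFinOrder_ζ : IsOfFinOrder ζ
  mem_range_of_fixed : ∀ a : F, ζ a = a → a ∈ Set.range (algebraMap k F)
  /-- The quotient `m/n`, where `n` is the order of `ζ`. -/
  r : ℕ
  r_ne_zero : (r : k) ≠ 0
  two_ne_zero : (2 : k) ≠ 0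
  V : Type u
  [addCommGroupV : AddCommGroup V]
  [moduleFV : Module F V]
  [finiteV : Module.Finite F V]
  [moduleKV : Module k V]
  [towerV : IsScalarTower k F V]
  θ : V ≃+ V
  θ_smul : ∀ (a : F) (v : V), θ (a • v) = ζ a • θ v
  β : k
  β_ne_zero : β ≠ 0
  θ_pow : ∀ v : V, (θ : V → V)^[orderOf ζ * r] v = β • v
  σ : F ≃+* F
  σ_σ : ∀ a, σ (σ a) = a
  σ_ζ : ∀ a, σ (ζ a) = ζ (σ a)
  /-- `σk` is the restriction of `σ` to `k`. -/
  σ_algebraMap : ∀ x : k, σ (algebraMap k F x) = algebraMap k F (σk x)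
  ε : ℤˣ
  /-- The pairing: linear in the first, `σ`-semilinear in the second variable. -/
  form : V →ₗ[F] V →ₛₗ[(σ : F →+* F)] F
  form_nondegenerate : ∀ x, (∀ y, form x y = 0) → x = 0
  form_symm : ∀ x y, form x y = ε • σ (form y x)
  c : Fˣ
  σ_c : σ c = c
  form_θ : ∀ x y, form (θ x) (θ y) = c * ζ (form x y)
  norm_c : Algebra.norm k (c : F) ^ r = β * σk β
  ξ : Fˣ
  σ_ξ : σ ξ = ξ
  norm_ξ : Algebra.norm k (ξ : F) ^ r = 1

attribute [instance] Datum.commRingF Datum.algebraF Datum.finiteF Datum.separableF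
  Datum.addCommGroupV Datum.moduleFV Datum.finiteV Datum.moduleKV Datum.towerV

namespace Datum

variable {k : Type u} [Field k] {σk : k ≃+* k} (s : Datum k σk)

/-! ### The algebra `A_β` and its modules -/

/-- The order of `ζ`. -/
abbrev n : ℕ := orderOf s.ζ

/-- The powers of `ζ` acting on `F`; this fixes the multiplication of the skew polynomial ring. -/
instance powersAction : MulSemiringAction (Multiplicative ℕ) s.F :=
  MulSemiringAction.compHom s.F (powersHom (s.F ≃ₐ[k] s.F) s.ζ)

theorem phi_apply (a : s.F) : SkewPolynomial.φ a = s.ζ a := by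
  change (powersHom (s.F ≃ₐ[k] s.F) s.ζ (Multiplicative.ofAdd 1)) a = s.ζ a
  simp

/-- The algebra `A_β`: the quotient of the skew polynomial ring `F⟨θ⟩`, `θ a = ζ(a) θ`,
by the two-sided ideal generated by `θ ^ m - β`. -/
def A : Type u :=
  RingQuot (fun p q : SkewPolynomial s.F =>
    p = SkewPolynomial.X ^ (s.n * s.r) ∧ q = SkewPolynomial.C (algebraMap k s.F s.β))

instance : Ring s.A := inferInstanceAs (Ring (RingQuot _))

/-- The quotient map `F⟨θ⟩ → A_β`. -/
def toA : SkewPolynomial s.F →+* s.A := RingQuot.mkRingHom _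

theorem toA_surjective : Function.Surjective s.toA := RingQuot.mkRingHom_surjective _

/-- The inclusion `F → A_β`. -/
def incl : s.F →+* s.A := s.toA.comp SkewPolynomial.CRingHom

/-- The generator `θ` of `A_β`. -/
def θA : s.A := s.toA SkewPolynomial.X

theorem θA_mul_incl (a : s.F) : s.θA * s.incl a = s.incl (s.ζ a) * s.θA := by
  change s.toA _ * s.toA _ = s.toA _ * s.toA _
  rw [← map_mul, ← map_mul]
  congr 1
  rw [SkewPolynomial.CRingHom_eq_C, SkewPolynomial.CRingHom_eq_C, SkewPolynomial.X,
    SkewPolynomial.monomial_mul_C, SkewPolynomial.C_mul_monomial]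
  simp only [Function.iterate_one, phi_apply, mul_one, one_mul]

theorem θA_pow : s.θA ^ (s.n * s.r) = s.incl (algebraMap k s.F s.β) := by
  change s.toA _ ^ _ = s.toA _
  rw [← map_pow]
  exact RingQuot.mkRingHom_rel ⟨rfl, rfl⟩

/-- `A_β` is generated by `F` and `θ`. -/
theorem A_induction {p : s.A → Prop} (h_incl : ∀ a, p (s.incl a)) (hθ : p s.θA)
    (hadd : ∀ x y, p x → p y → p (x + y)) (hmul : ∀ x y, p x → p y → p (x * y)) (x : s.A) :
    p x := by
  obtain ⟨q, rfl⟩ := s.toA_surjective x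
  induction q using SkewPolynomial.induction with
  | h0 => simpa using h_incl 0
  | ha n a q _ _ hq =>
    rw [map_add]
    refine hadd _ _ ?_ hq
    rw [← SkewPolynomial.C_mul_X_pow_eq_monomial, map_mul]
    refine hmul _ _ (h_incl a) ?_
    clear * - h_incl hθ hmul
    induction n with
    | zero => simpa using h_incl 1
    | succ n ih =>
      rw [pow_succ, map_mul]
      exact hmul _ _ ih hθ

/-- An additive map between `A_β`-modules that commutes with `F` and `θ` is `A_β`-linear. -/
def linearOfGenerators {P Q : Type u} [AddCommGroup P] [Module s.A P] [AddCommGroup Q]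
    [Module s.A Q] (f : P →+ Q) (hF : ∀ a u, f (s.incl a • u) = s.incl a • f u)
    (hθ : ∀ u, f (s.θA • u) = s.θA • f u) : P →ₗ[s.A] Q where
  toFun := f
  map_add' := f.map_add
  map_smul' x u := by
    revert u
    induction x using s.A_induction with
    | h_incl a => exact hF a
    | hθ => exact hθ
    | hadd x y hx hy => intro u; simp_all [add_smul]
    | hmul x y hx hy => intro u; simp_all [mul_smul]

@[simp] theorem linearOfGenerators_apply {P Q : Type u} [AddCommGroup P] [Module s.A P]
    [AddCommGroup Q] [Module s.A Q] (f : P →+ Q) (hF hθ) (u : P) :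
    s.linearOfGenerators f hF hθ u = f u := rfl

theorem smul_ofAdd (j : ℕ) (a : s.F) : Multiplicative.ofAdd j • a = (s.ζ ^ j) a := by
  change (powersHom (s.F ≃ₐ[k] s.F) s.ζ (Multiplicative.ofAdd j)) a = _
  simp

/-- `θ` as an element of the ring of additive endomorphisms of `V`. -/
def θEnd : AddMonoid.End s.V := s.θ.toAddMonoidHom

theorem θEnd_apply (v : s.V) : s.θEnd v = s.θ v := rfl

theorem θEnd_pow_smul (j : ℕ) (a : s.F) (v : s.V) :
    (s.θEnd ^ j) (a • v) = (s.ζ ^ j) a • (s.θEnd ^ j) v := by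
  induction j generalizing a v with
  | zero => simp
  | succ j ih =>
    rw [pow_succ, pow_succ]
    change (s.θEnd ^ j) (s.θ (a • v)) = _
    rw [θ_smul, ih]
    rfl

/-- The action of `F⟨θ⟩` on `V`. -/
def skewAct : SkewPolynomial s.F →+* AddMonoid.End s.V :=
  SkewMonoidAlgebra.liftNCRingHom (Module.toAddMonoidEnd s.F s.V)
    (powersHom (AddMonoid.End s.V) s.θEnd) (by
      intro a y
      obtain ⟨j, rfl⟩ := Multiplicative.ofAdd.surjective y
      rw [smul_ofAdd, powersHom_apply]
      ext v
      exact (s.θEnd_pow_smul j a v).symm)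

theorem skewAct_C (a : s.F) (v : s.V) : s.skewAct (SkewPolynomial.C a) v = a • v := by
  have h : s.skewAct (SkewPolynomial.C a) = Module.toAddMonoidEnd s.F s.V a * 1 :=
    SkewMonoidAlgebra.liftNC_single _ _ _ _
  rw [h]
  rfl

theorem skewAct_X (v : s.V) : s.skewAct SkewPolynomial.X v = s.θ v := by
  have h : s.skewAct SkewPolynomial.X = Module.toAddMonoidEnd s.F s.V 1 * s.θEnd ^ 1 :=
    SkewMonoidAlgebra.liftNC_single _ _ _ _
  rw [h, map_one, one_mul, pow_one]
  rfl

/-- The action of `A_β` on `V`. -/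
def actA : s.A →+* AddMonoid.End s.V :=
  RingQuot.lift ⟨s.skewAct, by
    rintro _ _ ⟨rfl, rfl⟩
    ext v
    rw [map_pow, skewAct_C]
    have h : s.skewAct SkewPolynomial.X = s.θEnd := by
      ext w
      exact s.skewAct_X w
    rw [h, algebraMap_smul, ← s.θ_pow v, AddMonoid.End.coe_pow]
    rfl⟩

/-- `V` is an `A_β`-module on which `θ ∈ A_β` acts by the given automorphism `θ`. -/
instance moduleAV : Module s.A s.V := Module.compHom s.V s.actA

theorem toA_smul (p : SkewPolynomial s.F) (v : s.V) : s.toA p • v = s.skewAct p v :=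
  DFunLike.congr_fun (RingQuot.lift_mkRingHom_apply s.skewAct _ p) v

theorem incl_smul (a : s.F) (v : s.V) : s.incl a • v = a • v := by
  rw [← skewAct_C, ← toA_smul]
  rfl

theorem θA_smul (v : s.V) : s.θA • v = s.θ v := by
  rw [← skewAct_X, ← toA_smul]
  rfl

theorem ζ_algebraMap (x : k) : s.ζ (algebraMap k s.F x) = algebraMap k s.F x := s.ζ.commutes x

theorem θ_smul_base (x : k) (v : s.V) : s.θ (x • v) = x • s.θ v := by
  rw [← algebraMap_smul s.F x v, θ_smul, ζ_algebraMap, algebraMap_smul]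

instance : SMulCommClass s.A k s.V where
  smul_comm x y v := by
    revert v
    induction x using s.A_induction with
    | h_incl a => intro v; rw [incl_smul, incl_smul, smul_comm]
    | hθ => intro v; rw [θA_smul, θA_smul, θ_smul_base]
    | hadd x y hx hy => intro v; simp_all [add_smul]
    | hmul x y hx hy => intro v; simp_all [mul_smul]

/-! ### The algebra `L_β`, the quiver and its involution -/

/-- The centre `L_β = k[b]`, `b = θ ^ n`, of `A_β`, in the presentation `k[b] / (b ^ (m/n) - β)`. -/
abbrev L : Type u := AdjoinRoot (Polynomial.X ^ s.r - Polynomial.C s.β : Polynomial k)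

/-- The element `b` of `L_β`. -/
abbrev b : s.L := AdjoinRoot.root _

theorem r_pos : s.r ≠ 0 := fun h => s.r_ne_zero (by simp [h])

theorem poly_monic : (Polynomial.X ^ s.r - Polynomial.C s.β : Polynomial k).Monic :=
  Polynomial.monic_X_pow_sub_C _ s.r_pos

instance : Module.Finite k s.L := s.poly_monic.finite_adjoinRoot

instance : IsArtinianRing s.L := IsArtinianRing.of_finite k s.L

theorem b_pow : s.b ^ s.r = algebraMap k s.L s.β := by
  have h := AdjoinRoot.eval₂_root (Polynomial.X ^ s.r - Polynomial.C s.β : Polynomial k)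
  simpa [sub_eq_zero] using h

theorem ζ_pow_n (j : ℕ) : s.ζ ^ (s.n * j) = 1 := by
  rw [pow_mul, pow_orderOf_eq_one, one_pow]

theorem θA_pow_mul_incl (j : ℕ) (a : s.F) :
    s.θA ^ j * s.incl a = s.incl ((s.ζ ^ j) a) * s.θA ^ j := by
  induction j generalizing a with
  | zero => simp
  | succ j ih =>
    rw [pow_succ, mul_assoc, θA_mul_incl, ← mul_assoc, ih, mul_assoc, pow_succ]
    rfl

theorem commute_base_θA (x : k) : Commute (s.incl (algebraMap k s.F x)) s.θA := by
  change _ * _ = _ * _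
  rw [θA_mul_incl, ζ_algebraMap]

/-- The homomorphism `L_β → A_β` that sends `b` to `θ ^ n`. -/
def ofL : s.L →+* s.A :=
  Ideal.Quotient.lift (Ideal.span {(Polynomial.X ^ s.r - Polynomial.C s.β : Polynomial k)})
    (Polynomial.eval₂RingHom' (s.incl.comp (algebraMap k s.F)) (s.θA ^ s.n)
      (fun x => (s.commute_base_θA x).pow_right _))
    (by
      intro p hp
      obtain ⟨q, rfl⟩ := Ideal.mem_span_singleton.1 hp
      rw [map_mul]
      suffices h : Polynomial.eval₂RingHom' (s.incl.comp (algebraMap k s.F)) (s.θA ^ s.n)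
          (fun x => (s.commute_base_θA x).pow_right _)
          (Polynomial.X ^ s.r - Polynomial.C s.β) = 0 by
        rw [h, zero_mul]
      rw [map_sub, map_pow]
      change (Polynomial.eval₂ _ _ Polynomial.X) ^ s.r - Polynomial.eval₂ _ _ (Polynomial.C _) = 0
      rw [Polynomial.eval₂_X, Polynomial.eval₂_C, ← pow_mul, θA_pow]
      simp)

theorem ofL_algebraMap (x : k) : s.ofL (algebraMap k s.L x) = s.incl (algebraMap k s.F x) := by
  change Polynomial.eval₂ _ _ (Polynomial.C x) = _
  rw [Polynomial.eval₂_C]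
  rfl

theorem ofL_b : s.ofL s.b = s.θA ^ s.n := by
  change Polynomial.eval₂ _ _ Polynomial.X = _
  rw [Polynomial.eval₂_X]

theorem L_induction {p : s.L → Prop} (h_base : ∀ x, p (algebraMap k s.L x)) (hb : p s.b)
    (hadd : ∀ x y, p x → p y → p (x + y)) (hmul : ∀ x y, p x → p y → p (x * y)) (l : s.L) :
    p l := by
  obtain ⟨q, rfl⟩ := AdjoinRoot.mk_surjective l
  induction q using Polynomial.induction_on with
  | C x => exact h_base x
  | add f g hf hg => rw [map_add]; exact hadd _ _ hf hg
  | monomial j x h =>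
    rw [pow_succ, ← mul_assoc, map_mul, AdjoinRoot.mk_X]
    exact hmul _ _ h hb

theorem ofL_central (l : s.L) (x : s.A) : s.ofL l * x = x * s.ofL l := by
  induction l using s.L_induction with
  | h_base y =>
    rw [ofL_algebraMap]
    induction x using s.A_induction with
    | h_incl a => rw [← map_mul, mul_comm, map_mul]
    | hθ => exact s.commute_base_θA y
    | hadd x z hx hz => rw [mul_add, add_mul, hx, hz]
    | hmul x z hx hz => rw [← mul_assoc, hx, mul_assoc, hz, mul_assoc]
  | hb =>
    rw [ofL_b]
    induction x using s.A_induction with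
    | h_incl a => rw [θA_pow_mul_incl, pow_orderOf_eq_one]; rfl
    | hθ => rw [← pow_succ, pow_succ']
    | hadd x z hx hz => rw [mul_add, add_mul, hx, hz]
    | hmul x z hx hz => rw [← mul_assoc, hx, mul_assoc, hz, mul_assoc]
  | hadd l l' h h' => rw [map_add, add_mul, mul_add, h, h']
  | hmul l l' h h' => rw [map_mul, mul_assoc, h', ← mul_assoc, h, mul_assoc]

/-- The norms `Nm_{F/k}(c)` and `Nm_{F/k}(ξ)`. -/
abbrev Nc : k := Algebra.norm k (s.c : s.F)

/-- See `Nc`. -/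
abbrev Nξ : k := Algebra.norm k (s.ξ : s.F)

theorem σk_norm (a : s.F) (ha : s.σ a = a) : σk (Algebra.norm k a) = Algebra.norm k a := by
  have h := Algebra.norm_eq_of_equiv_equiv σk s.σ
    (RingHom.ext fun x => (s.σ_algebraMap x).symm) a
  rw [ha] at h
  conv_lhs => rw [h]
  simp

theorem Nξ_ne_zero : s.Nξ ≠ 0 := by
  intro h
  have h1 := s.norm_ξ
  rw [show Algebra.norm k (s.ξ : s.F) = 0 from h, zero_pow s.r_pos] at h1
  exact zero_ne_one h1

theorem σk_σk {σk : k ≃+* k} (s : Datum k σk) (x : k) : σk (σk x) = x := by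
  apply s.algebraMap_injective
  rw [← σ_algebraMap, ← σ_algebraMap, σ_σ]

/-- The inverse of `b`. -/
def bInv : s.L := algebraMap k s.L s.β⁻¹ * s.b ^ (s.r - 1)

theorem b_mul_bInv : s.b * s.bInv = 1 := by
  rw [bInv, mul_left_comm, ← pow_succ', Nat.sub_add_cancel (Nat.one_le_iff_ne_zero.2 s.r_pos),
    b_pow, ← map_mul, inv_mul_cancel₀ s.β_ne_zero, map_one]

/-- The automorphism `μ_ξ` of `L_β`: `b ↦ Nm(ξ) b`. -/
def mu : s.L →+* s.L :=
  AdjoinRoot.lift (algebraMap k s.L) (algebraMap k s.L s.Nξ * s.b) (by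
    rw [Polynomial.eval₂_sub, Polynomial.eval₂_pow, Polynomial.eval₂_X, Polynomial.eval₂_C,
      mul_pow, ← map_pow, show s.Nξ ^ s.r = 1 from s.norm_ξ, b_pow, map_one, one_mul, sub_self])

/-- For `t ∈ k` with `t ^ (m/n) = β σ(β)`, the endomorphism of `L_β` that is `σ` on `k`
and sends `b` to `t b⁻¹`. -/
def sigmaTwist (t : k) (ht : t ^ s.r = s.β * σk s.β) : s.L →+* s.L :=
  AdjoinRoot.lift ((algebraMap k s.L).comp (σk : k →+* k)) (algebraMap k s.L t * s.bInv) (by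
    have h : s.bInv ^ s.r = algebraMap k s.L s.β⁻¹ := by
      have h1 : (s.b * s.bInv) ^ s.r = 1 := by rw [b_mul_bInv, one_pow]
      rw [mul_pow, b_pow] at h1
      calc s.bInv ^ s.r = algebraMap k s.L (s.β⁻¹ * s.β) * s.bInv ^ s.r := by
            rw [inv_mul_cancel₀ s.β_ne_zero, map_one, one_mul]
        _ = _ := by rw [map_mul, mul_assoc, h1, mul_one]
    rw [Polynomial.eval₂_sub, Polynomial.eval₂_pow, Polynomial.eval₂_X, Polynomial.eval₂_C,
      mul_pow, h, ← map_pow, ht, ← map_mul, mul_comm s.β, mul_assoc,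
      mul_inv_cancel₀ s.β_ne_zero, mul_one]
    exact sub_self _)

/-- The involution `σ_c` of `L_β`: it is `σ` on `k` and sends `b` to `Nm(c) b⁻¹`. -/
def sigmaC : s.L →+* s.L := s.sigmaTwist s.Nc s.norm_c

/-- The involution `σ_{c ξ⁻¹}` of `L_β`: it is `σ` on `k` and sends `b` to `Nm(c ξ⁻¹) b⁻¹`. -/
def sigmaCXi : s.L →+* s.L :=
  s.sigmaTwist (Algebra.norm k ((s.c * s.ξ⁻¹ : s.Fˣ) : s.F)) (by
    have h : Algebra.norm k ((s.ξ⁻¹ : s.Fˣ) : s.F) ^ s.r = 1 := by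
      have h1 : (Algebra.norm k ((s.ξ⁻¹ : s.Fˣ) : s.F) * s.Nξ) ^ s.r = 1 := by
        rw [← map_mul, Units.inv_mul, map_one, one_pow]
      rwa [mul_pow, show s.Nξ ^ s.r = 1 from s.norm_ξ, mul_one] at h1
    rw [Units.val_mul, map_mul, mul_pow, h, mul_one, s.norm_c])

theorem mu_base (x : k) : s.mu (algebraMap k s.L x) = algebraMap k s.L x := AdjoinRoot.lift_of _

theorem mu_b : s.mu s.b = algebraMap k s.L s.Nξ * s.b := AdjoinRoot.lift_root _

theorem sigmaTwist_base (t : k) (ht) (x : k) :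
    s.sigmaTwist t ht (algebraMap k s.L x) = algebraMap k s.L (σk x) := AdjoinRoot.lift_of _

theorem sigmaTwist_b (t : k) (ht) :
    s.sigmaTwist t ht s.b = algebraMap k s.L t * s.bInv := AdjoinRoot.lift_root _

theorem L_hom_ext {T : Type u} [Semiring T] {f g : s.L →+* T}
    (h : ∀ x, f (algebraMap k s.L x) = g (algebraMap k s.L x)) (hb : f s.b = g s.b) : f = g := by
  refine RingHom.ext fun l => ?_
  induction l using s.L_induction with
  | h_base x => exact h x
  | hb => exact hb
  | hadd x y hx hy => rw [map_add, map_add, hx, hy]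
  | hmul x y hx hy => rw [map_mul, map_mul, hx, hy]

theorem map_bInv {T : Type u} [CommRing T] (f : s.L →+* T) {y : T} (h : f s.b * y = 1) :
    f s.bInv = y := by
  have h1 : f s.b * f s.bInv = 1 := by rw [← map_mul, b_mul_bInv, map_one]
  exact left_inv_eq_right_inv (by rw [mul_comm, h1]) h

theorem Nc_ne_zero : s.Nc ≠ 0 := by
  intro h
  have h1 := s.norm_c
  rw [show Algebra.norm k (s.c : s.F) = 0 from h, zero_pow s.r_pos] at h1
  rcases mul_eq_zero.1 h1.symm with h2 | h2
  · exact s.β_ne_zero h2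
  · exact s.β_ne_zero (by simpa using h2)

theorem sigmaC_comp_sigmaC : s.sigmaC.comp s.sigmaC = RingHom.id _ := by
  refine s.L_hom_ext (fun x => ?_) ?_
  · simp only [sigmaC, RingHom.comp_apply, sigmaTwist_base, σk_σk s, RingHom.id_apply]
  · have h : s.sigmaC s.bInv = algebraMap k s.L s.Nc⁻¹ * s.b := by
      refine s.map_bInv _ ?_
      rw [sigmaC, sigmaTwist_b, mul_mul_mul_comm, ← map_mul, mul_inv_cancel₀ s.Nc_ne_zero,
        map_one, one_mul, mul_comm, b_mul_bInv]
    rw [RingHom.comp_apply]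
    nth_rewrite 2 [sigmaC]
    rw [sigmaTwist_b, map_mul, h, sigmaC, sigmaTwist_base, s.σk_norm _ s.σ_c, ← mul_assoc,
      ← map_mul, mul_inv_cancel₀ s.Nc_ne_zero, map_one, one_mul, RingHom.id_apply]

theorem mu_bInv : s.mu s.bInv = algebraMap k s.L s.Nξ⁻¹ * s.bInv := by
  refine s.map_bInv _ ?_
  rw [mu_b, mul_mul_mul_comm, ← map_mul, mul_inv_cancel₀ s.Nξ_ne_zero, map_one, one_mul,
    b_mul_bInv]

/-- `μ_ξ ∘ σ_c = σ_{c ξ⁻¹}`. -/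
theorem mu_comp_sigmaC : s.mu.comp s.sigmaC = s.sigmaCXi := by
  refine s.L_hom_ext (fun x => ?_) ?_
  · simp only [sigmaC, sigmaCXi, RingHom.comp_apply, sigmaTwist_base, mu_base]
  · have h2 : Algebra.norm k ((s.c * s.ξ⁻¹ : s.Fˣ) : s.F) = s.Nc * s.Nξ⁻¹ := by
      rw [Units.val_mul, map_mul]
      congr 1
      refine eq_inv_of_mul_eq_one_left ?_
      rw [← map_mul, Units.inv_mul, map_one]
    rw [RingHom.comp_apply, sigmaC, sigmaTwist_b, map_mul, mu_base, mu_bInv, sigmaCXi,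
      sigmaTwist_b, h2, map_mul, mul_assoc]

/-- `μ_ξ ∘ σ_c ∘ μ_ξ = σ_c`. -/
theorem mu_comp_sigmaC_comp_mu : s.mu.comp (s.sigmaC.comp s.mu) = s.sigmaC := by
  refine s.L_hom_ext (fun x => ?_) ?_
  · simp only [sigmaC, RingHom.comp_apply, sigmaTwist_base, mu_base]
  · rw [RingHom.comp_apply, RingHom.comp_apply, mu_b, map_mul, map_mul, sigmaC, sigmaTwist_base,
      sigmaTwist_b, s.σk_norm _ s.σ_ξ, map_mul, mu_base, mu_base, mu_bInv, mul_left_comm,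
      ← mul_assoc (algebraMap k s.L s.Nξ), ← map_mul, mul_inv_cancel₀ s.Nξ_ne_zero, map_one,
      one_mul]

/-- The vertex set `I = Spec L_β` of the quiver `Q_ξ`. The quiver `Q_ξ` has exactly one arrow
`i → next i` for every vertex `i`, and we identify an arrow with its source. -/
abbrev Vertex : Type u := PrimeSpectrum s.L

/-- The permutation `i ↦ ξ̄(i)` of the vertices induced by `μ_ξ`. -/
def next (i : s.Vertex) : s.Vertex := PrimeSpectrum.comap s.mu i

/-- The involution `i ↦ i†` of the vertices induced by `σ_c`. On arrows, it sends
`i → next i` to `(next i)† → i†`. -/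
def dag (i : s.Vertex) : s.Vertex := PrimeSpectrum.comap s.sigmaC i

theorem dag_dag (i : s.Vertex) : s.dag (s.dag i) = i := by
  rw [dag, dag, ← PrimeSpectrum.comap_comp_apply, sigmaC_comp_sigmaC]
  rfl

/-- The involution reverses the arrows of the quiver. -/
theorem next_dag_next (i : s.Vertex) : s.next (s.dag (s.next i)) = s.dag i := by
  rw [next, dag, next, ← PrimeSpectrum.comap_comp_apply, ← PrimeSpectrum.comap_comp_apply,
    mu_comp_sigmaC_comp_mu, dag]

/-- The equivalence relation on vertices generated by the arrows of the quiver and the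
involution. Its classes are the vertex sets of the unions of the orbits of the involution on the
set of connected components of the quiver. -/
def orbitSetoid : Setoid s.Vertex :=
  Relation.EqvGen.setoid (fun i j => j = s.next i ∨ j = s.dag i)

/-- The set of orbits of the involution on the connected components of the quiver. -/
abbrev Orbit : Type u := Quotient s.orbitSetoid

/-- The orbit of components to which a vertex belongs. -/
def orbit (i : s.Vertex) : s.Orbit := Quotient.mk _ i

/-- The residue field `L_i`, the factor of `L_β` at the vertex `i`. -/
def Lat (i : s.Vertex) : Type u := s.L ⧸ i.asIdeal

/-- The field structure of `L_i`. -/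
def fieldAux (i : s.Vertex) : Field (s.Lat i) := Ideal.Quotient.field i.asIdeal

instance fieldLat (i : s.Vertex) : Field (s.Lat i) := s.fieldAux i

/-- The projection `L_β → L_i`. -/
def toLat (i : s.Vertex) : s.L →+* s.Lat i := Ideal.Quotient.mk i.asIdeal

theorem toLat_surjective (i : s.Vertex) : Function.Surjective (s.toLat i) :=
  Ideal.Quotient.mk_surjective

instance (i : s.Vertex) : Algebra k (s.Lat i) := ((s.toLat i).comp (algebraMap k s.L)).toAlgebra

/-- If the arrow `i → next i` is fixed by the involution, `σ_{c ξ⁻¹}` fixes `i`. -/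
theorem comap_sigmaCXi (i : s.Vertex) (h : s.next i = s.dag i) :
    i.asIdeal ≤ i.asIdeal.comap s.sigmaCXi := by
  have h1 : PrimeSpectrum.comap s.sigmaCXi i = i := by
    rw [← mu_comp_sigmaC, PrimeSpectrum.comap_comp_apply]
    change s.dag (s.next i) = i
    rw [h, dag_dag]
  exact le_of_eq (congrArg PrimeSpectrum.asIdeal h1).symm

/-- The automorphism of `L_i` induced by `σ_{c ξ⁻¹}`, for an arrow `i → next i` that is fixed by
the involution. -/
def sigmaCXiAt (i : s.Vertex) (h : s.next i = s.dag i) : s.Lat i →+* s.Lat i :=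
  Ideal.quotientMap i.asIdeal s.sigmaCXi (s.comap_sigmaCXi i h)

/-! ### The group `H` and the space `g(ξ)` -/

/-- The field `k^σ`. -/
abbrev k₀ (_s : Datum k σk) : Subfield k := fixedField σk

theorem σk_coe (a : s.k₀) : σk (a : k) = a := a.2

theorem σ_algebraMap_k₀ (a : s.k₀) : s.σ (algebraMap k s.F a) = algebraMap k s.F a := by
  rw [σ_algebraMap, σk_coe]

/-- The pairing on `V` as a `k^σ`-bilinear map. -/
def formK : s.V →ₗ[s.k₀] s.V →ₗ[s.k₀] s.F :=
  LinearMap.mk₂ s.k₀ (fun x y => s.form x y) (by simp)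
    (fun a x y => by
      change s.form ((a : k) • x) y = (a : k) • _
      rw [← algebraMap_smul s.F (a : k) x, map_smul, LinearMap.smul_apply, algebraMap_smul])
    (by simp)
    (fun a x y => by
      change s.form x ((a : k) • y) = (a : k) • _
      rw [← algebraMap_smul s.F (a : k) y, LinearMap.map_smulₛₗ]
      change s.σ _ • _ = _
      rw [σ_algebraMap_k₀ s a, algebraMap_smul])

/-- `θ` as a `k^σ`-linear map. -/
def θLin : s.V →ₗ[s.k₀] s.V where
  toFun := s.θ
  map_add' := s.θ.map_add
  map_smul' a v := s.θ_smul_base (a : k) v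

/-- The `R`-points of `H`: the `R ⊗ F`-linear automorphisms of `R ⊗ V` that preserve the pairing
and commute with `θ`. -/
def H (R : Type u) [CommRing R] [Algebra s.k₀ R] :
    Subgroup (R ⊗[s.k₀] s.V ≃ₗ[R] R ⊗[s.k₀] s.V) where
  carrier := {g | g ∈ GLPts s.k₀ s.F s.V R ∧ g ∈ isometryPts s.k₀ s.formK R ∧
    ∀ x, g (s.θLin.baseChange R x) = s.θLin.baseChange R (g x)}
  one_mem' := ⟨one_mem _, one_mem _, fun _ => rfl⟩
  mul_mem' {g h} hg hh := ⟨mul_mem hg.1 hh.1, mul_mem hg.2.1 hh.2.1, fun x => by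
    change g (h _) = s.θLin.baseChange R (g (h x))
    rw [hh.2.2, hg.2.2]⟩
  inv_mem' {g} hg := ⟨inv_mem hg.1, inv_mem hg.2.1, fun x => by
    change g.symm _ = s.θLin.baseChange R (g.symm x)
    apply g.injective
    rw [hg.2.2]
    simp⟩

/-- The space `g(ξ)` of the `F`-linear endomorphisms `φ` of `V` with `θ φ θ⁻¹ = ξ φ` that are
skew-adjoint for the pairing. -/
def gξ : Submodule s.k₀ (s.V →ₗ[s.F] s.V) where
  carrier := {φ | (∀ v, s.θ (φ v) = (s.ξ : s.F) • φ (s.θ v)) ∧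
    ∀ x y, s.form (φ x) y + s.form x (φ y) = 0}
  zero_mem' := ⟨by simp, by simp⟩
  add_mem' {φ ψ} hφ hψ := ⟨fun v => by simp [hφ.1, hψ.1], fun x y => by
    have h1 := hφ.2 x y
    have h2 := hψ.2 x y
    simp only [LinearMap.add_apply, map_add]
    linear_combination h1 + h2⟩
  smul_mem' a φ hφ := ⟨fun v => by
      change s.θ ((a : k) • φ v) = _ • (a : k) • _
      rw [θ_smul_base, hφ.1, smul_comm], fun x y => by
      have h1 : s.formK (a • φ x) y + s.formK x (a • φ y) = 0 := by
        rw [map_smul, map_smul, LinearMap.smul_apply, ← smul_add]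
        change a • (s.form (φ x) y + s.form x (φ y)) = 0
        rw [hφ.2, smul_zero]
      exact h1⟩

/-- The isotypic part of `V` at the vertex `i`: the elements on which `L_β` acts through `L_i`. -/
def isotypic (i : s.Vertex) : Set s.V := {v | ∀ l ∈ i.asIdeal, s.ofL l • v = 0}

/-- The `R`-points of the factor `H^α` of `H`: the elements of `H` that act as the identity on the
isotypic parts of `V` at the vertices outside of `α`. -/
def Hα (α : s.Orbit) (R : Type u) [CommRing R] [Algebra s.k₀ R] :
    Subgroup (R ⊗[s.k₀] s.V ≃ₗ[R] R ⊗[s.k₀] s.V) where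
  carrier := {g | g ∈ s.H R ∧ ∀ i, s.orbit i ≠ α → ∀ v ∈ s.isotypic i,
    g ((1 : R) ⊗ₜ[s.k₀] v) = (1 : R) ⊗ₜ[s.k₀] v}
  one_mem' := ⟨one_mem _, fun _ _ _ _ => rfl⟩
  mul_mem' {g h} hg hh := ⟨mul_mem hg.1 hh.1, fun i hi v hv => by
    change g (h _) = _
    rw [hh.2 i hi v hv, hg.2 i hi v hv]⟩
  inv_mem' {g} hg := ⟨inv_mem hg.1, fun i hi v hv => by
    change g.symm _ = _
    rw [LinearEquiv.symm_apply_eq, hg.2 i hi v hv]⟩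

/-- The summand `g(ξ)^α` of `g(ξ)`: the elements of `g(ξ)` that vanish on the isotypic parts of `V`
at the vertices outside of `α`. -/
def gξα (α : s.Orbit) : Submodule s.k₀ (s.V →ₗ[s.F] s.V) where
  carrier := {φ | φ ∈ s.gξ ∧ ∀ i, s.orbit i ≠ α → ∀ v ∈ s.isotypic i, φ v = 0}
  zero_mem' := ⟨zero_mem _, by simp⟩
  add_mem' {φ ψ} hφ hψ := ⟨add_mem hφ.1 hψ.1, fun i hi v hv => by
    simp [hφ.2 i hi v hv, hψ.2 i hi v hv]⟩
  smul_mem' a φ hφ := ⟨Submodule.smul_mem _ _ hφ.1, fun i hi v hv => by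
    simp [hφ.2 i hi v hv]⟩

/-- The inclusion of `g(ξ)^α` into the `k^σ`-linear endomorphisms of `V`. -/
def gξαIncl (α : s.Orbit) : s.gξα α →ₗ[s.k₀] (s.V →ₗ[s.k₀] s.V) :=
  LinearMap.restrictScalarsₗ s.k₀ s.F s.V s.V s.k₀ ∘ₗ (s.gξα α).subtype

/-! ### Simple modules, admissible pairings, and the isomorphisms `η_e` -/

section Admissible

variable {P Q : Type u} [AddCommGroup P] [Module s.A P] [AddCommGroup Q] [Module s.A Q]

/-- Admissible pairings between two `A_β`-modules. -/
structure IsAdmissible (B : P →+ Q →+ s.F) : Prop where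
  smul_left : ∀ (a : s.F) (u : P) (v : Q), B (s.incl a • u) v = a * B u v
  smul_right : ∀ (a : s.F) (u : P) (v : Q), B u (s.incl a • v) = s.σ a * B u v
  theta : ∀ (u : P) (v : Q), B (s.θA • u) (s.θA • v) = s.c * s.ζ (B u v)

/-- Perfect pairings (linear in the first and `σ`-semilinear in the second variable). -/
structure IsPerfect (B : P →+ Q →+ s.F) : Prop where
  left : ∀ f : Q →+ s.F, (∀ (a : s.F) (v : Q), f (s.incl a • v) = s.σ a * f v) →
    ∃! u : P, ∀ v, B u v = f v
  right : ∀ f : P →+ s.F, (∀ (a : s.F) (u : P), f (s.incl a • u) = a * f u) →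
    ∃! v : Q, ∀ u, B u v = f u

/-- Hermitian pairings on an `A_β`-module. -/
def IsHermitian (B : P →+ P →+ s.F) : Prop := ∀ u v, B v u = s.σ (B u v)

/-- Isomorphisms of `A_β`-modules `P^ξ ≅ Q`, where `P^ξ` is the `F`-module `P` on which
`θ ∈ A_β` acts as `u ↦ ξ θ u`. -/
structure IsTwistedIso (η : P →+ Q) : Prop where
  bijective : Function.Bijective η
  map_smul : ∀ (a : s.F) (u : P), η (s.incl a • u) = s.incl a • η u
  map_theta : ∀ u : P, η (s.incl s.ξ • s.θA • u) = s.θA • η u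

end Admissible

/-- The choices that are made in order to describe `H` and `g(ξ)`: a simple module `S i` at each
vertex, admissible pairings between `S i` and `S i†`, and isomorphisms `η_e : (S i)^ξ ≅ S j` for
each arrow `e : i → j`. (The pairings and isomorphisms are indexed by pairs of vertices `i`, `j`
with `i† = j`, resp. `ξ̄(i) = j`.) -/
structure Choices where
  S : s.Vertex → Type u
  [addCommGroupS : ∀ i, AddCommGroup (S i)]
  [moduleS : ∀ i, Module s.A (S i)]
  [simpleS : ∀ i, IsSimpleModule s.A (S i)]
  /-- `S i` is a module over the factor of `A_β` at the vertex `i`. -/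
  support : ∀ i, ∀ l ∈ i.asIdeal, ∀ u : S i, s.ofL l • u = 0
  pairing : ∀ i j, s.dag i = j → S i →+ S j →+ s.F
  admissible : ∀ i j h, s.IsAdmissible (pairing i j h)
  perfect : ∀ i j h, s.IsPerfect (pairing i j h)
  /-- The signs `ε_i`. -/
  εv : s.Vertex → ℤˣ
  pairing_symm : ∀ i j (h : s.dag i = j) (h' : s.dag j = i) (u : S i) (v : S j),
    pairing j i h' v u = εv i • s.σ (pairing i j h u v)
  /-- The pairings are chosen with sign `1`, except at a self-dual vertex `i` such that `S i` has
  no perfect Hermitian admissible pairing. -/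
  εv_eq_neg_one : ∀ i, εv i = -1 → s.dag i = i ∧
    ¬ ∃ B : S i →+ S i →+ s.F, s.IsAdmissible B ∧ s.IsPerfect B ∧ s.IsHermitian B
  η : ∀ i j, s.next i = j → S i →+ S j
  η_iso : ∀ i j h, s.IsTwistedIso (η i j h)
  /-- The signs `ε_e`; an arrow is given by its source. -/
  εe : s.Vertex → ℤˣ
  /-- The relation between `η_e` for `e : i → j` and `η_{e†}` for the dual arrow
  `e† : j' → i'`, where `i' = i†` and `j' = j†`. -/
  η_adjoint : ∀ i j i' j' (hj : s.next i = j) (hi' : s.dag i = i') (hj' : s.dag j' = j)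
    (he' : s.next j' = i') (u : S i) (v : S j'),
    s.σ (pairing j' j hj' v (η i j hj u)) = εe i • pairing i i' hi' u (η j' i' he' v)
  /-- The isomorphisms are chosen with sign `1`, except at an arrow `e = e†` for which there is no
  self-adjoint isomorphism. -/
  εe_eq_neg_one : ∀ i, εe i = -1 → s.next i = s.dag i ∧
    ¬ ∃ f : S i →+ S (s.dag i), s.IsTwistedIso f ∧
      ∀ u v, pairing i _ rfl u (f v) = s.σ (pairing i _ rfl v (f u))

attribute [instance] Choices.addCommGroupS Choices.moduleS Choices.simpleS

namespace Choices

variable {s} (C : s.Choices)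

/-- The division algebra `D_i = End(S_i)ᵒᵖ`. -/
abbrev D (i : s.Vertex) : Type u := (Module.End s.A (C.S i))ᵐᵒᵖ

/-- The multiplicity space `M_i = Hom(S_i, V)`. -/
abbrev M (i : s.Vertex) : Type u := C.S i →ₗ[s.A] s.V

/-- The left `D_i`-module structure of `M_i`: `(d x)(u) = x(u d)`. -/
instance moduleDM (i : s.Vertex) : Module (C.D i) (C.M i) where
  smul d x := x.comp d.unop
  one_smul _ := rfl
  mul_smul _ _ _ := rfl
  smul_zero _ := rfl
  smul_add _ _ _ := rfl
  add_smul d d' x := LinearMap.ext fun u => x.map_add (d.unop u) (d'.unop u)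
  zero_smul x := LinearMap.ext fun _ => x.map_zero

theorem D_smul_apply {i : s.Vertex} (d : C.D i) (x : C.M i) (u : C.S i) :
    (d • x) u = x (d.unop u) := rfl

instance (i : s.Vertex) : SMulCommClass (C.D i) s.k₀ (C.M i) := ⟨fun _ _ _ => rfl⟩

/-- The action of `L_β` on `S_i` by `A_β`-linear endomorphisms. -/
def actL (i : s.Vertex) : s.L →+* Module.End s.A (C.S i) where
  toFun l :=
    { toFun := fun u => s.ofL l • u
      map_add' := smul_add _
      map_smul' := fun a u => by
        rw [RingHom.id_apply, ← mul_smul, s.ofL_central, mul_smul] }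
  map_one' := by ext u; simp
  map_mul' l l' := LinearMap.ext fun u => by
    change s.ofL (l * l') • u = s.ofL l • s.ofL l' • u
    rw [map_mul, mul_smul]
  map_zero' := by ext u; simp
  map_add' l l' := by ext u; simp [add_smul]

theorem actL_apply (i : s.Vertex) (l : s.L) (u : C.S i) : C.actL i l u = s.ofL l • u := rfl

theorem actL_comm (i : s.Vertex) (l : s.L) (d : Module.End s.A (C.S i)) :
    C.actL i l * d = d * C.actL i l := by
  ext u
  exact (d.map_smul _ _).symm

/-- The homomorphism `L_i → D_i`. -/
def LtoD (i : s.Vertex) : s.Lat i →+* C.D i :=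
  Ideal.Quotient.lift i.asIdeal
    { toFun := fun l => MulOpposite.op (C.actL i l)
      map_one' := by rw [map_one]; rfl
      map_mul' := fun l l' => by rw [mul_comm, map_mul]; rfl
      map_zero' := by rw [map_zero]; rfl
      map_add' := fun l l' => by rw [map_add]; rfl }
    (fun l hl => MulOpposite.unop_injective (LinearMap.ext fun u => C.support i l hl u))

/-- `D_i` is an `L_i`-algebra. -/
instance (i : s.Vertex) : Algebra (s.Lat i) (C.D i) :=
  (C.LtoD i).toAlgebra' (by
    intro l d
    obtain ⟨l, rfl⟩ := s.toLat_surjective i l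
    exact MulOpposite.unop_injective (C.actL_comm i l d.unop).symm)

/-- `η_e^♭(d)` for an arrow `e : i → j`: the unique `d' ∈ D_j` with
`η_e(u d) = η_e(u) d'` for all `u ∈ S_i`. -/
def ηFlat (i j : s.Vertex) (h : s.next i = j) (d : C.D i) : C.D j :=
  let e : C.S i ≃+ C.S j := AddEquiv.ofBijective (C.η i j h) (C.η_iso i j h).bijective
  MulOpposite.op (s.linearOfGenerators
    ((e.toAddMonoidHom.comp d.unop.toAddMonoidHom).comp e.symm.toAddMonoidHom)
    (by
      intro a w
      obtain ⟨u, rfl⟩ := e.surjective w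
      have h1 : s.incl a • e u = e (s.incl a • u) := ((C.η_iso i j h).map_smul a u).symm
      change e (d.unop (e.symm _)) = s.incl a • e (d.unop (e.symm _))
      rw [h1, e.symm_apply_apply, e.symm_apply_apply, d.unop.map_smul]
      exact (C.η_iso i j h).map_smul a _)
    (by
      intro w
      obtain ⟨u, rfl⟩ := e.surjective w
      have h1 : s.θA • e u = e (s.incl s.ξ • s.θA • u) := ((C.η_iso i j h).map_theta u).symm
      change e (d.unop (e.symm _)) = s.θA • e (d.unop (e.symm _))
      rw [h1, e.symm_apply_apply, e.symm_apply_apply]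
      refine Eq.trans ?_ ((C.η_iso i j h).map_theta _)
      rw [d.unop.map_smul, d.unop.map_smul]
      rfl))

theorem η_unop (i j : s.Vertex) (h : s.next i = j) (d : C.D i) (u : C.S i) :
    C.η i j h (d.unop u) = (C.ηFlat i j h d).unop (C.η i j h u) := by
  let e : C.S i ≃+ C.S j := AddEquiv.ofBijective (C.η i j h) (C.η_iso i j h).bijective
  change e _ = e (d.unop (e.symm (e u)))
  rw [e.symm_apply_apply]

theorem pairing_ext (i j : s.Vertex) (h : s.dag i = j) {u u' : C.S i}
    (huu' : ∀ v, C.pairing i j h u v = C.pairing i j h u' v) : u = u' :=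
  ((C.perfect i j h).left (C.pairing i j h u')
    (fun a v => (C.admissible i j h).smul_right a u' v)).unique huu' (fun _ => rfl)

theorem exists_pairing_eq (i j : s.Vertex) (h : s.dag i = j) (x : C.M i) (y : C.M j)
    (u : C.S i) : ∃ u' : C.S i, ∀ v, C.pairing i j h u' v = s.form (x u) (y v) := by
  obtain ⟨u', hu', -⟩ := (C.perfect i j h).left
    (AddMonoidHom.mk' (fun v => s.form (x u) (y v)) (fun v v' => by rw [map_add, map_add]))
    (fun a v => by
      change s.form (x u) (y (s.incl a • v)) = s.σ a * s.form (x u) (y v)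
      rw [map_smul, incl_smul, LinearMap.map_smulₛₗ]
      rfl)
  exact ⟨u', hu'⟩

theorem θA_surjective (i : s.Vertex) (v : C.S i) : ∃ w : C.S i, s.θA • w = v := by
  have h : s.θA * (s.θA ^ (s.n * s.r - 1) * s.incl (algebraMap k s.F s.β⁻¹)) = 1 := by
    have hn : 0 < s.n := s.isOfFinOrder_ζ.orderOf_pos
    rw [← mul_assoc, ← pow_succ', Nat.sub_add_cancel
      (Nat.succ_le_of_lt (Nat.mul_pos hn (Nat.pos_of_ne_zero s.r_pos))), θA_pow, ← map_mul,
      ← map_mul, mul_inv_cancel₀ s.β_ne_zero, map_one, map_one]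
  exact ⟨(s.θA ^ (s.n * s.r - 1) * s.incl (algebraMap k s.F s.β⁻¹)) • v, by
    rw [← mul_smul, h, one_smul]⟩

/-- The element `u {x, y}'_i` of `S_i`, see `pairD`. -/
def pairFun (i j : s.Vertex) (h : s.dag i = j) (x : C.M i) (y : C.M j) (u : C.S i) : C.S i :=
  (C.exists_pairing_eq i j h x y u).choose

theorem pairing_pairFun (i j : s.Vertex) (h : s.dag i = j) (x : C.M i) (y : C.M j) (u : C.S i)
    (v : C.S j) : C.pairing i j h (C.pairFun i j h x y u) v = s.form (x u) (y v) :=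
  (C.exists_pairing_eq i j h x y u).choose_spec v

/-- The pairing `{x, y}'_i ∈ D_i` of `x ∈ M_i` and `y ∈ M_j`, `j = i†`, which is characterized by
`⟨x(u), y(v)⟩ = ⟨u {x, y}'_i, v⟩_i`. -/
def pairD (i j : s.Vertex) (h : s.dag i = j) (x : C.M i) (y : C.M j) : C.D i :=
  MulOpposite.op (s.linearOfGenerators
    (AddMonoidHom.mk' (C.pairFun i j h x y) (fun u u' => by
      refine C.pairing_ext i j h fun v => ?_
      rw [map_add, AddMonoidHom.add_apply]
      simp only [pairing_pairFun]
      rw [map_add, map_add, LinearMap.add_apply]))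
    (by
      intro a u
      refine C.pairing_ext i j h fun v => ?_
      rw [(C.admissible i j h).smul_left]
      simp only [AddMonoidHom.mk'_apply, pairing_pairFun]
      rw [x.map_smul, incl_smul, map_smul, LinearMap.smul_apply, smul_eq_mul])
    (by
      intro u
      refine C.pairing_ext i j h fun v => ?_
      obtain ⟨w, rfl⟩ := C.θA_surjective j v
      rw [(C.admissible i j h).theta]
      simp only [AddMonoidHom.mk'_apply, pairing_pairFun]
      rw [x.map_smul, y.map_smul, θA_smul, θA_smul, s.form_θ]))

theorem pairing_pairD (i j : s.Vertex) (h : s.dag i = j) (x : C.M i) (y : C.M j) (u : C.S i)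
    (v : C.S j) : C.pairing i j h ((C.pairD i j h x y).unop u) v = s.form (x u) (y v) :=
  C.pairing_pairFun i j h x y u v

theorem pairD_unique (i j : s.Vertex) (h : s.dag i = j) (x : C.M i) (y : C.M j) (d : C.D i)
    (hd : ∀ u v, C.pairing i j h (d.unop u) v = s.form (x u) (y v)) :
    C.pairD i j h x y = d :=
  MulOpposite.unop_injective (LinearMap.ext fun u => C.pairing_ext i j h fun v => by
    rw [pairing_pairD, hd])

theorem smul_k₀_unop (i : s.Vertex) (a : s.k₀) (d : C.D i) (u : C.S i) :
    (algebraMap s.k₀ (s.Lat i) a • d).unop u = s.incl (algebraMap k s.F a) • d.unop u := by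
  have h : algebraMap s.k₀ (s.Lat i) a • d =
      MulOpposite.op (C.actL i (algebraMap k s.L (a : k))) * d := rfl
  rw [h, MulOpposite.unop_mul]
  change d.unop (s.ofL _ • u) = _
  rw [ofL_algebraMap, d.unop.map_smul]

theorem formK_apply (x y : s.V) : s.formK x y = s.form x y := rfl

/-- The `L_i`-valued pairing `{x, y}_i = Trd {x, y}'_i` of `x ∈ M_i` and `y ∈ M_j`, `j = i†`. -/
def pairL (i j : s.Vertex) (h : s.dag i = j) : C.M i →ₗ[s.k₀] C.M j →ₗ[s.k₀] s.Lat i :=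
  LinearMap.mk₂ s.k₀ (fun x y => reducedTrace (s.Lat i) (C.D i) (C.pairD i j h x y))
    (fun x x' y => by
      rw [← map_add]
      congr 1
      refine C.pairD_unique i j h _ _ _ fun u v => ?_
      rw [MulOpposite.unop_add, LinearMap.add_apply, map_add, AddMonoidHom.add_apply,
        pairing_pairD, pairing_pairD, LinearMap.add_apply, map_add, LinearMap.add_apply])
    (fun a x y => by
      rw [Algebra.smul_def, ← smul_eq_mul, ← map_smul]
      congr 1
      refine C.pairD_unique i j h _ _ _ fun u v => ?_
      rw [smul_k₀_unop, (C.admissible i j h).smul_left, pairing_pairD, LinearMap.smul_apply,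
        ← formK_apply, ← formK_apply, map_smul, LinearMap.smul_apply]
      exact (Algebra.smul_def (a : k) _).symm)
    (fun x y y' => by
      rw [← map_add]
      congr 1
      refine C.pairD_unique i j h _ _ _ fun u v => ?_
      rw [MulOpposite.unop_add, LinearMap.add_apply, map_add, AddMonoidHom.add_apply,
        pairing_pairD, pairing_pairD, LinearMap.add_apply, map_add])
    (fun a x y => by
      rw [Algebra.smul_def, ← smul_eq_mul, ← map_smul]
      congr 1
      refine C.pairD_unique i j h _ _ _ fun u v => ?_
      rw [smul_k₀_unop, (C.admissible i j h).smul_left, pairing_pairD, LinearMap.smul_apply,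
        ← formK_apply, ← formK_apply, map_smul]
      exact (Algebra.smul_def (a : k) _).symm)

/-- `Hom_{D_i}(M_i, M_j)` for an arrow `e : i → j`, where `D_i` acts on `M_j` through `η_e^♭`. -/
def HomD (i j : s.Vertex) (h : s.next i = j) : Submodule s.k₀ (C.M i →ₗ[s.k₀] C.M j) where
  carrier := {φ | ∀ (d : C.D i) (x : C.M i), φ (d • x) = C.ηFlat i j h d • φ x}
  zero_mem' d x := by simp
  add_mem' {φ ψ} hφ hψ d x := by
    rw [LinearMap.add_apply, LinearMap.add_apply, hφ, hψ, smul_add]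
  smul_mem' a φ hφ d x := by
    rw [LinearMap.smul_apply, LinearMap.smul_apply, hφ]
    exact (smul_comm _ a _).symm

theorem sigmaCXiAt_smul (i : s.Vertex) (h : s.next i = s.dag i) (a : s.k₀) (l : s.Lat i) :
    s.sigmaCXiAt i h (a • l) = a • s.sigmaCXiAt i h l := by
  obtain ⟨l, rfl⟩ := s.toLat_surjective i l
  have h1 : s.sigmaCXiAt i h (algebraMap s.k₀ (s.Lat i) a) = algebraMap s.k₀ (s.Lat i) a := by
    change s.toLat i (s.sigmaCXi (algebraMap k s.L (a : k))) = _
    rw [sigmaCXi, sigmaTwist_base, s.σk_coe]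
    rfl
  rw [Algebra.smul_def, map_mul, h1, ← Algebra.smul_def]

/-- The space `h^{ε'}(M_i, M_j)` for an arrow `e : i → j` fixed by the involution, i.e. with
`j = i†`: the `φ` in `Hom_{D_i}(M_i, M_j)` with
`{y, φ(x)}_i = ε' σ_{c ξ⁻¹}({x, φ(y)}_i)` for all `x, y ∈ M_i`. -/
def hSpace (i j : s.Vertex) (h : s.next i = j) (h' : s.dag i = j) (ε' : ℤˣ) :
    Submodule s.k₀ (C.M i →ₗ[s.k₀] C.M j) where
  carrier := {φ | φ ∈ C.HomD i j h ∧ ∀ x y : C.M i,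
    C.pairL i j h' y (φ x) = ε' • s.sigmaCXiAt i (h.trans h'.symm) (C.pairL i j h' x (φ y))}
  zero_mem' := ⟨zero_mem _, by simp⟩
  add_mem' {φ ψ} hφ hψ := ⟨add_mem hφ.1 hψ.1, fun x y => by
    rw [LinearMap.add_apply, LinearMap.add_apply, map_add, map_add, map_add, smul_add, hφ.2,
      hψ.2]⟩
  smul_mem' a φ hφ := ⟨Submodule.smul_mem _ _ hφ.1, fun x y => by
    rw [LinearMap.smul_apply, LinearMap.smul_apply, map_smul, map_smul, sigmaCXiAt_smul, hφ.2,
      smul_comm]⟩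

/-- Evaluation at `u ∈ S_i`, i.e. the map `M_i → V`, `x ↦ u ⊗ x = x(u)`. -/
def ev (i : s.Vertex) (u : C.S i) : C.M i →ₗ[s.k₀] s.V where
  toFun x := x u
  map_add' _ _ := rfl
  map_smul' _ _ := rfl

/-! ### The description of `H^α` and `g(ξ)^α` -/

/-- The ambient group of `R`-linear automorphisms of `R ⊗ M_i`. -/
abbrev AutR (i : s.Vertex) (R : Type u) [CommRing R] [Algebra s.k₀ R] : Type u :=
  R ⊗[s.k₀] C.M i ≃ₗ[R] R ⊗[s.k₀] C.M i

/-- The `R`-points of `GL_{D_i/k^σ}(M_i)`. -/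
abbrev GLD (i : s.Vertex) (R : Type u) [CommRing R] [Algebra s.k₀ R] : Subgroup (C.AutR i R) :=
  GLPts s.k₀ (C.D i) (C.M i) R

/-- The `R`-points of `Aut_{D_i/k^σ}(M_i, {·,·}_i)` at a self-dual vertex `i = i†`. -/
abbrev Isom (i : s.Vertex) (h : s.dag i = i) (R : Type u) [CommRing R] [Algebra s.k₀ R] :
    Subgroup (C.AutR i R) :=
  GLPts s.k₀ (C.D i) (C.M i) R ⊓ isometryPts s.k₀ (C.pairL i i h) R

/-- `T = g^{*,-1}` is the contragredient of `g`: the automorphism `T` of `M_j`, `j = i†`, with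
`{g x, T y}_i = {x, y}_i`. -/
def IsContragredient (i j : s.Vertex) (h : s.dag i = j) {R : Type u} [CommRing R]
    [Algebra s.k₀ R] (g : C.AutR i R) (T : C.AutR j R) : Prop :=
  T ∈ C.GLD j R ∧ ∀ x y, extPair s.k₀ R (C.pairL i j h) (g x) (T y) =
    extPair s.k₀ R (C.pairL i j h) x y

/-- A summand of `g(ξ)^α`, for given labels `v j` of vertices: a space `W` of maps
`M_a → M_b` for an arrow `a → b`, and the action of `(g_j) ∈ ∏ GL(M_{v j})` on it
(`act R g φ φ'` means `φ' = g φ`, for `φ`, `φ'` in `R ⊗ W`). -/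
structure Summand {J : Type} (v : J → s.Vertex) where
  a : s.Vertex
  b : s.Vertex
  arrow : s.next a = b
  W : Submodule s.k₀ (C.M a →ₗ[s.k₀] C.M b)
  act : ∀ (R : Type u) [CommRing R] [Algebra s.k₀ R], (∀ j, C.AutR (v j) R) →
    (R ⊗[s.k₀] C.M a →ₗ[R] R ⊗[s.k₀] C.M b) → (R ⊗[s.k₀] C.M a →ₗ[R] R ⊗[s.k₀] C.M b) → Prop

/-- The summand `Hom_{D_i}(M_i, M_i')` for an arrow between labelled vertices `i = v j`,
`i' = v j'`, with the action `φ ↦ g_{j'} φ g_j⁻¹`. -/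
def homSummand {J : Type} (v : J → s.Vertex) (j j' : J) (h : s.next (v j) = v j') :
    C.Summand v where
  a := v j
  b := v j'
  arrow := h
  W := C.HomD (v j) (v j') h
  act _ _ _ g φ φ' := ∀ x, φ' (g j x) = g j' (φ x)

/-- The summand `h^{-ε ε_e}(M_i, M_{i†})` for a self-dual arrow `e : i → i†` with labelled source
`i = v j`, with the action through `g_j` on `M_i` and the contragredient of `g_j` on `M_{i†}`. -/
def outSummand {J : Type} (v : J → s.Vertex) (j : J) (h : s.next (v j) = s.dag (v j)) :
    C.Summand v where
  a := v j
  b := s.dag (v j)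
  arrow := h
  W := C.hSpace (v j) (s.dag (v j)) h rfl (-(s.ε * C.εe (v j)))
  act _ _ _ g φ φ' := ∃ T, C.IsContragredient (v j) (s.dag (v j)) rfl (g j) T ∧
    ∀ x, φ' (g j x) = T (φ x)

/-- The summand `h^{-ε ε_e}(M_{i†}, M_i)` for a self-dual arrow `e : i† → i` with labelled target
`i = v j`, with the action through `g_j` on `M_i` and the contragredient of `g_j` on `M_{i†}`. -/
def inSummand {J : Type} (v : J → s.Vertex) (j : J) (h : s.next (s.dag (v j)) = v j) :
    C.Summand v where
  a := s.dag (v j)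
  b := v j
  arrow := h
  W := C.hSpace (s.dag (v j)) (v j) h (s.dag_dag _) (-(s.ε * C.εe (s.dag (v j))))
  act _ _ _ g φ φ' := ∃ T, C.IsContragredient (v j) (s.dag (v j)) rfl (g j) T ∧
    ∀ x, φ' (T x) = g j (φ x)

/-- The statement `(H^α, g(ξ)^α) ≅ (∏_j G_j, ⊕_e W_e)`: there are
* isomorphisms `Φ R : H^α(R) ≅ ∏_j G_j(R)`, natural in the commutative `k^σ`-algebra `R`, with
  `g (u ⊗ x) = u ⊗ g_j x`;
* a `k^σ`-linear isomorphism `Ψ : g(ξ)^α ≅ ⊕_e W_e` with `φ (u ⊗ x) = η_e(u) ⊗ φ_e(x)`;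
such that for every `R` the action of `H^α(R)` on `R ⊗ g(ξ)^α` by conjugation corresponds to the
action of `∏_j G_j(R)` on `⊕_e R ⊗ W_e`. -/
def IsDescribedBy (α : s.Orbit) {J E : Type} (v : J → s.Vertex)
    (G : ∀ (j : J) (R : Type u) [CommRing R] [Algebra s.k₀ R], Subgroup (C.AutR (v j) R))
    (P : E → C.Summand v) : Prop :=
  ∃ (Φ : ∀ (R : Type u) [CommRing R] [Algebra s.k₀ R], s.Hα α R ≃* ∀ j, G j R)
    (Ψ : s.gξα α ≃ₗ[s.k₀] ∀ e, (P e).W),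
    (∀ (R R' : Type u) [CommRing R] [Algebra s.k₀ R] [CommRing R'] [Algebra s.k₀ R']
      (f : R →ₐ[s.k₀] R') (g : s.Hα α R) (g' : s.Hα α R'),
      IsBaseChangeAlong s.k₀ f g.1 g'.1 →
        ∀ j, IsBaseChangeAlong s.k₀ f (Φ R g j).1 (Φ R' g' j).1) ∧
    (∀ (R : Type u) [CommRing R] [Algebra s.k₀ R] (g : s.Hα α R) (j : J) (u : C.S (v j))
      (x : R ⊗[s.k₀] C.M (v j)),
      g.1 ((C.ev (v j) u).baseChange R x) = (C.ev (v j) u).baseChange R ((Φ R g j).1 x)) ∧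
    (∀ (φ : s.gξα α) (e : E) (u : C.S (P e).a) (x : C.M (P e).a),
      φ.1 (x u) = (Ψ φ e).1 x (C.η (P e).a (P e).b (P e).arrow u)) ∧
    ∀ (R : Type u) [CommRing R] [Algebra s.k₀ R] (g : s.Hα α R) (w : R ⊗[s.k₀] s.gξα α),
      ∃ w' : R ⊗[s.k₀] s.gξα α,
        (∀ x, extHom s.k₀ R (s.gξαIncl α) w' (g.1 x) = g.1 (extHom s.k₀ R (s.gξαIncl α) w x)) ∧
        ∀ e, (P e).act R (fun j => (Φ R g j).1)
          (extHom s.k₀ R ((P e).W.subtype ∘ₗ LinearMap.proj e ∘ₗ Ψ.toLinearMap) w)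
          (extHom s.k₀ R ((P e).W.subtype ∘ₗ LinearMap.proj e ∘ₗ Ψ.toLinearMap) w')

end Choices

/-! ### The shapes -/

/-- Shape (CC-ℓ) with `ℓ = p + 1`: two disjoint directed cycles exchanged by the involution,
with vertices `v 0, …, v p` and `(v 0)†, …, (v p)†`. -/
structure ShapeCC (α : s.Orbit) (p : ℕ) where
  v : Fin (p + 1) → s.Vertex
  arrow : ∀ j, s.next (v j) = v (j + 1)
  injective : Function.Injective v
  dag_ne : ∀ j j', s.dag (v j) ≠ v j'
  mem_iff : ∀ i, s.orbit i = α ↔ ∃ j, i = v j ∨ i = s.dag (v j)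

/-- Shape (VV-ℓ) with `ℓ = p + 1`: a directed cycle with exactly two self-dual vertices `v 0` and
`v ℓ`, and with vertices `v 0, …, v ℓ, (v (ℓ-1))†, …, (v 1)†`. -/
structure ShapeVV (α : s.Orbit) (p : ℕ) where
  v : Fin (p + 2) → s.Vertex
  arrow : ∀ j : Fin (p + 1), s.next (v j.castSucc) = v j.succ
  injective : Function.Injective v
  fixed_iff : ∀ j, s.dag (v j) = v j ↔ j = 0 ∨ j = Fin.last (p + 1)
  dag_ne : ∀ j j', j ≠ j' → s.dag (v j) ≠ v j'
  mem_iff : ∀ i, s.orbit i = α ↔ ∃ j, i = v j ∨ i = s.dag (v j)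

/-- Shape (VE-ℓ): a directed cycle with exactly one self-dual vertex `v 0` and one self-dual
arrow `v ℓ → (v ℓ)†`, and with vertices `v 0, …, v ℓ, (v ℓ)†, …, (v 1)†`. -/
structure ShapeVE (α : s.Orbit) (ℓ : ℕ) where
  v : Fin (ℓ + 1) → s.Vertex
  arrow : ∀ j : Fin ℓ, s.next (v j.castSucc) = v j.succ
  arrow_last : s.next (v (Fin.last ℓ)) = s.dag (v (Fin.last ℓ))
  injective : Function.Injective v
  fixed_iff : ∀ j, s.dag (v j) = v j ↔ j = 0
  dag_ne : ∀ j j', j ≠ j' → s.dag (v j) ≠ v j'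
  mem_iff : ∀ i, s.orbit i = α ↔ ∃ j, i = v j ∨ i = s.dag (v j)

/-- Shape (EE-ℓ) with `ℓ = p + 1`: a directed cycle with no self-dual vertex and exactly two
self-dual arrows `(v 0)† → v 0` and `v p → (v p)†`, and with vertices
`v 0, …, v p, (v p)†, …, (v 0)†`. -/
structure ShapeEE (α : s.Orbit) (p : ℕ) where
  v : Fin (p + 1) → s.Vertex
  arrow_first : s.next (s.dag (v 0)) = v 0
  arrow : ∀ j : Fin p, s.next (v j.castSucc) = v j.succ
  arrow_last : s.next (v (Fin.last p)) = s.dag (v (Fin.last p))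
  injective : Function.Injective v
  dag_ne : ∀ j j', s.dag (v j) ≠ v j'
  mem_iff : ∀ i, s.orbit i = α ↔ ∃ j, i = v j ∨ i = s.dag (v j)

end Datum
end
end CyclicGrading

/-! The argument is Morita theory over `A_β`, made explicit so that it survives base change from
`k^σ` to an arbitrary algebra `R`.

Structure of `A_β`. The algebra `F` is Galois over `k` with group generated by `ζ`: there are
finitely many pairs `(x, y)` for which `∑ x g(y)` is 1 for `g = 1` and 0 for every other power `g`
of `ζ` (`exists_dual_families`). By means of these pairs every `z` in `A_β` is a sum of terms `x
t(z) θ ^ j` with `t(z)` in `L_β`, where `t(z)` arises from `z` by multiplications on both sides and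
additions (`exists_expansion`). Two-sided ideals are therefore controlled by the elements of `L_β`
that they contain, and `L_β` is reduced because `X ^ (m/n) - β` is separable. Hence `A_β` is
semisimple with one simple module per vertex, and `V` behaves like the sum of the `S_i ⊗ M_i` over
`D_i` (`exists_evR_expansion`, `exists_evR_lift`).

The group. The isotypic parts at `i` and `j` are orthogonal unless `j = i†`. So an element of `H` is
a family of `D_i`-linear automorphisms `g_i` of `M_i` in which the component at `i†` is the
contragredient of the one at `i`; only one vertex of each dual pair is free, and at a self-dual
vertex `g_i` is an isometry (`exists_Hα_equiv`).

The representation. The relation `θ φ θ⁻¹ = ξ φ` says that `φ` is `A_β`-linear on `V` twisted by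
`ξ`. Hence `φ` moves the part at `i` to the part at the next vertex and amounts to one component per
arrow (`exists_component`). Skew-adjointness determines the component at a dual arrow from the one
at the arrow, and at a self-dual arrow it becomes the Hermitian condition that defines `hSpace`
(`skew_iff_mem_hSpace`, `exists_gξα_equiv`).

Reduced traces. The pairings `{·,·}_i` lose nothing compared with the `D_i`-valued ones because the
reduced trace form of `D_i` is nondegenerate and commutes with the relevant involution. The
splitting of `D_i` behind this is cut out by an idempotent from an explicit representation of `A_β`
on functions on the group of powers of `ζ`; a count of `n * n` generators against the dimension of a
matrix algebra makes it an isomorphism (`isSplitWithTrace`).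

Choices and shapes. Pairings and the maps `η_e` come from Schur's lemma, applied to conjugate duals
and to twisted modules, and signs from symmetrization: a form either has a nonzero Hermitian part,
which then is perfect, or is skew-Hermitian. The four shapes are the ways in which a reflection can
act on a directed cycle or exchange two of them (`nonempty_shape`). -/

namespace CyclicGrading
noncomputable section

/-! ### Galois algebras with cyclic group: dual families, rank and norm -/

section GaloisAlgebra

variable {k F : Type u} [Field k] [CommRing F] [Algebra k F]

/-- The minimal polynomial of a nilpotent element divides a power of `X`; being separable, hence
squarefree, it divides `X` itself. -/
theorem isReduced_of_isSeparable [Nontrivial F] [Algebra.IsSeparable k F] : IsReduced F where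
  eq_zero x := by
    rintro ⟨n, hn⟩
    have hsq : Squarefree (minpoly k x) := (Algebra.IsSeparable.isSeparable k x).squarefree
    have h1 : minpoly k x ∣ Polynomial.X ^ n := minpoly.dvd _ _ (by simpa using hn)
    have h2 : minpoly k x ∣ Polynomial.X := (hsq.dvd_pow_iff_dvd (n := n) (by
      rintro rfl
      have h3 := isUnit_of_dvd_one (by simpa using h1)
      exact minpoly.not_isUnit k x h3)).1 h1
    have h3 := (minpoly.dvd_iff (A := k) (x := x) (p := Polynomial.X)).1 h2
    simpa using h3

/-- A finite reduced algebra over a field has a linear functional whose kernel contains no nonzero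
ideal. -/
theorem exists_functional_of_isReduced [Module.Finite k F] [IsReduced F] :
    ∃ l : F →ₗ[k] k, ∀ a : F, (∀ x, l (x * a) = 0) → a = 0 := by
  classical
  have : IsArtinianRing F := IsArtinianRing.of_finite k F
  let : ∀ m : MaximalSpectrum F, Field (F ⧸ m.asIdeal) := fun m => Ideal.Quotient.field _
  have h0 : ∀ m : MaximalSpectrum F, ∃ f : (F ⧸ m.asIdeal) →ₗ[k] k, f 1 ≠ 0 := fun m =>
    Module.Projective.exists_dual_ne_zero k one_ne_zero
  choose f hf using h0
  let e := IsArtinianRing.equivPi F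
  have : Fintype (MaximalSpectrum F) := Fintype.ofFinite _
  refine ⟨∑ m, (f m) ∘ₗ (Ideal.Quotient.mkₐ k m.asIdeal).toLinearMap, fun a ha => ?_⟩
  apply e.injective
  rw [map_zero]
  funext m
  by_contra hm
  have hm' : e a m ≠ 0 := hm
  -- `x` inverts `a` in the factor `m` and vanishes in the other factors, so `x * a` is the
  -- idempotent of `m`, on which the functional takes the nonzero value `f m 1`.
  obtain ⟨x, hx⟩ := e.surjective (Pi.single m (e a m)⁻¹)
  have h1 : ∀ m', Ideal.Quotient.mk m'.asIdeal (x * a) = if m' = m then 1 else 0 := by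
    intro m'
    have h2 : (e (x * a)) m' = if m' = m then 1 else 0 := by
      rw [map_mul, Pi.mul_apply, hx]
      split_ifs with h
      · subst h
        rw [Pi.single_eq_same, inv_mul_cancel₀ hm']
      · rw [Pi.single_eq_of_ne h, zero_mul]
    exact h2
  have h3 := ha x
  rw [LinearMap.sum_apply, Finset.sum_eq_single m] at h3
  · apply hf m
    have h4 := h1 m
    rw [if_pos rfl] at h4
    rw [← h4]
    exact h3
  · intro m' _ hm'
    have h4 := h1 m'
    rw [if_neg hm'] at h4
    change f m' (Ideal.Quotient.mk m'.asIdeal (x * a)) = 0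
    rw [h4, map_zero]
  · simp

variable {ζ : F ≃ₐ[k] F}

/-- A proper ideal that is stable under `ζ` is zero. -/
theorem eq_zero_of_mem_stable_ideal [IsReduced F] (hfin : IsOfFinOrder ζ)
    (hfix : ∀ a : F, ζ a = a → a ∈ Set.range (algebraMap k F)) (I : Ideal F) (hI : I ≠ ⊤)
    (hs : ∀ x ∈ I, ζ x ∈ I) {x : F} (hx : x ∈ I) : x = 0 := by
  classical
  have hpow : ∀ j : ℕ, (ζ ^ j) x ∈ I := fun j => by
    induction j with
    | zero => simpa
    | succ j ih => rw [pow_succ']; exact hs _ ih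
  -- The polynomial with roots the conjugates of `x`. Its coefficients are `ζ`-invariant, so lie in
  -- `k`; below the top degree they also lie in the proper ideal `I`, so they vanish. Thus `p` is a
  -- power of `X`, and `p(x) = 0` makes `x` nilpotent.
  let p : Polynomial F := ∏ j ∈ Finset.range (orderOf ζ),
    (Polynomial.X - Polynomial.C ((ζ ^ j) x))
  have hp : p.map (ζ : F →+* F) = p := by
    simp only [p, Polynomial.map_prod, Polynomial.map_sub, Polynomial.map_X, Polynomial.map_C]
    have h1 : ∀ j, ((ζ : F →+* F) ((ζ ^ j) x)) = (ζ ^ (j + 1)) x := fun j => by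
      rw [pow_succ']; rfl
    simp only [h1]
    -- Applying `ζ` shifts the factors cyclically: the last one becomes the one with `j = 0`.
    obtain ⟨n, hn⟩ : ∃ n, orderOf ζ = n + 1 := ⟨orderOf ζ - 1, by
      have := hfin.orderOf_pos; omega⟩
    rw [hn, Finset.prod_range_succ, ← hn, pow_orderOf_eq_one, hn, Finset.prod_range_succ' _ n]
    simp
  have hpX : p = Polynomial.X ^ orderOf ζ := by
    ext d
    by_cases hd : d = orderOf ζ
    · have hdeg : p.natDegree = orderOf ζ := by
        by_cases hF : Nontrivial F
        · simp [p]
        · rw [not_nontrivial_iff_subsingleton] at hF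
          exact absurd (Subsingleton.elim I ⊤) hI
      have hm : p.Monic := Polynomial.monic_prod_of_monic _ _ fun j _ =>
        Polynomial.monic_X_sub_C _
      rw [hd, Polynomial.coeff_X_pow_self, ← hdeg]
      exact hm
    · rw [Polynomial.coeff_X_pow, if_neg hd]
      have h1 : p.coeff d ∈ I := by
        rw [← Ideal.Quotient.eq_zero_iff_mem, ← Polynomial.coeff_map]
        have h2 : p.map (Ideal.Quotient.mk I) = Polynomial.X ^ orderOf ζ := by
          simp only [p, Polynomial.map_prod, Polynomial.map_sub, Polynomial.map_X,
            Polynomial.map_C, Ideal.Quotient.eq_zero_iff_mem.2 (hpow _), map_zero, sub_zero]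
          simp
        rw [h2, Polynomial.coeff_X_pow, if_neg hd]
      obtain ⟨c, hc⟩ := hfix (p.coeff d) (by
        conv_rhs => rw [← hp]
        rw [Polynomial.coeff_map]; rfl)
      by_contra hne
      apply hI
      rw [Ideal.eq_top_iff_one]
      have hc0 : c ≠ 0 := by rintro rfl; exact hne (by rw [← hc, map_zero])
      rw [← hc] at h1
      have := I.mul_mem_left (algebraMap k F c⁻¹) h1
      rwa [← map_mul, inv_mul_cancel₀ hc0, map_one] at this
  have h0 : p.eval x = 0 := by
    rw [Polynomial.eval_prod]
    refine Finset.prod_eq_zero (Finset.mem_range.2 hfin.orderOf_pos) ?_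
    simp
  rw [hpX, Polynomial.eval_pow, Polynomial.eval_X] at h0
  exact pow_eq_zero_iff (hfin.orderOf_pos.ne') |>.1 h0

/-- `F` is a Galois algebra with group generated by `ζ`: there are dual families. -/
theorem exists_dual_families [Nontrivial F] [IsReduced F] (hfin : IsOfFinOrder ζ)
    (hfix : ∀ a : F, ζ a = a → a ∈ Set.range (algebraMap k F)) :
    ∃ S : Finset (F × F), ∀ g ∈ Subgroup.zpowers ζ, ∀ [Decidable (g = 1)],
      ∑ p ∈ S, p.1 * g p.2 = if g = 1 then 1 else 0 := by
  classical
  let φ : (F ≃ₐ[k] F) → (F ⊗[k] F →ₐ[k] F) := fun g =>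
    Algebra.TensorProduct.productMap (AlgHom.id k F) (g : F →ₐ[k] F)
  have hφ : ∀ g a b, φ g (a ⊗ₜ b) = a * g b := fun g a b => by simp [φ]
  have : Fintype (Subgroup.zpowers ζ) := by
    have : Finite (Subgroup.zpowers ζ) := hfin.finite_zpowers
    exact Fintype.ofFinite _
  -- A tensor that separates the identity from `g`. If there were none, the image under `φ 1` of the
  -- kernel of `φ g` would be a proper ideal, and a maximal ideal above it would contain every `x -
  -- g x`.
  have key : ∀ g : Subgroup.zpowers ζ, g ≠ 1 → ∃ t, φ 1 t = 1 ∧ φ g t = 0 := by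
    intro g hg
    by_contra hcon
    push Not at hcon
    let J : Ideal F := (RingHom.ker (φ g)).map (φ 1)
    have hsurj : Function.Surjective (φ 1) := fun a => ⟨a ⊗ₜ 1, by simp [hφ]⟩
    have hJ : J ≠ ⊤ := by
      intro h
      have h1 : (1 : F) ∈ J := by rw [h]; trivial
      obtain ⟨t, ht, h2⟩ := (Ideal.mem_map_iff_of_surjective (φ 1) hsurj).1 h1
      exact hcon t h2 ht
    obtain ⟨m, hm, hJm⟩ := Ideal.exists_le_maximal J hJ
    have hgm : ∀ x, x - (g : F ≃ₐ[k] F) x ∈ m := fun x => hJm (by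
      refine (Ideal.mem_map_iff_of_surjective (φ 1) hsurj).2
        ⟨1 ⊗ₜ x - ((g : F ≃ₐ[k] F) x) ⊗ₜ 1, ?_, ?_⟩
      · rw [RingHom.mem_ker, map_sub, hφ, hφ]; simp
      · rw [map_sub, hφ, hφ]; simp)
    -- the intersection of the translates of `m`
    let I : Ideal F := ⨅ j : ℤ, m.comap ((ζ ^ j : F ≃ₐ[k] F) : F →+* F)
    have hI : I ≠ ⊤ := by
      intro h
      have h1 : (1 : F) ∈ I := by rw [h]; trivial
      have h2 := (Ideal.mem_iInf.1 h1) 0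
      rw [Ideal.mem_comap, map_one] at h2
      exact hm.ne_top ((Ideal.eq_top_iff_one _).2 h2)
    have hstab : ∀ x ∈ I, ζ x ∈ I := by
      intro x hx
      refine Ideal.mem_iInf.2 fun j => ?_
      have h2 := (Ideal.mem_iInf.1 hx) (j + 1)
      rw [Ideal.mem_comap] at h2 ⊢
      rw [zpow_add_one] at h2
      exact h2
    apply hg
    ext x
    -- The powers of `ζ` commute, so `x - g x` lies in every translate of the maximal ideal. The
    -- intersection of the translates is proper and stable, hence zero, which forces `g = 1`.
    have hx : x - (g : F ≃ₐ[k] F) x ∈ I := by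
      refine Ideal.mem_iInf.2 fun j => ?_
      rw [Ideal.mem_comap]
      obtain ⟨g, l, rfl⟩ := g
      have h3 := hgm ((ζ ^ j : F ≃ₐ[k] F) x)
      have h4 : (ζ ^ l : F ≃ₐ[k] F) ((ζ ^ j : F ≃ₐ[k] F) x) = (ζ ^ j : F ≃ₐ[k] F)
          ((ζ ^ l : F ≃ₐ[k] F) x) := by
        rw [← AlgEquiv.mul_apply, ← AlgEquiv.mul_apply, ← zpow_add, ← zpow_add, add_comm]
      change (ζ ^ j : F ≃ₐ[k] F) x - (ζ ^ l : F ≃ₐ[k] F) _ ∈ m at h3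
      rw [h4] at h3
      change (ζ ^ j : F ≃ₐ[k] F) (x - (ζ ^ l : F ≃ₐ[k] F) x) ∈ m
      rwa [map_sub]
    have h5 := eq_zero_of_mem_stable_ideal hfin hfix I hI hstab hx
    exact (sub_eq_zero.1 h5).symm
  choose! t ht1 ht2 using key
  -- The product of the separating tensors is sent to 1 by `φ 1` and to 0 by every other `φ g`; the
  -- entries of its pure tensors are the dual families.
  obtain ⟨S, hS⟩ := TensorProduct.exists_finset
    (∏ g ∈ Finset.univ.filter (fun g : Subgroup.zpowers ζ => g ≠ 1), t g)
  refine ⟨S, fun g hg _ => ?_⟩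
  have h1 : ∑ p ∈ S, p.1 * g p.2 = φ g (∑ p ∈ S, p.1 ⊗ₜ p.2) := by simp [hφ]
  rw [h1, ← hS, map_prod]
  split_ifs with h
  · subst h
    refine Finset.prod_eq_one fun g hg => ht1 g (Finset.mem_filter.1 hg).2
  · refine Finset.prod_eq_zero (i := ⟨g, hg⟩) (Finset.mem_filter.2 ⟨Finset.mem_univ _, ?_⟩) ?_
    · simpa [Subtype.ext_iff] using h
    · exact ht2 ⟨g, hg⟩ (by simpa [Subtype.ext_iff] using h)

theorem sum_zpowers_mem_range [Fintype (Subgroup.zpowers ζ)]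
    (hfix : ∀ a : F, ζ a = a → a ∈ Set.range (algebraMap k F)) (a : F) :
    ∑ g : Subgroup.zpowers ζ, (g : F ≃ₐ[k] F) a ∈ Set.range (algebraMap k F) := by
  refine hfix _ ?_
  rw [map_sum]
  exact Fintype.sum_equiv (Equiv.mulLeft (⟨ζ, Subgroup.mem_zpowers ζ⟩ : Subgroup.zpowers ζ)) _ _
    fun g => rfl

/-- Exchanging the two sums leaves only the term of `g = 1`. So the two families are dual bases, in
the sense of generating systems, for the trace form. -/
theorem eq_sum_dual_families [Fintype (Subgroup.zpowers ζ)] [DecidableEq (F ≃ₐ[k] F)]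
    {S : Finset (F × F)}
    (hS : ∀ g ∈ Subgroup.zpowers ζ, ∑ p ∈ S, p.1 * g p.2 = if g = 1 then 1 else 0) (a : F) :
    ∑ p ∈ S, p.1 * ∑ g : Subgroup.zpowers ζ, (g : F ≃ₐ[k] F) (p.2 * a) = a := by
  simp only [Finset.mul_sum]
  rw [Finset.sum_comm, Finset.sum_eq_single 1]
  · simp only [map_mul, ← mul_assoc, ← Finset.sum_mul]
    rw [hS _ (1 : Subgroup.zpowers ζ).2, if_pos (Subgroup.coe_one _), one_mul]
    rfl
  · intro g _ hg
    simp only [map_mul, ← mul_assoc, ← Finset.sum_mul, hS _ g.2]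
    rw [if_neg (show ¬ (g : F ≃ₐ[k] F) = 1 from fun h => hg (Subtype.ext h)), zero_mul]
  · simp

/-- The dual families provide inverses in closed form on both sides. -/
theorem exists_tensor_equiv_pi_zpowers [Nontrivial F] [IsReduced F]
    (hfin : IsOfFinOrder ζ)
    (hfix : ∀ a : F, ζ a = a → a ∈ Set.range (algebraMap k F)) [Fintype (Subgroup.zpowers ζ)] :
    ∃ e : F ⊗[k] F ≃ₗ[F] (Subgroup.zpowers ζ → F),
      ∀ x y g, e (x ⊗ₜ y) g = x * (g : F ≃ₐ[k] F) y := by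
  classical
  obtain ⟨S, hS⟩ := exists_dual_families hfin hfix
  let Φ : F ⊗[k] F →ₗ[F] (Subgroup.zpowers ζ → F) :=
    LinearMap.pi fun g => (Algebra.TensorProduct.productLeftAlgHom (S := F) (AlgHom.id F F)
      ((g : F ≃ₐ[k] F) : F →ₐ[k] F)).toLinearMap
  have hΦ : ∀ x y g, Φ (x ⊗ₜ y) g = x * (g : F ≃ₐ[k] F) y := fun x y g => by
    simp [Φ]
  have hinj : Function.Injective Φ := by
    -- A left inverse. On `x ⊗ y` the inner sum is `x` times the trace of `p.2 * y`; this trace lies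
    -- in `k` and moves across the tensor sign, where the dual basis formula recovers `y`.
    have h1 : ∀ w : F ⊗[k] F,
        ∑ p ∈ S, (∑ g : Subgroup.zpowers ζ, Φ w g * (g : F ≃ₐ[k] F) p.2) ⊗ₜ[k] p.1 = w := by
      intro w
      induction w with
      | zero => simp
      | add w w' h h' =>
        conv_rhs => rw [← h, ← h']
        rw [← Finset.sum_add_distrib]
        refine Finset.sum_congr rfl fun p _ => ?_
        rw [← TensorProduct.add_tmul, ← Finset.sum_add_distrib]
        simp only [map_add, Pi.add_apply, add_mul]
      | tmul x y =>
        conv_rhs => rw [← eq_sum_dual_families (fun g hg => hS g hg) y]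
        rw [TensorProduct.tmul_sum]
        refine Finset.sum_congr rfl fun p _ => ?_
        obtain ⟨c, hc⟩ := sum_zpowers_mem_range hfix (p.2 * y)
        simp only [hΦ]
        have h2 : ∑ g : Subgroup.zpowers ζ, x * (g : F ≃ₐ[k] F) y * (g : F ≃ₐ[k] F) p.2 =
            c • x := by
          rw [Algebra.smul_def, hc, Finset.sum_mul]
          refine Finset.sum_congr rfl fun g _ => ?_
          rw [map_mul]; ring
        rw [h2, ← hc, TensorProduct.smul_tmul, Algebra.smul_def, mul_comm]
    intro w w' h
    rw [← h1 w, ← h1 w', h]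
  have hsurj : Function.Surjective Φ := by
    intro f
    -- The tensor `∑ h(p.1) ⊗ p.2` is sent to the indicator function of `h`, since its value at `g`
    -- is `h` applied to the orthogonality sum of `h⁻¹ g`.
    refine ⟨∑ h : Subgroup.zpowers ζ, f h • ∑ p ∈ S, (h : F ≃ₐ[k] F) p.1 ⊗ₜ[k] p.2, ?_⟩
    funext g
    rw [map_sum, Finset.sum_apply, Finset.sum_eq_single g]
    · rw [map_smul, Pi.smul_apply, map_sum, Finset.sum_apply]
      simp only [hΦ, ← map_mul, ← map_sum]
      rw [show ∑ p ∈ S, p.1 * p.2 = 1 by simpa using hS 1 (one_mem _)]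
      simp
    · intro h _ hh
      rw [map_smul, Pi.smul_apply, map_sum, Finset.sum_apply]
      have h3 : ∀ p : F × F, (h : F ≃ₐ[k] F) p.1 * (g : F ≃ₐ[k] F) p.2 =
          (h : F ≃ₐ[k] F) (p.1 * ((h⁻¹ * g : Subgroup.zpowers ζ) : F ≃ₐ[k] F) p.2) := by
        intro p
        rw [map_mul, ← AlgEquiv.mul_apply]
        simp
      simp only [hΦ, h3, ← map_sum]
      rw [hS _ (h⁻¹ * g).2, if_neg, map_zero, smul_zero]
      intro h4
      apply hh
      rw [← Subgroup.coe_one, ← Subtype.ext_iff, inv_mul_eq_one] at h4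
      exact h4
    · simp
  exact ⟨LinearEquiv.ofBijective Φ ⟨hinj, hsurj⟩, hΦ⟩

/-- Both sides of the splitting of `F ⊗ F` are free over `F`; their ranks are compared. -/
theorem finrank_eq_orderOf [Module.Finite k F] [Nontrivial F] [IsReduced F]
    (hfin : IsOfFinOrder ζ)
    (hfix : ∀ a : F, ζ a = a → a ∈ Set.range (algebraMap k F)) :
    Module.finrank k F = orderOf ζ := by
  have : Finite (Subgroup.zpowers ζ) := hfin.finite_zpowers
  have : Fintype (Subgroup.zpowers ζ) := Fintype.ofFinite _
  obtain ⟨e, -⟩ := exists_tensor_equiv_pi_zpowers hfin hfix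
  have h := e.finrank_eq
  rw [Module.finrank_baseChange, Module.finrank_pi,
    ← Nat.card_eq_fintype_card, Nat.card_zpowers] at h
  exact h

/-- After base change to `F`, multiplication by `a` becomes diagonal with entries the conjugates of
`a`, and the determinant does not change under base change. -/
theorem norm_eq_prod_zpowers [Module.Finite k F] [Nontrivial F] [IsReduced F]
    (hfin : IsOfFinOrder ζ)
    (hfix : ∀ a : F, ζ a = a → a ∈ Set.range (algebraMap k F)) [Fintype (Subgroup.zpowers ζ)]
    (a : F) :
    algebraMap k F (Algebra.norm k a) = ∏ g : Subgroup.zpowers ζ, (g : F ≃ₐ[k] F) a := by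
  obtain ⟨e, he⟩ := exists_tensor_equiv_pi_zpowers hfin hfix
  rw [Algebra.norm_apply, ← LinearMap.det_baseChange, ← LinearMap.det_conj _ e]
  have h5 : (e : F ⊗[k] F →ₗ[F] _) ∘ₗ ((Algebra.lmul k F a).baseChange F) ∘ₗ
      (e.symm : (Subgroup.zpowers ζ → F) →ₗ[F] F ⊗[k] F) =
      LinearMap.pi fun g : Subgroup.zpowers ζ => (LinearMap.mulLeft F ((g : F ≃ₐ[k] F) a)) ∘ₗ LinearMap.proj g := by
    rw [← LinearMap.comp_assoc, LinearEquiv.comp_toLinearMap_symm_eq]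
    refine TensorProduct.AlgebraTensorModule.ext fun x y => ?_
    funext g
    simp only [LinearMap.comp_apply, LinearMap.baseChange_tmul, LinearMap.pi_apply,
      LinearMap.proj_apply]
    change e _ g = LinearMap.mulLeft F _ (e _ g)
    rw [LinearMap.mulLeft_apply, he, he]
    change x * (g : F ≃ₐ[k] F) (a * y) = _
    rw [map_mul]; ring
  rw [h5, LinearMap.det_pi]
  simp

theorem norm_eq_prod_range [Module.Finite k F] [Nontrivial F] [IsReduced F]
    (hfin : IsOfFinOrder ζ)
    (hfix : ∀ a : F, ζ a = a → a ∈ Set.range (algebraMap k F)) (a : F) :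
    algebraMap k F (Algebra.norm k a) = ∏ j ∈ Finset.range (orderOf ζ), (ζ ^ j) a := by
  have : Finite (Subgroup.zpowers ζ) := hfin.finite_zpowers
  have : Fintype (Subgroup.zpowers ζ) := Fintype.ofFinite _
  rw [norm_eq_prod_zpowers hfin hfix, Finset.prod_range]
  exact (Fintype.prod_equiv (finEquivZPowers hfin) _ _ fun j => by
    rw [finEquivZPowers_apply]).symm

end GaloisAlgebra
end
end CyclicGrading

namespace CyclicGrading
noncomputable section
namespace Datum
variable {k : Type u} [Field k] {σk : k ≃+* k} (s : Datum k σk)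

/-! ### The structure of `A_β` -/

instance : Nontrivial s.F := s.algebraMap_injective.nontrivial

instance : IsReduced s.F := isReduced_of_isSeparable (k := k)

theorem norm_eq_prod (a : s.F) :
    algebraMap k s.F (Algebra.norm k a) = ∏ j ∈ Finset.range s.n, (s.ζ ^ j) a :=
  norm_eq_prod_range s.isOfFinOrder_ζ s.mem_range_of_fixed a

theorem finrank_F : Module.finrank k s.F = s.n :=
  finrank_eq_orderOf s.isOfFinOrder_ζ s.mem_range_of_fixed

theorem n_pos : 0 < s.n := s.isOfFinOrder_ζ.orderOf_pos

theorem exists_dual : ∃ S : Finset (s.F × s.F), ∀ j : ℤ,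
    ∑ p ∈ S, p.1 * (s.ζ ^ j) p.2 = if (s.n : ℤ) ∣ j then 1 else 0 := by
  classical
  obtain ⟨S, hS⟩ := exists_dual_families s.isOfFinOrder_ζ s.mem_range_of_fixed
  refine ⟨S, fun j => ?_⟩
  rw [hS _ ⟨j, rfl⟩]
  simp only [orderOf_dvd_iff_zpow_eq_one]

/-- Ring homomorphisms from `A_β`. -/
def liftA {E : Type u} [Ring E] (f : s.F →+* E) (t : E) (ht : ∀ a, t * f a = f (s.ζ a) * t)
    (hp : t ^ (s.n * s.r) = f (algebraMap k s.F s.β)) : s.A →+* E :=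
  RingQuot.lift ⟨SkewMonoidAlgebra.liftNCRingHom f (powersHom E t) (by
      intro a y
      obtain ⟨j, rfl⟩ := Multiplicative.ofAdd.surjective y
      rw [smul_ofAdd, powersHom_apply]
      change f ((s.ζ ^ j) a) * t ^ j = t ^ j * f a
      symm
      induction j generalizing a with
      | zero => simp
      | succ j ih => rw [pow_succ, mul_assoc, ht, ← mul_assoc, ih, mul_assoc, pow_succ]; rfl), by
    rintro _ _ ⟨rfl, rfl⟩
    have h1 : SkewMonoidAlgebra.liftNC (f : s.F →+ E) (powersHom E t)
        (SkewPolynomial.X : SkewPolynomial s.F) = t :=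
      (SkewMonoidAlgebra.liftNC_single _ _ _ _).trans (by
        rw [powersHom_apply]
        change f 1 * t ^ 1 = t
        simp)
    have h2 : SkewMonoidAlgebra.liftNC (f : s.F →+ E) (powersHom E t)
        (SkewPolynomial.C (algebraMap k s.F s.β) : SkewPolynomial s.F) =
        f (algebraMap k s.F s.β) :=
      (SkewMonoidAlgebra.liftNC_single _ _ _ _).trans (by
        change f _ * (powersHom E t) 1 = _
        rw [map_one, mul_one])
    rw [map_pow]
    exact (congrArg (· ^ _) h1).trans (hp.trans h2.symm)⟩

theorem liftA_incl {E : Type u} [Ring E] (f : s.F →+* E) (t : E) (ht hp) (a : s.F) :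
    s.liftA f t ht hp (s.incl a) = f a := by
  refine (RingQuot.lift_mkRingHom_apply _ _ _).trans ?_
  refine (SkewMonoidAlgebra.liftNC_single _ _ _ _).trans ?_
  change f a * (powersHom E t) 1 = _
  rw [map_one, mul_one]

theorem liftA_θA {E : Type u} [Ring E] (f : s.F →+* E) (t : E) (ht hp) :
    s.liftA f t ht hp s.θA = t := by
  refine (RingQuot.lift_mkRingHom_apply _ _ _).trans ?_
  refine (SkewMonoidAlgebra.liftNC_single _ _ _ _).trans ?_
  rw [powersHom_apply]
  change f 1 * t ^ 1 = t
  simp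

theorem A_span_induction {p : s.A → Prop} (h0 : p 0) (hadd : ∀ x y, p x → p y → p (x + y))
    (h : ∀ a (j : ℕ), p (s.incl a * s.θA ^ j)) (x : s.A) : p x := by
  obtain ⟨q, rfl⟩ := s.toA_surjective x
  induction q using SkewPolynomial.induction with
  | h0 => simpa using h0
  | ha n a q _ _ hq =>
    rw [map_add]
    refine hadd _ _ ?_ hq
    rw [← SkewPolynomial.C_mul_X_pow_eq_monomial, map_mul, map_pow]
    exact h a n

theorem exists_θA_inv : ∃ w : s.A, s.θA * w = 1 ∧ w * s.θA = 1 := by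
  have h : s.θA * (s.θA ^ (s.n * s.r - 1) * s.incl (algebraMap k s.F s.β⁻¹)) = 1 := by
    rw [← mul_assoc, ← pow_succ', Nat.sub_add_cancel
      (Nat.succ_le_of_lt (Nat.mul_pos s.n_pos (Nat.pos_of_ne_zero s.r_pos))), θA_pow, ← map_mul,
      ← map_mul, mul_inv_cancel₀ s.β_ne_zero, map_one, map_one]
  refine ⟨_, h, ?_⟩
  rw [mul_assoc, (s.commute_base_θA _).eq, ← mul_assoc, ← pow_succ, pow_succ', mul_assoc, h]

/-- The unit `θ` of `A_β`. -/
def θU : s.Aˣ := ⟨s.θA, s.exists_θA_inv.choose, s.exists_θA_inv.choose_spec.1,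
  s.exists_θA_inv.choose_spec.2⟩

theorem θU_coe : (s.θU : s.A) = s.θA := rfl

theorem θU_zpow_mul_incl (j : ℤ) (a : s.F) :
    ((s.θU ^ j : s.Aˣ) : s.A) * s.incl a = s.incl ((s.ζ ^ j) a) * ((s.θU ^ j : s.Aˣ) : s.A) := by
  obtain ⟨m, rfl | rfl⟩ := j.eq_nat_or_neg
  · rw [zpow_natCast, zpow_natCast, Units.val_pow_eq_pow_val]
    exact s.θA_pow_mul_incl m a
  · rw [zpow_neg, zpow_neg, zpow_natCast, zpow_natCast, Units.inv_mul_eq_iff_eq_mul,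
      ← mul_assoc]
    rw [Units.val_pow_eq_pow_val, θU_coe, θA_pow_mul_incl, mul_assoc, ← θU_coe,
      ← Units.val_pow_eq_pow_val, Units.mul_inv, mul_one]
    congr 1
    exact ((s.ζ ^ m).apply_symm_apply a).symm

/-- The unit `b` of `L_β`. -/
def bU : s.Lˣ := ⟨s.b, s.bInv, s.b_mul_bInv, by rw [mul_comm, b_mul_bInv]⟩

theorem map_bU : Units.map (s.ofL : s.L →* s.A) s.bU = s.θU ^ s.n :=
  Units.ext (by
    rw [Units.val_pow_eq_pow_val]
    exact s.ofL_b)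

theorem θU_zpow_n_mul (q : ℤ) : ((s.θU ^ ((s.n : ℤ) * q) : s.Aˣ) : s.A) =
    s.ofL ((s.bU ^ q : s.Lˣ) : s.L) := by
  rw [zpow_mul, zpow_natCast, ← map_bU, ← map_zpow]
  rfl

theorem sum_range_zeta_mem_range (a : s.F) :
    ∑ h ∈ Finset.range s.n, (s.ζ ^ h) a ∈ Set.range (algebraMap k s.F) := by
  refine s.mem_range_of_fixed _ ?_
  rw [map_sum]
  have h1 : ∀ j, s.ζ ((s.ζ ^ j) a) = (s.ζ ^ (j + 1)) a := fun j => by rw [pow_succ']; rfl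
  simp only [h1]
  obtain ⟨n, hn⟩ : ∃ n, s.n = n + 1 := ⟨s.n - 1, by have := s.n_pos; omega⟩
  rw [hn, Finset.sum_range_succ, Finset.sum_range_succ' _ n, ← hn, pow_orderOf_eq_one, pow_zero]

/-- Every element of `A_β` is a linear combination with coefficients in `L_β` of elements
`x θ ^ j`, in a way that is compatible with two-sided ideals. -/
theorem exists_expansion : ∃ (S : Finset (s.F × s.F)) (t : ℤ → s.F → s.A →+ s.A),
    (∀ j y z, t j y z ∈ Set.range s.ofL) ∧
    (∀ z, ∑ j ∈ Finset.range s.n, ∑ p ∈ S, s.incl p.1 * t j p.2 z * s.θA ^ j = z) ∧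
    ∀ (J : Ideal s.A) [J.IsTwoSided] (j : ℤ) (y : s.F), ∀ z ∈ J, t j y z ∈ J := by
  obtain ⟨S, hS⟩ := s.exists_dual
  -- Projection onto degree `j` modulo `n`: on `a θ ^ i` the sum collapses to the orthogonality sum
  -- of `ζ ^ (i - j)`.
  let E : ℤ → s.A →+ s.A := fun j => ∑ p ∈ S,
    (AddMonoidHom.mulRight (s.incl ((s.ζ ^ (-j)) p.2))).comp (AddMonoidHom.mulLeft (s.incl p.1))
  have hE : ∀ j z, E j z = ∑ p ∈ S, s.incl p.1 * z * s.incl ((s.ζ ^ (-j)) p.2) := fun j z => by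
    simp [E]
  have hEm : ∀ j a (i : ℕ), E j (s.incl a * s.θA ^ i) =
      if (s.n : ℤ) ∣ (i - j) then s.incl a * s.θA ^ i else 0 := by
    intro j a i
    have h1 : ∀ p : s.F × s.F, s.incl p.1 * (s.incl a * s.θA ^ i) * s.incl ((s.ζ ^ (-j)) p.2) =
        s.incl (p.1 * (s.ζ ^ ((i : ℤ) - j)) p.2) * (s.incl a * s.θA ^ i) := by
      intro p
      rw [mul_assoc, mul_assoc, θA_pow_mul_incl, ← AlgEquiv.mul_apply, ← zpow_natCast,
        ← zpow_add, ← sub_eq_add_neg, ← mul_assoc, ← mul_assoc, ← mul_assoc, ← map_mul,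
        ← map_mul, ← map_mul]
      congr 2
      ring
    rw [hE]
    simp only [h1]
    rw [← Finset.sum_mul, ← map_sum, hS]
    split_ifs <;> simp
  have hEsum : ∀ z, ∑ j ∈ Finset.range s.n, E j z = z := by
    intro z
    induction z using s.A_span_induction with
    | h0 => simp
    | hadd x y hx hy => simp only [map_add]; rw [Finset.sum_add_distrib, hx, hy]
    | h a i =>
      rw [Finset.sum_eq_single (i % s.n)]
      · rw [hEm, if_pos]
        exact_mod_cast (Int.dvd_self_sub_emod : (s.n : ℤ) ∣ i - i % s.n)
      · intro j hj hne
        rw [hEm, if_neg]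
        intro hdvd
        apply hne
        have h2 : (j : ℤ) % s.n = i % s.n := (Int.emod_emod_of_dvd _ dvd_rfl ▸
          (Int.emod_eq_emod_iff_emod_sub_eq_zero.2 (Int.emod_eq_zero_of_dvd hdvd)).symm)
        have h3 : j % s.n = i % s.n := by exact_mod_cast h2
        rw [← h3, Nat.mod_eq_of_lt (Finset.mem_range.1 hj)]
      · intro h
        exact absurd (Finset.mem_range.2 (Nat.mod_lt _ s.n_pos)) h
  -- The sum of the conjugates by `θ ^ h`, `h < n`. On `F` it is the trace, with values in `k`, and
  -- orthogonality gives `∑ p.1 * T (p.2 * c) = c` for every `c`.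
  let T : s.A →+ s.A := ∑ h ∈ Finset.range s.n,
    (AddMonoidHom.mulRight ((s.θU ^ (-(h : ℤ)) : s.Aˣ) : s.A)).comp
      (AddMonoidHom.mulLeft ((s.θU ^ (h : ℤ) : s.Aˣ) : s.A))
  have hT : ∀ z, T z = ∑ h ∈ Finset.range s.n, ((s.θU ^ (h : ℤ) : s.Aˣ) : s.A) * z *
      ((s.θU ^ (-(h : ℤ)) : s.Aˣ) : s.A) := fun z => by simp [T]
  have hTsum : ∀ c, ∑ p ∈ S, s.incl p.1 * T (s.incl p.2 * c) = c := by
    intro c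
    simp only [hT, Finset.mul_sum]
    rw [Finset.sum_comm]
    have h1 : ∀ (h : ℕ) (p : s.F × s.F), s.incl p.1 * (((s.θU ^ (h : ℤ) : s.Aˣ) : s.A) *
        (s.incl p.2 * c) * ((s.θU ^ (-(h : ℤ)) : s.Aˣ) : s.A)) =
        s.incl (p.1 * (s.ζ ^ (h : ℤ)) p.2) * (((s.θU ^ (h : ℤ) : s.Aˣ) : s.A) * c *
          ((s.θU ^ (-(h : ℤ)) : s.Aˣ) : s.A)) := by
      intro h p
      rw [← mul_assoc _ (s.incl p.2), θU_zpow_mul_incl, map_mul]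
      simp only [mul_assoc]
    simp only [h1, ← Finset.sum_mul, ← map_sum, hS]
    rw [Finset.sum_eq_single 0]
    · simp
    · intro h hh hne
      rw [if_neg, map_zero, zero_mul]
      intro hd
      exact hne (Nat.eq_zero_of_dvd_of_lt (by exact_mod_cast hd) (Finset.mem_range.1 hh))
    · intro h
      exact absurd (Finset.mem_range.2 s.n_pos) h
  -- The coefficient is obtained by cutting out degree `j`, removing `θ ^ j`, multiplying by `y` and
  -- applying `T`. What remains before `T` lies in `F` times powers of `θ ^ n = b`, so `T` puts it
  -- into `L_β`.
  refine ⟨S, fun j y => T.comp ((AddMonoidHom.mulLeft (s.incl y)).comp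
    ((AddMonoidHom.mulRight ((s.θU ^ (-j) : s.Aˣ) : s.A)).comp (E j))), ?_, ?_, ?_⟩
  · intro j y z
    change T (s.incl y * (E j z * _)) ∈ _
    change _ ∈ s.ofL.range
    induction z using s.A_span_induction with
    | h0 => simp
    | hadd x y hx hy =>
      rw [map_add, add_mul, mul_add, map_add]
      exact add_mem hx hy
    | h a i =>
      rw [hEm]
      split_ifs with h
      · obtain ⟨q, hq⟩ := h
        have h2 : s.incl y * (s.incl a * s.θA ^ i * ((s.θU ^ (-j) : s.Aˣ) : s.A)) =
            s.incl (y * a) * s.ofL ((s.bU ^ q : s.Lˣ) : s.L) := by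
          rw [← θU_zpow_n_mul, ← hq, sub_eq_add_neg, zpow_add, zpow_natCast, Units.val_mul,
            Units.val_pow_eq_pow_val, θU_coe, map_mul]
          simp only [mul_assoc]
        rw [h2, hT]
        obtain ⟨c, hc⟩ := s.sum_range_zeta_mem_range (y * a)
        refine ⟨algebraMap k s.L c * ((s.bU ^ q : s.Lˣ) : s.L), ?_⟩
        rw [map_mul, ofL_algebraMap, hc, map_sum, Finset.sum_mul]
        refine Finset.sum_congr rfl fun h _ => ?_
        rw [← mul_assoc, θU_zpow_mul_incl, mul_assoc, mul_assoc, ofL_central,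
          ← mul_assoc _ _ (s.ofL _), ← Units.val_mul, ← zpow_add, add_neg_cancel, zpow_zero,
          Units.val_one, one_mul, zpow_natCast]
      · simp
  · intro z
    conv_rhs => rw [← hEsum z]
    refine Finset.sum_congr rfl fun j _ => ?_
    rw [← Finset.sum_mul]
    change (∑ p ∈ S, s.incl p.1 * T (s.incl p.2 * (E j z * _))) * _ = _
    rw [hTsum, mul_assoc, ← θU_coe, ← Units.val_pow_eq_pow_val, ← zpow_natCast, ← Units.val_mul,
      ← zpow_add, neg_add_cancel, zpow_zero, Units.val_one, mul_one]
  -- `E j` and `T` are sums of two-sided multiplications, so they preserve two-sided ideals.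
  · intro J _ j y z hz
    change T (s.incl y * (E j z * _)) ∈ _
    rw [hT]
    refine J.sum_mem fun h _ => J.mul_mem_right _ (J.mul_mem_left _ (J.mul_mem_left _
      (J.mul_mem_right _ ?_)))
    rw [hE]
    exact J.sum_mem fun p _ => J.mul_mem_right _ (J.mul_mem_left _ hz)

end Datum
end
end CyclicGrading

namespace CyclicGrading
noncomputable section
namespace Datum
variable {k : Type u} [Field k] {σk : k ≃+* k} (s : Datum k σk)

/-! ### Matrix representations of `A_β` -/

/-- The invertibility of `m/n` makes `X ^ (m/n) - β` separable, so `L_β` is a product of fields. -/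
instance : IsReduced s.L := by
  have h : IsRadical (Polynomial.X ^ s.r - Polynomial.C s.β : Polynomial k) :=
    (Polynomial.separable_X_pow_sub_C s.β s.r_ne_zero s.β_ne_zero).squarefree.isRadical
  exact (Ideal.isRadical_iff_quotient_reduced _).1 (isRadical_iff_span_singleton.1 h)

instance : Fintype s.Vertex := Fintype.ofFinite _

instance (i : s.Vertex) : i.asIdeal.IsMaximal := IsArtinianRing.isMaximal_of_isPrime _

theorem toLat_eq_zero (i : s.Vertex) (l : s.L) : s.toLat i l = 0 ↔ l ∈ i.asIdeal :=
  Ideal.Quotient.eq_zero_iff_mem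

theorem L_ext {x y : s.L} (h : ∀ i, s.toLat i x = s.toLat i y) : x = y := by
  rw [← sub_eq_zero]
  refine (isNilpotent_iff_eq_zero (x := x - y)).1 ?_
  rw [← mem_nilradical, nilradical_eq_sInf, Ideal.mem_sInf]
  intro I hI
  have := h ⟨I, hI⟩
  rwa [← sub_eq_zero, ← map_sub, toLat_eq_zero] at this

open Classical in
theorem exists_idem (i : s.Vertex) : ∃ l : s.L, ∀ j, s.toLat j l = if j = i then 1 else 0 := by
  have hcop : Pairwise (Function.onFun IsCoprime fun j : s.Vertex => j.asIdeal) := fun j j' h =>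
    Ideal.isCoprime_of_isMaximal fun h' => h (PrimeSpectrum.ext h')
  obtain ⟨l, hl⟩ := Ideal.exists_forall_sub_mem_ideal hcop
    (fun j => if j = i then (1 : s.L) else 0)
  refine ⟨l, fun j => ?_⟩
  have := hl j
  rw [← toLat_eq_zero, map_sub, sub_eq_zero] at this
  rw [this]
  split_ifs <;> simp

/-- The idempotent of `L_β` at the vertex `i`. -/
def idem (i : s.Vertex) : s.L := (s.exists_idem i).choose

open Classical in
theorem toLat_idem (i j : s.Vertex) : s.toLat j (s.idem i) = if j = i then 1 else 0 :=
  (s.exists_idem i).choose_spec j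

theorem sum_idem : ∑ i, s.idem i = 1 := s.L_ext fun j => by
  classical
  rw [map_sum, map_one]
  simp [toLat_idem]

/-- The index set of the matrix representation. -/
abbrev Idx : Type u := Subgroup.zpowers s.ζ

instance : Finite s.Idx := s.isOfFinOrder_ζ.finite_zpowers

instance : Fintype s.Idx := Fintype.ofFinite _

theorem card_Idx : Fintype.card s.Idx = s.n := by
  rw [← Nat.card_eq_fintype_card, Nat.card_zpowers]

/-- The generator `ζ` as an element of the index set. -/
def ζIdx : s.Idx := ⟨s.ζ, Subgroup.mem_zpowers s.ζ⟩

/-- An algebraic closure of `L_i`. -/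
abbrev Ω (i : s.Vertex) : Type u := AlgebraicClosure (s.Lat i)

theorem exists_embedding (i : s.Vertex) : Nonempty (s.F →ₐ[k] s.Ω i) := by
  obtain ⟨m, hm⟩ := Ideal.exists_maximal s.F
  let _ : Field (s.F ⧸ m) := Ideal.Quotient.field m
  have : Algebra.IsAlgebraic k (s.F ⧸ m) := Algebra.IsAlgebraic.of_finite k _
  exact ⟨(IsAlgClosed.lift (R := k) (S := s.F ⧸ m) (M := s.Ω i)).comp (Ideal.Quotient.mkₐ k m)⟩

/-- A homomorphism from `F` to the algebraic closure of `L_i`. -/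
def χ (i : s.Vertex) : s.F →ₐ[k] s.Ω i := (s.exists_embedding i).some

theorem exists_ω (i : s.Vertex) :
    ∃ w : s.Ω i, w ^ s.n = algebraMap (s.Lat i) (s.Ω i) (s.toLat i s.b) :=
  IsAlgClosed.exists_pow_nat_eq _ s.n_pos

/-- An `n`-th root of `b`. -/
def ω (i : s.Vertex) : s.Ω i := (s.exists_ω i).choose

theorem ω_pow (i : s.Vertex) :
    s.ω i ^ s.n = algebraMap (s.Lat i) (s.Ω i) (s.toLat i s.b) := (s.exists_ω i).choose_spec

theorem ω_ne_zero (i : s.Vertex) : s.ω i ≠ 0 := by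
  intro h
  have h1 := s.ω_pow i
  rw [h, zero_pow s.n_pos.ne', eq_comm, map_eq_zero] at h1
  have h2 : s.toLat i (s.b * s.bInv) = 1 := by rw [b_mul_bInv, map_one]
  rw [map_mul, h1, zero_mul] at h2
  exact zero_ne_one h2

/-- The space of the representation. -/
abbrev N (i : s.Vertex) : Type u := s.Idx → s.Ω i

/-- The action of `F` in the representation. -/
def repF (i : s.Vertex) : s.F →+* Module.End (s.Ω i) (s.N i) where
  toFun a := LinearMap.pi fun g => s.χ i ((g : s.F ≃ₐ[k] s.F) a) • LinearMap.proj g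
  map_one' := by ext; simp
  map_zero' := by ext; simp
  map_mul' a b := by
    refine LinearMap.ext fun f => funext fun g => ?_
    simp [mul_assoc]
  map_add' a b := by
    refine LinearMap.ext fun f => funext fun g => ?_
    simp [add_mul]

theorem repF_apply (i : s.Vertex) (a : s.F) (f : s.N i) (g : s.Idx) :
    s.repF i a f g = s.χ i ((g : s.F ≃ₐ[k] s.F) a) * f g := rfl

/-- The action of `θ` in the representation. -/
def repθ (i : s.Vertex) : Module.End (s.Ω i) (s.N i) :=
  LinearMap.pi fun g => s.ω i • LinearMap.proj (g * s.ζIdx)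

theorem repθ_apply (i : s.Vertex) (f : s.N i) (g : s.Idx) :
    s.repθ i f g = s.ω i * f (g * s.ζIdx) := rfl

theorem repθ_pow_apply (i : s.Vertex) (j : ℕ) (f : s.N i) (g : s.Idx) :
    (s.repθ i ^ j) f g = s.ω i ^ j * f (g * s.ζIdx ^ j) := by
  induction j generalizing g with
  | zero => simp
  | succ j ih =>
    rw [pow_succ', Module.End.mul_apply, repθ_apply, ih, pow_succ', pow_succ', mul_assoc, mul_assoc]

theorem ζIdx_pow_n : s.ζIdx ^ s.n = 1 := Subtype.ext (pow_orderOf_eq_one s.ζ)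

theorem algebraMap_Ω (i : s.Vertex) (x : k) :
    algebraMap k (s.Ω i) x = algebraMap (s.Lat i) (s.Ω i) (s.toLat i (algebraMap k s.L x)) := rfl

/-- A representation of `A_β` on which `L_β` acts through `L_i`. -/
def rep (i : s.Vertex) : s.A →+* Module.End (s.Ω i) (s.N i) :=
  s.liftA (s.repF i) (s.repθ i)
    (fun a => by
      refine LinearMap.ext fun f => funext fun g => ?_
      simp only [Module.End.mul_apply, repF_apply, repθ_apply]
      rw [mul_left_comm]
      rfl)
    (by
      refine LinearMap.ext fun f => funext fun g => ?_
      rw [repθ_pow_apply, pow_mul, pow_mul, ω_pow, ζIdx_pow_n, one_pow, mul_one, repF_apply,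
        AlgEquiv.commutes, AlgHom.commutes, algebraMap_Ω, ← map_pow, ← map_pow, b_pow])

theorem rep_incl (i : s.Vertex) (a : s.F) : s.rep i (s.incl a) = s.repF i a :=
  s.liftA_incl _ _ _ _ _

theorem rep_θA (i : s.Vertex) : s.rep i s.θA = s.repθ i := s.liftA_θA _ _ _ _

theorem rep_ofL (i : s.Vertex) (l : s.L) :
    s.rep i (s.ofL l) = algebraMap (s.Ω i) _ (algebraMap (s.Lat i) (s.Ω i) (s.toLat i l)) := by
  have : (s.rep i).comp s.ofL = (algebraMap (s.Ω i) (Module.End (s.Ω i) (s.N i))).comp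
      ((algebraMap (s.Lat i) (s.Ω i)).comp (s.toLat i)) := by
    refine s.L_hom_ext (fun x => ?_) ?_
    · refine LinearMap.ext fun f => funext fun g => ?_
      simp only [RingHom.comp_apply]
      rw [ofL_algebraMap, rep_incl, repF_apply, AlgEquiv.commutes, AlgHom.commutes]
      rfl
    · refine LinearMap.ext fun f => funext fun g => ?_
      simp only [RingHom.comp_apply]
      rw [ofL_b, map_pow, rep_θA, repθ_pow_apply, ω_pow, ζIdx_pow_n, mul_one]
      rfl
  exact congrArg (fun f => f l) this

/-- The representations `rep i` detect the image of `l` in every residue field, and a reduced ring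
embeds into the product of these. -/
theorem ofL_eq_zero (l : s.L) (h : s.ofL l = 0) : l = 0 := by
  refine s.L_ext fun i => ?_
  have h1 := s.rep_ofL i l
  rw [h, map_zero, eq_comm, map_eq_zero_iff _ (FaithfulSMul.algebraMap_injective _ _),
    map_eq_zero] at h1
  rw [h1, map_zero]

/-! ### Semisimplicity, idempotents and simple modules -/

/-- `A_β` is an algebra over its center `L_β`. -/
instance : Algebra s.L s.A := s.ofL.toAlgebra' s.ofL_central

theorem L_smul_def (l : s.L) (z : s.A) : l • z = s.ofL l * z := rfl

instance : Module.Finite s.L s.A := by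
  classical
  obtain ⟨S, t, h1, h2, -⟩ := s.exists_expansion
  refine ⟨⟨((Finset.range s.n) ×ˢ S).image fun q => s.incl q.2.1 * s.θA ^ q.1, ?_⟩⟩
  refine Submodule.eq_top_iff'.2 fun z => ?_
  rw [← h2 z]
  refine Submodule.sum_mem _ fun j hj => Submodule.sum_mem _ fun p hp => ?_
  obtain ⟨l, hl⟩ := h1 j p.2 z
  rw [← hl, ← ofL_central, mul_assoc, ← L_smul_def]
  refine Submodule.smul_mem _ _ (Submodule.subset_span ?_)
  exact Finset.mem_coe.2 (Finset.mem_image.2 ⟨(j, p), Finset.mem_product.2 ⟨hj, hp⟩, rfl⟩)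

instance : IsArtinianRing s.A := IsArtinianRing.of_finite s.L s.A

/-- The radical is a nilpotent two-sided ideal, so it contains the coefficients of each of its
elements. These are nilpotent elements of the reduced ring `L_β`, hence zero. -/
instance : IsSemisimpleRing s.A := by
  rw [IsArtinianRing.isSemisimpleRing_iff_jacobson, eq_bot_iff]
  intro z hz
  obtain ⟨S, t, h1, h2, h3⟩ := s.exists_expansion
  have h4 : IsNilpotent (Ring.jacobson s.A) := IsSemiprimaryRing.isNilpotent
  have h5 : ∀ j y, t j y z = 0 := by
    intro j y
    have h6 := h3 (Ring.jacobson s.A) j y z hz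
    obtain ⟨l, hl⟩ := h1 j y z
    obtain ⟨m, hm⟩ := h4
    have h7 : (t j y z) ^ m = 0 := by
      have := Ideal.pow_mem_pow h6 m
      rwa [hm] at this
    rw [← hl, ← map_pow] at h7
    have h8 := s.ofL_eq_zero _ h7
    rw [← hl, eq_zero_of_pow_eq_zero h8, map_zero]
  rw [← h2 z]
  simp [h5]

section SimpleModules

variable (S : Type u) [AddCommGroup S] [Module s.A S]

/-- The `A_β`-module `S` is a module over the factor of `A_β` at the vertex `i`. -/
def SupportedAt (i : s.Vertex) : Prop := ∀ l ∈ i.asIdeal, ∀ u : S, s.ofL l • u = 0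

variable {S}

variable {s} in
theorem SupportedAt.smul_eq {i : s.Vertex} (h : s.SupportedAt S i) {l l' : s.L}
    (hl : s.toLat i l = s.toLat i l') (u : S) : s.ofL l • u = s.ofL l' • u := by
  rw [← sub_eq_zero, ← sub_smul, ← map_sub]
  refine h _ ?_ u
  rw [← toLat_eq_zero, map_sub, hl, sub_self]

variable {s} in
theorem SupportedAt.idem_smul {i : s.Vertex} (h : s.SupportedAt S i) (u : S) :
    s.ofL (s.idem i) • u = u := by
  rw [h.smul_eq (l' := 1) (by rw [toLat_idem, if_pos rfl, map_one]), map_one, one_smul]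

/-- The data of a generator and a section. -/
theorem exists_section [IsSimpleModule s.A S] :
    ∃ (u : S) (sec : S →ₗ[s.A] s.A), u ≠ 0 ∧ ∀ w, sec w • u = w := by
  have := IsSimpleModule.nontrivial s.A S
  obtain ⟨u, hu⟩ := exists_ne (0 : S)
  obtain ⟨sec, hsec⟩ := IsSemisimpleModule.lifting_property (LinearMap.toSpanSingleton s.A S u)
    (IsSimpleModule.toSpanSingleton_surjective s.A hu) LinearMap.id
  exact ⟨u, sec, hu, fun w => LinearMap.congr_fun hsec w⟩

/-- The sums `∑ p e q` form a two-sided ideal, which contains the coefficients of `e` in `L_β`. If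
all of these vanished in `L_i`, then `e` would kill `u`, against `e u = u ≠ 0`. So one of them is
invertible in `L_i`, and the idempotent at `i` is a multiple of it. This says that the factor of
`A_β` at `i` is simple, in a form that can be used for explicit formulas. -/
theorem exists_idem_expansion {i : s.Vertex} (h : s.SupportedAt S i) {u : S} (hu : u ≠ 0)
    {e : s.A} (he : e • u = u) :
    ∃ (ι : Type) (_ : Fintype ι) (p q : ι → s.A), ∑ m, p m * e * q m = s.ofL (s.idem i) := by
  let J : Ideal s.A :=
    { carrier := {z | ∃ (ι : Type) (_ : Fintype ι) (p q : ι → s.A), ∑ m, p m * e * q m = z}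
      zero_mem' := ⟨Empty, inferInstance, Empty.elim, Empty.elim, by simp⟩
      add_mem' := by
        rintro _ _ ⟨ι, _, p, q, rfl⟩ ⟨ι', _, p', q', rfl⟩
        exact ⟨ι ⊕ ι', inferInstance, Sum.elim p p', Sum.elim q q', by simp⟩
      smul_mem' := by
        rintro x _ ⟨ι, _, p, q, rfl⟩
        exact ⟨ι, inferInstance, fun m => x * p m, q, by
          rw [smul_eq_mul, Finset.mul_sum]; simp only [mul_assoc]⟩ }
  have : J.IsTwoSided := ⟨by
    rintro _ x ⟨ι, _, p, q, rfl⟩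
    exact ⟨ι, inferInstance, p, fun m => q m * x, by
      rw [Finset.sum_mul]; simp only [mul_assoc]⟩⟩
  have heJ : e ∈ J := ⟨Unit, inferInstance, fun _ => 1, fun _ => 1, by simp⟩
  change s.ofL (s.idem i) ∈ J
  obtain ⟨T, t, h1, h2, h3⟩ := s.exists_expansion
  by_contra hcon
  apply hu
  rw [← he, ← h2 e, Finset.sum_smul]
  refine Finset.sum_eq_zero fun j _ => ?_
  rw [Finset.sum_smul]
  refine Finset.sum_eq_zero fun p _ => ?_
  obtain ⟨l, hl⟩ := h1 j p.2 e
  rw [← hl, mul_smul, mul_smul, h, smul_zero]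
  -- A coefficient `l` outside the prime would yield the idempotent: lift the inverse of its image
  -- and multiply by `idem i`.
  by_contra hli
  rw [← toLat_eq_zero] at hli
  obtain ⟨l', hl'⟩ := s.toLat_surjective i (s.toLat i l)⁻¹
  apply hcon
  have h4 : s.idem i = s.idem i * l' * l := s.L_ext fun j => by
    rw [map_mul, map_mul, toLat_idem]
    split_ifs with hj
    · subst hj
      rw [hl', one_mul, inv_mul_cancel₀ hli]
    · simp
  rw [h4, map_mul, hl]
  exact J.mul_mem_left _ (h3 J _ _ _ heJ)

/-- If all maps `w ↦ sec w • (q v)` were zero, `e` would kill every `q v`, and the expansion of the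
idempotent would kill `v`. With Schur's lemma, a vertex has only one simple module up to
isomorphism. -/
theorem exists_hom_ne_zero [IsSimpleModule s.A S] {i : s.Vertex} (h : s.SupportedAt S i)
    {Q : Type u} [AddCommGroup Q] [Module s.A Q] [Nontrivial Q] (hQ : s.SupportedAt Q i) :
    ∃ f : S →ₗ[s.A] Q, f ≠ 0 := by
  obtain ⟨u, sec, hu, hsec⟩ := s.exists_section (S := S)
  obtain ⟨ι, _, p, q, hpq⟩ := s.exists_idem_expansion h hu (hsec u)
  by_contra! hcon
  obtain ⟨v, hv⟩ := exists_ne (0 : Q)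
  apply hv
  rw [← hQ.idem_smul v, ← hpq, Finset.sum_smul]
  refine Finset.sum_eq_zero fun m _ => ?_
  rw [mul_smul, mul_smul]
  have h1 := LinearMap.congr_fun (hcon ((LinearMap.toSpanSingleton s.A Q (q m • v)).comp sec)) u
  rw [LinearMap.comp_apply, LinearMap.toSpanSingleton_apply, LinearMap.zero_apply] at h1
  rw [h1, smul_zero]

end SimpleModules

/-- The representation as a module. -/
@[reducible] def repModule (i : s.Vertex) : Module s.A (s.N i) :=
  Module.compHom (s.N i) (s.rep i)

theorem exists_simple (i : s.Vertex) : ∃ (S : Type u) (_ : AddCommGroup S) (_ : Module s.A S),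
    IsSimpleModule s.A S ∧ s.SupportedAt S i := by
  let _ := s.repModule i
  obtain ⟨m, hm⟩ := IsSemisimpleModule.exists_simple_submodule s.A (s.N i)
  refine ⟨m, inferInstance, inferInstance, hm, fun l hl u => Subtype.ext ?_⟩
  change s.rep i (s.ofL l) (u : s.N i) = 0
  rw [rep_ofL, (s.toLat_eq_zero i l).2 hl, map_zero, map_zero, LinearMap.zero_apply]

end Datum
end
end CyclicGrading

namespace CyclicGrading
noncomputable section

/-! ### Reduced traces -/

section ReducedTrace

variable {L D : Type u} [Field L] [Ring D] [Algebra L D]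

/-- An isomorphism between matrix algebras is conjugation by a linear isomorphism (Skolem–Noether).
-/
theorem trace_algEquiv_matrix {K : Type u} [Field K] {n m : ℕ}
    (f : Matrix (Fin n) (Fin n) K ≃ₐ[K] Matrix (Fin m) (Fin m) K) (x : Matrix (Fin n) (Fin n) K) :
    (f x).trace = x.trace := by
  obtain ⟨T, hT⟩ := AlgEquiv.eq_linearEquivConjAlgEquiv
    ((Matrix.toLinAlgEquiv'.symm.trans f).trans Matrix.toLinAlgEquiv')
  have h1 := congrArg (fun F => LinearMap.trace K _ (F (Matrix.toLinAlgEquiv' x))) hT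
  have h2 : LinearMap.trace K _ (T.conjAlgEquiv K (Matrix.toLinAlgEquiv' x)) = x.trace := by
    refine Eq.trans (LinearMap.trace_conj' (Matrix.toLin' x) T) ?_
    exact Matrix.trace_toLin'_eq x
  rw [h2] at h1
  rw [← h1]
  simp only [AlgEquiv.trans_apply, AlgEquiv.symm_apply_apply]
  exact (Matrix.trace_toLin'_eq (f x)).symm

/-- The algebra `D` is split over the algebraic closure, with traces in the base field. -/
def IsSplitWithTrace (L D : Type u) [Field L] [Ring D] [Algebra L D] : Prop :=
  ∃ (n : ℕ) (e : AlgebraicClosure L ⊗[L] D ≃ₐ[AlgebraicClosure L]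
      Matrix (Fin n) (Fin n) (AlgebraicClosure L)),
    ∀ d : D, (e (1 ⊗ₜ d)).trace ∈ Set.range (algebraMap L (AlgebraicClosure L))

/-- Two splittings differ by an isomorphism of matrix algebras, so one splitting with traces in `L`
defines the reduced trace for all. -/
theorem IsSplitWithTrace.isReducedTrace (h : IsSplitWithTrace L D) :
    IsReducedTrace L D (reducedTrace L D) := by
  have hex : ∃ t : D →ₗ[L] L, IsReducedTrace L D t := by
    obtain ⟨n, e, he⟩ := h
    choose t ht using he
    have hinj := FaithfulSMul.algebraMap_injective L (AlgebraicClosure L)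
    refine ⟨{ toFun := t, map_add' := ?_, map_smul' := ?_ }, ?_⟩
    · intro x y
      apply hinj
      rw [map_add, ht, ht, ht, TensorProduct.tmul_add, map_add, Matrix.trace_add]
    · intro a x
      apply hinj
      rw [ht, RingHom.id_apply, smul_eq_mul, map_mul, ht, TensorProduct.tmul_smul,
        ← algebraMap_smul (AlgebraicClosure L) a (1 ⊗ₜ[L] x), map_smul, Matrix.trace_smul,
        smul_eq_mul]
    · intro m e' d
      change algebraMap _ _ (t d) = _
      rw [ht, ← trace_algEquiv_matrix (e.symm.trans e')]
      simp
  unfold reducedTrace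
  rw [dif_pos hex]
  exact hex.choose_spec

/-- Otherwise the matrix trace would vanish on the whole matrix algebra, by linearity over the
closure; a diagonal matrix unit has trace 1. -/
theorem IsSplitWithTrace.reducedTrace_ne_zero [Nontrivial D] (h : IsSplitWithTrace L D) :
    reducedTrace L D ≠ 0 := by
  intro h0
  have h1 := h.isReducedTrace
  obtain ⟨n, e, -⟩ := h
  have h2 : ∀ z, (e z).trace = 0 := by
    intro z
    induction z with
    | zero => simp
    | add x y hx hy => rw [map_add, Matrix.trace_add, hx, hy, add_zero]
    | tmul a d =>
      have h3 : a ⊗ₜ[L] d = a • (1 ⊗ₜ[L] d) := by rw [TensorProduct.smul_tmul', smul_eq_mul, mul_one]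
      rw [h3, map_smul, Matrix.trace_smul, ← h1 n e, h0, LinearMap.zero_apply, map_zero, smul_zero]
  -- Size 0 would make the base change of `D` the zero ring.
  rcases n with _ | n
  · have h4 : (1 : AlgebraicClosure L ⊗[L] D) = 0 := e.injective (Subsingleton.elim _ _)
    exact one_ne_zero h4
  · have h5 := h2 (e.symm (Matrix.single 0 0 1))
    rw [e.apply_symm_apply, Matrix.trace_single_eq_same] at h5
    exact one_ne_zero h5

/-- An algebra map into matrices of the size of a splitting extends over the closure to another
splitting, so it computes the same trace. This avoids checking bijectivity for the transposed
splitting of `reducedTrace_anti`. -/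
theorem IsSplitWithTrace.eq_of_algHom {n : ℕ}
    (e : AlgebraicClosure L ⊗[L] D ≃ₐ[AlgebraicClosure L]
      Matrix (Fin n) (Fin n) (AlgebraicClosure L)) (h : IsReducedTrace L D (reducedTrace L D))
    [Nontrivial D]
    (f : D →ₐ[L] Matrix (Fin n) (Fin n) (AlgebraicClosure L)) (d : D) :
    algebraMap L (AlgebraicClosure L) (reducedTrace L D d) = (f d).trace := by
  let F : AlgebraicClosure L ⊗[L] D →ₐ[AlgebraicClosure L]
      Matrix (Fin n) (Fin n) (AlgebraicClosure L) :=
    Algebra.TensorProduct.lift (Algebra.ofId _ _) f (fun x y => by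
      rw [Algebra.ofId_apply]; exact Algebra.commutes x (f y))
  have hn : Nonempty (Fin n) := by
    rcases n with _ | n
    · have h4 : (1 : AlgebraicClosure L ⊗[L] D) = 0 := e.injective (Subsingleton.elim _ _)
      exact absurd h4 one_ne_zero
    · exact ⟨0⟩
  -- An endomorphism of a simple, finite-dimensional algebra: injective, and surjective by
  -- dimension.
  let G : Matrix (Fin n) (Fin n) (AlgebraicClosure L) →ₐ[AlgebraicClosure L]
      Matrix (Fin n) (Fin n) (AlgebraicClosure L) := F.comp e.symm
  have hG : Function.Injective G := RingHom.injective G.toRingHom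
  have hGs : Function.Surjective G := (LinearMap.injective_iff_surjective (f := G.toLinearMap)).1 hG
  have h1 := h n (e.trans (AlgEquiv.ofBijective G ⟨hG, hGs⟩)) d
  rw [h1]
  change (F (e.symm (e _))).trace = _
  rw [e.symm_apply_apply]
  congr 1
  change Algebra.TensorProduct.lift _ _ _ (1 ⊗ₜ[L] d) = _
  rw [Algebra.TensorProduct.lift_tmul, map_one, one_mul]

/-- The reduced trace is compatible with semilinear anti-automorphisms. -/
theorem IsSplitWithTrace.reducedTrace_anti [Nontrivial D] (h : IsSplitWithTrace L D)
    (τ : L ≃+* L) (star : D ≃+* Dᵐᵒᵖ)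
    (hstar : ∀ l : L, (star (algebraMap L D l)).unop = algebraMap L D (τ l)) (d : D) :
    reducedTrace L D (star d).unop = τ (reducedTrace L D d) := by
  have h1 := h.isReducedTrace
  obtain ⟨n, e, -⟩ := h
  let T : AlgebraicClosure L ≃+* AlgebraicClosure L := IsAlgClosure.equivOfEquiv _ _ τ
  have hT : ∀ l, T (algebraMap L _ l) = algebraMap L _ (τ l) := fun l =>
    IsAlgClosure.equivOfEquiv_algebraMap _ _ τ l
  have hinv : ∀ l : L, star.symm (MulOpposite.op (algebraMap L D (τ l))) = algebraMap L D l :=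
    fun l => by rw [RingEquiv.symm_apply_eq, ← hstar, MulOpposite.op_unop]
  have he : ∀ l : L, e (1 ⊗ₜ algebraMap L D l) =
      algebraMap (AlgebraicClosure L) _ (algebraMap L (AlgebraicClosure L) l) := by
    intro l
    rw [← e.commutes]
    congr 1
    rw [Algebra.TensorProduct.algebraMap_apply, Algebra.algebraMap_self, RingHom.id_apply,
      Algebra.algebraMap_eq_smul_one, TensorProduct.tmul_smul, TensorProduct.smul_tmul',
      Algebra.algebraMap_eq_smul_one]
  -- Transposition undoes the order reversal of the inverse of `star`, and the extension `T` of `τ`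
  -- undoes its effect on `L`; so this is again an `L`-algebra map.
  let f : D →ₐ[L] Matrix (Fin n) (Fin n) (AlgebraicClosure L) :=
    { toFun := fun d => ((e (1 ⊗ₜ star.symm (MulOpposite.op d))).map T).transpose
      map_one' := by
        rw [MulOpposite.op_one, map_one]
        change ((e 1).map T).transpose = 1
        rw [map_one, Matrix.map_one T (map_zero T) (map_one T), Matrix.transpose_one]
      map_zero' := by simp
      map_mul' := fun x y => by
        have h2 : ∀ a b : D, (1 : AlgebraicClosure L) ⊗ₜ[L] (a * b) = (1 ⊗ₜ a) * (1 ⊗ₜ b) :=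
          fun a b => by rw [Algebra.TensorProduct.tmul_mul_tmul, one_mul]
        rw [MulOpposite.op_mul, map_mul, h2, map_mul]
        change (T.mapMatrix (_ * _)).transpose = _
        rw [map_mul, Matrix.transpose_mul]
        rfl
      map_add' := fun x y => by
        rw [MulOpposite.op_add, map_add, TensorProduct.tmul_add, map_add]
        change (T.mapMatrix (_ + _)).transpose = _
        rw [map_add, Matrix.transpose_add]
        rfl
      commutes' := fun l => by
        obtain ⟨l, rfl⟩ := τ.surjective l
        rw [hinv, he, Matrix.algebraMap_eq_diagonal, Matrix.diagonal_map (map_zero T),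
          Matrix.diagonal_transpose, Matrix.algebraMap_eq_diagonal]
        congr 1
        funext i
        exact hT l }
  apply FaithfulSMul.algebraMap_injective L (AlgebraicClosure L)
  rw [IsSplitWithTrace.eq_of_algHom e h1 f, ← hT, h1 n e]
  change (((e (1 ⊗ₜ star.symm (MulOpposite.op (star d).unop))).map T).transpose).trace = _
  rw [MulOpposite.op_unop, RingEquiv.symm_apply_apply, Matrix.trace_transpose]
  exact (AddMonoidHom.map_trace (T : AlgebraicClosure L →+ AlgebraicClosure L) _).symm

end ReducedTrace

/-! ### Traces and spanning properties of the matrix representations -/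

namespace Datum
variable {k : Type u} [Field k] {σk : k ≃+* k} (s : Datum k σk)

/-- The operator of `a θ ^ j` is a diagonal operator composed with the translation by `ζ ^ j`. Its
trace is 0 unless `n` divides `j`, and then it is the trace of `a` times `b ^ (j/n)`. -/
theorem trace_rep_mem_range (i : s.Vertex) (z : s.A) :
    LinearMap.trace (s.Ω i) _ (s.rep i z) ∈ Set.range (algebraMap (s.Lat i) (s.Ω i)) := by
  classical
  change _ ∈ (algebraMap (s.Lat i) (s.Ω i)).range
  induction z using s.A_span_induction with
  | h0 => simp
  | hadd x y hx hy => rw [map_add, map_add]; exact add_mem hx hy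
  | h a j =>
    have h1 : LinearMap.trace (s.Ω i) _ (s.rep i (s.incl a * s.θA ^ j)) =
        ∑ g : s.Idx, s.χ i ((g : s.F ≃ₐ[k] s.F) a) * (s.ω i ^ j *
          (Pi.single g 1 : s.N i) (g * s.ζIdx ^ j)) := by
      rw [LinearMap.trace_eq_matrix_trace _ (Pi.basisFun (s.Ω i) s.Idx), Matrix.trace]
      refine Finset.sum_congr rfl fun g _ => ?_
      rw [Matrix.diag_apply, LinearMap.toMatrix_apply, Pi.basisFun_apply, Pi.basisFun_repr,
        map_mul, map_pow, rep_incl, rep_θA, Module.End.mul_apply, repF_apply, repθ_pow_apply]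
    rw [h1]
    by_cases hj : s.ζIdx ^ j = 1
    · have h2 : s.n ∣ j := by
        rw [Datum.n, orderOf_dvd_iff_pow_eq_one]
        exact congrArg Subtype.val hj
      obtain ⟨q, rfl⟩ := h2
      obtain ⟨c, hc⟩ := sum_zpowers_mem_range s.mem_range_of_fixed a
      refine ⟨s.toLat i (algebraMap k s.L c * s.b ^ q), ?_⟩
      rw [map_mul, map_mul, ← algebraMap_Ω, ← (s.χ i).commutes, hc, map_sum, Finset.sum_mul]
      refine Finset.sum_congr rfl fun g _ => ?_
      rw [hj, mul_one, Pi.single_eq_same, mul_one, pow_mul, ω_pow, map_pow, map_pow]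
    · rw [Finset.sum_eq_zero]
      · exact zero_mem _
      · intro g _
        rw [Pi.single_eq_of_ne (by simpa using hj), mul_zero, mul_zero]

instance (i : s.Vertex) : Algebra s.L (s.Lat i) := (s.toLat i).toAlgebra

/-- The dual families produce the coordinate projections `pr g`, and `pr g` times a power of `θ` is
a matrix unit up to a power of `ω i`. -/
theorem rep_span (i : s.Vertex) (T : Module.End (s.Ω i) (s.N i)) :
    T ∈ Submodule.span (s.Ω i) (Set.range (s.rep i)) := by
  classical
  obtain ⟨S, hS⟩ := s.exists_dual
  let pr : s.Idx → Module.End (s.Ω i) (s.N i) := fun g =>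
    ∑ p ∈ S, s.χ i ((g : s.F ≃ₐ[k] s.F) p.1) • s.rep i (s.incl p.2)
  have hpr : ∀ g f h, pr g f h = if h = g then f g else 0 := by
    intro g f h
    have h1 : pr g f h = s.χ i ((g : s.F ≃ₐ[k] s.F)
        (∑ p ∈ S, p.1 * ((g⁻¹ * h : s.Idx) : s.F ≃ₐ[k] s.F) p.2)) * f h := by
      simp only [pr, LinearMap.sum_apply, LinearMap.smul_apply, Finset.sum_apply, Pi.smul_apply,
        rep_incl, repF_apply, map_sum, map_mul, Finset.sum_mul, smul_eq_mul]
      refine Finset.sum_congr rfl fun p _ => ?_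
      rw [mul_assoc]
      congr 3
      rw [← AlgEquiv.mul_apply]
      simp
    obtain ⟨j, hj⟩ := (g⁻¹ * h).2
    rw [h1, ← hj, hS]
    have h2 : (s.n : ℤ) ∣ j ↔ h = g := by
      rw [Datum.n, orderOf_dvd_iff_zpow_eq_one]
      change (fun x : ℤ => s.ζ ^ x) j = 1 ↔ _
      rw [hj, ← Subgroup.coe_one, ← Subtype.ext_iff, inv_mul_eq_one, eq_comm]
    simp only [h2]
    split_ifs with h3
    · rw [map_one, map_one, one_mul, h3]
    · rw [map_zero, map_zero, zero_mul]
  have hpow : ∀ h : s.Idx, ∃ j : ℕ, s.ζIdx ^ j = h := by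
    rintro ⟨h, hh⟩
    obtain ⟨j, rfl⟩ := (Submonoid.mem_powers_iff _ _).1
      (s.isOfFinOrder_ζ.mem_powers_iff_mem_zpowers.2 hh)
    exact ⟨j, rfl⟩
  choose j hj using hpow
  have hprs : ∀ g h, pr g * s.rep i s.θA ^ j h ∈ Submodule.span (s.Ω i) (Set.range (s.rep i)) := by
    intro g h
    rw [← map_pow, Finset.sum_mul]
    refine Submodule.sum_mem _ fun p _ => ?_
    rw [smul_mul_assoc, ← map_mul]
    exact Submodule.smul_mem _ _ (Submodule.subset_span ⟨_, rfl⟩)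
  -- The matrix unit from `g * h` to `g` is `pr g * θ ^ j h` divided by `ω i ^ j h`; its coefficient
  -- is the corresponding entry of `T`.
  have hT : T = ∑ g : s.Idx, ∑ h : s.Idx,
      (T (Pi.single (g * h) 1) g * (s.ω i ^ j h)⁻¹) • (pr g * s.rep i s.θA ^ j h) := by
    refine LinearMap.pi_ext' fun x => LinearMap.ext_ring (funext fun y => ?_)
    simp only [LinearMap.comp_apply, LinearMap.single_apply, LinearMap.sum_apply,
      LinearMap.smul_apply, Finset.sum_apply, Pi.smul_apply, Module.End.mul_apply, hpr, rep_θA,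
      repθ_pow_apply, hj, smul_eq_mul]
    rw [Finset.sum_eq_single y]
    · rw [Finset.sum_eq_single (y⁻¹ * x)]
      · rw [if_pos rfl, mul_inv_cancel_left, Pi.single_eq_same, mul_one, mul_assoc,
          inv_mul_cancel₀ (pow_ne_zero _ (s.ω_ne_zero i)), mul_one]
      · intro h _ hh
        rw [if_pos rfl, Pi.single_eq_of_ne, mul_zero, mul_zero]
        rintro rfl
        exact hh (by simp)
      · simp
    · intro g _ hg
      refine Finset.sum_eq_zero fun h _ => ?_
      rw [if_neg (Ne.symm hg), mul_zero]
    · simp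
  rw [hT]
  exact Submodule.sum_mem _ fun g _ => Submodule.sum_mem _ fun h _ => Submodule.smul_mem _ _ (hprs g h)

/-- The number of generators matters: `n * n` is the dimension of the endomorphism algebra of `N i`.
-/
theorem A_span_L : ∃ v : Fin s.n × Fin s.n → s.A, Submodule.span s.L (Set.range v) = ⊤ := by
  let B : Module.Basis (Fin s.n) k s.F := Module.finBasisOfFinrankEq k s.F s.finrank_F
  refine ⟨fun q => s.incl (B q.1) * s.θA ^ (q.2 : ℕ), ?_⟩
  refine Submodule.eq_top_iff'.2 fun z => ?_
  induction z using s.A_span_induction with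
  | h0 => exact zero_mem _
  | hadd x y hx hy => exact add_mem hx hy
  | h a j =>
    have h1 : s.incl a * s.θA ^ j = ∑ l, (s.b ^ (j / s.n) * algebraMap k s.L (B.repr a l)) •
        (s.incl (B l) * s.θA ^ (j % s.n)) := by
      conv_lhs => rw [← B.sum_repr a, map_sum, Finset.sum_mul]
      refine Finset.sum_congr rfl fun l _ => ?_
      rw [L_smul_def, map_mul, ofL_algebraMap, map_pow, ofL_b, Algebra.smul_def, map_mul]
      conv_lhs => rw [← Nat.div_add_mod j s.n, pow_add, pow_mul]
      have h2 : (s.θA ^ s.n) ^ (j / s.n) = s.ofL (s.b ^ (j / s.n)) := by rw [map_pow, ofL_b]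
      rw [h2, s.ofL_central (s.b ^ (j / s.n)) (s.incl (algebraMap k s.F _))]
      simp only [mul_assoc]
      rw [← mul_assoc (s.ofL _) (s.incl (B l)), s.ofL_central _ (s.incl (B l)), mul_assoc]
    rw [h1]
    exact Submodule.sum_mem _ fun l _ => Submodule.smul_mem _ _
      (Submodule.subset_span ⟨(l, ⟨j % s.n, Nat.mod_lt _ s.n_pos⟩), rfl⟩)

/-- The representation as an `L_β`-linear map. -/
def repL (i : s.Vertex) : s.A →ₗ[s.L] Module.End (s.Ω i) (s.N i) where
  toFun := s.rep i
  map_add' := map_add _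
  map_smul' l z := by
    rw [L_smul_def, map_mul, rep_ofL, RingHom.id_apply, ← Algebra.smul_def, algebraMap_smul]
    rfl

/-- The surjections from the coordinate space of dimension `n * n` to the base change of `A_β` and
on to the endomorphisms of `N i` compose to a surjection between spaces of equal dimension. So the
composite is injective, and with it the second map. -/
theorem repL_baseChange_injective (i : s.Vertex) :
    Function.Injective ((s.repL i).liftBaseChange (s.Ω i)) := by
  obtain ⟨v, hv⟩ := s.A_span_L
  let P : (Fin s.n × Fin s.n → s.Ω i) →ₗ[s.Ω i] (s.Ω i ⊗[s.L] s.A) :=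
    Fintype.linearCombination (s.Ω i) fun q => 1 ⊗ₜ[s.L] v q
  have hP : Function.Surjective P := by
    rw [← LinearMap.range_eq_top, Fintype.range_linearCombination,
      ← Submodule.baseChange_top, ← hv, Submodule.baseChange_span, ← Set.range_comp]
    rfl
  have hΘ : Function.Surjective ((s.repL i).liftBaseChange (s.Ω i)) := by
    rw [← LinearMap.range_eq_top, eq_top_iff]
    intro T _
    refine Submodule.span_le.2 ?_ (s.rep_span i T)
    rintro _ ⟨z, rfl⟩
    exact ⟨1 ⊗ₜ z, by rw [LinearMap.liftBaseChange_tmul, one_smul]; rfl⟩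
  have hinj : Function.Injective (((s.repL i).liftBaseChange (s.Ω i)) ∘ₗ P) := by
    refine (LinearMap.injective_iff_surjective_of_finrank_eq_finrank ?_).2 ?_
    · rw [Module.finrank_linearMap, Module.finrank_pi, Module.finrank_pi, Fintype.card_prod,
        Fintype.card_fin, card_Idx]
    · rw [LinearMap.coe_comp]
      exact hΘ.comp hP
  intro x y hxy
  obtain ⟨x, rfl⟩ := hP x
  obtain ⟨y, rfl⟩ := hP y
  rw [hinj hxy]

end Datum
end
end CyclicGrading

namespace CyclicGrading
noncomputable section
namespace Datum
variable {k : Type u} [Field k] {σk : k ≃+* k} {s : Datum k σk}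
namespace Choices
variable (C : s.Choices)

/-! ### Generators of the simple modules, and the reduced trace of `D_i` -/

theorem supportedAt (i : s.Vertex) : s.SupportedAt (C.S i) i := C.support i

/-- A generator of `S_i`. -/
def gen (i : s.Vertex) : C.S i := (s.exists_section (S := C.S i)).choose

/-- An `A_β`-linear embedding of `S_i` into `A_β`. -/
def sec (i : s.Vertex) : C.S i →ₗ[s.A] s.A := (s.exists_section (S := C.S i)).choose_spec.choose

theorem gen_ne_zero (i : s.Vertex) : C.gen i ≠ 0 :=
  (s.exists_section (S := C.S i)).choose_spec.choose_spec.1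

theorem sec_smul_gen (i : s.Vertex) (w : C.S i) : C.sec i w • C.gen i = w :=
  (s.exists_section (S := C.S i)).choose_spec.choose_spec.2 w

/-- The idempotent of `A_β` that generates the image of `S_i`. -/
abbrev e (i : s.Vertex) : s.A := C.sec i (C.gen i)

theorem exists_expansion_idem (i : s.Vertex) :
    ∃ (ι : Type) (_ : Fintype ι) (p q : ι → s.A),
      ∑ m, p m * C.e i * q m = s.ofL (s.idem i) :=
  s.exists_idem_expansion (C.supportedAt i) (C.gen_ne_zero i) (C.sec_smul_gen i _)

theorem toLat_smul_unop (i : s.Vertex) (l : s.L) (d : C.D i) (u : C.S i) :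
    (s.toLat i l • d).unop u = s.ofL l • d.unop u := by
  have h : s.toLat i l • d = MulOpposite.op (C.actL i l) * d := rfl
  rw [h, MulOpposite.unop_mul]
  change d.unop (s.ofL l • u) = _
  rw [d.unop.map_smul]

/-- The embedding of `D_i` into `A_β` (multiplicative, but not unital). -/
def dA (i : s.Vertex) : C.D i →+ s.A where
  toFun d := C.sec i (d.unop (C.gen i))
  map_zero' := by simp
  map_add' d d' := by simp

theorem dA_apply (i : s.Vertex) (d : C.D i) : C.dA i d = C.sec i (d.unop (C.gen i)) := rfl

/-- The opposite ring in the definition of `D i` is what makes this multiplicative rather than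
order-reversing. -/
theorem dA_mul (i : s.Vertex) (d d' : C.D i) : C.dA i (d * d') = C.dA i d * C.dA i d' := by
  have h : C.dA i d * C.dA i d' = C.sec i (C.dA i d • d'.unop (C.gen i)) :=
    ((C.sec i).map_smul _ _).symm
  rw [h, ← map_smul d'.unop, dA_apply C i d, sec_smul_gen]
  rfl

theorem dA_one (i : s.Vertex) : C.dA i 1 = C.e i := rfl

theorem dA_smul (i : s.Vertex) (l : s.L) (d : C.D i) :
    C.dA i (s.toLat i l • d) = s.ofL l * C.dA i d := by
  rw [dA_apply, toLat_smul_unop, map_smul]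
  rfl

/-- The projection of `A_β` onto `D_i`. -/
def ofA (i : s.Vertex) : s.A →+ C.D i where
  toFun w := MulOpposite.op ((LinearMap.toSpanSingleton s.A _ (w • C.gen i)).comp (C.sec i))
  map_zero' := by
    refine MulOpposite.unop_injective (LinearMap.ext fun v => ?_)
    simp
  map_add' w w' := by
    refine MulOpposite.unop_injective (LinearMap.ext fun v => ?_)
    simp [add_smul]

theorem ofA_unop (i : s.Vertex) (w : s.A) (v : C.S i) :
    (C.ofA i w).unop v = C.sec i v • w • C.gen i := rfl

theorem ofA_dA (i : s.Vertex) (d : C.D i) : C.ofA i (C.dA i d) = d := by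
  refine MulOpposite.unop_injective (LinearMap.ext fun v => ?_)
  rw [ofA_unop, dA_apply, sec_smul_gen, ← map_smul, sec_smul_gen]

/-- Together with `ofA_dA` this identifies `D i` with the corner ring `e A_β e`. -/
theorem dA_ofA (i : s.Vertex) (w : s.A) : C.dA i (C.ofA i w) = C.e i * w * C.e i := by
  rw [dA_apply, ofA_unop, ← mul_smul, map_smul, smul_eq_mul]

theorem ofA_mul_ofL (i : s.Vertex) (l : s.L) (w : s.A) :
    C.ofA i (s.ofL l * w) = s.toLat i l • C.ofA i w := by
  refine MulOpposite.unop_injective (LinearMap.ext fun v => ?_)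
  rw [toLat_smul_unop, ofA_unop, ofA_unop, mul_smul, ← mul_smul, ← ofL_central, mul_smul]

/-- The image of the idempotent in the representation. -/
def eN (i : s.Vertex) : Submodule (s.Ω i) (s.N i) := LinearMap.range (s.rep i (C.e i))

theorem rep_dA_mem (i : s.Vertex) (d : C.D i) (f : s.N i) :
    s.rep i (C.dA i d) f ∈ C.eN i := by
  refine ⟨s.rep i (C.dA i d) f, ?_⟩
  rw [← Module.End.mul_apply, ← map_mul, ← dA_one, ← dA_mul, one_mul]

theorem rep_e_apply (i : s.Vertex) (f : C.eN i) : s.rep i (C.e i) f = f := by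
  obtain ⟨_, f, rfl⟩ := f
  change s.rep i (C.e i) (s.rep i (C.e i) f) = s.rep i (C.e i) f
  rw [← Module.End.mul_apply, ← map_mul, ← dA_one, ← dA_mul, one_mul]

/-- The projection onto the image of the idempotent. -/
def eProj (i : s.Vertex) : s.N i →ₗ[s.Ω i] C.eN i :=
  (s.rep i (C.e i)).codRestrict (C.eN i) fun f => ⟨f, rfl⟩

theorem eProj_eN (i : s.Vertex) (f : C.eN i) : C.eProj i f = f := Subtype.ext (C.rep_e_apply i f)

/-- The representation of `D_i` on the image of the idempotent. -/
def repD (i : s.Vertex) : C.D i →ₐ[s.Lat i] Module.End (s.Ω i) (C.eN i) where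
  toFun d := (s.rep i (C.dA i d)).restrict (fun f _ => C.rep_dA_mem i d f)
  map_one' := LinearMap.ext fun f => Subtype.ext (C.rep_e_apply i f)
  map_mul' d d' := LinearMap.ext fun f => Subtype.ext (by
    simp only [LinearMap.coe_restrict_apply, Module.End.mul_apply, dA_mul, map_mul])
  map_zero' := LinearMap.ext fun f => Subtype.ext (by simp)
  map_add' d d' := LinearMap.ext fun f => Subtype.ext (by simp)
  commutes' l := LinearMap.ext fun f => Subtype.ext (by
    obtain ⟨l, rfl⟩ := s.toLat_surjective i l
    rw [Module.algebraMap_end_apply, Submodule.coe_smul_of_tower, LinearMap.coe_restrict_apply,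
      Algebra.algebraMap_eq_smul_one, dA_smul, dA_one, map_mul, Module.End.mul_apply, rep_e_apply,
      rep_ofL, Module.algebraMap_end_apply, algebraMap_smul])

theorem repD_apply (i : s.Vertex) (d : C.D i) (f : C.eN i) :
    (C.repD i d f : s.N i) = s.rep i (C.dA i d) f := rfl

/-- The splitting of `D_i`. -/
def split (i : s.Vertex) :
    s.Ω i ⊗[s.Lat i] C.D i →ₐ[s.Ω i] Module.End (s.Ω i) (C.eN i) :=
  Algebra.TensorProduct.lift (Algebra.ofId _ _) (C.repD i)
    (fun x y => by rw [Algebra.ofId_apply]; exact Algebra.commutes x (C.repD i y))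

theorem split_tmul (i : s.Vertex) (a : s.Ω i) (d : C.D i) :
    C.split i (a ⊗ₜ d) = a • C.repD i d := by
  rw [split, Algebra.TensorProduct.lift_tmul, Algebra.ofId_apply, ← Algebra.smul_def]

/-- An endomorphism of the image of `e` is the compression of one of `N i`, which is a combination
of operators of elements `w` of `A_β`; the compression of `w` is the operator of `e w e`, which
comes from `D i`. -/
theorem split_surjective (i : s.Vertex) : Function.Surjective (C.split i) := by
  let c : Module.End (s.Ω i) (s.N i) →ₗ[s.Ω i] Module.End (s.Ω i) (C.eN i) :=
    (LinearMap.lcomp (s.Ω i) (C.eN i) (C.eN i).subtype) ∘ₗ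
      (LinearMap.llcomp (s.Ω i) (s.N i) (s.N i) (C.eN i)
        (C.eProj i))
  have hc : ∀ (T) (f : C.eN i), (c T f : s.N i) = s.rep i (C.e i) (T f) := fun T f => rfl
  have h1 : ∀ T, c T ∈ LinearMap.range (C.split i).toLinearMap := by
    intro T
    rw [← Submodule.mem_comap]
    refine Submodule.span_le.2 ?_ (s.rep_span i T)
    rintro _ ⟨w, rfl⟩
    refine ⟨1 ⊗ₜ C.ofA i w, ?_⟩
    rw [AlgHom.toLinearMap_apply, split_tmul, one_smul]
    refine LinearMap.ext fun f => Subtype.ext ?_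
    rw [hc, repD_apply, dA_ofA, map_mul, map_mul, Module.End.mul_apply, Module.End.mul_apply,
      rep_e_apply]
  intro T
  obtain ⟨z, hz⟩ := h1 ((C.eN i).subtype ∘ₗ T ∘ₗ C.eProj i)
  refine ⟨z, Eq.trans hz (LinearMap.ext fun f => Subtype.ext ?_)⟩
  rw [hc]
  simp only [LinearMap.comp_apply, Submodule.subtype_apply, rep_e_apply, eProj_eN]

instance (i : s.Vertex) : Module s.L (C.D i) := Module.compHom _ (s.toLat i)

instance (i : s.Vertex) : IsScalarTower s.L (s.Lat i) (C.D i) :=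
  ⟨fun l x d => by
    change (s.toLat i l * x) • d = s.toLat i l • (x • d)
    rw [mul_smul]⟩

/-- The base change of `D i` is a direct summand of the base change of `A_β`, with retraction `ofA`,
and on the latter the representation is injective. -/
theorem split_injective (i : s.Vertex) : Function.Injective (C.split i) := by
  rw [injective_iff_map_eq_zero]
  intro z hz
  let dAL : C.D i →ₗ[s.L] s.A := { C.dA i with map_smul' := fun l d => C.dA_smul i l d }
  let ofAL : s.A →ₗ[s.L] C.D i := { C.ofA i with map_smul' := fun l d => C.ofA_mul_ofL i l d }
  -- Passage to tensors over `L_β`, where the comparison with `A_β` takes place.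
  obtain ⟨z, rfl⟩ := TensorProduct.mapOfCompatibleSMul_surjective (s.Lat i) s.L s.L (s.Ω i)
    (C.D i) z
  have hleft : Function.Injective (dAL.lTensor (s.Ω i)) := by
    refine Function.LeftInverse.injective (g := ofAL.lTensor (s.Ω i)) fun x => ?_
    rw [← LinearMap.comp_apply, ← LinearMap.lTensor_comp]
    have : ofAL ∘ₗ dAL = LinearMap.id := LinearMap.ext fun d => C.ofA_dA i d
    rw [this, LinearMap.lTensor_id, LinearMap.id_apply]
  have hcomp : ∀ z : s.Ω i ⊗[s.L] C.D i,
      (s.repL i).liftBaseChange (s.Ω i) (dAL.lTensor (s.Ω i) z) =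
      (C.eN i).subtype ∘ₗ (C.split i (TensorProduct.mapOfCompatibleSMul (s.Lat i) s.L s.L (s.Ω i)
        (C.D i) z)) ∘ₗ C.eProj i := by
    intro z
    induction z with
    | zero => simp
    | add x y hx hy => simp only [map_add, hx, hy, LinearMap.add_comp,
        LinearMap.comp_add]
    | tmul a d =>
      rw [LinearMap.lTensor_tmul, LinearMap.liftBaseChange_tmul,
        TensorProduct.mapOfCompatibleSMul_tmul, split_tmul, LinearMap.smul_comp,
        LinearMap.comp_smul]
      congr 1
      refine LinearMap.ext fun f => ?_
      change s.rep i (C.dA i d) f = s.rep i (C.dA i d) (s.rep i (C.e i) f)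
      rw [← Module.End.mul_apply, ← map_mul, ← dA_one, ← dA_mul, mul_one]
  have h1 := hcomp z
  rw [hz, LinearMap.zero_comp, LinearMap.comp_zero] at h1
  have h2 := s.repL_baseChange_injective i (h1.trans (map_zero _).symm)
  rw [hleft (h2.trans (map_zero _).symm), map_zero]

/-- The operator of `dA d` maps all of `N i` into the image of `e`, so its trace there equals its
trace on `N i`, which is known to lie in `L_i`. -/
theorem isSplitWithTrace (i : s.Vertex) : IsSplitWithTrace (s.Lat i) (C.D i) := by
  let E := AlgEquiv.ofBijective (C.split i) ⟨C.split_injective i, C.split_surjective i⟩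
  let B := Module.finBasis (s.Ω i) (C.eN i)
  refine ⟨_, E.trans (algEquivMatrix B), fun d => ?_⟩
  have h1 : (E.trans (algEquivMatrix B) (1 ⊗ₜ d)).trace =
      LinearMap.trace (s.Ω i) _ (C.repD i d) := by
    rw [LinearMap.trace_eq_matrix_trace _ B, AlgEquiv.trans_apply]
    change (LinearMap.toMatrix B B (C.split i _)).trace = _
    rw [split_tmul, one_smul]
  have h2 : LinearMap.trace (s.Ω i) _ (C.repD i d) =
      LinearMap.trace (s.Ω i) _ (s.rep i (C.dA i d)) :=
    LinearMap.trace_restrict_eq_of_forall_mem _ _ fun f => C.rep_dA_mem i d f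
  rw [h1, h2]
  exact s.trace_rep_mem_range i _

instance (i : s.Vertex) : Nontrivial (C.D i) := by
  have := IsSimpleModule.nontrivial s.A (C.S i)
  infer_instance

/-- The reduced trace of `D_i`. -/
abbrev trd (i : s.Vertex) : C.D i →ₗ[s.Lat i] s.Lat i := reducedTrace (s.Lat i) (C.D i)

/-- A nonzero `d` is invertible by Schur's lemma, so every `x` is a left multiple of `d`, and the
nonzero reduced trace would vanish everywhere. -/
theorem eq_zero_of_trd (i : s.Vertex) (d : C.D i) (h : ∀ d', C.trd i (d' * d) = 0) : d = 0 := by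
  by_contra hd
  refine (C.isSplitWithTrace i).reducedTrace_ne_zero (LinearMap.ext fun x => ?_)
  have hu : IsUnit d.unop := (Module.End.isUnit_iff _).2 (LinearMap.bijective_of_ne_zero
    fun h0 => hd (MulOpposite.unop_injective h0))
  obtain ⟨v, hv⟩ := hu
  have h1 := h (x * MulOpposite.op (↑v⁻¹ : Module.End s.A (C.S i)))
  rw [mul_assoc] at h1
  have h2 : MulOpposite.op (↑v⁻¹ : Module.End s.A (C.S i)) * d = 1 :=
    MulOpposite.unop_injective (by
      rw [MulOpposite.unop_mul, MulOpposite.unop_op, ← hv, Units.mul_inv]; rfl)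
  rw [h2, mul_one] at h1
  exact h1

end Choices
end Datum
end
end CyclicGrading

namespace CyclicGrading
noncomputable section
namespace Datum
variable {k : Type u} [Field k] {σk : k ≃+* k} (s : Datum k σk)

/-! ### Finiteness over `k^σ` -/

/-- If `σ` moves `x`, then `1` and `x` span `k`: the quotient of `y - σ(y)` by `x - σ(x)` is
invariant and serves as the coefficient of `x` in `y`. -/
instance finite_k : Module.Finite s.k₀ k := by
  classical
  by_cases h : ∃ x, σk x ≠ x
  · obtain ⟨x, hx⟩ := h
    have hx' : x - σk x ≠ 0 := fun h => hx (sub_eq_zero.1 h).symm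
    have hs : σk (x - σk x) = -(x - σk x) := by rw [map_sub, s.σk_σk]; ring
    have hfix : ∀ y, σk ((y - σk y) / (x - σk x)) = (y - σk y) / (x - σk x) := fun y => by
      rw [map_div₀, hs, map_sub, s.σk_σk, div_neg, ← neg_div, neg_sub]
    refine ⟨⟨({1, x} : Finset k), Submodule.eq_top_iff'.2 fun y => ?_⟩⟩
    have h2 : σk (y - (y - σk y) / (x - σk x) * x) = y - (y - σk y) / (x - σk x) * x := by
      rw [map_sub, map_mul, hfix]
      field_simp
      ring
    rw [Finset.coe_pair, Submodule.mem_span_pair]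
    refine ⟨⟨_, h2⟩, ⟨_, hfix y⟩, ?_⟩
    change (y - (y - σk y) / (x - σk x) * x) * 1 + (y - σk y) / (x - σk x) * x = y
    ring
  · push Not at h
    refine ⟨⟨({1} : Finset k), Submodule.eq_top_iff'.2 fun y => ?_⟩⟩
    rw [Finset.coe_singleton, Submodule.mem_span_singleton]
    exact ⟨⟨y, h y⟩, mul_one y⟩

instance : IsScalarTower s.k₀ k s.F := ⟨fun a x y => by
  change ((a : k) * x) • y = (a : k) • x • y
  rw [mul_smul]⟩

instance : IsScalarTower s.k₀ k s.V := ⟨fun a x y => by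
  change ((a : k) * x) • y = (a : k) • x • y
  rw [mul_smul]⟩

instance : Module.Finite s.k₀ s.F := Module.Finite.trans k s.F

instance : Module.Finite k s.V := Module.Finite.trans s.F s.V

instance : Module.Finite s.k₀ s.V := Module.Finite.trans k s.V

theorem exists_functional : ∃ l : s.F →ₗ[s.k₀] s.k₀, ∀ a, (∀ x, l (x * a) = 0) → a = 0 :=
  exists_functional_of_isReduced

/-- A functional on `F` whose kernel contains no nonzero ideal. -/
def functional : s.F →ₗ[s.k₀] s.k₀ := s.exists_functional.choose

theorem eq_zero_of_functional (a : s.F) (h : ∀ x, s.functional (x * a) = 0) : a = 0 :=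
  s.exists_functional.choose_spec a h

instance : Algebra s.k₀ s.A := ((s.ofL.comp (algebraMap k s.L)).comp s.k₀.subtype).toAlgebra'
  fun _ x => s.ofL_central _ x

theorem algebraMap_A (a : s.k₀) :
    algebraMap s.k₀ s.A a = s.incl (algebraMap k s.F a) := s.ofL_algebraMap a

instance : Module.Finite s.k₀ s.L := by
  have : IsScalarTower s.k₀ k s.L := ⟨fun a x y => by
    change ((a : k) * x) • y = (a : k) • x • y
    rw [mul_smul]⟩
  exact Module.Finite.trans k s.L

instance : IsScalarTower s.k₀ s.L s.A := .of_algebraMap_eq fun _ => rfl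

instance : Module.Finite s.k₀ s.A := Module.Finite.trans s.L s.A

/-! ### Twisting `θ` by an element of `F` -/

theorem prod_range_mul (a : s.F) (j : ℕ) : ∏ i ∈ Finset.range (s.n * j), (s.ζ ^ i) a =
    algebraMap k s.F (Algebra.norm k a ^ j) := by
  induction j with
  | zero => simp
  | succ j ih =>
    rw [Nat.mul_succ, Finset.prod_range_add, ih, pow_succ, map_mul, norm_eq_prod]
    congr 1
    refine Finset.prod_congr rfl fun i _ => ?_
    rw [pow_add, ζ_pow_n, one_mul]

theorem mul_pow_eq {E : Type u} [Ring E] (f : s.F →+* E) (t : E)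
    (ht : ∀ a, t * f a = f (s.ζ a) * t) (a : s.F) (j : ℕ) :
    (f a * t) ^ j = f (∏ i ∈ Finset.range j, (s.ζ ^ i) a) * t ^ j := by
  have ht' : ∀ (j : ℕ) b, t ^ j * f b = f ((s.ζ ^ j) b) * t ^ j := by
    intro j
    induction j with
    | zero => simp
    | succ j ih => intro b; rw [pow_succ, mul_assoc, ht, ← mul_assoc, ih, mul_assoc, pow_succ]; rfl
  induction j with
  | zero => simp
  | succ j ih =>
    rw [pow_succ, ih, Finset.prod_range_succ, map_mul, mul_assoc, ← mul_assoc (t ^ j), ht',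
      mul_assoc, mul_assoc, pow_succ]

/-- Ring homomorphisms from `A_β` that are given in terms of `a⁻¹ θ` instead of `θ`. -/
def liftTwist {E : Type u} [Ring E] (f : s.F →+* E) (t : E) (ht : ∀ a, t * f a = f (s.ζ a) * t)
    (a : s.F) (y : k) (hp : t ^ (s.n * s.r) = f (algebraMap k s.F y))
    (hy : Algebra.norm k a ^ s.r * y = s.β) : s.A →+* E :=
  s.liftA f (f a * t) (fun b => by
    rw [mul_assoc, ht, ← mul_assoc, ← map_mul, mul_comm, map_mul, mul_assoc])
    (by rw [s.mul_pow_eq f t ht, prod_range_mul, hp, ← map_mul, ← map_mul, hy])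

theorem liftTwist_incl {E : Type u} [Ring E] (f : s.F →+* E) (t : E) (ht) (a : s.F) (y : k) (hp)
    (hy) (b : s.F) : s.liftTwist f t ht a y hp hy (s.incl b) = f b :=
  s.liftA_incl _ _ _ _ _

theorem liftTwist_θA {E : Type u} [Ring E] (f : s.F →+* E) (t : E) (ht) (a : s.F) (y : k) (hp)
    (hy) : s.liftTwist f t ht a y hp hy s.θA = f a * t :=
  s.liftA_θA _ _ _ _

/-! ### Conjugate dual modules -/

section ConjDual

variable (Q : Type u) [AddCommGroup Q] [Module s.A Q]

/-- The `σ`-semilinear functionals on an `A_β`-module. -/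
def conjDual : AddSubgroup (Q →+ s.F) where
  carrier := {f | ∀ a v, f (s.incl a • v) = s.σ a * f v}
  zero_mem' a v := by simp
  add_mem' {f g} hf hg a v := by
    rw [AddMonoidHom.add_apply, AddMonoidHom.add_apply, hf, hg, mul_add]
  neg_mem' {f} hf a v := by
    rw [AddMonoidHom.neg_apply, AddMonoidHom.neg_apply, hf, mul_neg]

variable {Q}

/-- The action of `F` on the semilinear functionals. -/
def conjDualF : s.F →+* AddMonoid.End (s.conjDual Q) where
  toFun a := AddMonoidHom.mk' (fun f => ⟨(AddMonoidHom.mulLeft a).comp f.1, fun b v => by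
    change a * f.1 _ = _ * (a * f.1 v)
    rw [f.2, mul_left_comm]⟩) (fun f g => Subtype.ext (AddMonoidHom.ext fun v => mul_add _ _ _))
  map_one' := AddMonoidHom.ext fun f => Subtype.ext (AddMonoidHom.ext fun v => one_mul _)
  map_mul' a b := AddMonoidHom.ext fun f => Subtype.ext (AddMonoidHom.ext fun v => mul_assoc _ _ _)
  map_zero' := AddMonoidHom.ext fun f => Subtype.ext (AddMonoidHom.ext fun v => zero_mul _)
  map_add' a b := AddMonoidHom.ext fun f => Subtype.ext (AddMonoidHom.ext fun v => add_mul _ _ _)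

theorem θU_inv_mul_incl (a : s.F) :
    ((s.θU⁻¹ : s.Aˣ) : s.A) * s.incl a = s.incl (s.ζ.symm a) * ((s.θU⁻¹ : s.Aˣ) : s.A) := by
  have h := s.θU_zpow_mul_incl (-1) a
  rw [zpow_neg_one, zpow_neg_one] at h
  exact h

/-- The action of `θ` on the semilinear functionals, up to the factor `c`. -/
def conjDualθ : AddMonoid.End (s.conjDual Q) :=
  AddMonoidHom.mk' (fun f => ⟨(s.ζ : s.F →+ s.F).comp (f.1.comp
    (DistribSMul.toAddMonoidHom Q ((s.θU⁻¹ : s.Aˣ) : s.A))), fun b v => by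
      change s.ζ (f.1 (((s.θU⁻¹ : s.Aˣ) : s.A) • s.incl b • v)) = _ * s.ζ (f.1 _)
      rw [← mul_smul, θU_inv_mul_incl, mul_smul, f.2, map_mul, ← σ_ζ]
      congr 2
      exact s.ζ.apply_symm_apply b⟩)
    (fun f g => Subtype.ext (AddMonoidHom.ext fun v => map_add s.ζ _ _))

theorem conjDualθ_apply (f : s.conjDual Q) (v : Q) :
    (s.conjDualθ f).1 v = s.ζ (f.1 (((s.θU⁻¹ : s.Aˣ) : s.A) • v)) := rfl

theorem conjDualθ_pow_apply (j : ℕ) (f : s.conjDual Q) (v : Q) :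
    ((s.conjDualθ ^ j) f).1 v = (s.ζ ^ j) (f.1 (((s.θU⁻¹ ^ j : s.Aˣ) : s.A) • v)) := by
  induction j generalizing f v with
  | zero => simp
  | succ j ih =>
    rw [pow_succ]
    change ((s.conjDualθ ^ j) (s.conjDualθ f)).1 v = _
    rw [ih, conjDualθ_apply, ← mul_smul, pow_succ' (s.θU⁻¹), pow_succ s.ζ]
    rfl

/-- The values are moved by `ζ ^ m = 1` and the arguments by `θ ^ (-m) = β⁻¹`; semilinearity turns
the latter into `σ(β)⁻¹`. -/
theorem conjDualθ_pow : (s.conjDualθ : AddMonoid.End (s.conjDual Q)) ^ (s.n * s.r) =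
    s.conjDualF (algebraMap k s.F (σk s.β)⁻¹) := by
  refine AddMonoidHom.ext fun f => Subtype.ext (AddMonoidHom.ext fun v => ?_)
  have h1 : ((s.θU⁻¹ ^ (s.n * s.r) : s.Aˣ) : s.A) = s.incl (algebraMap k s.F s.β⁻¹) := by
    rw [inv_pow]
    refine Units.inv_eq_of_mul_eq_one_right ?_
    rw [Units.val_pow_eq_pow_val, θU_coe, θA_pow, ← map_mul, ← map_mul,
      mul_inv_cancel₀ s.β_ne_zero, map_one, map_one]
  refine (s.conjDualθ_pow_apply _ f v).trans ?_
  rw [ζ_pow_n, h1, f.2, σ_algebraMap, map_inv₀]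
  rfl

variable (Q) in
/-- The action of `A_β` on the semilinear functionals. -/
def conjDualAct : s.A →+* AddMonoid.End (s.conjDual Q) :=
  s.liftTwist (s.conjDualF (Q := Q)) s.conjDualθ (fun _ =>
    AddMonoidHom.ext fun _ => Subtype.ext (AddMonoidHom.ext fun _ => map_mul s.ζ _ _))
    -- The condition on the norm of `c` is exactly what is needed here: multiplying by `c` changes
    -- `σ(β)⁻¹` into `β`.
    s.c (σk s.β)⁻¹ s.conjDualθ_pow (by
      rw [s.norm_c, mul_assoc, mul_inv_cancel₀, mul_one]
      exact fun h => s.β_ne_zero (by simpa using h))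

instance conjDualModule : Module s.A (s.conjDual Q) := Module.compHom _ (s.conjDualAct Q)

theorem incl_smul_conjDual (a : s.F) (f : s.conjDual Q) (v : Q) :
    (s.incl a • f).1 v = a * f.1 v := by
  have h : s.conjDualAct Q (s.incl a) = s.conjDualF a := by
    unfold conjDualAct
    exact s.liftTwist_incl _ _ _ _ _ _ _ _
  change (s.conjDualAct Q (s.incl a) f).1 v = _
  rw [h]
  rfl

theorem θA_smul_conjDual (f : s.conjDual Q) (v : Q) :
    (s.θA • f).1 (s.θA • v) = s.c * s.ζ (f.1 v) := by
  have h : s.conjDualAct Q s.θA = s.conjDualF s.c * s.conjDualθ := by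
    unfold conjDualAct
    exact s.liftTwist_θA _ _ _ _ _ _ _
  change (s.conjDualAct Q s.θA f).1 _ = _
  rw [h]
  change s.c * s.ζ (f.1 (((s.θU⁻¹ : s.Aˣ) : s.A) • s.θA • v)) = _
  rw [← mul_smul, ← θU_coe, Units.inv_mul, one_smul]

theorem θA_smul_surjective {P : Type u} [AddCommGroup P] [Module s.A P] (v : P) :
    ∃ w : P, s.θA • w = v :=
  ⟨((s.θU⁻¹ : s.Aˣ) : s.A) • v, by rw [← mul_smul, ← θU_coe, Units.mul_inv, one_smul]⟩

theorem isAdmissible_eval : s.IsAdmissible (s.conjDual Q).subtype where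
  smul_left := s.incl_smul_conjDual
  smul_right a f v := f.2 a v
  theta := s.θA_smul_conjDual

variable {P : Type u} [AddCommGroup P] [Module s.A P] {s}

/-- The linear map to the conjugate dual defined by an admissible pairing. -/
def IsAdmissible.toDual {B : P →+ Q →+ s.F} (h : s.IsAdmissible B) : P →ₗ[s.A] s.conjDual Q :=
  s.linearOfGenerators (B.codRestrict (s.conjDual Q) fun u a v => h.smul_right a u v)
    (fun a u => Subtype.ext (AddMonoidHom.ext fun v => by
      rw [incl_smul_conjDual]
      exact h.smul_left a u v))
    (fun u => Subtype.ext (AddMonoidHom.ext fun v => by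
      obtain ⟨w, rfl⟩ := s.θA_smul_surjective v
      rw [θA_smul_conjDual]
      exact h.theta u w))

theorem IsAdmissible.toDual_apply {B : P →+ Q →+ s.F} (h : s.IsAdmissible B) (u : P) (v : Q) :
    (h.toDual u).1 v = B u v := rfl

theorem isAdmissible_of_linear (f : P →ₗ[s.A] s.conjDual Q) :
    s.IsAdmissible ((s.conjDual Q).subtype.comp f.toAddMonoidHom) where
  smul_left a u v := by
    change (f (s.incl a • u)).1 v = a * (f u).1 v
    rw [f.map_smul, incl_smul_conjDual]
  smul_right a u v := (f u).2 a v
  theta u v := by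
    change (f (s.θA • u)).1 _ = s.c * s.ζ ((f u).1 v)
    rw [f.map_smul, θA_smul_conjDual]

variable (s) in
/-- The pairing `(v, u) ↦ σ(B(u, v))`. -/
def flipPairing (B : P →+ Q →+ s.F) : Q →+ P →+ s.F :=
  AddMonoidHom.mk' (fun v => (s.σ : s.F →+ s.F).comp (B.flip v)) (fun v v' =>
    AddMonoidHom.ext fun u => by
      change s.σ (B u (v + v')) = s.σ (B u v) + s.σ (B u v')
      rw [map_add, map_add])

theorem flipPairing_apply (B : P →+ Q →+ s.F) (u : P) (v : Q) :
    s.flipPairing B v u = s.σ (B u v) := rfl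

theorem IsAdmissible.flip {B : P →+ Q →+ s.F} (h : s.IsAdmissible B) :
    s.IsAdmissible (s.flipPairing B) where
  smul_left a v u := by
    rw [flipPairing_apply, h.smul_right, map_mul, s.σ_σ, flipPairing_apply]
  smul_right a v u := by rw [flipPairing_apply, h.smul_left, map_mul, flipPairing_apply]
  theta v u := by rw [flipPairing_apply, h.theta, map_mul, s.σ_c, s.σ_ζ, flipPairing_apply]

theorem IsPerfect.flip {B : P →+ Q →+ s.F} (h : s.IsPerfect B) :
    s.IsPerfect (s.flipPairing B) where
  left f hf := by
    obtain ⟨v, hv, huniq⟩ := h.right ((s.σ : s.F →+ s.F).comp f) (fun a u => by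
      change s.σ (f _) = a * s.σ (f u)
      rw [hf, map_mul, s.σ_σ])
    refine ⟨v, fun u => ?_, fun v' hv' => huniq v' fun u => ?_⟩
    · rw [flipPairing_apply, hv]
      exact s.σ_σ _
    · change _ = s.σ (f u)
      rw [← hv', flipPairing_apply, s.σ_σ]
  right f hf := by
    obtain ⟨v, hv, huniq⟩ := h.left ((s.σ : s.F →+ s.F).comp f) (fun a u => by
      change s.σ (f _) = _ * s.σ (f u)
      rw [hf, map_mul])
    refine ⟨v, fun u => ?_, fun v' hv' => huniq v' fun u => ?_⟩
    · rw [flipPairing_apply, hv]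
      exact s.σ_σ _
    · change _ = s.σ (f u)
      rw [← hv', flipPairing_apply, s.σ_σ]

/-- The action of `L_β` with respect to an admissible pairing. -/
theorem IsAdmissible.ofL_smul {B : P →+ Q →+ s.F} (h : s.IsAdmissible B) (l : s.L) (u : P)
    (v : Q) : B (s.ofL l • u) v = B u (s.ofL (s.sigmaC l) • v) := by
  induction l using s.L_induction generalizing u v with
  | h_base x =>
    rw [sigmaC, sigmaTwist_base, ofL_algebraMap, ofL_algebraMap, h.smul_left, h.smul_right,
      σ_algebraMap, s.σk_σk]
  | hb =>
    obtain ⟨w, rfl⟩ : ∃ w : Q, s.ofL s.b • w = v :=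
      ⟨s.ofL s.bInv • v, by rw [← mul_smul, ← map_mul, b_mul_bInv, map_one, one_smul]⟩
    -- Iterating the similitude relation. For `j = n` the product of the conjugates of `c` is its
    -- norm, and `ζ ^ n = 1`.
    have h1 : ∀ j u w, B (s.θA ^ j • u) (s.θA ^ j • w) =
        (∏ i ∈ Finset.range j, (s.ζ ^ i) s.c) * (s.ζ ^ j) (B u w) := by
      intro j
      induction j with
      | zero => simp
      | succ j ih =>
        intro u w
        rw [pow_succ, mul_smul, mul_smul, ih, h.theta, map_mul, ← mul_assoc,
          Finset.prod_range_succ, pow_succ]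
        rfl
    have h2 : s.sigmaC s.b * s.b = algebraMap k s.L s.Nc := by
      rw [sigmaC, sigmaTwist_b, mul_assoc, mul_comm s.bInv, b_mul_bInv, mul_one]
    rw [← mul_smul, ← map_mul, h2, ofL_algebraMap, h.smul_right, ofL_b, h1,
      ← norm_eq_prod, pow_orderOf_eq_one, σ_algebraMap, s.σk_norm _ s.σ_c]
    rfl
  | hadd x y hx hy =>
    rw [map_add, add_smul, map_add, AddMonoidHom.add_apply, hx, hy, map_add, map_add, add_smul,
      map_add]
  | hmul x y hx hy =>
    rw [map_mul, mul_smul, hx, hy, map_mul, mul_comm, map_mul, mul_smul]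

/-- Across the evaluation pairing `l` becomes `σ_c(l)`, so `L_β` acts on the dual through the factor
at the dual vertex. -/
theorem SupportedAt.conjDual {i j : s.Vertex} (h : s.SupportedAt Q j) (hij : s.dag i = j) :
    s.SupportedAt (s.conjDual Q) i := fun l hl f => by
  refine Subtype.ext (AddMonoidHom.ext fun v => ?_)
  refine (s.isAdmissible_eval.ofL_smul l f v).trans ?_
  change f.1 _ = 0
  rw [h, map_zero]
  rw [← hij]
  change s.sigmaC (s.sigmaC l) ∈ i.asIdeal
  rwa [← RingHom.comp_apply, sigmaC_comp_sigmaC]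

variable (s Q) in
-- `F` is semisimple, so all its modules are projective and their linear functionals separate
-- points.
theorem conjDual_nontrivial [Nontrivial Q] : Nontrivial (s.conjDual Q) := by
  let _ : Module s.F Q := Module.compHom Q s.incl
  have : IsArtinianRing s.F := IsArtinianRing.of_finite k s.F
  have : IsSemisimpleRing s.F := IsArtinianRing.isSemisimpleRing_of_isReduced _
  have : Module.Projective s.F Q := Module.projective_of_isSemisimpleRing _ _
  obtain ⟨v, hv⟩ := exists_ne (0 : Q)
  have h1 := mt (Module.forall_dual_apply_eq_zero_iff s.F v).1 hv
  push Not at h1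
  obtain ⟨f, hf⟩ := h1
  let g : s.conjDual Q := ⟨(s.σ : s.F →+ s.F).comp f.toAddMonoidHom, fun a w => by
    change s.σ (f (a • w)) = s.σ a * s.σ (f w)
    rw [map_smul, smul_eq_mul, map_mul]⟩
  refine ⟨g, 0, fun h => hf ?_⟩
  have h2 : s.σ (f v) = 0 := DFunLike.congr_fun (congrArg Subtype.val h) v
  simpa using h2

/-- The structure of a vector space over `k^σ` on an `A_β`-module. -/
@[reducible] def k₀Module (s : Datum k σk) (P : Type u) [AddCommGroup P] [Module s.A P] :
    Module s.k₀ P :=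
  Module.compHom P (algebraMap s.k₀ s.A)

variable (s) in
theorem k₀Module_isScalarTower (P : Type u) [AddCommGroup P] [Module s.A P] :
    let _ := s.k₀Module P
    IsScalarTower s.k₀ s.A P :=
  let _ := s.k₀Module P
  .of_algebraMap_smul fun _ _ => rfl

/-- The conjugate dual of `Q` embeds into the `k^σ`-linear dual of `Q`, so its dimension is at most
that of `Q`. -/
theorem finrank_le_of_isAdmissible [Module.Finite s.A P] [Module.Finite s.A Q]
    {B : P →+ Q →+ s.F} (h : s.IsAdmissible B)
    (hB : Function.Injective h.toDual) :
    let _ := s.k₀Module P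
    let _ := s.k₀Module Q
    Module.finrank s.k₀ P ≤ Module.finrank s.k₀ Q ∧
      (Module.finrank s.k₀ P = Module.finrank s.k₀ Q → Function.Surjective h.toDual) := by
  intro _ _
  let _ := s.k₀Module (s.conjDual Q)
  have := s.k₀Module_isScalarTower P
  have := s.k₀Module_isScalarTower Q
  have := s.k₀Module_isScalarTower (s.conjDual Q)
  have : Module.Finite s.k₀ P := Module.Finite.trans s.A P
  have : Module.Finite s.k₀ Q := Module.Finite.trans s.A Q
  have hsm : ∀ (a : s.k₀) (v : Q), a • v = s.incl (algebraMap k s.F a) • v := fun a v => by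
    rw [← algebraMap_A]; rfl
  -- Composition with a functional on `F` whose kernel contains no nonzero ideal; this property
  -- makes it injective.
  let T : s.conjDual Q →ₗ[s.k₀] Module.Dual s.k₀ Q :=
    { toFun := fun f =>
        { toFun := fun v => s.functional (f.1 v)
          map_add' := fun v w => by rw [map_add, map_add]
          map_smul' := fun a v => by
            rw [hsm, f.2, σ_algebraMap_k₀, RingHom.id_apply, ← map_smul]
            congr 1
            exact (Algebra.smul_def (a : k) _).symm }
      map_add' := fun f g => LinearMap.ext fun v => map_add s.functional _ _
      map_smul' := fun a f => LinearMap.ext fun v => by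
        change s.functional ((algebraMap s.k₀ s.A a • f).1 v) = a • s.functional (f.1 v)
        rw [algebraMap_A, incl_smul_conjDual, ← map_smul]
        congr 1
        exact (Algebra.smul_def (a : k) _).symm }
  have hT : Function.Injective T := by
    rw [injective_iff_map_eq_zero]
    intro f hf
    refine Subtype.ext (AddMonoidHom.ext fun v => ?_)
    refine s.eq_zero_of_functional _ fun x => ?_
    have h1 := LinearMap.congr_fun hf (s.incl (s.σ x) • v)
    change s.functional (f.1 _) = 0 at h1
    rwa [f.2, s.σ_σ] at h1
  have hfin : Module.Finite s.k₀ (s.conjDual Q) := Module.Finite.of_injective T hT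
  have hdim : Module.finrank s.k₀ (s.conjDual Q) ≤ Module.finrank s.k₀ Q := by
    have h1 := LinearMap.finrank_le_finrank_of_injective (f := T) hT
    rwa [Subspace.dual_finrank_eq] at h1
  have hle : Module.finrank s.k₀ P ≤ Module.finrank s.k₀ (s.conjDual Q) :=
    LinearMap.finrank_le_finrank_of_injective (f := h.toDual.restrictScalars s.k₀) hB
  refine ⟨hle.trans hdim, fun heq => ?_⟩
  exact (LinearMap.injective_iff_surjective_of_finrank_eq_finrank
    (f := h.toDual.restrictScalars s.k₀) (le_antisymm hle (hdim.trans heq.ge))).1 hB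

/-- Nonzero admissible pairings between simple modules are perfect. -/
theorem IsAdmissible.isPerfect [IsSimpleModule s.A P] [IsSimpleModule s.A Q]
    {B : P →+ Q →+ s.F} (h : s.IsAdmissible B) (hB : B ≠ 0) : s.IsPerfect B := by
  have h1 : h.toDual ≠ 0 := fun h0 => hB (AddMonoidHom.ext fun u => AddMonoidHom.ext fun v => by
    rw [← h.toDual_apply, h0]; rfl)
  have h2 : h.flip.toDual ≠ 0 := fun h0 => hB (AddMonoidHom.ext fun u =>
    AddMonoidHom.ext fun v => by
      have h3 : s.σ (B u v) = 0 := by rw [← flipPairing_apply, ← h.flip.toDual_apply, h0]; rfl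
      simpa using h3)
  have h3 := LinearMap.injective_of_ne_zero h1
  have h4 := LinearMap.injective_of_ne_zero h2
  -- By Schur's lemma both maps to the conjugate duals are injective. The two inequalities of
  -- dimensions give equality, hence surjectivity on both sides.
  obtain ⟨h5, h6⟩ := finrank_le_of_isAdmissible h h3
  obtain ⟨h7, h8⟩ := finrank_le_of_isAdmissible h.flip h4
  constructor
  · intro f hf
    obtain ⟨u, hu⟩ := h6 (le_antisymm h5 h7) ⟨f, hf⟩
    refine ⟨u, fun v => ?_, fun u' hu' => h3 (Subtype.ext (AddMonoidHom.ext fun v => ?_))⟩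
    · rw [← h.toDual_apply, hu]
    · rw [hu, h.toDual_apply, hu']
  · intro f hf
    obtain ⟨u, hu⟩ := h8 (le_antisymm h7 h5) ⟨(s.σ : s.F →+ s.F).comp f, fun a v => by
      change s.σ (f _) = _ * s.σ (f v)
      rw [hf, map_mul]⟩
    refine ⟨u, fun v => ?_, fun u' hu' => h4 (Subtype.ext (AddMonoidHom.ext fun v => ?_))⟩
    · have h9 : s.σ (B v u) = s.σ (f v) := by
        rw [← flipPairing_apply, ← h.flip.toDual_apply, hu]; rfl
      exact s.σ.injective h9
    · rw [hu, h.flip.toDual_apply, flipPairing_apply, hu']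
      rfl

/-- The conjugate dual of `Q` is nonzero and supported at the same vertex as `P`, so it receives a
nonzero map from `P`. -/
theorem exists_isAdmissible [IsSimpleModule s.A P] [IsSimpleModule s.A Q] {i j : s.Vertex}
    (hP : s.SupportedAt P i) (hQ : s.SupportedAt Q j) (hij : s.dag i = j) :
    ∃ B : P →+ Q →+ s.F, s.IsAdmissible B ∧ B ≠ 0 := by
  have := IsSimpleModule.nontrivial s.A Q
  have := s.conjDual_nontrivial Q
  obtain ⟨f, hf⟩ := s.exists_hom_ne_zero hP (hQ.conjDual hij)
  refine ⟨_, isAdmissible_of_linear f, fun h0 => hf (LinearMap.ext fun u => ?_)⟩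
  exact Subtype.ext (AddMonoidHom.ext fun v => DFunLike.congr_fun (DFunLike.congr_fun h0 u) v)

/-- The first half of the choices: pairings and signs. -/
theorem exists_isAdmissible_symm [IsSimpleModule s.A P] {i : s.Vertex}
    (hP : s.SupportedAt P i) (hi : s.dag i = i) :
    ∃ (B : P →+ P →+ s.F) (ε : ℤˣ), s.IsAdmissible B ∧ s.IsPerfect B ∧
      (∀ u v, B v u = ε • s.σ (B u v)) ∧ (ε = -1 →
        ¬ ∃ B : P →+ P →+ s.F, s.IsAdmissible B ∧ s.IsPerfect B ∧ s.IsHermitian B) := by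
  by_cases h : ∃ B : P →+ P →+ s.F, s.IsAdmissible B ∧ s.IsPerfect B ∧ s.IsHermitian B
  · obtain ⟨B, h1, h2, h3⟩ := h
    exact ⟨B, 1, h1, h2, fun u v => by rw [one_smul, h3 u v], fun h => by simp at h⟩
  · obtain ⟨B, h1, h2⟩ := exists_isAdmissible hP hP hi
    refine ⟨B, -1, h1, h1.isPerfect h2, fun u v => ?_, fun _ => h⟩
    by_contra hne
    -- The symmetrization is Hermitian. If it were nonzero it would be perfect, which is excluded;
    -- so it is zero and `B` has sign `-1`.
    have h3 : s.IsAdmissible (B + s.flipPairing B) :=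
      { smul_left := fun a u v => by
          simp only [AddMonoidHom.add_apply, h1.smul_left, h1.flip.smul_left, mul_add]
        smul_right := fun a u v => by
          simp only [AddMonoidHom.add_apply, h1.smul_right, h1.flip.smul_right, mul_add]
        theta := fun u v => by
          simp only [AddMonoidHom.add_apply, h1.theta, h1.flip.theta, map_add, mul_add] }
    have h4 : B + s.flipPairing B ≠ 0 := fun h0 => hne (by
      have h5 : B v u + s.σ (B u v) = 0 := DFunLike.congr_fun (DFunLike.congr_fun h0 v) u
      rw [Units.neg_smul, one_smul]
      exact eq_neg_of_add_eq_zero_left h5)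
    refine h ⟨_, h3, h3.isPerfect h4, fun u v => ?_⟩
    change B v u + s.σ (B u v) = s.σ (B u v + s.σ (B v u))
    rw [map_add, s.σ_σ, add_comm]

end ConjDual

end Datum
end
end CyclicGrading

namespace CyclicGrading
noncomputable section
namespace Datum
variable {k : Type u} [Field k] {σk : k ≃+* k} (s : Datum k σk)

/-! ### Existence of the choices -/

/-- The automorphism of `A_β` that is the identity on `F` and sends `θ` to `ξ θ`. -/
def twist : s.A →+* s.A :=
  s.liftTwist s.incl s.θA s.θA_mul_incl s.ξ s.β s.θA_pow (by
    rw [s.norm_ξ, one_mul])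

theorem twist_incl (a : s.F) : s.twist (s.incl a) = s.incl a := s.liftTwist_incl _ _ _ _ _ _ _ _

theorem twist_θA : s.twist s.θA = s.incl s.ξ * s.θA := s.liftTwist_θA _ _ _ _ _ _ _

/-- `(ξ θ) ^ n` is the norm of `ξ` times `θ ^ n`. -/
theorem twist_ofL (l : s.L) : s.twist (s.ofL l) = s.ofL (s.mu l) := by
  induction l using s.L_induction with
  | h_base x => rw [mu_base, ofL_algebraMap, twist_incl]
  | hb =>
    rw [mu_b, map_mul, ofL_algebraMap, ofL_b, map_pow, twist_θA,
      s.mul_pow_eq s.incl s.θA s.θA_mul_incl, norm_eq_prod]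
  | hadd x y hx hy => simp only [map_add, hx, hy]
  | hmul x y hx hy => simp only [map_mul, hx, hy]

theorem twist_surjective : Function.Surjective s.twist := by
  intro z
  change z ∈ s.twist.range
  induction z using s.A_induction with
  | h_incl a => exact ⟨s.incl a, s.twist_incl a⟩
  | hθ =>
    refine ⟨s.incl ((s.ξ⁻¹ : s.Fˣ) : s.F) * s.θA, ?_⟩
    rw [map_mul, twist_incl, twist_θA, ← mul_assoc, ← map_mul, Units.inv_mul, map_one, one_mul]
  | hadd x y hx hy => exact add_mem hx hy
  | hmul x y hx hy => exact mul_mem hx hy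

/-- The `F`-module `P` on which `θ` acts as `ξ θ`. -/
def Twisted (_s : Datum k σk) (P : Type u) : Type u := P

section Twisted

variable (P : Type u) [AddCommGroup P] [Module s.A P]

instance : AddCommGroup (s.Twisted P) := inferInstanceAs (AddCommGroup P)

instance : Module s.A (s.Twisted P) := Module.compHom P s.twist

variable {P} in
/-- The identity map. -/
def toTwisted : P ≃+ s.Twisted P := AddEquiv.refl P

variable {P} in
theorem smul_toTwisted (z : s.A) (u : P) :
    z • s.toTwisted u = s.toTwisted (s.twist z • u) := rfl

instance [IsSimpleModule s.A P] : IsSimpleModule s.A (s.Twisted P) := by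
  have : RingHomSurjective s.twist := ⟨s.twist_surjective⟩
  let f : s.Twisted P →ₛₗ[s.twist] P :=
    { toFun := s.toTwisted.symm
      map_add' := fun _ _ => rfl
      map_smul' := fun _ _ => rfl }
  exact (LinearMap.isSimpleModule_iff_of_bijective f s.toTwisted.symm.bijective).2 inferInstance

variable {P s} {Q : Type u} [AddCommGroup Q] [Module s.A Q]

theorem SupportedAt.twisted {i j : s.Vertex} (h : s.SupportedAt P i) (hij : s.next i = j) :
    s.SupportedAt (s.Twisted P) j := fun l hl u => by
  obtain ⟨u, rfl⟩ := s.toTwisted.surjective u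
  rw [smul_toTwisted, twist_ofL, h, map_zero]
  rw [← hij] at hl
  exact hl

theorem isTwistedIso_of_linear [IsSimpleModule s.A P] [IsSimpleModule s.A Q]
    {f : s.Twisted P →ₗ[s.A] Q} (hf : f ≠ 0) :
    s.IsTwistedIso (f.toAddMonoidHom.comp (s.toTwisted (P := P)).toAddMonoidHom) where
  bijective := (LinearMap.bijective_of_ne_zero hf).comp s.toTwisted.bijective
  map_smul a u := by
    refine Eq.trans ?_ (f.map_smul (s.incl a) (s.toTwisted u))
    rw [smul_toTwisted, twist_incl]
    rfl
  map_theta u := by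
    refine Eq.trans ?_ (f.map_smul s.θA (s.toTwisted u))
    rw [smul_toTwisted, twist_θA, mul_smul]
    rfl

theorem isTwistedIso_of_ne_zero [IsSimpleModule s.A P] [IsSimpleModule s.A Q] {f : P →+ Q}
    (h1 : ∀ (a : s.F) u, f (s.incl a • u) = s.incl a • f u)
    (h2 : ∀ u, f (s.incl s.ξ • s.θA • u) = s.θA • f u) (hf : f ≠ 0) : s.IsTwistedIso f := by
  let g : s.Twisted P →ₗ[s.A] Q := s.linearOfGenerators (P := s.Twisted P)
    (f.comp s.toTwisted.symm.toAddMonoidHom)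
    (fun a u => by
      obtain ⟨u, rfl⟩ := s.toTwisted.surjective u
      rw [smul_toTwisted, twist_incl]
      exact h1 a u)
    (fun u => by
      obtain ⟨u, rfl⟩ := s.toTwisted.surjective u
      rw [smul_toTwisted, twist_θA, mul_smul]
      exact h2 u)
  exact isTwistedIso_of_linear (f := g) fun h0 =>
    hf (AddMonoidHom.ext fun u => LinearMap.congr_fun h0 (s.toTwisted u))

theorem exists_isTwistedIso [IsSimpleModule s.A P] [IsSimpleModule s.A Q] {i j : s.Vertex}
    (hP : s.SupportedAt P i) (hQ : s.SupportedAt Q j) (hij : s.next i = j) :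
    ∃ f : P →+ Q, s.IsTwistedIso f := by
  have := IsSimpleModule.nontrivial s.A Q
  obtain ⟨f, hf⟩ := s.exists_hom_ne_zero (hP.twisted hij) hQ
  exact ⟨_, isTwistedIso_of_linear hf⟩

variable {P' Q' : Type u} [AddCommGroup P'] [Module s.A P'] [AddCommGroup Q'] [Module s.A Q']

/-- The adjoint of a twisted isomorphism with respect to perfect admissible pairings. -/
theorem IsTwistedIso.exists_adjoint {B : P →+ P' →+ s.F} (hB : s.IsAdmissible B)
    (hB' : s.IsPerfect B) {B₁ : Q' →+ Q →+ s.F} (hB₁ : s.IsAdmissible B₁)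
    (hB₁' : s.IsPerfect B₁) {η : P →+ Q} (hη : s.IsTwistedIso η) :
    ∃ η' : Q' →+ P', s.IsTwistedIso η' ∧ ∀ u v, s.σ (B₁ v (η u)) = B u (η' v) := by
  -- The functional `u ↦ σ(B₁(v, η u))` is `F`-linear because `B₁` is semilinear in its second
  -- variable, so perfectness of `B` represents it.
  have h1 : ∀ v, ∃ w, ∀ u, B u w = s.σ (B₁ v (η u)) := fun v => by
    obtain ⟨w, hw, -⟩ := hB'.right ((s.σ : s.F →+ s.F).comp ((B₁ v).comp η)) (fun a u => by
      change s.σ (B₁ v (η _)) = a * s.σ (B₁ v (η u))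
      rw [hη.map_smul, hB₁.smul_right, map_mul, s.σ_σ])
    exact ⟨w, hw⟩
  choose w hw using h1
  have hext : ∀ w₁ w₂, (∀ u, B u w₁ = B u w₂) → w₁ = w₂ := fun w₁ w₂ h =>
    (hB'.right (B.flip w₂) (fun a u => hB.smul_left a u w₂)).unique h (fun _ => rfl)
  have hext₁ : ∀ v₁ v₂, (∀ u, B₁ v₁ u = B₁ v₂ u) → v₁ = v₂ := fun v₁ v₂ h =>
    (hB₁'.left (B₁ v₂) (fun a u => hB₁.smul_right a v₂ u)).unique h (fun _ => rfl)
  have hθ : ∀ u, η (s.θA • u) = s.incl ((s.ξ⁻¹ : s.Fˣ) : s.F) • s.θA • η u := fun u => by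
    rw [← hη.map_theta, ← hη.map_smul, ← mul_smul (s.incl _) (s.incl _), ← map_mul,
      Units.inv_mul, map_one, one_smul]
  have hξ : s.σ ((s.ξ⁻¹ : s.Fˣ) : s.F) = ((s.ξ⁻¹ : s.Fˣ) : s.F) := by
    have h2 : s.σ ((s.ξ⁻¹ : s.Fˣ) : s.F) * s.ξ = 1 := by
      conv_lhs => rw [← s.σ_ξ]
      rw [← map_mul, Units.inv_mul, map_one]
    exact (Units.inv_eq_of_mul_eq_one_left h2).symm
  refine ⟨AddMonoidHom.mk' w (fun v v' => hext _ _ fun u => by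
    rw [map_add, hw, hw, hw, map_add, AddMonoidHom.add_apply, map_add]), ?_, fun u v => (hw v u).symm⟩
  constructor
  · constructor
    · intro v v' hv
      refine hext₁ _ _ fun y => ?_
      obtain ⟨u, rfl⟩ := hη.bijective.2 y
      apply s.σ.injective
      rw [← hw, ← hw]
      exact congrArg (B u) hv
    · intro y
      let e : P ≃+ Q := AddEquiv.ofBijective η hη.bijective
      obtain ⟨v, hv, -⟩ := hB₁'.left ((s.σ : s.F →+ s.F).comp ((B.flip y).comp
        e.symm.toAddMonoidHom)) (fun a z => by
          obtain ⟨u, rfl⟩ := e.surjective z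
          have h1 : s.incl a • e u = e (s.incl a • u) := (hη.map_smul a u).symm
          change s.σ (B (e.symm _) y) = _ * s.σ (B (e.symm _) y)
          rw [h1, e.symm_apply_apply, e.symm_apply_apply, hB.smul_left, map_mul])
      refine ⟨v, hext _ _ fun u => ?_⟩
      change B u (w v) = _
      rw [hw, hv]
      change s.σ (s.σ (B (e.symm (e u)) y)) = _
      rw [s.σ_σ, e.symm_apply_apply]
  · intro a v
    refine hext _ _ fun u => ?_
    change B u (w _) = B u (_ • w v)
    rw [hB.smul_right, hw, hw, hB₁.smul_left, map_mul]
  · intro v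
    refine hext _ _ fun u => ?_
    obtain ⟨u, rfl⟩ := s.θA_smul_surjective u
    change B _ (w _) = B _ (_ • w v)
    -- The factor `ξ` in the first variable cancels against `ξ⁻¹` in the second because `σ` fixes
    -- `ξ`.
    rw [hB.theta, hw, hw, hθ, hB₁.smul_left, hB₁.smul_right, hB₁.theta, hξ, ← mul_assoc,
      Units.mul_inv, one_mul, map_mul, s.σ_c, s.σ_ζ]

/-- The sum of an isomorphism and its adjoint is self-adjoint. If it is nonzero it is an isomorphism
by Schur's lemma; if no self-adjoint isomorphism exists, the adjoint must be the negative. -/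
theorem exists_selfadjoint_isTwistedIso [IsSimpleModule s.A P] [IsSimpleModule s.A Q]
    {B : P →+ Q →+ s.F} (hB : s.IsAdmissible B) (hB' : s.IsPerfect B) {i j : s.Vertex}
    (hP : s.SupportedAt P i) (hQ : s.SupportedAt Q j) (hij : s.next i = j) :
    ∃ (η : P →+ Q) (ε : ℤˣ), s.IsTwistedIso η ∧
      (∀ u v, s.σ (B v (η u)) = ε • B u (η v)) ∧
      (ε = -1 → ¬ ∃ f : P →+ Q, s.IsTwistedIso f ∧ ∀ u v, B u (f v) = s.σ (B v (f u))) := by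
  by_cases h : ∃ f : P →+ Q, s.IsTwistedIso f ∧ ∀ u v, B u (f v) = s.σ (B v (f u))
  · obtain ⟨f, h1, h2⟩ := h
    exact ⟨f, 1, h1, fun u v => by rw [one_smul, h2 u v], fun h => by simp at h⟩
  · obtain ⟨η, hη⟩ := exists_isTwistedIso hP hQ hij
    obtain ⟨η', h1, h2⟩ := hη.exists_adjoint hB hB' hB hB'
    refine ⟨η, -1, hη, fun u v => ?_, fun _ => h⟩
    by_contra hne
    have h3 : s.IsTwistedIso (η + η') := isTwistedIso_of_ne_zero
      (fun a u => by
        simp only [AddMonoidHom.add_apply, hη.map_smul, h1.map_smul, smul_add])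
      (fun u => by
        simp only [AddMonoidHom.add_apply, hη.map_theta, h1.map_theta, smul_add])
      (fun h0 => hne (by
        have h4 : η v + η' v = 0 := DFunLike.congr_fun h0 v
        rw [h2, eq_neg_of_add_eq_zero_right h4, map_neg, Units.neg_smul, one_smul]))
    refine h ⟨_, h3, fun u v => ?_⟩
    change B u (η v + η' v) = s.σ (B v (η u + η' u))
    rw [map_add, map_add, map_add, ← h2, ← h2, s.σ_σ, add_comm]

end Twisted

/-- At a self-dual vertex the sign is dictated by symmetrization. For a pair of distinct dual
vertices one pairing is chosen freely and the other is its flip, with sign 1. -/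
theorem exists_pairings (S : s.Vertex → Type u) [∀ i, AddCommGroup (S i)]
    [∀ i, Module s.A (S i)] [∀ i, IsSimpleModule s.A (S i)] (hS : ∀ i, s.SupportedAt (S i) i) :
    ∃ (pairing : ∀ i j, s.dag i = j → S i →+ S j →+ s.F) (εv : s.Vertex → ℤˣ),
      (∀ i j h, s.IsAdmissible (pairing i j h)) ∧ (∀ i j h, s.IsPerfect (pairing i j h)) ∧
      (∀ i j (h : s.dag i = j) (h' : s.dag j = i) (u : S i) (v : S j),
        pairing j i h' v u = εv i • s.σ (pairing i j h u v)) ∧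
      ∀ i, εv i = -1 → s.dag i = i ∧
        ¬ ∃ B : S i →+ S i →+ s.F, s.IsAdmissible B ∧ s.IsPerfect B ∧ s.IsHermitian B := by
  have h0 : ∀ i j (_ : s.dag i = j), ∃ (B : S i →+ S j →+ s.F) (ε : ℤˣ),
      s.IsAdmissible B ∧ s.IsPerfect B ∧
      (∀ (e : i = j) (u v : S i), B v (e ▸ u) = ε • s.σ (B u (e ▸ v))) ∧
      (i ≠ j → ε = 1) ∧
      (ε = -1 → i = j ∧ ¬ ∃ B : S i →+ S i →+ s.F,
        s.IsAdmissible B ∧ s.IsPerfect B ∧ s.IsHermitian B) := by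
    intro i j h
    by_cases hij : i = j
    · subst hij
      obtain ⟨B, ε, h1, h2, h3, h4⟩ := exists_isAdmissible_symm (hS i) h
      exact ⟨B, ε, h1, h2, fun _ => h3, fun h => absurd rfl h, fun h => ⟨rfl, h4 h⟩⟩
    · obtain ⟨B, h1, h2⟩ := exists_isAdmissible (hS i) (hS j) h
      exact ⟨B, 1, h1, h1.isPerfect h2, fun e => absurd e hij, fun _ => rfl, fun h => by simp at h⟩
  choose B ε hadm hperf hself hne hneg using h0
  -- An enumeration of the vertices, to decide which member of a dual pair carries the chosen
  -- pairing.
  let rk : s.Vertex → ℕ := fun i => Fintype.equivFin s.Vertex i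
  have hrk : ∀ i j, rk i = rk j → i = j := fun i j h =>
    (Fintype.equivFin s.Vertex).injective (Fin.ext h)
  have hdag : ∀ {i j}, s.dag i = j → s.dag j = i := fun {i j} h => by rw [← h, dag_dag]
  have hε : ∀ i j (h : s.dag i = j), ε i (s.dag i) rfl = ε i j h := by rintro i _ rfl; rfl
  refine ⟨fun i j h => if rk i ≤ rk j then B i j h else s.flipPairing (B j i (hdag h)),
    fun i => ε i (s.dag i) rfl, fun i j h => ?_, fun i j h => ?_, fun i j h h' u v => ?_,
    fun i h => ⟨(hneg i _ _ h).1.symm, (hneg i _ _ h).2⟩⟩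
  · beta_reduce
    split_ifs
    · exact hadm _ _ _
    · exact (hadm _ _ _).flip
  · beta_reduce
    split_ifs
    · exact hperf _ _ _
    · exact (hperf _ _ _).flip
  · dsimp only
    rw [hε i j h]
    by_cases hij : i = j
    · subst hij
      rw [if_pos le_rfl]
      exact hself i i h rfl u v
    · rw [hne i j h hij, one_smul]
      rcases lt_trichotomy (rk i) (rk j) with h1 | h1 | h1
      · rw [if_neg (not_le.2 h1), if_pos h1.le, flipPairing_apply]
      · exact absurd (hrk i j h1) hij
      · rw [if_neg (not_le.2 h1), if_pos h1.le, flipPairing_apply, s.σ_σ]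

theorem nonempty_choices : Nonempty s.Choices := by
  choose S hgrp hmod hsimple hS using s.exists_simple
  obtain ⟨pairing, εv, hadm, hperf, hsymm, hεv⟩ := s.exists_pairings S hS
  have h0 : ∀ i j (_ : s.next i = j), ∃ (f : S i →+ S j) (ε : ℤˣ), s.IsTwistedIso f ∧
      (∀ hd : s.dag i = j, ∀ u v,
        s.σ (pairing i j hd v (f u)) = ε • pairing i j hd u (f v)) ∧
      (s.dag i ≠ j → ε = 1) ∧
      (ε = -1 → s.dag i = j ∧ ∀ hd : s.dag i = j, ¬ ∃ f : S i →+ S j, s.IsTwistedIso f ∧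
        ∀ u v, pairing i j hd u (f v) = s.σ (pairing i j hd v (f u))) := by
    intro i j h
    by_cases hij : s.dag i = j
    · obtain ⟨f, ε, h1, h2, h3⟩ := exists_selfadjoint_isTwistedIso (hadm i j hij)
        (hperf i j hij) (hS i) (hS j) h
      exact ⟨f, ε, h1, fun _ => h2, fun h => absurd hij h, fun h => ⟨hij, fun _ => h3 h⟩⟩
    · obtain ⟨f, h1⟩ := exists_isTwistedIso (hS i) (hS j) h
      exact ⟨f, 1, h1, fun e => absurd e hij, fun _ => rfl, fun h => by simp at h⟩
  choose η ε hη hself hne hneg using h0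
  have hadj : ∀ i j i' j' (hj : s.next i = j) (hi' : s.dag i = i') (hj' : s.dag j' = j),
      ∃ η' : S j' →+ S i', s.IsTwistedIso η' ∧
        ∀ u v, s.σ (pairing j' j hj' v (η i j hj u)) = pairing i i' hi' u (η' v) :=
    fun i j i' j' hj hi' hj' => (hη i j hj).exists_adjoint (hadm _ _ _) (hperf _ _ _) (hadm _ _ _)
      (hperf _ _ _)
  choose adj hadj1 hadj2 using hadj
  let rk : s.Vertex → ℕ := fun i => Fintype.equivFin s.Vertex i
  have hrk : ∀ i j, rk i = rk j → i = j := fun i j h =>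
    (Fintype.equivFin s.Vertex).injective (Fin.ext h)
  have hdag : ∀ {i j}, s.dag i = j → s.dag j = i := fun {i j} h => by rw [← h, dag_dag]
  have hnext : ∀ {i j}, s.next i = j → s.next (s.dag j) = s.dag i := fun {i j} h => by
    rw [← h, next_dag_next]
  have hε : ∀ i j (h : s.next i = j), ε i (s.next i) rfl = ε i j h := by rintro i _ rfl; rfl
  -- The dual of the arrow `i → j` starts at `j†`. The arrow with the smaller source keeps its
  -- chosen map and its dual gets the adjoint; for a self-dual arrow the sources coincide and the
  -- map chosen with its sign is kept.
  let η₁ : ∀ i j, s.next i = j → S i →+ S j := fun i j h =>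
    if rk i ≤ rk (s.dag j) then η i j h else
      adj (s.dag j) (s.dag i) j i (hnext h) (s.dag_dag j) rfl
  have hη₁ : ∀ i j i' j' (hj : s.next i = j) (hi' : s.dag i = i') (hj' : s.dag j' = j)
      (he' : s.next j' = i'), rk i < rk j' → η₁ j' i' he' = adj i j i' j' hj hi' hj' := by
    intro i j i' j' hj hi' hj' he' hlt
    obtain rfl : s.dag i' = i := hdag hi'
    subst hj'
    exact if_neg (not_le.2 hlt)
  have hη₂ : ∀ i j j' (hj : s.next i = j) (_ : s.dag j' = j), rk i ≤ rk j' →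
      η₁ i j hj = η i j hj := by
    intro i j j' hj hj' hle
    obtain rfl : s.dag j = j' := hdag hj'
    exact if_pos hle
  refine ⟨{ S := S, support := hS, pairing := pairing, admissible := hadm, perfect := hperf
            εv := εv, pairing_symm := hsymm, εv_eq_neg_one := hεv, η := η₁
            εe := fun i => ε i (s.next i) rfl, η_iso := ?_, η_adjoint := ?_
            εe_eq_neg_one := ?_ }⟩
  · intro i j h
    dsimp only [η₁]
    split_ifs
    · exact hη _ _ _
    · exact hadj1 _ _ _ _ _ _ _
  · intro i j i' j' hj hi' hj' he' u v
    rw [hε i j hj]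
    rcases lt_trichotomy (rk i) (rk j') with h1 | h1 | h1
    · rw [hη₁ i j i' j' hj hi' hj' he' h1, hη₂ i j j' hj hj' h1.le, hadj2 i j i' j' hj hi' hj',
        hne i j hj, one_smul]
      intro h2
      have h3 : i = j' := by rw [← hdag h2, hdag hj']
      rw [h3] at h1
      exact lt_irrefl _ h1
    · obtain rfl := hrk _ _ h1
      obtain rfl : j = i' := hj.symm.trans he'
      rw [hη₂ i j i hj hj' le_rfl]
      exact hself i j hj hj' u v
    · rw [hη₁ j' i' j i he' hj' hi' hj h1, hη₂ j' i' i he' hi' h1.le, hne i j hj, one_smul,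
        ← hadj2 j' i' j i he' hj' hi', s.σ_σ]
      intro h2
      have h3 : i = j' := by rw [← hdag h2, hdag hj']
      rw [h3] at h1
      exact lt_irrefl _ h1
  · intro i h
    have h1 := (hneg i _ rfl h).1
    refine ⟨h1.symm, ?_⟩
    rw [hε i (s.dag i) h1.symm] at h
    exact (hneg i _ _ h).2 rfl

end Datum
end
end CyclicGrading

namespace CyclicGrading
noncomputable section

/-! ### Base change from a field -/

section BaseChange

variable {k₀ : Type u} [Field k₀] {R : Type u} [CommRing R] [Algebra k₀ R]

/-- An element of `R ⊗ W` that satisfies the base changes of a family of linear equations comes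
from the solution space. -/
theorem exists_baseChange_subtype_eq {W : Type u} [AddCommGroup W] [Module k₀ W]
    (W' : Submodule k₀ W) {ι : Type*} {Y : ι → Type*} [∀ l, AddCommGroup (Y l)]
    [∀ l, Module k₀ (Y l)] (T : ∀ l, W →ₗ[k₀] Y l) (hT : ∀ w, (∀ l, T l w = 0) → w ∈ W')
    (z : R ⊗[k₀] W) (hz : ∀ l, (T l).lTensor R z = 0) :
    ∃ z' : R ⊗[k₀] W', W'.subtype.baseChange R z' = z := by
  classical
  let B := Module.Basis.ofVectorSpace k₀ R
  -- The equations are defined over `k₀`, so each coordinate in a basis of `R` satisfies them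
  -- separately.
  have h1 : ∀ i, TensorProduct.equivFinsuppOfBasisLeft B z i ∈ W' := by
    intro i
    refine hT _ fun l => ?_
    have h2 : ∀ z : R ⊗[k₀] W, T l (TensorProduct.equivFinsuppOfBasisLeft B z i) =
        TensorProduct.equivFinsuppOfBasisLeft B ((T l).lTensor R z) i := by
      intro z
      induction z with
      | zero => simp
      | add x y hx hy => simp only [map_add, Finsupp.add_apply, hx, hy]
      | tmul r w => simp
    rw [h2, hz, map_zero, Finsupp.zero_apply]
  refine ⟨(TensorProduct.equivFinsuppOfBasisLeft B z).sum fun i _ => B i ⊗ₜ ⟨_, h1 i⟩, ?_⟩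
  rw [Finsupp.sum, map_sum]
  conv_rhs => rw [← (TensorProduct.equivFinsuppOfBasisLeft B).symm_apply_apply z,
    TensorProduct.equivFinsuppOfBasisLeft_symm_apply]
  rfl

/-- The case of a zero solution space: nondegeneracy, expressed by any family of linear maps,
persists after base change. -/
theorem eq_zero_of_lTensor {W : Type u} [AddCommGroup W] [Module k₀ W]
    {ι : Type*} {Y : ι → Type*} [∀ l, AddCommGroup (Y l)]
    [∀ l, Module k₀ (Y l)] (T : ∀ l, W →ₗ[k₀] Y l) (hT : ∀ w, (∀ l, T l w = 0) → w = 0)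
    (z : R ⊗[k₀] W) (hz : ∀ l, (T l).lTensor R z = 0) : z = 0 := by
  obtain ⟨z', rfl⟩ := exists_baseChange_subtype_eq ⊥ T (fun w h => by simpa using hT w h) z hz
  rw [Subsingleton.elim z' 0, map_zero]

theorem extHom_tmul {W M N : Type u} [AddCommGroup W]
    [Module k₀ W] [AddCommGroup M] [Module k₀ M] [AddCommGroup N] [Module k₀ N]
    (p : W →ₗ[k₀] (M →ₗ[k₀] N)) (r : R) (w : W) :
    extHom k₀ R p (r ⊗ₜ w) = r • (p w).baseChange R := by
  simp [extHom, LinearMap.tensorProduct]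

/-- For a finite-dimensional source, the formation of homomorphism spaces commutes with base change.
-/
theorem extHom_id_surjective {M N : Type u} [AddCommGroup M] [Module k₀ M] [Module.Finite k₀ M]
    [AddCommGroup N] [Module k₀ N] (T : R ⊗[k₀] M →ₗ[R] R ⊗[k₀] N) :
    ∃ z, extHom k₀ R (LinearMap.id : (M →ₗ[k₀] N) →ₗ[k₀] _) z = T := by
  have := Module.finitePresentation_of_finite k₀ M
  obtain ⟨z, hz⟩ := (Module.FinitePresentation.isBaseChange_map k₀ M N R).equiv.surjective T
  refine ⟨z, ?_⟩
  rw [← hz]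
  clear hz
  induction z with
  | zero => simp
  | add x y hx hy => simp only [map_add, hx, hy]
  | tmul r f => rw [extHom_tmul, IsBaseChange.equiv_tmul]; rfl

theorem extPair_apply_one_tmul {M N P : Type u}
    [AddCommGroup M] [Module k₀ M] [AddCommGroup N] [Module k₀ N] [AddCommGroup P] [Module k₀ P]
    (B : M →ₗ[k₀] N →ₗ[k₀] P) (x : M) (y : R ⊗[k₀] N) :
    extPair k₀ R B (1 ⊗ₜ x) y = (B x).lTensor R y := by
  induction y with
  | zero => simp
  | add x y hx hy => simp only [map_add, hx, hy]
  | tmul r f => simp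

theorem extPair_smul_left {M N P : Type u}
    [AddCommGroup M] [Module k₀ M] [AddCommGroup N] [Module k₀ N] [AddCommGroup P] [Module k₀ P]
    (B : M →ₗ[k₀] N →ₗ[k₀] P) (r : R) (x : R ⊗[k₀] M) (y : R ⊗[k₀] N) :
    extPair k₀ R B (r • x) y = r • extPair k₀ R B x y := by
  induction y with
  | zero => simp
  | add y y' hy hy' => simp only [map_add, hy, hy', smul_add]
  | tmul t f =>
    induction x with
    | zero => simp
    | add x x' hx hx' => simp only [map_add, smul_add, LinearMap.add_apply, hx, hx']
    | tmul t' f' => simp [TensorProduct.smul_tmul', mul_assoc]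

theorem extPair_smul_right {M N P : Type u}
    [AddCommGroup M] [Module k₀ M] [AddCommGroup N] [Module k₀ N] [AddCommGroup P] [Module k₀ P]
    (B : M →ₗ[k₀] N →ₗ[k₀] P) (r : R) (x : R ⊗[k₀] M) (y : R ⊗[k₀] N) :
    extPair k₀ R B x (r • y) = r • extPair k₀ R B x y := by
  induction y with
  | zero => simp
  | add y y' hy hy' => simp only [map_add, hy, hy', smul_add]
  | tmul t f =>
    induction x with
    | zero => simp
    | add x x' hx hx' => simp only [map_add, smul_add, LinearMap.add_apply, hx, hx']
    | tmul t' f' => simp [TensorProduct.smul_tmul', mul_left_comm]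

/-- Compatibility of `extPair` with linear maps between the variables. -/
theorem extPair_map {M N P M' N' P' : Type u}
    [AddCommGroup M] [Module k₀ M] [AddCommGroup N] [Module k₀ N] [AddCommGroup P] [Module k₀ P]
    [AddCommGroup M'] [Module k₀ M'] [AddCommGroup N'] [Module k₀ N'] [AddCommGroup P']
    [Module k₀ P'] {B : M →ₗ[k₀] N →ₗ[k₀] P} {B' : M' →ₗ[k₀] N' →ₗ[k₀] P'} {a : M →ₗ[k₀] M'}
    {b : N →ₗ[k₀] N'} {c : P →ₗ[k₀] P'} (h : ∀ x y, B' (a x) (b y) = c (B x y))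
    (x : R ⊗[k₀] M) (y : R ⊗[k₀] N) :
    extPair k₀ R B' (a.baseChange R x) (b.baseChange R y) = c.baseChange R (extPair k₀ R B x y) := by
  induction y with
  | zero => simp
  | add y y' hy hy' => simp only [map_add, hy, hy']
  | tmul t f =>
    induction x with
    | zero => simp
    | add x x' hx hx' => simp only [map_add, LinearMap.add_apply, hx, hx']
    | tmul t' f' => simp [h]

/-- Compatibility of `extPair` with exchanging the variables. -/
theorem extPair_flip {M N P P' : Type u}
    [AddCommGroup M] [Module k₀ M] [AddCommGroup N] [Module k₀ N] [AddCommGroup P] [Module k₀ P]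
    [AddCommGroup P'] [Module k₀ P'] {B : M →ₗ[k₀] N →ₗ[k₀] P} {B' : N →ₗ[k₀] M →ₗ[k₀] P'}
    {c : P →ₗ[k₀] P'} (h : ∀ x y, B' y x = c (B x y)) (x : R ⊗[k₀] M) (y : R ⊗[k₀] N) :
    extPair k₀ R B' y x = c.baseChange R (extPair k₀ R B x y) := by
  induction y with
  | zero => simp
  | add y y' hy hy' => simp only [map_add, LinearMap.add_apply, hy, hy']
  | tmul t f =>
    induction x with
    | zero => simp
    | add x x' hx hx' => simp only [map_add, LinearMap.add_apply, hx, hx']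
    | tmul t' f' => simp [h, mul_comm]

theorem extPair_map_left {M N P M' : Type u}
    [AddCommGroup M] [Module k₀ M] [AddCommGroup N] [Module k₀ N] [AddCommGroup P] [Module k₀ P]
    [AddCommGroup M'] [Module k₀ M'] {B : M →ₗ[k₀] N →ₗ[k₀] P} {B' : M' →ₗ[k₀] N →ₗ[k₀] P}
    {a : M →ₗ[k₀] M'} {c : P →ₗ[k₀] P} (h : ∀ x y, B' (a x) y = c (B x y))
    (x : R ⊗[k₀] M) (y : R ⊗[k₀] N) :
    extPair k₀ R B' (a.baseChange R x) y = c.baseChange R (extPair k₀ R B x y) := by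
  have h1 := extPair_map (b := LinearMap.id) h x y
  rwa [LinearMap.baseChange_id] at h1

end BaseChange

namespace Datum
variable {k : Type u} [Field k] {σk : k ≃+* k} {s : Datum k σk}
namespace Choices
variable (C : s.Choices)

/-! ### Recovering `V` from the multiplicity spaces -/

/-- The map `V → M_i` defined by the embedding of `S_i` into `A_β`. -/
def coord (i : s.Vertex) : s.V →ₗ[s.k₀] C.M i where
  toFun v := (LinearMap.toSpanSingleton s.A s.V v).comp (C.sec i)
  map_add' v w := LinearMap.ext fun u => by
    change C.sec i u • (v + w) = C.sec i u • v + C.sec i u • w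
    exact smul_add _ _ _
  map_smul' a v := LinearMap.ext fun u => by
    change C.sec i u • a • v = a • C.sec i u • v
    exact smul_comm _ _ _

theorem coord_apply (i : s.Vertex) (v : s.V) (w : C.S i) : C.coord i v w = C.sec i w • v := rfl

/-- The action of an element of `A_β` as a linear map. -/
abbrev actV (s : Datum k σk) (q : s.A) : s.V →ₗ[s.k₀] s.V := DistribSMul.toLinearMap s.k₀ s.V q

/-- The endomorphism of `S_i` defined by an element `u`. -/
def toD (i : s.Vertex) (u : C.S i) : C.D i :=
  MulOpposite.op ((LinearMap.toSpanSingleton s.A _ u).comp (C.sec i))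

theorem toD_unop (i : s.Vertex) (u w : C.S i) : (C.toD i u).unop w = C.sec i w • u := rfl

theorem coord_comp_ev (i : s.Vertex) (q : s.A) (w : C.S i) :
    C.coord i ∘ₗ actV s q ∘ₗ C.ev i w =
      DistribSMul.toLinearMap s.k₀ (C.M i) (C.toD i (q • w)) := by
  refine LinearMap.ext fun x => LinearMap.ext fun w' => ?_
  change C.sec i w' • q • x w = x ((C.toD i (q • w)).unop w')
  rw [toD_unop, map_smul, map_smul]

/-- The idempotent at `i` acts as 1 on `S_i` and as 0 on `S_j`, and it can be moved through the
middle because it is central. -/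
theorem coord_comp_ev_of_ne {i j : s.Vertex} (hij : i ≠ j) (q : s.A) (w : C.S j) :
    C.coord i ∘ₗ actV s q ∘ₗ C.ev j w = 0 := by
  refine LinearMap.ext fun x => LinearMap.ext fun w' => ?_
  change C.sec i w' • q • x w = 0
  have h1 : s.ofL (s.idem i) • w = 0 := by
    rw [(C.supportedAt j).smul_eq (l' := 0), map_zero, zero_smul]
    rw [map_zero, s.toLat_idem, if_neg hij.symm]
  rw [← (C.supportedAt i).idem_smul w', map_smul, smul_eq_mul, s.ofL_central, mul_smul,
    ← mul_smul (s.ofL _) q, s.ofL_central, mul_smul, ← map_smul, h1, map_zero, smul_zero,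
    smul_zero]

/-- The evaluation map `R ⊗ M_i → R ⊗ V`, `x ↦ u ⊗ x`. -/
abbrev evR (R : Type u) [CommRing R] [Algebra s.k₀ R] (i : s.Vertex) (u : C.S i) :
    R ⊗[s.k₀] C.M i →ₗ[R] R ⊗[s.k₀] s.V := (C.ev i u).baseChange R

section

variable {R : Type u} [CommRing R] [Algebra s.k₀ R]

theorem evR_add (i : s.Vertex) (u u' : C.S i) :
    C.evR R i (u + u') = C.evR R i u + C.evR R i u' := by
  have h : C.ev i (u + u') = C.ev i u + C.ev i u' := LinearMap.ext fun x => map_add x u u'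
  exact (congrArg (LinearMap.baseChange R) h).trans (LinearMap.baseChange_add _ _)

theorem evR_act (i : s.Vertex) (d : C.D i) (u : C.S i) (x : R ⊗[s.k₀] C.M i) :
    C.evR R i u (extAct s.k₀ R d x) = C.evR R i (d.unop u) x := by
  rw [extAct, ← LinearMap.comp_apply, ← LinearMap.baseChange_comp]
  rfl

theorem act_evR (i : s.Vertex) (q : s.A) (u : C.S i) (x : R ⊗[s.k₀] C.M i) :
    extAct s.k₀ R q (C.evR R i u x) = C.evR R i (q • u) x := by
  rw [extAct, ← LinearMap.comp_apply, ← LinearMap.baseChange_comp]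
  congr 2
  exact LinearMap.ext fun x => (x.map_smul q u).symm

theorem extAct_A_F (a : s.F) (x : R ⊗[s.k₀] s.V) :
    extAct s.k₀ R (s.incl a) x = extAct s.k₀ R a x := by
  rw [extAct, extAct]
  congr 2
  exact LinearMap.ext fun v => s.incl_smul a v

theorem extAct_A_θ (x : R ⊗[s.k₀] s.V) :
    extAct s.k₀ R s.θA x = s.θLin.baseChange R x := by
  rw [extAct]
  congr 2
  exact LinearMap.ext fun v => s.θA_smul v

theorem extAct_add {D M : Type u} [Ring D] [AddCommGroup M]
    [Module s.k₀ M] [Module D M] [SMulCommClass D s.k₀ M] (d d' : D) (x : R ⊗[s.k₀] M) :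
    extAct s.k₀ R (d + d') x = extAct s.k₀ R d x + extAct s.k₀ R d' x := by
  rw [extAct, extAct, extAct, ← LinearMap.add_apply, ← LinearMap.baseChange_add]
  congr 2
  exact LinearMap.ext fun v => add_smul _ _ _

theorem extAct_mul {D M : Type u} [Ring D] [AddCommGroup M]
    [Module s.k₀ M] [Module D M] [SMulCommClass D s.k₀ M] (d d' : D) (x : R ⊗[s.k₀] M) :
    extAct s.k₀ R (d * d') x = extAct s.k₀ R d (extAct s.k₀ R d' x) := by
  rw [extAct, extAct, extAct, ← LinearMap.comp_apply, ← LinearMap.baseChange_comp]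
  congr 2
  exact LinearMap.ext fun v => mul_smul _ _ _

/-- Every element of `R ⊗ V` is a sum of values of the evaluation maps. -/
theorem exists_evR_expansion : ∃ (ι : s.Vertex → Type) (_ : ∀ i, Fintype (ι i))
    (w : ∀ i, ι i → C.S i) (q : ∀ i, ι i → s.A),
    (∀ i (u : C.S i), ∑ m, (C.toD i (q i m • u)).unop (w i m) = u) ∧
    ∀ (R : Type u) [CommRing R] [Algebra s.k₀ R] (x : R ⊗[s.k₀] s.V),
      ∑ i, ∑ m, C.evR R i (w i m) ((C.coord i).baseChange R (extAct s.k₀ R (q i m) x)) = x := by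
  choose ι hι p q hpq using C.exists_expansion_idem
  -- With `w = p • gen` one has `sec w = p e`, so the sum of `sec w * q` is the idempotent at `i`;
  -- the sum of these over `i` is 1.
  refine ⟨ι, hι, fun i m => p i m • C.gen i, q, fun i u => ?_, fun R _ _ x => ?_⟩
  · simp only [toD_unop]
    have h1 : ∀ m, C.sec i (p i m • C.gen i) • q i m • u = (p i m * C.e i * q i m) • u :=
      fun m => by rw [map_smul, smul_eq_mul, mul_smul, mul_smul, mul_smul]
    simp only [h1]
    rw [← Finset.sum_smul, hpq, (C.supportedAt i).idem_smul]
  · have h2 : ∑ i, ∑ m, C.ev i (p i m • C.gen i) ∘ₗ C.coord i ∘ₗ actV s (q i m) =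
        LinearMap.id := by
      refine LinearMap.ext fun v => ?_
      simp only [LinearMap.sum_apply, LinearMap.comp_apply, LinearMap.id_apply]
      have h3 : ∀ i m, C.ev i (p i m • C.gen i) (C.coord i (actV s (q i m) v)) =
          (p i m * C.e i * q i m) • v := fun i m => by
        change C.sec i (p i m • C.gen i) • q i m • v = _
        rw [map_smul, smul_eq_mul, mul_smul, mul_smul, mul_smul]
      simp only [h3]
      simp only [← Finset.sum_smul, hpq]
      rw [← map_sum, s.sum_idem, map_one, one_smul]
    have h4 := congrArg (LinearMap.baseChangeHom s.k₀ R s.V s.V) h2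
    simp only [map_sum, LinearMap.baseChangeHom_apply, LinearMap.baseChange_comp,
      LinearMap.baseChange_id] at h4
    have h5 := LinearMap.congr_fun h4 x
    simp only [LinearMap.sum_apply, LinearMap.comp_apply, LinearMap.id_apply] at h5
    exact h5

theorem evR_ext {Y : Type*} [AddCommGroup Y] {f g : R ⊗[s.k₀] s.V →+ Y}
    (h : ∀ i u x, f (C.evR R i u x) = g (C.evR R i u x)) : f = g := by
  obtain ⟨ι, _, w, q, -, h2⟩ := C.exists_evR_expansion
  refine AddMonoidHom.ext fun x => ?_
  rw [← h2 R x]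
  simp only [map_sum, h]

theorem coordR_evR (i : s.Vertex) (q : s.A) (w : C.S i) (x : R ⊗[s.k₀] C.M i) :
    (C.coord i).baseChange R (extAct s.k₀ R q (C.evR R i w x)) =
      extAct s.k₀ R (C.toD i (q • w)) x := by
  have h := congrArg (LinearMap.baseChange R) (C.coord_comp_ev i q w)
  rw [LinearMap.baseChange_comp, LinearMap.baseChange_comp] at h
  exact LinearMap.congr_fun h x

theorem coordR_evR_of_ne {i j : s.Vertex} (hij : i ≠ j) (q : s.A) (w : C.S j)
    (x : R ⊗[s.k₀] C.M j) :
    (C.coord i).baseChange R (extAct s.k₀ R q (C.evR R j w x)) = 0 := by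
  have h := congrArg (LinearMap.baseChange R) (C.coord_comp_ev_of_ne hij q w)
  rw [LinearMap.baseChange_comp, LinearMap.baseChange_comp, LinearMap.baseChange_zero] at h
  exact LinearMap.congr_fun h x

theorem coordR_evR_gen (i : s.Vertex) (x : R ⊗[s.k₀] C.M i) :
    (C.coord i).baseChange R (C.evR R i (C.gen i) x) = x := by
  rw [← LinearMap.comp_apply, ← LinearMap.baseChange_comp]
  have h : C.coord i ∘ₗ C.ev i (C.gen i) = LinearMap.id :=
    LinearMap.ext fun x => LinearMap.ext fun w => by
      change C.sec i w • x (C.gen i) = x w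
      rw [← map_smul, sec_smul_gen]
  rw [h, LinearMap.baseChange_id, LinearMap.id_apply]

theorem evR_gen_injective (i : s.Vertex) : Function.Injective (C.evR R i (C.gen i)) :=
  Function.LeftInverse.injective (C.coordR_evR_gen i)

theorem evR_coordR (i : s.Vertex) (w : C.S i) (x : R ⊗[s.k₀] s.V) :
    C.evR R i w ((C.coord i).baseChange R x) = extAct s.k₀ R (C.sec i w) x := by
  rw [extAct, ← LinearMap.comp_apply, ← LinearMap.baseChange_comp]
  rfl

/-- Compatible families of maps on the multiplicity spaces define a map on `V`. -/
theorem exists_evR_lift {Y : Type*} [AddCommGroup Y] [Module R Y]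
    (f : ∀ i, C.S i → R ⊗[s.k₀] C.M i →ₗ[R] Y) (hadd : ∀ i u u', f i (u + u') = f i u + f i u')
    (hf : ∀ i (d : C.D i) u x, f i u (extAct s.k₀ R d x) = f i (d.unop u) x) :
    ∃ G : R ⊗[s.k₀] s.V →ₗ[R] Y, ∀ i u x, G (C.evR R i u x) = f i u x := by
  obtain ⟨ι, _, w, q, h1, -⟩ := C.exists_evR_expansion
  -- The expansion of elements of `R ⊗ V` forces this formula. Additivity in `u` and compatibility
  -- with `D_i` play the role of balancedness for a map out of `S_i ⊗ M_i`.
  refine ⟨∑ i, ∑ m, f i (w i m) ∘ₗ (C.coord i).baseChange R ∘ₗ extAct s.k₀ R (q i m),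
    fun j u x => ?_⟩
  simp only [LinearMap.sum_apply, LinearMap.comp_apply]
  rw [Finset.sum_eq_single j]
  · simp only [coordR_evR, hf]
    rw [← LinearMap.sum_apply]
    let F : C.S j →+ (R ⊗[s.k₀] C.M j →ₗ[R] Y) := AddMonoidHom.mk' (f j) (hadd j)
    change (∑ m, F _) x = F u x
    rw [← map_sum, h1]
  · intro i _ hij
    simp [coordR_evR_of_ne C hij]
  · simp

/-! ### Automorphisms -/

/-- `G` acts on `u ⊗ x` as `g i` on `x`. -/
def IsComp (G : R ⊗[s.k₀] s.V →ₗ[R] R ⊗[s.k₀] s.V) (i : s.Vertex)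
    (g : R ⊗[s.k₀] C.M i →ₗ[R] R ⊗[s.k₀] C.M i) : Prop :=
  ∀ u x, G (C.evR R i u x) = C.evR R i u (g x)

variable {C}

theorem IsComp.unique {G : R ⊗[s.k₀] s.V →ₗ[R] R ⊗[s.k₀] s.V} {i : s.Vertex}
    {g g' : R ⊗[s.k₀] C.M i →ₗ[R] R ⊗[s.k₀] C.M i} (h : C.IsComp G i g)
    (h' : C.IsComp G i g') : g = g' :=
  LinearMap.ext fun x => C.evR_gen_injective i (by rw [← h, ← h'])

theorem eq_of_isComp {G G' : R ⊗[s.k₀] s.V →ₗ[R] R ⊗[s.k₀] s.V}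
    {g : ∀ i, R ⊗[s.k₀] C.M i →ₗ[R] R ⊗[s.k₀] C.M i} (h : ∀ i, C.IsComp G i (g i))
    (h' : ∀ i, C.IsComp G' i (g i)) : G = G' := by
  have h1 : G.toAddMonoidHom = G'.toAddMonoidHom := C.evR_ext fun i u x => by
    change G _ = G' _
    rw [h, h']
  exact LinearMap.ext fun x => DFunLike.congr_fun h1 x

theorem IsComp.mul {G G' : R ⊗[s.k₀] s.V →ₗ[R] R ⊗[s.k₀] s.V} {i : s.Vertex}
    {g g' : R ⊗[s.k₀] C.M i →ₗ[R] R ⊗[s.k₀] C.M i} (h : C.IsComp G i g)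
    (h' : C.IsComp G' i g') : C.IsComp (G ∘ₗ G') i (g ∘ₗ g') := fun u x => by
  rw [LinearMap.comp_apply, h', h, LinearMap.comp_apply]

theorem isComp_id (i : s.Vertex) : C.IsComp (R := R) LinearMap.id i LinearMap.id := fun _ _ => rfl

variable (C)

/-- The component is read off at the generator of `S_i`; every other `u` is an `A_β`-multiple of it,
and `G` commutes with `A_β`. -/
theorem exists_isComp_linear (G : R ⊗[s.k₀] s.V →ₗ[R] R ⊗[s.k₀] s.V)
    (hG : ∀ (q : s.A) x, G (extAct s.k₀ R q x) = extAct s.k₀ R q (G x)) (i : s.Vertex) :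
    ∃ g, C.IsComp G i g ∧ ∀ (d : C.D i) x, g (extAct s.k₀ R d x) = extAct s.k₀ R d (g x) := by
  have h : C.IsComp G i ((C.coord i).baseChange R ∘ₗ G ∘ₗ C.evR R i (C.gen i)) := fun u x => by
    rw [LinearMap.comp_apply, evR_coordR, LinearMap.comp_apply, ← hG, act_evR, sec_smul_gen]
  refine ⟨_, h, fun d x => C.evR_gen_injective i ?_⟩
  rw [← h, evR_act, evR_act, h]

/-- The components of an automorphism. -/
theorem exists_isComp {G : R ⊗[s.k₀] s.V ≃ₗ[R] R ⊗[s.k₀] s.V}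
    (hG : G ∈ GLPts s.k₀ s.A s.V R) (i : s.Vertex) :
    ∃ g : C.AutR i R, g ∈ C.GLD i R ∧ C.IsComp G.toLinearMap i g.toLinearMap := by
  obtain ⟨g, h1, h2⟩ := C.exists_isComp_linear G.toLinearMap hG i
  obtain ⟨g', h1', -⟩ := C.exists_isComp_linear G.symm.toLinearMap
    (inv_mem hG : G⁻¹ ∈ GLPts s.k₀ s.A s.V R) i
  have h3 : g ∘ₗ g' = LinearMap.id := (h1.mul h1').unique (by
    rw [LinearEquiv.comp_coe, LinearEquiv.symm_trans_self]
    exact isComp_id i)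
  have h4 : g' ∘ₗ g = LinearMap.id := (h1'.mul h1).unique (by
    rw [LinearEquiv.comp_coe, LinearEquiv.self_trans_symm]
    exact isComp_id i)
  exact ⟨LinearEquiv.ofLinearMap g g' h3 h4, h2, h1⟩

theorem exists_of_isComp_linear (g : ∀ i, R ⊗[s.k₀] C.M i →ₗ[R] R ⊗[s.k₀] C.M i)
    (hg : ∀ i (d : C.D i) x, g i (extAct s.k₀ R d x) = extAct s.k₀ R d (g i x)) :
    ∃ G : R ⊗[s.k₀] s.V →ₗ[R] R ⊗[s.k₀] s.V, (∀ i, C.IsComp G i (g i)) ∧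
      ∀ (q : s.A) x, G (extAct s.k₀ R q x) = extAct s.k₀ R q (G x) := by
  obtain ⟨G, hG⟩ := C.exists_evR_lift (R := R) (fun i u => C.evR R i u ∘ₗ g i)
    (fun i u u' => by rw [evR_add, LinearMap.add_comp])
    (fun i d u x => by rw [LinearMap.comp_apply, hg, evR_act, LinearMap.comp_apply])
  refine ⟨G, hG, fun q x => ?_⟩
  have h : (G ∘ₗ extAct s.k₀ R q).toAddMonoidHom = (extAct s.k₀ R q ∘ₗ G).toAddMonoidHom :=
    C.evR_ext fun i u x => by
      change G (extAct s.k₀ R q _) = extAct s.k₀ R q (G _)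
      rw [act_evR, hG, hG]
      exact (C.act_evR i q u _).symm
  exact DFunLike.congr_fun h x

/-- Every family of components comes from an automorphism. -/
theorem exists_of_isComp (g : ∀ i, C.AutR i R) (hg : ∀ i, g i ∈ C.GLD i R) :
    ∃ G ∈ GLPts s.k₀ s.A s.V R, ∀ i, C.IsComp G.toLinearMap i (g i).toLinearMap := by
  obtain ⟨G, h1, h2⟩ := C.exists_of_isComp_linear (fun i => (g i).toLinearMap) hg
  obtain ⟨G', h1', -⟩ := C.exists_of_isComp_linear (fun i => (g i).symm.toLinearMap)
    (fun i => (inv_mem (hg i) : (g i)⁻¹ ∈ C.GLD i R))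
  have h3 : G ∘ₗ G' = LinearMap.id := eq_of_isComp (g := fun i => LinearMap.id) (fun i => by
    have := (h1 i).mul (h1' i)
    rwa [LinearEquiv.comp_coe, LinearEquiv.symm_trans_self] at this) (fun i => isComp_id i)
  have h4 : G' ∘ₗ G = LinearMap.id := eq_of_isComp (g := fun i => LinearMap.id) (fun i => by
    have := (h1' i).mul (h1 i)
    rwa [LinearEquiv.comp_coe, LinearEquiv.self_trans_symm] at this) (fun i => isComp_id i)
  exact ⟨LinearEquiv.ofLinearMap G G' h3 h4, h2, h1⟩

theorem mem_GLPts_A (G : R ⊗[s.k₀] s.V ≃ₗ[R] R ⊗[s.k₀] s.V) :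
    G ∈ GLPts s.k₀ s.A s.V R ↔ G ∈ GLPts s.k₀ s.F s.V R ∧
      ∀ x, G (s.θLin.baseChange R x) = s.θLin.baseChange R (G x) := by
  refine ⟨fun h => ⟨fun a x => ?_, fun x => ?_⟩, fun h q x => ?_⟩
  · rw [← extAct_A_F, ← extAct_A_F]
    exact h _ x
  · rw [← extAct_A_θ, ← extAct_A_θ]
    exact h _ x
  · induction q using s.A_induction generalizing x with
    | h_incl a => rw [extAct_A_F, extAct_A_F, h.1]
    | hθ => rw [extAct_A_θ, extAct_A_θ, h.2]
    | hadd q q' hq hq' => rw [extAct_add, extAct_add, map_add, hq, hq']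
    | hmul q q' hq hq' => rw [extAct_mul, extAct_mul, hq, hq']

theorem mem_H_iff (G : R ⊗[s.k₀] s.V ≃ₗ[R] R ⊗[s.k₀] s.V) :
    G ∈ s.H R ↔ G ∈ GLPts s.k₀ s.A s.V R ∧ G ∈ isometryPts s.k₀ s.formK R := by
  rw [mem_GLPts_A]
  change _ ∧ _ ∧ _ ↔ _
  tauto

end

end Choices
end Datum
end
end CyclicGrading

namespace CyclicGrading
noncomputable section
namespace Datum
variable {k : Type u} [Field k] {σk : k ≃+* k} (s : Datum k σk)

/-! ### The pairing on `V` -/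

/-- The pairing on `V` as a biadditive map. -/
def formHom : s.V →+ s.V →+ s.F :=
  AddMonoidHom.mk' (fun x => (s.formK x).toAddMonoidHom) (fun x y => AddMonoidHom.ext fun z => by
    change s.formK (x + y) z = s.formK x z + s.formK y z
    rw [map_add, LinearMap.add_apply])

theorem formHom_apply (x y : s.V) : s.formHom x y = s.form x y := rfl

theorem isAdmissible_formHom : s.IsAdmissible s.formHom where
  smul_left a u v := by
    rw [formHom_apply, incl_smul, map_smul, LinearMap.smul_apply, smul_eq_mul, formHom_apply]
  smul_right a u v := by
    rw [formHom_apply, incl_smul, LinearMap.map_smulₛₗ, smul_eq_mul, formHom_apply]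
    rfl
  theta u v := by
    rw [formHom_apply, θA_smul, θA_smul, form_θ, formHom_apply]

theorem form_smul_left (a : s.F) (x y : s.V) : s.form (a • x) y = a * s.form x y := by
  rw [map_smul, LinearMap.smul_apply, smul_eq_mul]

theorem form_smul_right (a : s.F) (x y : s.V) : s.form x (a • y) = s.σ a * s.form x y := by
  rw [LinearMap.map_smulₛₗ, smul_eq_mul]
  rfl

theorem form_eq_zero_of_right (y : s.V) (h : ∀ x, s.form x y = 0) : y = 0 :=
  s.form_nondegenerate y fun x => by rw [s.form_symm, h, map_zero, smul_zero]

/-- `σ` as a linear map, up to the sign `ε`. -/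
def σLin : s.F →ₗ[s.k₀] s.F where
  toFun a := s.ε • s.σ a
  map_add' a b := by rw [map_add, smul_add]
  map_smul' a x := by
    rw [← algebraMap_smul s.F a x, smul_eq_mul, map_mul, RingHom.id_apply, ← algebraMap_smul s.F a,
      smul_eq_mul, mul_smul_comm]
    congr 2
    exact s.σ_algebraMap_k₀ a

/-- `x ↦ c ζ(x)` as a linear map. -/
def cζLin : s.F →ₗ[s.k₀] s.F where
  toFun a := s.c * s.ζ a
  map_add' a b := by rw [map_add, mul_add]
  map_smul' a x := by
    rw [← algebraMap_smul s.F a x, smul_eq_mul, map_mul, RingHom.id_apply, ← algebraMap_smul s.F a,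
      smul_eq_mul, mul_left_comm]
    congr 1
    exact s.ζ_algebraMap a

/-- The `k^σ`-valued pairing obtained from the pairing on `V`. -/
def formB : s.V →ₗ[s.k₀] s.V →ₗ[s.k₀] s.k₀ := s.formK.compr₂ s.functional

theorem formB_apply (x y : s.V) : s.formB x y = s.functional (s.form x y) := rfl

theorem formB_nondegenerate_right (y : s.V) (h : ∀ x, s.formB x y = 0) : y = 0 :=
  s.form_eq_zero_of_right y fun x => s.eq_zero_of_functional _ fun a => by
    rw [← form_smul_left]
    exact h _

theorem exists_adjoint_formB (T : s.V →ₗ[s.k₀] s.V) :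
    ∃ T' : s.V →ₗ[s.k₀] s.V, ∀ x y, s.formB (T x) y = s.formB x (T' y) := by
  have h1 : Function.Injective s.formB.flip := by
    rw [injective_iff_map_eq_zero]
    exact fun y hy => s.formB_nondegenerate_right y fun x => LinearMap.congr_fun hy x
  have h2 : Function.Surjective s.formB.flip :=
    (LinearMap.injective_iff_surjective_of_finrank_eq_finrank
      (Subspace.dual_finrank_eq (K := s.k₀) (V := s.V)).symm).1 h1
  let e := LinearEquiv.ofBijective s.formB.flip ⟨h1, h2⟩
  refine ⟨e.symm.toLinearMap ∘ₗ T.dualMap ∘ₗ e.toLinearMap, fun x y => ?_⟩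
  have h3 : e (e.symm (T.dualMap (e y))) = T.dualMap (e y) := e.apply_symm_apply _
  exact (LinearMap.congr_fun h3 x).symm

/-- The adjoint for the `k^σ`-valued pairing also serves for the `F`-valued one: `T` commutes with
`F`, and the difference of the two sides spans an ideal on which the functional vanishes. -/
theorem exists_adjoint (T : s.V →ₗ[s.F] s.V) :
    ∃ T' : s.V →ₗ[s.F] s.V, ∀ x y, s.form (T x) y = s.form x (T' y) := by
  obtain ⟨T', hT'⟩ := s.exists_adjoint_formB (T.restrictScalars s.k₀)
  have h1 : ∀ x y, s.form (T x) y = s.form x (T' y) := fun x y => by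
    rw [← sub_eq_zero]
    refine s.eq_zero_of_functional _ fun a => ?_
    rw [mul_sub, ← form_smul_left, ← form_smul_left, map_sub, ← map_smul T, ← formB_apply,
      ← formB_apply, ← hT']
    exact sub_self _
  refine ⟨{ toFun := T', map_add' := T'.map_add, map_smul' := fun a y => ?_ }, h1⟩
  rw [RingHom.id_apply, ← sub_eq_zero]
  refine s.form_eq_zero_of_right _ fun x => ?_
  rw [map_sub, ← h1, form_smul_right, form_smul_right, ← h1, sub_self]

section BaseChange

variable (R : Type u) [CommRing R] [Algebra s.k₀ R]

/-- The pairing on `R ⊗ V`. -/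
abbrev formR : R ⊗[s.k₀] s.V →ₗ[s.k₀] R ⊗[s.k₀] s.V →ₗ[s.k₀] R ⊗[s.k₀] s.F :=
  extPair s.k₀ R s.formK

variable {R}

theorem formR_symm (x y : R ⊗[s.k₀] s.V) :
    s.formR R y x = s.σLin.baseChange R (s.formR R x y) :=
  extPair_flip (fun x y => s.form_symm y x) x y

theorem formR_nondegenerate_right (y : R ⊗[s.k₀] s.V) (h : ∀ x, s.formR R x y = 0) : y = 0 := by
  refine eq_zero_of_lTensor (fun x : s.V => s.formK x)
    (fun w hw => s.form_eq_zero_of_right w hw) y fun x => ?_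
  rw [← extPair_apply_one_tmul]
  exact h _

theorem formR_act_left (a : s.F) (x y : R ⊗[s.k₀] s.V) :
    s.formR R (extAct s.k₀ R a x) y =
      (LinearMap.mulLeft s.k₀ a).baseChange R (s.formR R x y) :=
  extPair_map_left (fun x y => s.form_smul_left a x y) x y

theorem formR_act_right (a : s.F) (x y : R ⊗[s.k₀] s.V) :
    s.formR R x (extAct s.k₀ R a y) =
      (LinearMap.mulLeft s.k₀ (s.σ a)).baseChange R (s.formR R x y) := by
  have h := extPair_map (R := R) (a := LinearMap.id)
    (b := DistribSMul.toLinearMap s.k₀ s.V a) (c := LinearMap.mulLeft s.k₀ (s.σ a))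
    (B := s.formK) (B' := s.formK) (fun x y => s.form_smul_right a x y) x y
  rwa [LinearMap.baseChange_id] at h

theorem formR_θ (x y : R ⊗[s.k₀] s.V) :
    s.formR R (s.θLin.baseChange R x) (s.θLin.baseChange R y) =
      s.cζLin.baseChange R (s.formR R x y) :=
  extPair_map (fun x y => s.form_θ x y) x y

theorem θR_surjective (x : R ⊗[s.k₀] s.V) : ∃ y, s.θLin.baseChange R y = x := by
  have h : Function.Surjective (s.θLin.lTensor R) := LinearMap.lTensor_surjective R s.θ.surjective
  exact h x

/-- An endomorphism of `R ⊗ V` is a combination of base changed ones, and adjoints are taken term by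
term. -/
theorem exists_adjoint_formBR (T : R ⊗[s.k₀] s.V →ₗ[R] R ⊗[s.k₀] s.V) :
    ∃ T' : R ⊗[s.k₀] s.V →ₗ[R] R ⊗[s.k₀] s.V,
      ∀ x y, extPair s.k₀ R s.formB (T x) y = extPair s.k₀ R s.formB x (T' y) := by
  obtain ⟨z, rfl⟩ := extHom_id_surjective T
  induction z with
  | zero => exact ⟨0, by simp⟩
  | add z z' h h' =>
    obtain ⟨T, hT⟩ := h
    obtain ⟨T', hT'⟩ := h'
    exact ⟨T + T', fun x y => by simp only [map_add, LinearMap.add_apply, hT, hT']⟩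
  | tmul r f =>
    obtain ⟨f', hf'⟩ := s.exists_adjoint_formB f
    refine ⟨r • f'.baseChange R, fun x y => ?_⟩
    rw [extHom_tmul, LinearMap.smul_apply, LinearMap.smul_apply, extPair_smul_left,
      extPair_smul_right]
    congr 1
    have h1 : extPair s.k₀ R (s.formB ∘ₗ f) x y = extPair s.k₀ R s.formB (f.baseChange R x) y := by
      have := extPair_map_left (R := R) (a := f) (c := LinearMap.id) (B := s.formB ∘ₗ f)
        (B' := s.formB) (fun _ _ => rfl) x y
      rw [this, LinearMap.baseChange_id, LinearMap.id_apply]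
    have h2 := extPair_map (R := R) (a := LinearMap.id) (b := f') (c := LinearMap.id)
      (B := s.formB ∘ₗ f) (B' := s.formB) (fun x y => (hf' x y).symm) x y
    rw [LinearMap.baseChange_id, LinearMap.baseChange_id, LinearMap.id_apply,
      LinearMap.id_apply] at h2
    rw [h2, h1]
    rfl

/-- As over the base: the functionals `x ↦ functional (a x)`, for all `a` in `F`, remain jointly
injective after base change. -/
theorem exists_adjointR (T : R ⊗[s.k₀] s.V →ₗ[R] R ⊗[s.k₀] s.V)
    (hT : ∀ (a : s.F) x, T (extAct s.k₀ R a x) = extAct s.k₀ R a (T x)) :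
    ∃ T' : R ⊗[s.k₀] s.V →ₗ[R] R ⊗[s.k₀] s.V,
      ∀ x y, s.formR R (T x) y = s.formR R x (T' y) := by
  obtain ⟨T', hT'⟩ := s.exists_adjoint_formBR T
  refine ⟨T', fun x y => ?_⟩
  have h0 : ∀ x y, extPair s.k₀ R s.formB x y = s.functional.baseChange R (s.formR R x y) := by
    intro x y
    have h := extPair_map (R := R) (a := LinearMap.id) (b := LinearMap.id) (c := s.functional)
      (B := s.formK) (B' := s.formB) (fun x y => rfl) x y
    rwa [LinearMap.baseChange_id, LinearMap.id_apply, LinearMap.id_apply] at h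
  rw [← sub_eq_zero]
  refine eq_zero_of_lTensor (fun a : s.F => s.functional ∘ₗ LinearMap.mulLeft s.k₀ a)
    (fun w hw => s.eq_zero_of_functional w hw) _ fun a => ?_
  rw [LinearMap.lTensor_comp, map_sub, LinearMap.comp_apply, LinearMap.comp_apply]
  have h1 := s.formR_act_left a (T x) y
  have h2 := s.formR_act_left a x (T' y)
  change _ = (LinearMap.mulLeft s.k₀ a).lTensor R _ at h1
  change _ = (LinearMap.mulLeft s.k₀ a).lTensor R _ at h2
  rw [← h1, ← h2, ← hT, sub_eq_zero]
  change s.functional.baseChange R _ = s.functional.baseChange R _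
  rw [← h0, ← h0, hT']

/-- The contragredient of an automorphism of the `A_β`-module `V`. -/
theorem exists_contragredientR {G : R ⊗[s.k₀] s.V ≃ₗ[R] R ⊗[s.k₀] s.V}
    (hG : G ∈ GLPts s.k₀ s.A s.V R) :
    ∃ G' ∈ GLPts s.k₀ s.A s.V R, ∀ x y, s.formR R (G x) (G' y) = s.formR R x y := by
  have hGi : G⁻¹ ∈ GLPts s.k₀ s.A s.V R := inv_mem hG
  rw [Choices.mem_GLPts_A] at hG hGi
  obtain ⟨T, hT⟩ := s.exists_adjointR G.toLinearMap hG.1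
  obtain ⟨T', hT'⟩ := s.exists_adjointR G⁻¹.toLinearMap hGi.1
  have hext : ∀ y y' : R ⊗[s.k₀] s.V, (∀ x, s.formR R x y = s.formR R x y') → y = y' :=
    fun y y' h => sub_eq_zero.1 (s.formR_nondegenerate_right _ fun x => by
      rw [map_sub, h, sub_self])
  have h1 : ∀ x, G⁻¹.toLinearMap (G.toLinearMap x) = x := G.symm_apply_apply
  have h2 : ∀ x, G.toLinearMap (G⁻¹.toLinearMap x) = x := G.apply_symm_apply
  -- The contragredient is the adjoint of the inverse of `G`, and its own inverse is the adjoint of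
  -- `G`.
  refine ⟨LinearEquiv.ofLinearMap T' T ?_ ?_, ?_, fun x y => ?_⟩
  · exact LinearMap.ext fun y => hext _ _ fun x => by
      rw [LinearMap.comp_apply, ← hT', ← hT, h2]
      rfl
  · exact LinearMap.ext fun y => hext _ _ fun x => by
      rw [LinearMap.comp_apply, ← hT, ← hT', h1]
      rfl
  · rw [Choices.mem_GLPts_A]
    refine ⟨fun a y => hext _ _ fun x => ?_, fun y => hext _ _ fun x => ?_⟩
    · change s.formR R x (T' _) = s.formR R x (extAct _ _ _ (T' y))
      rw [← hT', formR_act_right, formR_act_right, hT']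
    · change s.formR R x (T' _) = s.formR R x (s.θLin.baseChange R (T' y))
      obtain ⟨x, rfl⟩ := s.θR_surjective x
      rw [formR_θ, ← hT', ← hT']
      have h3 : G⁻¹.toLinearMap (s.θLin.baseChange R x) = s.θLin.baseChange R (G⁻¹.toLinearMap x) :=
        hGi.2 x
      rw [h3, formR_θ]
  · change s.formR R _ (T' y) = _
    rw [← hT']
    congr 2
    exact h1 x

end BaseChange

end Datum

namespace Datum
variable {k : Type u} [Field k] {σk : k ≃+* k} {s : Datum k σk}
namespace Choices
variable (C : s.Choices)

/-! ### Comparison of the pairings -/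

instance (i : s.Vertex) : Algebra s.k₀ (C.D i) :=
  ((algebraMap (s.Lat i) (C.D i)).comp (algebraMap s.k₀ (s.Lat i))).toAlgebra'
    fun a d => by
      rw [RingHom.comp_apply]
      exact Algebra.commutes (algebraMap s.k₀ (s.Lat i) a) d

theorem k₀_smul_D (i : s.Vertex) (a : s.k₀) (d : C.D i) :
    a • d = algebraMap s.k₀ (s.Lat i) a • d := by
  rw [Algebra.smul_def, Algebra.smul_def]
  rfl

instance (i : s.Vertex) : IsScalarTower s.k₀ (s.Lat i) (C.D i) := .of_algebraMap_eq fun _ => rfl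

/-- The pairing `{·,·}'_i` as a bilinear map. -/
def pairDk (i j : s.Vertex) (h : s.dag i = j) : C.M i →ₗ[s.k₀] C.M j →ₗ[s.k₀] C.D i :=
  LinearMap.mk₂ s.k₀ (C.pairD i j h)
    (fun x x' y => C.pairD_unique i j h _ _ _ fun u v => by
      rw [MulOpposite.unop_add, LinearMap.add_apply, map_add, AddMonoidHom.add_apply,
        pairing_pairD, pairing_pairD, LinearMap.add_apply, map_add, LinearMap.add_apply])
    (fun a x y => C.pairD_unique i j h _ _ _ fun u v => by
      rw [k₀_smul_D, smul_k₀_unop, (C.admissible i j h).smul_left, pairing_pairD,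
        LinearMap.smul_apply, ← formK_apply, ← formK_apply, map_smul, LinearMap.smul_apply]
      exact (Algebra.smul_def (a : k) _).symm)
    (fun x y y' => C.pairD_unique i j h _ _ _ fun u v => by
      rw [MulOpposite.unop_add, LinearMap.add_apply, map_add, AddMonoidHom.add_apply,
        pairing_pairD, pairing_pairD, LinearMap.add_apply, map_add])
    (fun a x y => C.pairD_unique i j h _ _ _ fun u v => by
      rw [k₀_smul_D, smul_k₀_unop, (C.admissible i j h).smul_left, pairing_pairD,
        LinearMap.smul_apply, ← formK_apply, ← formK_apply, map_smul]
      exact (Algebra.smul_def (a : k) _).symm)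

theorem pairD_smul_left (i j : s.Vertex) (h : s.dag i = j) (d : C.D i) (x : C.M i) (y : C.M j) :
    C.pairD i j h (d • x) y = d * C.pairD i j h x y :=
  C.pairD_unique i j h _ _ _ fun u v => by
    rw [MulOpposite.unop_mul, Module.End.mul_apply, pairing_pairD, D_smul_apply]

/-- `d ↦ ⟨u d, v⟩_i`. -/
def pairingLin (i j : s.Vertex) (h : s.dag i = j) (u : C.S i) (v : C.S j) :
    C.D i →ₗ[s.k₀] s.F where
  toFun d := C.pairing i j h (d.unop u) v
  map_add' d d' := by
    rw [MulOpposite.unop_add, LinearMap.add_apply, map_add, AddMonoidHom.add_apply]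
  map_smul' a d := by
    rw [k₀_smul_D, smul_k₀_unop, (C.admissible i j h).smul_left, RingHom.id_apply]
    exact (Algebra.smul_def (a : k) _).symm

section

variable {R : Type u} [CommRing R] [Algebra s.k₀ R]

theorem formR_evR (i j : s.Vertex) (h : s.dag i = j) (u : C.S i) (v : C.S j)
    (x : R ⊗[s.k₀] C.M i) (y : R ⊗[s.k₀] C.M j) :
    s.formR R (C.evR R i u x) (C.evR R j v y) =
      (C.pairingLin i j h u v).baseChange R (extPair s.k₀ R (C.pairDk i j h) x y) :=
  extPair_map (fun x y => (C.pairing_pairD i j h x y u v).symm) x y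

theorem pairLR_eq (i j : s.Vertex) (h : s.dag i = j)
    (x : R ⊗[s.k₀] C.M i) (y : R ⊗[s.k₀] C.M j) :
    extPair s.k₀ R (C.pairL i j h) x y =
      ((C.trd i).restrictScalars s.k₀).baseChange R (extPair s.k₀ R (C.pairDk i j h) x y) := by
  have h1 := extPair_map (R := R) (a := LinearMap.id) (b := LinearMap.id)
    (c := (C.trd i).restrictScalars s.k₀) (B := C.pairDk i j h) (B' := C.pairL i j h)
    (fun x y => rfl) x y
  rwa [LinearMap.baseChange_id, LinearMap.baseChange_id, LinearMap.id_apply,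
    LinearMap.id_apply] at h1

theorem pairDR_act (i j : s.Vertex) (h : s.dag i = j) (d : C.D i)
    (x : R ⊗[s.k₀] C.M i) (y : R ⊗[s.k₀] C.M j) :
    extPair s.k₀ R (C.pairDk i j h) (extAct s.k₀ R d x) y =
      (LinearMap.mulLeft s.k₀ d).baseChange R (extPair s.k₀ R (C.pairDk i j h) x y) :=
  extPair_map_left (fun x y => C.pairD_smul_left i j h d x y) x y

/-- The values `⟨u d, v⟩_i` for all `u` and `v` determine `d`, also with coefficients in `R`. -/
theorem formR_evR_eq_iff (i j : s.Vertex) (h : s.dag i = j)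
    (x x' : R ⊗[s.k₀] C.M i) (y y' : R ⊗[s.k₀] C.M j) :
    (∀ u v, s.formR R (C.evR R i u x) (C.evR R j v y) =
      s.formR R (C.evR R i u x') (C.evR R j v y')) ↔
    extPair s.k₀ R (C.pairDk i j h) x y = extPair s.k₀ R (C.pairDk i j h) x' y' := by
  simp only [C.formR_evR i j h]
  refine ⟨fun h1 => ?_, fun h1 u v => by rw [h1]⟩
  rw [← sub_eq_zero]
  refine eq_zero_of_lTensor (fun p : C.S i × C.S j => C.pairingLin i j h p.1 p.2) (fun d hd => ?_)
    _ fun p => ?_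
  · refine MulOpposite.unop_injective (LinearMap.ext fun u => C.pairing_ext i j h fun v => ?_)
    refine (hd (u, v)).trans ?_
    simp
  · rw [map_sub, sub_eq_zero]
    exact h1 p.1 p.2

/-- The reduced trace form is nondegenerate, so an element is known from the traces of its left
multiples. -/
theorem pairLR_eq_iff (i j : s.Vertex) (h : s.dag i = j)
    (x x' : R ⊗[s.k₀] C.M i) (y y' : R ⊗[s.k₀] C.M j) :
    (∀ d : C.D i, extPair s.k₀ R (C.pairL i j h) (extAct s.k₀ R d x) y =
      extPair s.k₀ R (C.pairL i j h) (extAct s.k₀ R d x') y') ↔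
    extPair s.k₀ R (C.pairDk i j h) x y = extPair s.k₀ R (C.pairDk i j h) x' y' := by
  simp only [pairLR_eq, pairDR_act]
  refine ⟨fun h1 => ?_, fun h1 u => by rw [h1]⟩
  rw [← sub_eq_zero]
  refine eq_zero_of_lTensor (fun d : C.D i => (C.trd i).restrictScalars s.k₀ ∘ₗ
    LinearMap.mulLeft s.k₀ d) (fun d hd => C.eq_zero_of_trd i d hd) _ fun d => ?_
  rw [map_sub, sub_eq_zero, LinearMap.lTensor_comp]
  exact h1 d

/-- The pairings with values in `F` and with values in `L_i` are preserved by the same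
automorphisms. -/
theorem pairLR_isometry_iff (i j : s.Vertex) (h : s.dag i = j) {g : C.AutR i R}
    (hg : g ∈ C.GLD i R) (T : C.AutR j R) :
    (∀ x y, extPair s.k₀ R (C.pairL i j h) (g x) (T y) = extPair s.k₀ R (C.pairL i j h) x y) ↔
    ∀ x y u v, s.formR R (C.evR R i u (g x)) (C.evR R j v (T y)) =
      s.formR R (C.evR R i u x) (C.evR R j v y) := by
  constructor
  · intro h1 x y
    rw [C.formR_evR_eq_iff i j h, ← C.pairLR_eq_iff i j h]
    intro d
    rw [← hg, h1]
  · intro h1 x y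
    have h2 := (C.pairLR_eq_iff i j h _ _ _ _).2
      ((C.formR_evR_eq_iff i j h _ _ _ _).1 (h1 x y)) 1
    have h3 : ∀ x : R ⊗[s.k₀] C.M i, extAct s.k₀ R (1 : C.D i) x = x := fun x => by
      have h4 : DistribSMul.toLinearMap s.k₀ (C.M i) (1 : C.D i) = LinearMap.id :=
        LinearMap.ext fun x => one_smul _ x
      rw [extAct, h4, LinearMap.baseChange_id, LinearMap.id_apply]
    rwa [h3, h3] at h2

/-- The idempotent at `i` is moved across the pairing by `σ_c`, where it becomes the one at `i†` and
kills the part at `j`. -/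
theorem form_eq_zero_of_ne {i j : s.Vertex} (h : s.dag i ≠ j) (x : C.M i) (y : C.M j) (u : C.S i)
    (v : C.S j) : s.form (x u) (y v) = 0 := by
  have h1 := s.isAdmissible_formHom.ofL_smul (s.idem i) (x u) (y v)
  rw [← map_smul x, (C.supportedAt i).idem_smul, ← map_smul y, (C.supportedAt j).smul_eq (l' := 0),
    map_zero s.ofL, zero_smul, map_zero, map_zero] at h1
  · exact h1
  · rw [map_zero, s.toLat_eq_zero]
    change s.idem i ∈ (s.dag j).asIdeal
    rw [← s.toLat_eq_zero, s.toLat_idem, if_neg]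
    intro h2
    apply h
    rw [← h2, s.dag_dag]

theorem formR_evR_of_ne {i j : s.Vertex} (h : s.dag i ≠ j) (u : C.S i) (v : C.S j)
    (x : R ⊗[s.k₀] C.M i) (y : R ⊗[s.k₀] C.M j) :
    s.formR R (C.evR R i u x) (C.evR R j v y) = 0 := by
  have h1 := extPair_map (R := R) (a := C.ev i u) (b := C.ev j v) (c := (0 : s.F →ₗ[s.k₀] s.F))
    (B := s.formK.compl₁₂ (C.ev i u) (C.ev j v)) (B' := s.formK)
    (fun x y => C.form_eq_zero_of_ne h x y u v) x y
  rw [h1, LinearMap.baseChange_zero, LinearMap.zero_apply]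

theorem isometry_of_isComp {G : R ⊗[s.k₀] s.V ≃ₗ[R] R ⊗[s.k₀] s.V} {g : ∀ i, C.AutR i R}
    (hG : ∀ i, C.IsComp G.toLinearMap i (g i).toLinearMap)
    (h : ∀ i j, s.dag i = j → ∀ x y u v,
      s.formR R (C.evR R i u (g i x)) (C.evR R j v (g j y)) =
      s.formR R (C.evR R i u x) (C.evR R j v y)) : G ∈ isometryPts s.k₀ s.formK R := by
  have hG' : ∀ i u x, G (C.evR R i u x) = C.evR R i u (g i x) := fun i => hG i
  have h1 : ∀ j v y x, s.formR R (G x) (G (C.evR R j v y)) = s.formR R x (C.evR R j v y) := by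
    intro j v y x
    let f₁ := ((s.formR R).flip (G (C.evR R j v y))).toAddMonoidHom.comp
      G.toLinearMap.toAddMonoidHom
    let f₂ := ((s.formR R).flip (C.evR R j v y)).toAddMonoidHom
    have h2 : f₁ = f₂ := C.evR_ext fun i u x => by
      change s.formR R (G _) (G _) = s.formR R _ _
      rw [hG', hG']
      by_cases hij : s.dag i = j
      · exact h i j hij x y u v
      · rw [C.formR_evR_of_ne hij, C.formR_evR_of_ne hij]
    exact DFunLike.congr_fun h2 x
  intro x y
  let f₁ := (s.formR R (G x)).toAddMonoidHom.comp G.toLinearMap.toAddMonoidHom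
  let f₂ := (s.formR R x).toAddMonoidHom
  have h2 : f₁ = f₂ := C.evR_ext fun i u y => h1 i u y x
  exact DFunLike.congr_fun h2 y

theorem formR_evR_flip {i j : s.Vertex} {g : C.AutR i R} {T : C.AutR j R}
    (h : ∀ x y u v, s.formR R (C.evR R i u (g x)) (C.evR R j v (T y)) =
      s.formR R (C.evR R i u x) (C.evR R j v y)) (y x v u) :
    s.formR R (C.evR R j v (T y)) (C.evR R i u (g x)) =
      s.formR R (C.evR R j v y) (C.evR R i u x) := by
  rw [s.formR_symm, h, ← s.formR_symm]

/-- Extend `g` by the identity at all other vertices to an automorphism of `R ⊗ V`, take the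
contragredient there, and restrict it to the part at `j`. -/
theorem exists_isContragredient (i j : s.Vertex) (h : s.dag i = j) {g : C.AutR i R}
    (hg : g ∈ C.GLD i R) : ∃ T, C.IsContragredient i j h g T := by
  classical
  let f : ∀ i, C.AutR i R := Function.update (fun _ => 1) i g
  have hf : f i = g := Function.update_self _ _ _
  obtain ⟨G, h1, h2⟩ := C.exists_of_isComp f (fun i' => by
    by_cases hi : i' = i
    · subst hi
      rw [hf]
      exact hg
    · rw [show f i' = 1 from Function.update_of_ne hi _ _]
      exact one_mem _)
  obtain ⟨G', h3, h4⟩ := s.exists_contragredientR h1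
  obtain ⟨T, h5, h6⟩ := C.exists_isComp h3 j
  refine ⟨T, h5, (C.pairLR_isometry_iff i j h hg T).2 fun x y u v => ?_⟩
  have h7 : G (C.evR R i u x) = C.evR R i u (g x) := by
    have := h2 i u x
    rwa [hf] at this
  have h8 : G' (C.evR R j v y) = C.evR R j v (T y) := h6 v y
  rw [← h7, ← h8, h4]

/-- Two contragredients pair equally with the part at `i`, and trivially with all other parts; the
pairing on `R ⊗ V` is nondegenerate. -/
theorem isContragredient_unique {i j : s.Vertex} (h : s.dag i = j) {g : C.AutR i R}
    (hg : g ∈ C.GLD i R) {T T' : C.AutR j R} (hT : C.IsContragredient i j h g T)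
    (hT' : C.IsContragredient i j h g T') : T = T' := by
  have h1 := (C.pairLR_isometry_iff i j h hg T).1 hT.2
  have h2 := (C.pairLR_isometry_iff i j h hg T').1 hT'.2
  refine LinearEquiv.ext fun y => C.evR_gen_injective j ?_
  rw [← sub_eq_zero]
  refine s.formR_nondegenerate_right _ fun x => ?_
  rw [map_sub, sub_eq_zero]
  let f₁ := ((s.formR R).flip (C.evR R j (C.gen j) (T y))).toAddMonoidHom
  let f₂ := ((s.formR R).flip (C.evR R j (C.gen j) (T' y))).toAddMonoidHom
  have h3 : f₁ = f₂ := C.evR_ext fun i' u x => by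
    change s.formR R _ _ = s.formR R _ _
    by_cases hi : s.dag i' = j
    · obtain rfl : i = i' := by rw [← s.dag_dag i, h, ← hi, s.dag_dag]
      obtain ⟨x, rfl⟩ := g.surjective x
      rw [h1, h2]
    · rw [C.formR_evR_of_ne hi, C.formR_evR_of_ne hi]
  exact DFunLike.congr_fun h3 x

end

end Choices
end Datum
end
end CyclicGrading

namespace CyclicGrading
noncomputable section
namespace Datum
variable {k : Type u} [Field k] {σk : k ≃+* k} {s : Datum k σk}

theorem orbit_next (i : s.Vertex) : s.orbit (s.next i) = s.orbit i :=
  (Quotient.sound (Relation.EqvGen.rel i (s.next i) (Or.inl rfl))).symm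

theorem orbit_dag (i : s.Vertex) : s.orbit (s.dag i) = s.orbit i :=
  (Quotient.sound (Relation.EqvGen.rel i (s.dag i) (Or.inr rfl))).symm

namespace Choices
variable (C : s.Choices)

section

variable {R : Type u} [CommRing R] [Algebra s.k₀ R]

/-! ### The components of the elements of `H` -/

theorem isContragredient_of_mem_H {G : R ⊗[s.k₀] s.V ≃ₗ[R] R ⊗[s.k₀] s.V} (hG : G ∈ s.H R)
    {i j : s.Vertex} (h : s.dag i = j) {g : C.AutR i R} {T : C.AutR j R} (hg : g ∈ C.GLD i R)
    (hT : T ∈ C.GLD j R) (hGg : C.IsComp G.toLinearMap i g.toLinearMap)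
    (hGT : C.IsComp G.toLinearMap j T.toLinearMap) : C.IsContragredient i j h g T := by
  refine ⟨hT, (C.pairLR_isometry_iff i j h hg T).2 fun x y u v => ?_⟩
  have h1 : G (C.evR R i u x) = C.evR R i u (g x) := hGg u x
  have h2 : G (C.evR R j v y) = C.evR R j v (T y) := hGT v y
  rw [← h1, ← h2]
  exact ((mem_H_iff G).1 hG).2 _ _

theorem exists_mem_H (g : ∀ i, C.AutR i R) (hg : ∀ i, g i ∈ C.GLD i R)
    (h : ∀ i j (hij : s.dag i = j), ∀ x y, extPair s.k₀ R (C.pairL i j hij) (g i x) (g j y) =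
      extPair s.k₀ R (C.pairL i j hij) x y) :
    ∃ G ∈ s.H R, ∀ i, C.IsComp G.toLinearMap i (g i).toLinearMap := by
  obtain ⟨G, h1, h2⟩ := C.exists_of_isComp g hg
  exact ⟨G, (mem_H_iff G).2 ⟨h1, C.isometry_of_isComp h2 fun i j hij =>
    (C.pairLR_isometry_iff i j hij (hg i) (g j)).1 (h i j hij)⟩, h2⟩

/-- The detour over the `F`-valued pairing is needed because `{·,·}_i` and `{·,·}_j` take values in
different fields in general, whereas the pairing on `V` is `ε`-Hermitian. -/
theorem extPair_pairL_flip {i j : s.Vertex} (h : s.dag i = j) (h' : s.dag j = i) {g : C.AutR i R}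
    {T : C.AutR j R} (hg : g ∈ C.GLD i R) (hT : C.IsContragredient i j h g T) :
    C.IsContragredient j i h' T g :=
  ⟨hg, (C.pairLR_isometry_iff j i h' hT.1 g).2
    (C.formR_evR_flip ((C.pairLR_isometry_iff i j h hg T).1 hT.2))⟩

theorem mem_isotypic (i : s.Vertex) (x : C.M i) (u : C.S i) : x u ∈ s.isotypic i := fun l hl => by
  rw [← map_smul, C.support i l hl, map_zero]

theorem isComp_id_of_fix {G : R ⊗[s.k₀] s.V →ₗ[R] R ⊗[s.k₀] s.V} {i : s.Vertex}
    (h : ∀ v ∈ s.isotypic i, G (1 ⊗ₜ v) = 1 ⊗ₜ v) : C.IsComp G i LinearMap.id := fun u x => by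
  rw [LinearMap.id_apply]
  induction x with
  | zero => simp
  | add x y hx hy => rw [map_add, map_add, hx, hy]
  | tmul r x =>
    have h1 : C.evR R i u (r ⊗ₜ x) = r • (1 ⊗ₜ x u) := by
      rw [LinearMap.baseChange_tmul, TensorProduct.smul_tmul', smul_eq_mul, mul_one]
      rfl
    rw [h1, map_smul, h _ (C.mem_isotypic i x u)]

theorem coord_smul_of_mem_isotypic {i j : s.Vertex} (hij : i ≠ j) (q : s.A) {v : s.V}
    (hv : v ∈ s.isotypic j) : C.coord i (q • v) = 0 := by
  refine LinearMap.ext fun w => ?_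
  rw [coord_apply, ← (C.supportedAt i).idem_smul w, map_smul, smul_eq_mul, s.ofL_central, mul_smul,
    ← mul_smul (s.ofL _) q, s.ofL_central, mul_smul, hv, smul_zero, smul_zero]
  · rfl
  · rw [← s.toLat_eq_zero, s.toLat_idem, if_neg hij.symm]

/-- In the expansion of an isotypic vector only the terms at its own vertex survive. -/
theorem eq_on_isotypic {Y : Type*} [AddCommGroup Y] {f g : R ⊗[s.k₀] s.V →+ Y} {i : s.Vertex}
    (h : ∀ u x, f (C.evR R i u x) = g (C.evR R i u x)) {v : s.V} (hv : v ∈ s.isotypic i) :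
    f (1 ⊗ₜ v) = g (1 ⊗ₜ v) := by
  obtain ⟨ι, _, w, q, -, h2⟩ := C.exists_evR_expansion
  rw [← h2 R (1 ⊗ₜ v), Finset.sum_eq_single i]
  · simp only [map_sum, h]
  · intro j _ hj
    refine Finset.sum_eq_zero fun m _ => ?_
    rw [extAct, LinearMap.baseChange_tmul, LinearMap.baseChange_tmul]
    have h3 : C.coord j (DistribSMul.toLinearMap s.k₀ s.V (q j m) v) = 0 :=
      C.coord_smul_of_mem_isotypic hj _ hv
    rw [h3, TensorProduct.tmul_zero, map_zero]
  · simp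

theorem mem_Hα_iff (α : s.Orbit) (G : R ⊗[s.k₀] s.V ≃ₗ[R] R ⊗[s.k₀] s.V) :
    G ∈ s.Hα α R ↔ G ∈ s.H R ∧
      ∀ i, s.orbit i ≠ α → C.IsComp G.toLinearMap i LinearMap.id := by
  refine ⟨fun h => ⟨h.1, fun i hi => C.isComp_id_of_fix fun v hv => h.2 i hi v hv⟩,
    fun h => ⟨h.1, fun i hi v hv => ?_⟩⟩
  exact C.eq_on_isotypic (f := G.toLinearMap.toAddMonoidHom) (g := AddMonoidHom.id _)
    (fun u x => h.2 i hi u x) hv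

/-- An automorphism in `H` has components. -/
theorem exists_isComp_of_mem_H {G : R ⊗[s.k₀] s.V ≃ₗ[R] R ⊗[s.k₀] s.V} (hG : G ∈ s.H R)
    (i : s.Vertex) : ∃ g ∈ C.GLD i R, C.IsComp G.toLinearMap i g.toLinearMap :=
  C.exists_isComp ((mem_H_iff G).1 hG).1 i

theorem isComp_mul {G G' : R ⊗[s.k₀] s.V ≃ₗ[R] R ⊗[s.k₀] s.V} {i : s.Vertex} {g g' : C.AutR i R}
    (h : C.IsComp G.toLinearMap i g.toLinearMap) (h' : C.IsComp G'.toLinearMap i g'.toLinearMap) :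
    C.IsComp (G * G').toLinearMap i (g * g').toLinearMap :=
  h.mul h'

theorem isComp_unique {G : R ⊗[s.k₀] s.V ≃ₗ[R] R ⊗[s.k₀] s.V} {i : s.Vertex} {g g' : C.AutR i R}
    (h : C.IsComp G.toLinearMap i g.toLinearMap) (h' : C.IsComp G.toLinearMap i g'.toLinearMap) :
    g = g' :=
  LinearEquiv.toLinearMap_injective (h.unique h')

theorem eq_of_isComp_equiv {G G' : R ⊗[s.k₀] s.V ≃ₗ[R] R ⊗[s.k₀] s.V} {g : ∀ i, C.AutR i R}
    (h : ∀ i, C.IsComp G.toLinearMap i (g i).toLinearMap)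
    (h' : ∀ i, C.IsComp G'.toLinearMap i (g i).toLinearMap) : G = G' :=
  LinearEquiv.toLinearMap_injective (eq_of_isComp h h')

/-! ### The decomposition of `H` -/

/-- An element of `H` is cut into pieces by replacing its components outside `α` by the identity.
The pieces preserve the pairing because an orbit contains with a vertex also its dual. -/
theorem exists_H_equiv (R : Type u) [CommRing R] [Algebra s.k₀ R] :
    ∃ Φ : s.H R ≃* ∀ α : s.Orbit, s.Hα α R, ∀ (g : s.H R) (i : s.Vertex) (h : C.AutR i R),
      C.IsComp g.1.toLinearMap i h.toLinearMap →
        C.IsComp (Φ g (s.orbit i)).1.toLinearMap i h.toLinearMap := by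
  classical
  have h1 : ∀ (G : s.H R) (α : s.Orbit), ∃ G' : s.Hα α R, ∀ i, s.orbit i = α →
      ∀ h : C.AutR i R, C.IsComp G.1.toLinearMap i h.toLinearMap →
        C.IsComp G'.1.toLinearMap i h.toLinearMap := by
    intro G α
    choose g hg hGg using C.exists_isComp_of_mem_H G.2
    -- The vertices `i` and `i†` fall on the same side of the case distinction, so both pairing
    -- conditions are inherited.
    obtain ⟨G', hG', hc⟩ := C.exists_mem_H (fun i => if s.orbit i = α then g i else 1)
      (fun i => by
        split_ifs
        · exact hg i
        · exact one_mem _)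
      (fun i j hij => by
        have hj : s.orbit j = s.orbit i := by rw [← hij, orbit_dag]
        rw [hj]
        split_ifs
        · exact (C.isContragredient_of_mem_H G.2 hij (hg i) (hg j) (hGg i) (hGg j)).2
        · exact fun _ _ => rfl)
    refine ⟨⟨G', (C.mem_Hα_iff α G').2 ⟨hG', fun i hi => ?_⟩⟩, fun i hi h hh => ?_⟩
    · have := hc i
      rw [if_neg hi] at this
      exact this
    · have := hc i
      rw [if_pos hi] at this
      rwa [← C.isComp_unique (hGg i) hh]
  choose f hf using h1
  have huniq : ∀ (α : s.Orbit) (G₁ G₂ : s.Hα α R), (∀ i, s.orbit i = α → ∃ h : C.AutR i R,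
      C.IsComp G₁.1.toLinearMap i h.toLinearMap ∧ C.IsComp G₂.1.toLinearMap i h.toLinearMap) →
      G₁ = G₂ := by
    intro α G₁ G₂ h
    have h2 : ∀ i, ∃ h : C.AutR i R, C.IsComp G₁.1.toLinearMap i h.toLinearMap ∧
        C.IsComp G₂.1.toLinearMap i h.toLinearMap := by
      intro i
      by_cases hi : s.orbit i = α
      · exact h i hi
      · exact ⟨1, ((C.mem_Hα_iff α _).1 G₁.2).2 i hi, ((C.mem_Hα_iff α _).1 G₂.2).2 i hi⟩
    choose h h3 h4 using h2
    exact Subtype.ext (C.eq_of_isComp_equiv h3 h4)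
  let F : s.H R →* ∀ α : s.Orbit, s.Hα α R := MonoidHom.mk' f (fun G G' => funext fun α => by
    refine huniq α _ _ fun i hi => ?_
    obtain ⟨g, -, hg⟩ := C.exists_isComp_of_mem_H G.2 i
    obtain ⟨g', -, hg'⟩ := C.exists_isComp_of_mem_H G'.2 i
    exact ⟨g * g', hf _ α i hi _ (C.isComp_mul hg hg'),
      C.isComp_mul (hf _ α i hi _ hg) (hf _ α i hi _ hg')⟩)
  have hF : Function.Bijective F := by
    constructor
    · intro G₁ G₂ h
      choose g _ hg using C.exists_isComp_of_mem_H G₁.2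
      choose g' _ hg' using C.exists_isComp_of_mem_H G₂.2
      refine Subtype.ext (C.eq_of_isComp_equiv hg fun i => ?_)
      have h2 := hf G₁ _ i rfl _ (hg i)
      have h3 := hf G₂ _ i rfl _ (hg' i)
      have h4 : f G₁ (s.orbit i) = f G₂ (s.orbit i) := congrFun h _
      rw [h4] at h2
      rw [C.isComp_unique h2 h3]
      exact hg' i
    · intro G
      choose g hg hg' using fun i => C.exists_isComp_of_mem_H (G (s.orbit i)).2.1 i
      obtain ⟨G', hG', hc⟩ := C.exists_mem_H g hg (fun i j hij => by
        have hj : s.orbit j = s.orbit i := by rw [← hij, orbit_dag]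
        have h2 := hg' j
        rw [hj] at h2
        exact (C.isContragredient_of_mem_H (G (s.orbit i)).2.1 hij (hg i) (hg j) (hg' i) h2).2)
      refine ⟨⟨G', hG'⟩, funext fun α => huniq α _ _ fun i hi => ⟨g i, ?_, ?_⟩⟩
      · exact hf _ α i hi _ (hc i)
      · subst hi
        exact hg' i
  exact ⟨MulEquiv.ofBijective F hF, fun G i h hh => hf G _ i rfl h hh⟩

theorem exists_H_equiv_isotypic (C : s.Choices) :
    ∃ Φ : ∀ (R : Type u) [CommRing R] [Algebra s.k₀ R], s.H R ≃* ∀ α : s.Orbit, s.Hα α R,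
      ∀ (R : Type u) [CommRing R] [Algebra s.k₀ R] (g : s.H R) (i : s.Vertex),
        ∀ v ∈ s.isotypic i, (Φ R g (s.orbit i)).1 ((1 : R) ⊗ₜ[s.k₀] v) = g.1 (1 ⊗ₜ v) := by
  refine ⟨fun R _ _ => (C.exists_H_equiv R).choose, fun R _ _ g i v hv => ?_⟩
  obtain ⟨h, -, hh⟩ := C.exists_isComp_of_mem_H g.2 i
  have h1 := (C.exists_H_equiv R).choose_spec g i h hh
  exact C.eq_on_isotypic (f := AddMonoidHomClass.toAddMonoidHom
    ((C.exists_H_equiv R).choose g (s.orbit i)).1)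
    (g := AddMonoidHomClass.toAddMonoidHom g.1) (fun u x => (h1 u x).trans (hh u x).symm) hv

/-! ### The description of `H^α` -/

/-- The labels represent each dual pair of vertices in `α` once. The component at the dual of a
label is forced to be the contragredient, and at a self-dual label this forces an isometry; outside
`α` the components are trivial. -/
theorem exists_Hα_equiv (α : s.Orbit) {J : Type} (v : J → s.Vertex) (hv : Function.Injective v)
    (hdag : ∀ j j', s.dag (v j) = v j' → j = j')
    (hmem : ∀ i, s.orbit i = α ↔ ∃ j, i = v j ∨ i = s.dag (v j))
    (R : Type u) [CommRing R] [Algebra s.k₀ R] (G : ∀ j, Subgroup (C.AutR (v j) R))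
    (hG : ∀ j g, g ∈ G j ↔ g ∈ C.GLD (v j) R ∧
      ∀ h : s.dag (v j) = v j, g ∈ isometryPts s.k₀ (C.pairL (v j) (v j) h) R) :
    ∃ Φ : s.Hα α R ≃* ∀ j, G j, ∀ g j,
      C.IsComp g.1.toLinearMap (v j) (Φ g j).1.toLinearMap := by
  classical
  have h1 : ∀ (g : s.Hα α R) (j : J), ∃ h : G j,
      C.IsComp g.1.toLinearMap (v j) h.1.toLinearMap := by
    intro g j
    obtain ⟨h, h1, h2⟩ := C.exists_isComp_of_mem_H g.2.1 (v j)
    exact ⟨⟨h, (hG j h).2 ⟨h1, fun hd =>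
      (C.isContragredient_of_mem_H g.2.1 hd h1 h1 h2 h2).2⟩⟩, h2⟩
  choose f hf using h1
  let F : s.Hα α R →* ∀ j, G j := MonoidHom.mk' f (fun g g' => funext fun j => Subtype.ext
    (C.isComp_unique (hf (g * g') j) (C.isComp_mul (hf g j) (hf g' j))))
  have hF : Function.Bijective F := by
    constructor
    · intro g₁ g₂ h
      have h2 : ∀ i, ∃ h : C.AutR i R, C.IsComp g₁.1.toLinearMap i h.toLinearMap ∧
          C.IsComp g₂.1.toLinearMap i h.toLinearMap := by
        intro i
        by_cases hi : s.orbit i = α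
        · have h3 : ∀ j, f g₁ j = f g₂ j := fun j => congrFun h j
          obtain ⟨j, rfl | rfl⟩ := (hmem i).1 hi
          · exact ⟨_, hf g₁ j, h3 j ▸ hf g₂ j⟩
          · obtain ⟨T₁, h4, h5⟩ := C.exists_isComp_of_mem_H g₁.2.1 (s.dag (v j))
            obtain ⟨T₂, h6, h7⟩ := C.exists_isComp_of_mem_H g₂.2.1 (s.dag (v j))
            have h8 := ((hG j _).1 (f g₁ j).2).1
            refine ⟨T₁, h5, ?_⟩
            rwa [C.isContragredient_unique rfl h8
              (C.isContragredient_of_mem_H g₁.2.1 rfl h8 h4 (hf g₁ j) h5)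
              (C.isContragredient_of_mem_H g₂.2.1 rfl h8 h6 (h3 j ▸ hf g₂ j) h7)]
        · exact ⟨1, ((C.mem_Hα_iff α _).1 g₁.2).2 i hi, ((C.mem_Hα_iff α _).1 g₂.2).2 i hi⟩
      choose h h3 h4 using h2
      exact Subtype.ext (C.eq_of_isComp_equiv h3 h4)
    · intro g
      have hg : ∀ j, (g j).1 ∈ C.GLD (v j) R := fun j => ((hG j _).1 (g j).2).1
      -- The full family of components: `g j` at a label, its contragredient at the dual of a label,
      -- and 1 elsewhere. The clauses overlap at self-dual labels, where they agree because `g j` is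
      -- an isometry.
      have h2 : ∀ i, ∃ h ∈ C.GLD i R, (∀ j (e : v j = i), h = e ▸ (g j).1) ∧
          (∀ j (e : s.dag (v j) = i), C.IsContragredient (v j) i e (g j).1 h) ∧
          (s.orbit i ≠ α → h = 1) := by
        intro i
        by_cases hi : ∃ j, v j = i
        · obtain ⟨j, rfl⟩ := hi
          refine ⟨(g j).1, hg j, fun j' e => ?_, fun j' e => ?_, fun h => ?_⟩
          · obtain rfl := hv e
            rfl
          · obtain rfl := hdag _ _ e
            exact ⟨hg j', ((hG j' _).1 (g j').2).2 e⟩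
          · exact absurd ((hmem _).2 ⟨j, Or.inl rfl⟩) h
        · by_cases hi' : ∃ j, s.dag (v j) = i
          · obtain ⟨j, rfl⟩ := hi'
            obtain ⟨T, hT⟩ := C.exists_isContragredient (v j) _ rfl (hg j)
            refine ⟨T, hT.1, fun j' e => absurd ⟨j', e⟩ hi, fun j' e => ?_, fun h => ?_⟩
            · have h3 : v j' = v j := by rw [← s.dag_dag (v j'), e, s.dag_dag]
              obtain rfl := hv h3
              exact hT
            · exact absurd ((hmem _).2 ⟨j, Or.inr rfl⟩) h
          · exact ⟨1, one_mem _, fun j' e => absurd ⟨j', e⟩ hi, fun j' e => absurd ⟨j', e⟩ hi',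
              fun _ => rfl⟩
      choose h hh h3 h4 h5 using h2
      have h3' : ∀ j, h (v j) = (g j).1 := fun j => h3 (v j) j rfl
      obtain ⟨G', hG', hc⟩ := C.exists_mem_H h hh (fun i i' hi => by
        by_cases hα : s.orbit i = α
        · obtain ⟨j, rfl | rfl⟩ := (hmem i).1 hα
          · rw [h3']
            exact (h4 i' j hi).2
          · have h6 : i' = v j := by rw [← hi, s.dag_dag]
            subst h6
            rw [h3']
            exact (C.extPair_pairL_flip rfl hi (hg j) (h4 _ j rfl)).2
        · have h6 : s.orbit i' ≠ α := by rwa [← hi, orbit_dag]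
          rw [h5 i hα, h5 i' h6]
          exact fun _ _ => rfl)
      refine ⟨⟨G', (C.mem_Hα_iff α G').2 ⟨hG', fun i hi => ?_⟩⟩, funext fun j => Subtype.ext ?_⟩
      · have := hc i
        rw [h5 i hi] at this
        exact this
      · rw [← h3' j]
        exact C.isComp_unique (hf _ j) (hc (v j))
  exact ⟨MulEquiv.ofBijective F hF, hf⟩

end

/-- Evaluation at the generator is injective and commutes with the change of coefficients, so
naturality passes from `V` to the multiplicity spaces. -/
theorem isBaseChangeAlong_of_isComp {R R' : Type u} [CommRing R] [Algebra s.k₀ R] [CommRing R']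
    [Algebra s.k₀ R'] {f : R →ₐ[s.k₀] R'} {G : R ⊗[s.k₀] s.V ≃ₗ[R] R ⊗[s.k₀] s.V}
    {G' : R' ⊗[s.k₀] s.V ≃ₗ[R'] R' ⊗[s.k₀] s.V} (h : IsBaseChangeAlong s.k₀ f G G')
    {i : s.Vertex} {g : C.AutR i R} {g' : C.AutR i R'}
    (hg : C.IsComp G.toLinearMap i g.toLinearMap)
    (hg' : C.IsComp G'.toLinearMap i g'.toLinearMap) : IsBaseChangeAlong s.k₀ f g g' := by
  have h1 : ∀ (u : C.S i) (x : R ⊗[s.k₀] C.M i), C.evR R' i u (f.toLinearMap.rTensor _ x) =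
      f.toLinearMap.rTensor _ (C.evR R i u x) := by
    intro u x
    induction x with
    | zero => simp
    | add x y hx hy => simp only [map_add, hx, hy]
    | tmul r x => simp
  intro x
  refine C.evR_gen_injective i ?_
  have h2 : G' (C.evR R' i (C.gen i) (f.toLinearMap.rTensor _ x)) =
      C.evR R' i (C.gen i) (g' (f.toLinearMap.rTensor _ x)) := hg' _ _
  have h3 : G (C.evR R i (C.gen i) x) = C.evR R i (C.gen i) (g x) := hg _ _
  rw [← h2, h1, h1, h, h3]

end Choices
end Datum
end
end CyclicGrading

namespace CyclicGrading
noncomputable section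
namespace Datum
variable {k : Type u} [Field k] {σk : k ≃+* k} {s : Datum k σk}

/-! ### The decomposition of `g(ξ)` -/

/-- So `φ` is an `A_β`-linear map from the twist of `V` by `ξ` to `V`. -/
theorem smul_apply_of_twisted {φ : s.V →ₗ[s.F] s.V}
    (hφ : ∀ v, s.θ (φ v) = (s.ξ : s.F) • φ (s.θ v)) (z : s.A) (v : s.V) :
    z • φ v = φ (s.twist z • v) := by
  induction z using s.A_induction generalizing v with
  | h_incl a => rw [twist_incl, incl_smul, incl_smul, map_smul]
  | hθ => rw [twist_θA, mul_smul, θA_smul, θA_smul, incl_smul, map_smul, hφ]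
  | hadd x y hx hy => rw [add_smul, hx, hy, map_add, add_smul, map_add]
  | hmul x y hx hy => rw [mul_smul, hy, hx, map_mul, mul_smul]

theorem toLat_mu {i : s.Vertex} {l l' : s.L} (h : s.toLat (s.next i) l = s.toLat (s.next i) l') :
    s.toLat i (s.mu l) = s.toLat i (s.mu l') := by
  rw [← sub_eq_zero, ← map_sub, ← map_sub, toLat_eq_zero]
  change _ ∈ (s.next i).asIdeal
  rw [← toLat_eq_zero, map_sub, h, sub_self]

theorem toLat_sigmaC {i : s.Vertex} {l l' : s.L} (h : s.toLat (s.dag i) l = s.toLat (s.dag i) l') :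
    s.toLat i (s.sigmaC l) = s.toLat i (s.sigmaC l') := by
  rw [← sub_eq_zero, ← map_sub, ← map_sub, toLat_eq_zero]
  change _ ∈ (s.dag i).asIdeal
  rw [← toLat_eq_zero, map_sub, h, sub_self]

open Classical in
variable (s) in
/-- The idempotent of `L_β` that belongs to a union of components. -/
def orbitIdem (α : s.Orbit) : s.L := ∑ i with s.orbit i = α, s.idem i

open Classical in
theorem toLat_orbitIdem (α : s.Orbit) (i : s.Vertex) :
    s.toLat i (s.orbitIdem α) = if s.orbit i = α then 1 else 0 := by
  rw [orbitIdem, map_sum]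
  simp only [toLat_idem]
  rw [Finset.sum_ite_eq]
  simp

/-- An orbit is closed under the passage to the next vertex, so its idempotent has the same residues
before and after `μ_ξ`. -/
theorem mu_orbitIdem (α : s.Orbit) : s.mu (s.orbitIdem α) = s.orbitIdem α := by
  classical
  refine s.L_ext fun i => ?_
  rw [toLat_orbitIdem]
  split_ifs with h
  · rw [toLat_mu (l' := 1), map_one, map_one]
    rw [toLat_orbitIdem, orbit_next, if_pos h, map_one]
  · rw [toLat_mu (l' := 0), map_zero, map_zero]
    rw [toLat_orbitIdem, orbit_next, if_neg h, map_zero]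

theorem sigmaC_orbitIdem (α : s.Orbit) : s.sigmaC (s.orbitIdem α) = s.orbitIdem α := by
  classical
  refine s.L_ext fun i => ?_
  rw [toLat_orbitIdem]
  split_ifs with h
  · rw [toLat_sigmaC (l' := 1), map_one, map_one]
    rw [toLat_orbitIdem, orbit_dag, if_pos h, map_one]
  · rw [toLat_sigmaC (l' := 0), map_zero, map_zero]
    rw [toLat_orbitIdem, orbit_dag, if_neg h, map_zero]

instance : Fintype s.Orbit := Fintype.ofFinite _

theorem sum_orbitIdem : ∑ α, s.orbitIdem α = 1 := by
  classical
  refine s.L_ext fun i => ?_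
  rw [map_sum, map_one]
  simp only [toLat_orbitIdem]
  rw [Finset.sum_ite_eq]
  simp

theorem isotypic_smul_eq {i : s.Vertex} {v : s.V} (hv : v ∈ s.isotypic i) {l l' : s.L}
    (h : s.toLat i l = s.toLat i l') : s.ofL l • v = s.ofL l' • v := by
  rw [← sub_eq_zero, ← sub_smul, ← map_sub]
  refine hv _ ?_
  rw [← toLat_eq_zero, map_sub, h, sub_self]

theorem idem_smul_mem_isotypic (i : s.Vertex) (v : s.V) : s.ofL (s.idem i) • v ∈ s.isotypic i :=
  fun l hl => by
    classical
    rw [← mul_smul, ← map_mul]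
    have h : l * s.idem i = 0 := s.L_ext fun j => by
      rw [map_mul, toLat_idem, map_zero]
      split_ifs with hj
      · subst hj
        rw [(s.toLat_eq_zero j l).2 hl, zero_mul]
      · rw [mul_zero]
    rw [h, map_zero, zero_smul]

variable (s) in
/-- The projection of `V` onto the part that belongs to a union of components. -/
def orbitProj (α : s.Orbit) : s.V →ₗ[s.F] s.V where
  toFun v := s.ofL (s.orbitIdem α) • v
  map_add' := smul_add _
  map_smul' a v := by
    rw [RingHom.id_apply, ← incl_smul, ← incl_smul, ← mul_smul, ofL_central, mul_smul]

theorem orbitProj_apply (α : s.Orbit) (v : s.V) :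
    s.orbitProj α v = s.ofL (s.orbitIdem α) • v := rfl

theorem orbitProj_of_mem {i : s.Vertex} {α : s.Orbit} (h : s.orbit i = α) {v : s.V}
    (hv : v ∈ s.isotypic i) : s.orbitProj α v = v := by
  classical
  rw [orbitProj_apply, isotypic_smul_eq hv (l' := 1), map_one, one_smul]
  rw [toLat_orbitIdem, if_pos h, map_one]

theorem orbitProj_of_mem_of_ne {i : s.Vertex} {α : s.Orbit} (h : s.orbit i ≠ α) {v : s.V}
    (hv : v ∈ s.isotypic i) : s.orbitProj α v = 0 := by
  classical
  rw [orbitProj_apply, isotypic_smul_eq hv (l' := 0), map_zero, zero_smul]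
  rw [toLat_orbitIdem, if_neg h, map_zero]

theorem sum_orbitProj (v : s.V) : ∑ α, s.orbitProj α v = v := by
  simp only [orbitProj_apply]
  rw [← Finset.sum_smul, ← map_sum, sum_orbitIdem, map_one, one_smul]

theorem apply_orbitProj_of_ne {α α' : s.Orbit} (h : α' ≠ α) (φ : s.gξα α) (v : s.V) :
    φ.1 (s.orbitProj α' v) = 0 := by
  classical
  rw [orbitProj_apply, orbitIdem, map_sum, Finset.sum_smul, map_sum]
  refine Finset.sum_eq_zero fun i hi => φ.2.2 i ?_ _ (idem_smul_mem_isotypic i v)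
  rw [(Finset.mem_filter.1 hi).2]
  exact h

theorem apply_orbitProj {α : s.Orbit} (φ : s.gξα α) (v : s.V) :
    φ.1 (s.orbitProj α v) = φ.1 v := by
  conv_rhs => rw [← sum_orbitProj v, map_sum]
  rw [Finset.sum_eq_single α]
  · intro α' _ h
    exact apply_orbitProj_of_ne h φ v
  · simp

/-- The idempotent of an orbit is central and fixed by both `μ_ξ` and `σ_c`. So the projection
commutes with `φ` and is self-adjoint, and truncation keeps the conditions that define `g(ξ)`. -/
theorem comp_orbitProj_mem (α : s.Orbit) (φ : s.gξ) : φ.1 ∘ₗ s.orbitProj α ∈ s.gξα α := by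
  refine ⟨⟨fun v => ?_, fun x y => ?_⟩, fun i hi v hv => ?_⟩
  · rw [LinearMap.comp_apply, LinearMap.comp_apply, φ.2.1, orbitProj_apply, orbitProj_apply,
      ← θA_smul, ← mul_smul, ← ofL_central, mul_smul, θA_smul]
  · rw [LinearMap.comp_apply, LinearMap.comp_apply]
    have h1 := φ.2.2 x (s.orbitProj α y)
    have h2 := s.isAdmissible_formHom.ofL_smul (s.orbitIdem α) (φ.1 x) y
    rw [formHom_apply, formHom_apply, smul_apply_of_twisted φ.2.1, twist_ofL, mu_orbitIdem,
      sigmaC_orbitIdem] at h2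
    rw [orbitProj_apply, h2, ← orbitProj_apply]
    exact h1
  · rw [LinearMap.comp_apply, orbitProj_of_mem_of_ne hi hv, map_zero]

variable (s) in
theorem exists_gξ_equiv : ∃ Ψ : s.gξ ≃ₗ[s.k₀] ∀ α : s.Orbit, s.gξα α,
    ∀ (φ : s.gξ) (i : s.Vertex), ∀ v ∈ s.isotypic i, (Ψ φ (s.orbit i)).1 v = φ.1 v := by
  let f : s.gξ →ₗ[s.k₀] ∀ α : s.Orbit, s.gξα α :=
    { toFun := fun φ α => ⟨_, comp_orbitProj_mem α φ⟩
      map_add' := fun φ ψ => rfl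
      map_smul' := fun a φ => rfl }
  have hf : ∀ φ α v, (f φ α).1 v = φ.1 (s.orbitProj α v) := fun _ _ _ => rfl
  have hf' : Function.Bijective f := by
    constructor
    · intro φ ψ h
      refine Subtype.ext (LinearMap.ext fun v => ?_)
      rw [← sum_orbitProj v, map_sum, map_sum]
      refine Finset.sum_congr rfl fun α _ => ?_
      rw [← hf, ← hf, h]
    · intro ψ
      have hmem : ∑ α, (ψ α).1 ∈ s.gξ := Submodule.sum_mem _ fun α _ => (ψ α).2.1
      refine ⟨⟨_, hmem⟩, funext fun α => Subtype.ext (LinearMap.ext fun v => ?_)⟩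
      rw [hf, LinearMap.sum_apply, Finset.sum_eq_single α, apply_orbitProj]
      · intro α' _ h
        exact apply_orbitProj_of_ne h.symm _ v
      · simp
  refine ⟨LinearEquiv.ofBijective f hf', fun φ i v hv => ?_⟩
  change φ.1 (s.orbitProj (s.orbit i) v) = _
  rw [orbitProj_of_mem rfl hv]

end Datum
end
end CyclicGrading

namespace CyclicGrading
noncomputable section
namespace Datum
variable {k : Type u} [Field k] {σk : k ≃+* k} {s : Datum k σk}

/-! ### Self-dual arrows -/

theorem IsTwistedIso.map_twist {P Q : Type u} [AddCommGroup P] [Module s.A P] [AddCommGroup Q]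
    [Module s.A Q] {f : P →+ Q} (hf : s.IsTwistedIso f) (z : s.A) (u : P) :
    f (s.twist z • u) = z • f u := by
  induction z using s.A_induction generalizing u with
  | h_incl a => rw [twist_incl, hf.map_smul]
  | hθ => rw [twist_θA, mul_smul, hf.map_theta]
  | hadd x y hx hy => rw [map_add, add_smul, map_add, hx, hy, add_smul]
  | hmul x y hx hy => rw [map_mul, mul_smul, hx, hy, mul_smul]

theorem sigmaCXi_mu (l : s.L) : s.sigmaCXi (s.mu l) = s.sigmaC l := by
  rw [← mu_comp_sigmaC]
  exact RingHom.congr_fun s.mu_comp_sigmaC_comp_mu l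

theorem sigmaCXi_sigmaCXi (l : s.L) : s.sigmaCXi (s.sigmaCXi l) = l := by
  nth_rewrite 2 [← mu_comp_sigmaC]
  rw [RingHom.comp_apply, sigmaCXi_mu]
  exact RingHom.congr_fun s.sigmaC_comp_sigmaC l

theorem mu_surjective : Function.Surjective s.mu := fun l =>
  ⟨s.sigmaC (s.sigmaCXi l), by
    have h := sigmaCXi_sigmaCXi l
    rwa [← mu_comp_sigmaC, RingHom.comp_apply, mu_comp_sigmaC] at h⟩

theorem sigmaCXiAt_toLat (i : s.Vertex) (h : s.next i = s.dag i) (l : s.L) :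
    s.sigmaCXiAt i h (s.toLat i l) = s.toLat i (s.sigmaCXi l) := rfl

theorem sigmaCXiAt_sigmaCXiAt (i : s.Vertex) (h : s.next i = s.dag i) (l : s.Lat i) :
    s.sigmaCXiAt i h (s.sigmaCXiAt i h l) = l := by
  obtain ⟨l, rfl⟩ := s.toLat_surjective i l
  rw [sigmaCXiAt_toLat, sigmaCXiAt_toLat, sigmaCXi_sigmaCXi]

namespace Choices
variable (C : s.Choices)

/-- The adjoint of an endomorphism of `S_j`, `j = i†`, with respect to `⟨·,·⟩_i`. -/
def adj (i j : s.Vertex) (h : s.dag i = j) (T : Module.End s.A (C.S j)) : Module.End s.A (C.S i) :=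
  have hT : ∀ u, ∃ u' : C.S i, ∀ v, C.pairing i j h u' v = C.pairing i j h u (T v) := fun u =>
    ((C.perfect i j h).left ((C.pairing i j h u).comp T.toAddMonoidHom) (fun a v => by
      change C.pairing i j h u (T _) = _
      rw [T.map_smul, (C.admissible i j h).smul_right]
      rfl)).exists
  s.linearOfGenerators
    (AddMonoidHom.mk' (fun u => (hT u).choose) (fun u u' => C.pairing_ext i j h fun v => by
      rw [(hT _).choose_spec, map_add, map_add, AddMonoidHom.add_apply, AddMonoidHom.add_apply,
        (hT u).choose_spec, (hT u').choose_spec]))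
    (fun a u => C.pairing_ext i j h fun v => by
      change C.pairing i j h (hT _).choose _ = C.pairing i j h (_ • (hT _).choose) _
      rw [(hT _).choose_spec, (C.admissible i j h).smul_left, (C.admissible i j h).smul_left,
        (hT u).choose_spec])
    (fun u => C.pairing_ext i j h fun v => by
      obtain ⟨w, rfl⟩ := C.θA_surjective j v
      change C.pairing i j h (hT _).choose _ = C.pairing i j h (_ • (hT _).choose) _
      rw [(hT _).choose_spec, T.map_smul, (C.admissible i j h).theta, (C.admissible i j h).theta,
        (hT u).choose_spec])

theorem pairing_adj (i j : s.Vertex) (h : s.dag i = j) (T : Module.End s.A (C.S j)) (u : C.S i)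
    (v : C.S j) : C.pairing i j h (C.adj i j h T u) v = C.pairing i j h u (T v) :=
  ((C.perfect i j h).left ((C.pairing i j h u).comp T.toAddMonoidHom) (fun a v => by
      change C.pairing i j h u (T _) = _
      rw [T.map_smul, (C.admissible i j h).smul_right]
      rfl)).exists.choose_spec v

section SelfDual

variable (i j : s.Vertex) (h : s.next i = j) (h' : s.dag i = j)

/-- The involution of `D_i` for an arrow `i → j` with `j = i†`. -/
def starD (d : C.D i) : C.D i := MulOpposite.op (C.adj i j h' (C.ηFlat i j h d).unop)

theorem pairing_starD (d : C.D i) (u v : C.S i) :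
    C.pairing i j h' ((C.starD i j h h' d).unop u) (C.η i j h v) =
      C.pairing i j h' u (C.η i j h (d.unop v)) := by
  rw [η_unop]
  exact C.pairing_adj _ _ _ _ _ _

theorem D_ext_of_pairing {d d' : C.D i} (hd : ∀ u v, C.pairing i j h' (d.unop u) (C.η i j h v) =
    C.pairing i j h' (d'.unop u) (C.η i j h v)) : d = d' :=
  MulOpposite.unop_injective (LinearMap.ext fun u => C.pairing_ext i j h' fun w => by
    obtain ⟨v, rfl⟩ := (C.η_iso i j h).bijective.2 w
    exact hd u v)

theorem starD_add (d d' : C.D i) :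
    C.starD i j h h' (d + d') = C.starD i j h h' d + C.starD i j h h' d' :=
  C.D_ext_of_pairing i j h h' fun u v => by
    rw [pairing_starD, MulOpposite.unop_add, MulOpposite.unop_add, LinearMap.add_apply,
      LinearMap.add_apply, map_add, map_add, map_add, AddMonoidHom.add_apply, pairing_starD,
      pairing_starD]

theorem starD_mul (d d' : C.D i) :
    C.starD i j h h' (d * d') = C.starD i j h h' d' * C.starD i j h h' d :=
  C.D_ext_of_pairing i j h h' fun u v => by
    rw [pairing_starD, MulOpposite.unop_mul, MulOpposite.unop_mul, Module.End.mul_apply,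
      Module.End.mul_apply, pairing_starD, pairing_starD]

/-- Thus `(u, v) ↦ ⟨u, η_e(v)⟩_i` is an `ε_e`-Hermitian form on `S_i`, and `starD` is its adjoint
involution. -/
theorem pairing_η_flip (u v : C.S i) :
    s.σ (C.pairing i j h' v (C.η i j h u)) = C.εe i • C.pairing i j h' u (C.η i j h v) :=
  C.η_adjoint i j j i h h' h' h u v

theorem starD_starD (d : C.D i) : C.starD i j h h' (C.starD i j h h' d) = d :=
  C.D_ext_of_pairing i j h h' fun u v => by
    rw [pairing_starD]
    apply s.σ.injective
    rw [pairing_η_flip, pairing_starD, pairing_η_flip]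

/-- `starD` as an isomorphism of `D_i` with its opposite. -/
def starEquiv : C.D i ≃+* (C.D i)ᵐᵒᵖ where
  toFun d := MulOpposite.op (C.starD i j h h' d)
  invFun d := C.starD i j h h' d.unop
  left_inv d := C.starD_starD i j h h' d
  right_inv d := MulOpposite.unop_injective (C.starD_starD i j h h' d.unop)
  map_mul' d d' := by rw [starD_mul]; rfl
  map_add' d d' := by rw [starD_add]; rfl

/-- `η_e` turns `μ_ξ(l)` into `l`, the pairing turns `l` into `σ_c(l)`, and `σ_{c ξ⁻¹}` composed
with `μ_ξ` is `σ_c`. Since `μ_ξ` is surjective, elements of the form `μ_ξ(l)` suffice. -/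
theorem starD_algebraMap (l : s.Lat i) :
    C.starD i j h h' (algebraMap (s.Lat i) (C.D i) l) =
      algebraMap (s.Lat i) (C.D i) (s.sigmaCXiAt i (h.trans h'.symm) l) := by
  obtain ⟨l, rfl⟩ := s.toLat_surjective i l
  obtain ⟨l, rfl⟩ := s.mu_surjective l
  rw [sigmaCXiAt_toLat, sigmaCXi_mu]
  refine C.D_ext_of_pairing i j h h' fun u v => ?_
  rw [pairing_starD]
  change C.pairing i j h' u (C.η i j h (s.ofL (s.mu l) • v)) =
    C.pairing i j h' (s.ofL (s.sigmaC l) • u) _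
  rw [← twist_ofL, (C.η_iso i j h).map_twist, (C.admissible i j h').ofL_smul]
  congr 3
  exact (RingHom.congr_fun s.sigmaC_comp_sigmaC l).symm

theorem trd_starD (d : C.D i) :
    C.trd i (C.starD i j h h' d) = s.sigmaCXiAt i (h.trans h'.symm) (C.trd i d) :=
  (C.isSplitWithTrace i).reducedTrace_anti
    (RingEquiv.ofRingHom (s.sigmaCXiAt i (h.trans h'.symm)) (s.sigmaCXiAt i (h.trans h'.symm))
      (RingHom.ext fun l => s.sigmaCXiAt_sigmaCXiAt i _ l)
      (RingHom.ext fun l => s.sigmaCXiAt_sigmaCXiAt i _ l))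
    (C.starEquiv i j h h') (fun l => C.starD_algebraMap i j h h' l) d

variable {i j h}

theorem pairD_ηFlat_smul {φ : C.M i →ₗ[s.k₀] C.M j} (hφ : φ ∈ C.HomD i j h) (d : C.D i)
    (x y : C.M i) : C.pairD i j h' x (φ (d • y)) =
      C.pairD i j h' x (φ y) * C.starD i j h h' d :=
  C.D_ext_of_pairing i j h h' fun u v => by
    rw [pairing_pairD, hφ, D_smul_apply, ← η_unop, MulOpposite.unop_mul, Module.End.mul_apply,
      pairing_starD, pairing_pairD]

theorem starD_units_smul (e : ℤˣ) (d : C.D i) :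
    C.starD i j h h' (e • d) = e • C.starD i j h h' d := by
  rw [Units.smul_def, Units.smul_def]
  exact map_zsmul (AddMonoidHom.mk' (C.starD i j h h') (C.starD_add i j h h')) _ _

/-- Exchanging the two variables costs `ε` for the pairing on `V` and `ε_e` for the form on `S_i`;
the minus sign comes from skewness. -/
theorem skew_iff_pairD (φ : C.M i →ₗ[s.k₀] C.M j) (x y : C.M i) :
    (∀ u v, s.form (φ x (C.η i j h u)) (y v) + s.form (x u) (φ y (C.η i j h v)) = 0) ↔
      C.pairD i j h' x (φ y) = -(s.ε * C.εe i) • C.starD i j h h' (C.pairD i j h' y (φ x)) := by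
  have key : ∀ u v, s.form (φ x (C.η i j h u)) (y v) = C.pairing i j h'
      (((s.ε * C.εe i) • C.starD i j h h' (C.pairD i j h' y (φ x))).unop u) (C.η i j h v) := by
    intro u v
    rw [s.form_symm, ← C.pairing_pairD i j h', pairing_η_flip, ← pairing_starD, smul_smul]
    rw [Units.smul_def, Units.smul_def, MulOpposite.unop_smul, LinearMap.smul_apply, map_zsmul]
    rfl
  simp only [key, ← C.pairing_pairD i j h' x, ← AddMonoidHom.add_apply, ← map_add,
    ← LinearMap.add_apply, ← MulOpposite.unop_add]
  rw [Units.neg_smul, ← add_eq_zero_iff_eq_neg']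
  constructor
  · intro hd
    refine C.D_ext_of_pairing i j h h' fun u v => ?_
    rw [hd]
    simp
  · intro hd u v
    rw [hd]
    simp

/-- Taking reduced traces in the `D_i`-valued identity gives the condition of `hSpace`, since the
trace commutes with the involution. Conversely the condition for all multiples `d • y` gives the
traces of all left multiples of the defect, which therefore vanishes. -/
theorem skew_iff_mem_hSpace {φ : C.M i →ₗ[s.k₀] C.M j} (hφ : φ ∈ C.HomD i j h) :
    (∀ x y u v, s.form (φ x (C.η i j h u)) (y v) + s.form (x u) (φ y (C.η i j h v)) = 0) ↔
      φ ∈ C.hSpace i j h h' (-(s.ε * C.εe i)) := by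
  simp only [skew_iff_pairD C h' φ]
  generalize -(s.ε * C.εe i) = e
  have he : ∀ d : C.D i, e • e • d = d := fun d => by
    rw [smul_smul, Int.units_mul_self, one_smul]
  constructor
  · refine fun hs => ⟨hφ, fun x y => ?_⟩
    change C.trd i _ = e • s.sigmaCXiAt i _ (C.trd i _)
    rw [hs y x, ← trd_starD, Units.smul_def, Units.smul_def, map_zsmul]
  · rintro ⟨-, hs⟩ x y
    have h1 : C.pairD i j h' y (φ x) - e • C.starD i j h h' (C.pairD i j h' x (φ y)) = 0 := by
      refine C.eq_zero_of_trd i _ fun d => ?_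
      have h2 : C.trd i (C.pairD i j h' (d • y) (φ x)) =
        e • s.sigmaCXiAt i _ (C.trd i (C.pairD i j h' x (φ (d • y)))) := hs x (d • y)
      rw [pairD_smul_left, pairD_ηFlat_smul C h' hφ, ← C.trd_starD i j h h', starD_mul, starD_starD] at h2
      rw [mul_sub, map_sub, h2, mul_smul_comm, Units.smul_def, Units.smul_def, map_zsmul, sub_self]
    rw [sub_eq_zero.1 h1, starD_units_smul, starD_starD, he]

end SelfDual

end Choices
end Datum
end
end CyclicGrading

namespace CyclicGrading
noncomputable section
namespace Datum
variable {k : Type u} [Field k] {σk : k ≃+* k} {s : Datum k σk}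

theorem next_injective : Function.Injective s.next := fun i j h => by
  rw [← s.dag_dag i, ← s.dag_dag j, ← s.next_dag_next i, ← s.next_dag_next j, h]

/-! ### Components of endomorphisms in `g(ξ)` -/

theorem form_adjoint_flip {T T' : s.V →ₗ[s.F] s.V} (h : ∀ x y, s.form (T x) y = s.form x (T' y))
    (x y : s.V) : s.form (T' x) y = s.form x (T y) := by
  rw [s.form_symm, ← h, ← s.form_symm]

/-- Move `θ` and `T` across the pairing; `ξ` changes sides unaltered because `σ` fixes it. -/
theorem twisted_adjoint {T T' : s.V →ₗ[s.F] s.V} (h : ∀ x y, s.form (T x) y = s.form x (T' y))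
    (hT : ∀ v, s.θ (T v) = (s.ξ : s.F) • T (s.θ v)) (v : s.V) :
    s.θ (T' v) = (s.ξ : s.F) • T' (s.θ v) := by
  rw [← sub_eq_zero]
  refine s.form_eq_zero_of_right _ fun x => ?_
  obtain ⟨x, rfl⟩ := s.θ.surjective x
  rw [map_sub, s.form_θ, ← h, ← s.form_θ, hT, form_smul_left, form_smul_right, s.σ_ξ, h, sub_self]

namespace Choices
variable (C : s.Choices)

theorem lid_evR (i : s.Vertex) (u : C.S i) (x : s.k₀ ⊗[s.k₀] C.M i) :
    TensorProduct.lid s.k₀ s.V (C.evR s.k₀ i u x) = TensorProduct.lid s.k₀ _ x u := by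
  induction x with
  | zero => simp
  | add x y hx hy => rw [map_add, map_add, hx, hy, map_add, LinearMap.add_apply]
  | tmul r x =>
    rw [LinearMap.baseChange_tmul, TensorProduct.lid_tmul, TensorProduct.lid_tmul]
    rfl

theorem ev_ext {Y : Type*} [AddCommGroup Y] {f g : s.V →+ Y}
    (h : ∀ i (x : C.M i) u, f (x u) = g (x u)) : f = g := by
  let e : s.k₀ ⊗[s.k₀] s.V →+ s.V := (TensorProduct.lid s.k₀ s.V).toLinearMap.toAddMonoidHom
  have h1 : f.comp e = g.comp e := C.evR_ext (R := s.k₀) fun i u x => by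
    change f (TensorProduct.lid s.k₀ s.V (C.evR s.k₀ i u x)) =
      g (TensorProduct.lid s.k₀ s.V (C.evR s.k₀ i u x))
    rw [lid_evR, h]
  refine AddMonoidHom.ext fun v => ?_
  obtain ⟨v, rfl⟩ := (TensorProduct.lid s.k₀ s.V).surjective v
  exact DFunLike.congr_fun h1 v

theorem ev_ext_isotypic {Y : Type*} [AddCommGroup Y] {f g : s.V →+ Y} {i : s.Vertex}
    (h : ∀ (x : C.M i) u, f (x u) = g (x u)) {v : s.V} (hv : v ∈ s.isotypic i) : f v = g v := by
  let e : s.k₀ ⊗[s.k₀] s.V →+ s.V := (TensorProduct.lid s.k₀ s.V).toLinearMap.toAddMonoidHom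
  have h1 := C.eq_on_isotypic (R := s.k₀) (f := f.comp e) (g := g.comp e) (fun u x => by
    change f (TensorProduct.lid s.k₀ s.V (C.evR s.k₀ i u x)) =
      g (TensorProduct.lid s.k₀ s.V (C.evR s.k₀ i u x))
    rw [lid_evR, h]) hv
  have h2 : e (1 ⊗ₜ v) = v := by
    change TensorProduct.lid s.k₀ s.V _ = v
    simp
  rwa [AddMonoidHom.comp_apply, AddMonoidHom.comp_apply, h2] at h1

theorem η_surjective (i j : s.Vertex) (h : s.next i = j) : Function.Surjective (C.η i j h) :=
  (C.η_iso i j h).bijective.2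

theorem hom_ext_of_η {i j : s.Vertex} (h : s.next i = j) {x y : C.M j}
    (hxy : ∀ u, x (C.η i j h u) = y (C.η i j h u)) : x = y :=
  LinearMap.ext fun w => by
    obtain ⟨u, rfl⟩ := C.η_surjective i j h w
    exact hxy u

/-- The component sends `x` to `φ ∘ x ∘ η_e⁻¹`, which is `A_β`-linear because `φ` and `η_e` are
twisted in the same way. -/
theorem exists_component {φ : s.V →ₗ[s.F] s.V}
    (hφ : ∀ v, s.θ (φ v) = (s.ξ : s.F) • φ (s.θ v)) (i j : s.Vertex) (h : s.next i = j) :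
    ∃ c ∈ C.HomD i j h, ∀ (x : C.M i) u, φ (x u) = c x (C.η i j h u) := by
  let e : C.S i ≃+ C.S j := AddEquiv.ofBijective (C.η i j h) (C.η_iso i j h).bijective
  have he : ∀ u, e u = C.η i j h u := fun _ => rfl
  let g : C.M i → C.M j := fun x =>
    { toFun := fun w => φ (x (e.symm w))
      map_add' := fun w w' => by rw [map_add, map_add, map_add]
      map_smul' := fun z w => by
        obtain ⟨u, rfl⟩ := e.surjective w
        rw [he, ← (C.η_iso i j h).map_twist, ← he, ← he, e.symm_apply_apply, e.symm_apply_apply,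
          map_smul x, RingHom.id_apply, smul_apply_of_twisted hφ] }
  have hg : ∀ x u, φ (x u) = g x (C.η i j h u) := fun x u => by
    change _ = φ (x (e.symm (e u)))
    rw [e.symm_apply_apply]
  refine ⟨{ toFun := g, map_add' := fun x y => ?_, map_smul' := fun a x => ?_ },
    fun d x => ?_, hg⟩
  · refine C.hom_ext_of_η h fun u => ?_
    rw [← hg, LinearMap.add_apply, LinearMap.add_apply, map_add, hg, hg]
  · refine C.hom_ext_of_η h fun u => ?_
    rw [← hg, RingHom.id_apply, LinearMap.smul_apply, LinearMap.smul_apply, ← hg]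
    exact (φ.restrictScalars s.k₀).map_smul a _
  · refine C.hom_ext_of_η h fun u => ?_
    change g _ _ = (_ • g x) _
    rw [← hg, D_smul_apply, D_smul_apply, ← η_unop, ← hg]

/-- A family of components defines an endomorphism. -/
theorem exists_of_components (c : ∀ i, C.M i →ₗ[s.k₀] C.M (s.next i))
    (hc : ∀ i, c i ∈ C.HomD i (s.next i) rfl) :
    ∃ φ : s.V →ₗ[s.F] s.V, (∀ v, s.θ (φ v) = (s.ξ : s.F) • φ (s.θ v)) ∧
      ∀ i (x : C.M i) u, φ (x u) = c i x (C.η i _ rfl u) := by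
  obtain ⟨G, hG⟩ := C.exists_evR_lift (R := s.k₀) (Y := s.V)
    (fun i u => C.ev _ (C.η i _ rfl u) ∘ₗ c i ∘ₗ (TensorProduct.lid s.k₀ _).toLinearMap)
    (fun i u u' => LinearMap.ext fun x => by
      change c i (TensorProduct.lid s.k₀ _ x) (C.η i _ rfl (u + u')) = _
      rw [map_add, map_add]
      rfl)
    (fun i d u x => by
      change c i (TensorProduct.lid s.k₀ _ (extAct s.k₀ s.k₀ d x)) (C.η i _ rfl u) =
        c i (TensorProduct.lid s.k₀ _ x) (C.η i _ rfl (d.unop u))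
      have h1 : TensorProduct.lid s.k₀ _ (extAct s.k₀ s.k₀ d x) =
          d • TensorProduct.lid s.k₀ _ x := by
        induction x with
        | zero => simp
        | add x y hx hy => rw [map_add, map_add, hx, hy, map_add, smul_add]
        | tmul r x =>
          rw [extAct, LinearMap.baseChange_tmul, TensorProduct.lid_tmul, TensorProduct.lid_tmul,
            smul_comm]
          rfl
      rw [h1, hc, D_smul_apply, η_unop])
  let φ : s.V →+ s.V := AddMonoidHom.mk' (fun v => G (1 ⊗ₜ v)) fun v w => by
    rw [TensorProduct.tmul_add, map_add]
  have hφ : ∀ i (x : C.M i) u, φ (x u) = c i x (C.η i _ rfl u) := fun i x u => by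
    have h1 := hG i u (1 ⊗ₜ x)
    rw [LinearMap.baseChange_tmul] at h1
    refine h1.trans ?_
    change c i (TensorProduct.lid s.k₀ _ (1 ⊗ₜ x)) (C.η i _ rfl u) = _
    rw [TensorProduct.lid_tmul, one_smul]
  refine ⟨{ φ with map_smul' := fun a v => ?_ }, fun v => ?_, hφ⟩
  · have h1 : φ.comp (DistribSMul.toAddMonoidHom s.V a) =
        (DistribSMul.toAddMonoidHom s.V a).comp φ := C.ev_ext fun i x u => by
      change φ (a • x u) = a • φ (x u)
      rw [← incl_smul, ← map_smul x, hφ, hφ, (C.η_iso i _ rfl).map_smul, map_smul, incl_smul]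
    exact DFunLike.congr_fun h1 v
  · have h1 : s.θ.toAddMonoidHom.comp φ = ((DistribSMul.toAddMonoidHom s.V (s.ξ : s.F)).comp
        φ).comp s.θ.toAddMonoidHom := C.ev_ext fun i x u => by
      change s.θ (φ (x u)) = (s.ξ : s.F) • φ (s.θ (x u))
      rw [← θA_smul, ← θA_smul, hφ, ← map_smul x, hφ, ← incl_smul, ← map_smul (c i x),
        ← map_smul (c i _), ← (C.η_iso i _ rfl).map_theta, (C.η_iso i _ rfl).map_smul]
    exact DFunLike.congr_fun h1 v

theorem exists_single (a b : s.Vertex) (h : s.next a = b) {ψ : C.M a →ₗ[s.k₀] C.M b}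
    (hψ : ψ ∈ C.HomD a b h) :
    ∃ φ : s.V →ₗ[s.F] s.V, (∀ v, s.θ (φ v) = (s.ξ : s.F) • φ (s.θ v)) ∧
      (∀ (x : C.M a) u, φ (x u) = ψ x (C.η a b h u)) ∧
      ∀ i, i ≠ a → ∀ (x : C.M i) u, φ (x u) = 0 := by
  classical
  subst h
  let c : ∀ i, C.M i →ₗ[s.k₀] C.M (s.next i) := fun i => if h : i = a then h ▸ ψ else 0
  have hc : c a = ψ := by simp [c]
  have hc' : ∀ i, i ≠ a → c i = 0 := fun i hi => by simp [c, hi]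
  obtain ⟨φ, h1, h2⟩ := C.exists_of_components c fun i => by
    by_cases hi : i = a
    · subst hi
      rwa [hc]
    · rw [hc' i hi]
      exact zero_mem _
  refine ⟨φ, h1, fun x u => by rw [h2, hc], fun i hi x u => by rw [h2, hc' i hi]; rfl⟩

/-- An element of the summand of `g(ξ)` at an arrow and its dual, with a given component. -/
theorem exists_mem_gξ (a b : s.Vertex) (h : s.next a = b) {ψ : C.M a →ₗ[s.k₀] C.M b}
    (hψ : ψ ∈ C.HomD a b h)
    (hψ' : ∀ h' : s.dag a = b, ψ ∈ C.hSpace a b h h' (-(s.ε * C.εe a))) :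
    ∃ φ ∈ s.gξ, (∀ (x : C.M a) u, φ (x u) = ψ x (C.η a b h u)) ∧
      ∀ i, i ≠ a → i ≠ s.dag b → ∀ (x : C.M i) u, φ (x u) = 0 := by
  obtain ⟨φ, h1, h2, h3⟩ := C.exists_single a b h hψ
  by_cases h' : s.dag a = b
  · refine ⟨φ, ⟨h1, fun x y => ?_⟩, h2, fun i hi _ => h3 i hi⟩
    -- At a self-dual arrow the extension of `ψ` by zero is already skew: pairs of vertices other
    -- than `(a, a)` contribute nothing, by vanishing or by orthogonality.
    have hs := (C.skew_iff_mem_hSpace h' hψ).2 (hψ' h')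
    have hne : ∀ i, i ≠ a → s.dag i ≠ b := fun i hi hb => hi (by
      rw [← s.dag_dag i, hb, ← h', s.dag_dag])
    have key : ∀ i (x : C.M i) u j (y : C.M j) v,
        s.form (φ (x u)) (y v) + s.form (x u) (φ (y v)) = 0 := by
      intro i x u j y v
      by_cases hi : i = a
      · subst hi
        by_cases hj : j = i
        · subst hj
          rw [h2, h2, hs]
        · rw [h2, h3 j hj, map_zero, C.form_eq_zero_of_ne, add_zero]
          rw [← h', s.dag_dag]
          exact Ne.symm hj
      · rw [h3 i hi, map_zero, LinearMap.zero_apply, zero_add]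
        by_cases hj : j = a
        · subst hj
          rw [h2, C.form_eq_zero_of_ne (hne i hi)]
        · rw [h3 j hj, map_zero]
    have h4 : ∀ i (x : C.M i) u,
        s.formHom (φ (x u)) + (s.formHom (x u)).comp φ.toAddMonoidHom = 0 := fun i x u =>
      C.ev_ext fun j y v => key i x u j y v
    have h5 : (s.formHom.flip y).comp φ.toAddMonoidHom + s.formHom.flip (φ y) = 0 :=
      C.ev_ext fun i x u => DFunLike.congr_fun (h4 i x u) y
    exact DFunLike.congr_fun h5 x
  -- Otherwise the adjoint is subtracted. It lives at the source `b†` of the dual arrow, which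
  -- differs from `a`, so the component at `a` remains `ψ`.
  · obtain ⟨φ', hφ'⟩ := s.exists_adjoint φ
    have h4 := form_adjoint_flip hφ'
    have h5 := twisted_adjoint hφ' h1
    have h6 : ∀ i, i ≠ s.dag b → ∀ (x : C.M i) u, φ' (x u) = 0 := by
      intro i hi x u
      refine s.form_eq_zero_of_right _ fun y => ?_
      have h7 : s.formHom.flip (φ' (x u)) = 0 := C.ev_ext fun j y v => by
        change s.form (y v) (φ' (x u)) = 0
        rw [← hφ']
        by_cases hj : j = a
        · subst hj
          rw [h2, C.form_eq_zero_of_ne (Ne.symm hi)]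
        · rw [h3 j hj, map_zero, LinearMap.zero_apply]
      exact DFunLike.congr_fun h7 y
    refine ⟨φ - φ', ⟨fun v => ?_, fun x y => ?_⟩, fun x u => ?_, fun i hi hi' x u => ?_⟩
    · rw [LinearMap.sub_apply, LinearMap.sub_apply, map_sub, h1, h5, smul_sub]
    · rw [LinearMap.sub_apply, LinearMap.sub_apply, map_sub, map_sub, LinearMap.sub_apply, hφ', h4]
      ring
    · rw [LinearMap.sub_apply, h2, h6, sub_zero]
      intro ha
      exact h' (by rw [ha, s.dag_dag])
    · rw [LinearMap.sub_apply, h3 i hi, h6 i hi', sub_zero]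

/-- The family `P` contains each arrow of `α` up to duality once, `(P e).a` being the source of the
arrow and `s.dag (P e).b` that of its dual. The component at an arrow that is not self-dual is
arbitrary, and the one at the dual arrow follows from it. -/
theorem exists_gξα_equiv (α : s.Orbit) {J E : Type} {v : J → s.Vertex} (P : E → C.Summand v)
    (hW : ∀ e φ, φ ∈ (P e).W ↔ φ ∈ C.HomD (P e).a (P e).b (P e).arrow ∧
      ∀ h' : s.dag (P e).a = (P e).b,
        φ ∈ C.hSpace (P e).a (P e).b (P e).arrow h' (-(s.ε * C.εe (P e).a)))
    (hinj : Function.Injective fun e => (P e).a)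
    (hdag : ∀ e e', s.dag (P e).b = (P e').a → e = e')
    (hmem : ∀ i, s.orbit i = α ↔ ∃ e, i = (P e).a ∨ i = s.dag (P e).b) :
    ∃ Ψ : s.gξα α ≃ₗ[s.k₀] ∀ e, (P e).W,
      ∀ (φ : s.gξα α) (e : E) (u : C.S (P e).a) (x : C.M (P e).a),
        φ.1 (x u) = (Ψ φ e).1 x (C.η (P e).a (P e).b (P e).arrow u) := by
  classical
  have : Finite E := Finite.of_injective _ hinj
  have : Fintype E := Fintype.ofFinite E
  have h1 : ∀ (φ : s.gξα α) e, ∃ c : (P e).W, ∀ (x : C.M (P e).a) u,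
      φ.1 (x u) = c.1 x (C.η (P e).a (P e).b (P e).arrow u) := by
    intro φ e
    obtain ⟨c, hc, hφ⟩ := C.exists_component φ.2.1.1 (P e).a (P e).b (P e).arrow
    refine ⟨⟨c, (hW e c).2 ⟨hc, fun h' => (C.skew_iff_mem_hSpace h' hc).1 fun x y u w => ?_⟩⟩, hφ⟩
    rw [← hφ, ← hφ]
    exact φ.2.1.2 _ _
  choose f hf using h1
  have huniq : ∀ e (c c' : (P e).W), (∀ (x : C.M (P e).a) u,
      c.1 x (C.η (P e).a (P e).b (P e).arrow u) = c'.1 x (C.η (P e).a (P e).b (P e).arrow u)) →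
      c = c' := fun e c c' h =>
    Subtype.ext (LinearMap.ext fun x => C.hom_ext_of_η (P e).arrow (h x))
  let Ψ : s.gξα α →ₗ[s.k₀] ∀ e, (P e).W :=
    { toFun := f
      map_add' := fun φ φ' => funext fun e => huniq e _ _ fun x u => by
        rw [← hf]
        change φ.1 (x u) + φ'.1 (x u) = (f φ e).1 x _ + (f φ' e).1 x _
        rw [hf, hf]
      map_smul' := fun a φ => funext fun e => huniq e _ _ fun x u => by
        rw [← hf]
        change a • φ.1 (x u) = a • (f φ e).1 x _
        rw [hf] }
  have hΨ : Function.Bijective Ψ := by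
    constructor
    · rw [injective_iff_map_eq_zero]
      intro φ hφ
      have h2 : ∀ e (x : C.M (P e).a) u, φ.1 (x u) = 0 := fun e x u => by
        rw [hf, show f φ e = 0 from congrFun hφ e]
        rfl
      have h3 : φ.1.toAddMonoidHom = 0 := C.ev_ext fun i x u => by
        change φ.1 (x u) = 0
        by_cases hi : s.orbit i = α
        · obtain ⟨e, rfl | rfl⟩ := (hmem i).1 hi
          · exact h2 e x u
          -- At the source of the dual arrow: the only component of `φ` with values in the part at
          -- `b` is the one from `a`, which is zero. So the image of `φ` is orthogonal to the part
          -- at `b†`, and skewness makes `φ` vanish there.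
          · have h4 : (s.formHom (x u)).comp φ.1.toAddMonoidHom = 0 := C.ev_ext fun j y w => by
              change s.form (x u) (φ.1 (y w)) = 0
              by_cases hj : j = (P e).a
              · subst hj
                rw [h2, map_zero]
              · obtain ⟨c, -, hc⟩ := C.exists_component φ.2.1.1 j _ rfl
                rw [hc, C.form_eq_zero_of_ne]
                rw [s.dag_dag, ← (P e).arrow]
                exact fun h => hj (next_injective h).symm
            refine s.form_nondegenerate _ fun y => ?_
            have h5 : s.form (x u) (φ.1 y) = 0 := DFunLike.congr_fun h4 y
            have h6 := φ.2.1.2 (x u) y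
            rwa [h5, add_zero] at h6
        · exact φ.2.2 i hi _ (C.mem_isotypic i x u)
      exact Subtype.ext (LinearMap.ext fun v => DFunLike.congr_fun h3 v)
    · intro ψ
      have h2 := fun e => C.exists_mem_gξ (P e).a (P e).b (P e).arrow
        ((hW e _).1 (ψ e).2).1 ((hW e _).1 (ψ e).2).2
      choose φ h3 h4 h5 using h2
      have h6 : ∑ e, φ e ∈ s.gξα α := by
        refine ⟨Submodule.sum_mem _ fun e _ => h3 e, fun i hi w hw => ?_⟩
        rw [LinearMap.sum_apply]
        refine Finset.sum_eq_zero fun e _ => ?_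
        refine C.ev_ext_isotypic (f := (φ e).toAddMonoidHom) (g := 0) (fun x u => ?_) hw
        exact h5 e i (fun h => hi ((hmem i).2 ⟨e, .inl h⟩)) (fun h => hi ((hmem i).2 ⟨e, .inr h⟩))
          x u
      refine ⟨⟨_, h6⟩, funext fun e => huniq e _ _ fun x u => ?_⟩
      change (f _ e).1 x _ = _
      rw [← hf, LinearMap.sum_apply, Finset.sum_eq_single e, h4]
      · exact fun e' _ he => h5 e' _ (fun h => he (hinj h).symm)
          (fun h => he (hdag _ _ h.symm)) x u
      · simp
  exact ⟨LinearEquiv.ofBijective Ψ hΨ, fun φ e u x => hf φ e x u⟩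

end Choices
end Datum
end
end CyclicGrading

namespace CyclicGrading
noncomputable section

section

variable {k₀ : Type u} [Field k₀] {R : Type u} [CommRing R] [Algebra k₀ R]
variable {W M N M' N' M'' : Type u} [AddCommGroup W] [Module k₀ W] [AddCommGroup M] [Module k₀ M]
  [AddCommGroup N] [Module k₀ N] [AddCommGroup M'] [Module k₀ M'] [AddCommGroup N'] [Module k₀ N']
  [AddCommGroup M''] [Module k₀ M'']

theorem extHom_rel {M₁ : Type u} [AddCommGroup M₁] [Module k₀ M₁] {p : W →ₗ[k₀] (M →ₗ[k₀] N)}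
    {p' : W →ₗ[k₀] (M' →ₗ[k₀] N')} {a : M₁ →ₗ[k₀] M} {a' : M₁ →ₗ[k₀] M'} {b : N →ₗ[k₀] M''}
    {b' : N' →ₗ[k₀] M''} (h : ∀ w x, b (p w (a x)) = b' (p' w (a' x))) (z : R ⊗[k₀] W)
    (x : R ⊗[k₀] M₁) :
    b.baseChange R (extHom k₀ R p z (a.baseChange R x)) =
      b'.baseChange R (extHom k₀ R p' z (a'.baseChange R x)) := by
  induction z with
  | zero => simp
  | add z z' hz hz' => simp only [map_add, LinearMap.add_apply, hz, hz']
  | tmul r w =>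
    rw [extHom_tmul, extHom_tmul, LinearMap.smul_apply, LinearMap.smul_apply, map_smul, map_smul]
    congr 1
    induction x with
    | zero => simp
    | add x y hx hy => simp only [map_add, hx, hy]
    | tmul t x => simp only [LinearMap.baseChange_tmul, h]

theorem lTensor_comp_apply (f : N →ₗ[k₀] N') (v : M) (z : R ⊗[k₀] (M →ₗ[k₀] N)) :
    (f ∘ₗ LinearMap.applyₗ v).lTensor R z =
      f.baseChange R (extHom k₀ R LinearMap.id z (1 ⊗ₜ v)) := by
  induction z with
  | zero => simp
  | add z z' hz hz' => simp only [map_add, LinearMap.add_apply, hz, hz']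
  | tmul r w =>
    rw [extHom_tmul, LinearMap.smul_apply, map_smul]
    simp [TensorProduct.smul_tmul']

end

namespace Datum
variable {k : Type u} [Field k] {σk : k ≃+* k} {s : Datum k σk}

/-! ### The conjugation action -/

section

variable {R : Type u} [CommRing R] [Algebra s.k₀ R]

/-- A linear endomorphism of `R ⊗ V` that satisfies the equations of `g(ξ)^α` comes from
`R ⊗ g(ξ)^α`. -/
theorem exists_extHom_gξαIncl (α : s.Orbit) (T : R ⊗[s.k₀] s.V →ₗ[R] R ⊗[s.k₀] s.V)
    (h1 : ∀ (a : s.F) x, T (extAct s.k₀ R a x) = extAct s.k₀ R a (T x))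
    (h2 : ∀ x, s.θLin.baseChange R (T x) =
      extAct s.k₀ R (s.ξ : s.F) (T (s.θLin.baseChange R x)))
    (h3 : ∀ x y, s.formR R (T x) y + s.formR R x (T y) = 0)
    (h4 : ∀ i, s.orbit i ≠ α → ∀ v ∈ s.isotypic i, T (1 ⊗ₜ v) = 0) :
    ∃ w, extHom s.k₀ R (s.gξαIncl α) w = T := by
  obtain ⟨z, rfl⟩ := extHom_id_surjective T
  let m : s.F → s.V →ₗ[s.k₀] s.V := fun a => DistribSMul.toLinearMap s.k₀ s.V a
  -- The four conditions (linearity over `F`, twisting, skewness, vanishing outside `α`) as one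
  -- family of linear maps, with values padded to `V × F`.
  let ι := ((s.F × s.V) ⊕ s.V) ⊕ ((s.V × s.V) ⊕ {v : s.V // ∃ i, s.orbit i ≠ α ∧ v ∈ s.isotypic i})
  let ev : s.V → (s.V →ₗ[s.k₀] s.V) →ₗ[s.k₀] s.V := fun v => LinearMap.applyₗ v
  let E : ι → (s.V →ₗ[s.k₀] s.V) →ₗ[s.k₀] s.V × s.F := fun l => match l with
    | .inl (.inl q) => LinearMap.inl _ _ _ ∘ₗ (LinearMap.id ∘ₗ ev (q.1 • q.2) - m q.1 ∘ₗ ev q.2)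
    | .inl (.inr v) => LinearMap.inl _ _ _ ∘ₗ (s.θLin ∘ₗ ev v - m (s.ξ : s.F) ∘ₗ ev (s.θ v))
    | .inr (.inl q) => LinearMap.inr _ _ _ ∘ₗ (s.formK.flip q.2 ∘ₗ ev q.1 + s.formK q.1 ∘ₗ ev q.2)
    | .inr (.inr v) => LinearMap.inl _ _ _ ∘ₗ (LinearMap.id ∘ₗ ev v.1)
  obtain ⟨z', rfl⟩ := exists_baseChange_subtype_eq (R := R) (LinearMap.range (s.gξαIncl α)) E
    (fun f hf => by
      refine ⟨⟨{ f with map_smul' := fun a v => ?_ }, ⟨fun v => ?_, fun x y => ?_⟩,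
        fun i hi v hv => ?_⟩, rfl⟩
      · exact sub_eq_zero.1 (congrArg Prod.fst (hf (.inl (.inl (a, v)))))
      · exact sub_eq_zero.1 (congrArg Prod.fst (hf (.inl (.inr v))))
      · exact congrArg Prod.snd (hf (.inr (.inl (x, y))))
      · exact congrArg Prod.fst (hf (.inr (.inr ⟨v, i, hi, hv⟩)))) z
    (by
      rintro ((⟨a, v⟩ | v) | (⟨x, y⟩ | ⟨v, i, hi, hv⟩))
      · change LinearMap.lTensor R (LinearMap.inl _ _ _ ∘ₗ (LinearMap.id ∘ₗ ev (a • v) - m a ∘ₗ ev v)) z = 0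
        rw [LinearMap.lTensor_comp, LinearMap.comp_apply]
        refine (congrArg (LinearMap.lTensor R _) ?_).trans (map_zero _)
        rw [LinearMap.lTensor_sub, LinearMap.sub_apply, lTensor_comp_apply, lTensor_comp_apply,
          LinearMap.baseChange_id, LinearMap.id_apply, sub_eq_zero]
        refine Eq.trans ?_ (h1 a (1 ⊗ₜ v))
        rw [extAct, LinearMap.baseChange_tmul]
        rfl
      · change LinearMap.lTensor R (LinearMap.inl _ _ _ ∘ₗ (s.θLin ∘ₗ ev v - m (s.ξ : s.F) ∘ₗ ev (s.θ v))) z = 0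
        rw [LinearMap.lTensor_comp, LinearMap.comp_apply]
        refine (congrArg (LinearMap.lTensor R _) ?_).trans (map_zero _)
        rw [LinearMap.lTensor_sub, LinearMap.sub_apply, lTensor_comp_apply, lTensor_comp_apply,
          sub_eq_zero]
        refine (h2 (1 ⊗ₜ v)).trans ?_
        rw [LinearMap.baseChange_tmul]
        rfl
      · change LinearMap.lTensor R (LinearMap.inr _ _ _ ∘ₗ (s.formK.flip y ∘ₗ ev x + s.formK x ∘ₗ ev y)) z = 0
        rw [LinearMap.lTensor_comp, LinearMap.comp_apply]
        refine (congrArg (LinearMap.lTensor R _) ?_).trans (map_zero _)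
        rw [LinearMap.lTensor_add, LinearMap.add_apply, lTensor_comp_apply, lTensor_comp_apply]
        refine Eq.trans ?_ (h3 (1 ⊗ₜ x) (1 ⊗ₜ y))
        rw [extPair_apply_one_tmul]
        refine congrArg₂ _ ?_ rfl
        generalize extHom s.k₀ R LinearMap.id z (1 ⊗ₜ x) = t
        induction t with
        | zero => simp
        | add t t' ht ht' => simp only [map_add, LinearMap.add_apply, ht, ht']
        | tmul r t => simp
      · change LinearMap.lTensor R (LinearMap.inl _ _ _ ∘ₗ (LinearMap.id ∘ₗ ev v)) z = 0
        rw [LinearMap.lTensor_comp, LinearMap.comp_apply]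
        refine (congrArg (LinearMap.lTensor R _) ?_).trans (map_zero _)
        rw [lTensor_comp_apply, h4 i hi v hv, map_zero])
  -- The solution space is the range of the inclusion, and tensoring is right exact.
  obtain ⟨w, rfl⟩ := LinearMap.lTensor_surjective R (s.gξαIncl α).surjective_rangeRestrict z'
  refine ⟨w, ?_⟩
  rw [extHom, extHom, LinearMap.comp_apply, LinearMap.comp_apply, LinearMap.baseChange_id,
    LinearMap.id_apply]
  congr 1
  change _ = (LinearMap.range (s.gξαIncl α)).subtype.baseChange R
    ((s.gξαIncl α).rangeRestrict.baseChange R w)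
  rw [← LinearMap.comp_apply, ← LinearMap.baseChange_comp]
  rfl

theorem extHom_gξαIncl_form (α : s.Orbit) (w : R ⊗[s.k₀] s.gξα α) (x y : R ⊗[s.k₀] s.V) :
    s.formR R (extHom s.k₀ R (s.gξαIncl α) w x) y +
      s.formR R x (extHom s.k₀ R (s.gξαIncl α) w y) = 0 := by
  induction w with
  | zero => simp
  | add w w' hw hw' =>
    rw [map_add, LinearMap.add_apply, LinearMap.add_apply, map_add, map_add, LinearMap.add_apply,
      add_add_add_comm, hw, hw', add_zero]
  | tmul r φ =>
    rw [extHom_tmul, LinearMap.smul_apply, LinearMap.smul_apply, extPair_smul_left,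
      extPair_smul_right, ← smul_add]
    have h : s.formR R ((s.gξαIncl α φ).baseChange R x) y +
        s.formR R x ((s.gξαIncl α φ).baseChange R y) = 0 := by
      induction x with
      | zero => simp
      | add x x' hx hx' =>
        rw [map_add, map_add, map_add, LinearMap.add_apply, LinearMap.add_apply,
          add_add_add_comm, hx, hx', add_zero]
      | tmul t x =>
        induction y with
        | zero => simp
        | add y y' hy hy' =>
          rw [map_add, map_add, map_add, add_add_add_comm, hy, hy', add_zero]
        | tmul t' y =>
          rw [LinearMap.baseChange_tmul, LinearMap.baseChange_tmul, extPair_tmul, extPair_tmul,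
            ← TensorProduct.tmul_add]
          have h1 : s.formK (s.gξαIncl α φ x) y + s.formK x (s.gξαIncl α φ y) = 0 := φ.2.1.2 x y
          rw [h1, TensorProduct.tmul_zero]
    rw [h, smul_zero]

theorem extHom_gξαIncl_isotypic (α : s.Orbit) (w : R ⊗[s.k₀] s.gξα α) {i : s.Vertex}
    (hi : s.orbit i ≠ α) {v : s.V} (hv : v ∈ s.isotypic i) :
    extHom s.k₀ R (s.gξαIncl α) w (1 ⊗ₜ v) = 0 := by
  induction w with
  | zero => simp
  | add w w' hw hw' => rw [map_add, LinearMap.add_apply, hw, hw', add_zero]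
  | tmul r φ =>
    rw [extHom_tmul, LinearMap.smul_apply, LinearMap.baseChange_tmul]
    have h : s.gξαIncl α φ v = 0 := φ.2.2 i hi v hv
    rw [h, TensorProduct.tmul_zero, smul_zero]

/-- `R ⊗ g(ξ)^α` is stable under conjugation by `H^α`. -/
theorem exists_conj (α : s.Orbit) (g : s.Hα α R) (w : R ⊗[s.k₀] s.gξα α) :
    ∃ w' : R ⊗[s.k₀] s.gξα α, ∀ x, extHom s.k₀ R (s.gξαIncl α) w' (g.1 x) =
      g.1 (extHom s.k₀ R (s.gξαIncl α) w x) := by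
  obtain ⟨⟨hF, hform, hθ⟩, hα⟩ := g.2
  obtain ⟨⟨hF', hform', hθ'⟩, hα'⟩ := inv_mem g.2
  have hα'' : ∀ i, s.orbit i ≠ α → ∀ v ∈ s.isotypic i, g.1.symm (1 ⊗ₜ v) = 1 ⊗ₜ v := hα'
  have hFs : ∀ (a : s.F) x, g.1.symm (extAct s.k₀ R a x) = extAct s.k₀ R a (g.1.symm x) := hF'
  have hθs : ∀ x, g.1.symm (s.θLin.baseChange R x) = s.θLin.baseChange R (g.1.symm x) := hθ'
  set T := extHom s.k₀ R (s.gξαIncl α) w with hT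
  have h1 : ∀ (a : s.F) x, T (extAct s.k₀ R a x) = extAct s.k₀ R a (T x) := fun a x => by
    have h := extHom_rel (p := s.gξαIncl α) (p' := s.gξαIncl α)
      (a := DistribSMul.toLinearMap s.k₀ s.V a) (a' := LinearMap.id) (b := LinearMap.id)
      (b' := DistribSMul.toLinearMap s.k₀ s.V a) (fun φ v => φ.1.map_smul a v) w x
    rwa [LinearMap.baseChange_id, LinearMap.id_apply, LinearMap.id_apply] at h
  have h2 : ∀ x, s.θLin.baseChange R (T x) =
      extAct s.k₀ R (s.ξ : s.F) (T (s.θLin.baseChange R x)) := fun x => by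
    have h := extHom_rel (p := s.gξαIncl α) (p' := s.gξαIncl α)
      (a := LinearMap.id) (a' := s.θLin) (b := s.θLin)
      (b' := DistribSMul.toLinearMap s.k₀ s.V (s.ξ : s.F)) (fun φ v => φ.2.1.1 v) w x
    rwa [LinearMap.baseChange_id, LinearMap.id_apply] at h
  obtain ⟨w', hw'⟩ := exists_extHom_gξαIncl α (g.1.toLinearMap ∘ₗ T ∘ₗ g.1.symm.toLinearMap)
    (fun a x => by
      change g.1 (T (g.1.symm _)) = extAct s.k₀ R a (g.1 (T (g.1.symm x)))
      rw [hFs, h1, hF])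
    (fun x => by
      change s.θLin.baseChange R (g.1 (T (g.1.symm x))) =
        extAct s.k₀ R (s.ξ : s.F) (g.1 (T (g.1.symm _)))
      rw [← hθ, h2, hF, hθs])
    (fun x y => by
      change s.formR R (g.1 (T (g.1.symm x))) y + s.formR R x (g.1 (T (g.1.symm y))) = 0
      have h3 := hform (T (g.1.symm x)) (g.1.symm y)
      have h4 := hform (g.1.symm x) (T (g.1.symm y))
      rw [g.1.apply_symm_apply] at h3 h4
      rw [h3, h4]
      exact extHom_gξαIncl_form α w _ _)
    (fun i hi v hv => by
      change g.1 (T (g.1.symm _)) = 0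
      rw [hα'' i hi v hv, extHom_gξαIncl_isotypic α w hi hv, map_zero])
  refine ⟨w', fun x => ?_⟩
  rw [hw']
  change g.1 (T (g.1.symm (g.1 x))) = _
  rw [g.1.symm_apply_apply]

end

namespace Choices
variable (C : s.Choices)

/-- A description of `(H^α, g(ξ)^α)` by a labelling of vertices and a choice of arrows. -/
theorem isDescribedBy (α : s.Orbit) {J E : Type} (v : J → s.Vertex)
    (G : ∀ (j : J) (R : Type u) [CommRing R] [Algebra s.k₀ R], Subgroup (C.AutR (v j) R))
    (P : E → C.Summand v) (hv : Function.Injective v)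
    (hdag : ∀ j j', s.dag (v j) = v j' → j = j')
    (hmem : ∀ i, s.orbit i = α ↔ ∃ j, i = v j ∨ i = s.dag (v j))
    (hG : ∀ (R : Type u) [CommRing R] [Algebra s.k₀ R] j g, g ∈ G j R ↔ g ∈ C.GLD (v j) R ∧
      ∀ h : s.dag (v j) = v j, g ∈ isometryPts s.k₀ (C.pairL (v j) (v j) h) R)
    (hW : ∀ e φ, φ ∈ (P e).W ↔ φ ∈ C.HomD (P e).a (P e).b (P e).arrow ∧
      ∀ h' : s.dag (P e).a = (P e).b,
        φ ∈ C.hSpace (P e).a (P e).b (P e).arrow h' (-(s.ε * C.εe (P e).a)))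
    (ha : Function.Injective fun e => (P e).a)
    (hdag' : ∀ e e', s.dag (P e).b = (P e').a → e = e')
    (hmem' : ∀ i, s.orbit i = α ↔ ∃ e, i = (P e).a ∨ i = s.dag (P e).b)
    (hact : ∀ e (R : Type u) [CommRing R] [Algebra s.k₀ R] (g : s.Hα α R)
      (γ : ∀ j, C.AutR (v j) R), (∀ j, γ j ∈ C.GLD (v j) R) →
      (∀ j, C.IsComp g.1.toLinearMap (v j) (γ j).toLinearMap) →
      ∀ φ φ', (∀ (g₁ : C.AutR (P e).a R) (g₂ : C.AutR (P e).b R),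
        C.IsComp g.1.toLinearMap _ g₁.toLinearMap → C.IsComp g.1.toLinearMap _ g₂.toLinearMap →
        ∀ x, φ' (g₁ x) = g₂ (φ x)) → (P e).act R γ φ φ') :
    C.IsDescribedBy α v G P := by
  have hΦ := fun (R : Type u) [CommRing R] [Algebra s.k₀ R] =>
    C.exists_Hα_equiv α v hv hdag hmem R (fun j => G j R) (hG R)
  obtain ⟨Ψ, hΨ⟩ := C.exists_gξα_equiv α P hW ha hdag' hmem'
  refine ⟨fun R _ _ => (hΦ R).choose, Ψ, ?_, ?_, hΨ, ?_⟩
  · intro R R' _ _ _ _ f g g' hgg' j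
    exact C.isBaseChangeAlong_of_isComp hgg' ((hΦ R).choose_spec g j) ((hΦ R').choose_spec g' j)
  · intro R _ _ g j u x
    exact (hΦ R).choose_spec g j u x
  · intro R _ _ g w
    obtain ⟨w', hw'⟩ := exists_conj α g w
    refine ⟨w', hw', fun e => ?_⟩
    refine hact e R g _ (fun j => ((hG R j _).1 ((hΦ R).choose g j).2).1)
      (fun j => (hΦ R).choose_spec g j) _ _ fun g₁ g₂ h₁ h₂ x => ?_
    have hrel : ∀ (w : R ⊗[s.k₀] s.gξα α) u x, extHom s.k₀ R (s.gξαIncl α) w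
        (C.evR R (P e).a u x) = C.evR R (P e).b (C.η _ _ (P e).arrow u)
          (extHom s.k₀ R ((P e).W.subtype ∘ₗ LinearMap.proj e ∘ₗ Ψ.toLinearMap) w x) := by
      intro w u x
      have h := extHom_rel (R := R) (p := s.gξαIncl α)
        (p' := (P e).W.subtype ∘ₗ LinearMap.proj e ∘ₗ Ψ.toLinearMap)
        (a := C.ev (P e).a u) (a' := LinearMap.id) (b := LinearMap.id)
        (b' := C.ev (P e).b (C.η _ _ (P e).arrow u)) (fun φ x => hΨ φ e u x) w x
      rwa [LinearMap.baseChange_id, LinearMap.baseChange_id, LinearMap.id_apply,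
        LinearMap.id_apply] at h
    -- With `η_e(u)` the generator, the identity between components can be tested in `R ⊗ V`, where
    -- it is the conjugation relation.
    obtain ⟨u, hu⟩ := C.η_surjective _ _ (P e).arrow (C.gen (P e).b)
    refine C.evR_gen_injective (P e).b ?_
    have h₁' : ∀ u x, g.1 (C.evR R (P e).a u x) = C.evR R (P e).a u (g₁ x) := h₁
    have h₂' : ∀ u x, g.1 (C.evR R (P e).b u x) = C.evR R (P e).b u (g₂ x) := h₂
    rw [← hu, ← hrel, ← h₁', hw', hrel, h₂']

end Choices
end Datum
end
end CyclicGrading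

namespace CyclicGrading
noncomputable section
namespace Datum
variable {k : Type u} [Field k] {σk : k ≃+* k}

/-! ### The dependence of the quiver on the data -/

/-- `r` and `β` determine `L_β`, the norm of `ξ` determines `μ_ξ`, and `σ|_k` with the norm of `c`
determines `σ_c`; all are known from their effect on `k` and `b`. -/
theorem exists_vertex_equiv {s₁ s₂ : Datum k σk} (hr : s₁.r = s₂.r) (hβ : s₁.β = s₂.β)
    (hc : s₁.Nc = s₂.Nc) (hξ : s₁.Nξ = s₂.Nξ) : ∃ f : s₁.Vertex ≃ s₂.Vertex,
      ∀ i, f (s₁.next i) = s₂.next (f i) ∧ f (s₁.dag i) = s₂.dag (f i) := by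
  have hL : (Polynomial.X ^ s₂.r - Polynomial.C s₂.β : Polynomial k) =
      Polynomial.X ^ s₁.r - Polynomial.C s₁.β := by rw [hr, hβ]
  let e : s₂.L ≃ₐ[k] s₁.L := AdjoinRoot.algEquivOfEq k _ _ hL
  let g : s₂.L →+* s₁.L := e.toRingEquiv.toRingHom
  have hg : ∀ x, g (algebraMap k s₂.L x) = algebraMap k s₁.L x := e.commutes
  have hb : g s₂.b = s₁.b := AdjoinRoot.algEquivOfEq_root _ _ hL
  have hmu : s₁.mu.comp g = g.comp s₂.mu := by
    refine s₂.L_hom_ext (fun x => ?_) ?_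
    · simp only [RingHom.comp_apply, mu_base, hg]
    · rw [RingHom.comp_apply, RingHom.comp_apply, hb, mu_b, mu_b, map_mul, hg, hb, hξ]
  have hσ : s₁.sigmaC.comp g = g.comp s₂.sigmaC := by
    refine s₂.L_hom_ext (fun x => ?_) ?_
    · simp only [RingHom.comp_apply, sigmaC, sigmaTwist_base, hg]
    · have h : g s₂.bInv = s₁.bInv := s₂.map_bInv g (by rw [hb, b_mul_bInv])
      rw [RingHom.comp_apply, RingHom.comp_apply, hb, sigmaC, sigmaTwist_b, sigmaC, sigmaTwist_b,
        map_mul, hg, h, hc]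
  refine ⟨(PrimeSpectrum.comapEquiv e.symm.toRingEquiv).toEquiv, fun i => ⟨?_, ?_⟩⟩
  · change PrimeSpectrum.comap g (PrimeSpectrum.comap s₁.mu i) =
      PrimeSpectrum.comap s₂.mu (PrimeSpectrum.comap g i)
    rw [← PrimeSpectrum.comap_comp_apply, ← PrimeSpectrum.comap_comp_apply, hmu]
  · change PrimeSpectrum.comap g (PrimeSpectrum.comap s₁.sigmaC i) =
      PrimeSpectrum.comap s₂.sigmaC (PrimeSpectrum.comap g i)
    rw [← PrimeSpectrum.comap_comp_apply, ← PrimeSpectrum.comap_comp_apply, hσ]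

variable (s : Datum k σk)

/-! ### The shapes of the components -/

/-- `next` as a permutation. -/
def nextPerm : Equiv.Perm s.Vertex :=
  Equiv.ofBijective s.next (Finite.injective_iff_bijective.1 next_injective)

/-- The vertices of the directed cycle through `w`. -/
def cyc (w : s.Vertex) (a : ℤ) : s.Vertex := (s.nextPerm ^ a) w

/-- The length of the directed cycle through `w`. -/
def len (w : s.Vertex) : ℕ := MulAction.period s.nextPerm w

variable {s}

theorem len_pos (w : s.Vertex) : 0 < s.len w :=
  MulAction.period_pos_of_orderOf_pos (orderOf_pos _) w

theorem cyc_zero (w : s.Vertex) : s.cyc w 0 = w := rfl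

theorem cyc_cyc (w : s.Vertex) (a b : ℤ) : s.cyc (s.cyc w a) b = s.cyc w (a + b) := by
  rw [cyc, cyc, cyc, add_comm, zpow_add]
  rfl

theorem next_cyc (w : s.Vertex) (a : ℤ) : s.next (s.cyc w a) = s.cyc w (a + 1) := by
  rw [← cyc_cyc]
  rfl

theorem cyc_eq_iff (w : s.Vertex) (a b : ℤ) :
    s.cyc w a = s.cyc w b ↔ (s.len w : ℤ) ∣ a - b := by
  rw [len, ← MulAction.zpow_smul_eq_iff_period_dvd, sub_eq_neg_add, zpow_add, mul_smul, zpow_neg,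
    inv_smul_eq_iff]
  rfl

theorem cyc_eq_iff_of_lt {w : s.Vertex} {a b : ℤ} (h : |a - b| < s.len w) :
    s.cyc w a = s.cyc w b ↔ a = b := by
  rw [cyc_eq_iff]
  refine ⟨fun h' => sub_eq_zero.1 (Int.eq_zero_of_abs_lt_dvd h' h), fun h' => ?_⟩
  rw [h', sub_self]
  exact dvd_zero _

/-- The involution conjugates the permutation `next` into its inverse, the relation of a dihedral
group. -/
theorem dag_cyc (w : s.Vertex) (a : ℤ) : s.dag (s.cyc w a) = s.cyc (s.dag w) (-a) := by
  let δ : Equiv.Perm s.Vertex := Function.Involutive.toPerm s.dag s.dag_dag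
  have h : δ * s.nextPerm * δ⁻¹ = s.nextPerm⁻¹ := by
    rw [eq_inv_iff_mul_eq_one]
    refine Equiv.ext fun i => ?_
    change s.dag (s.next (s.dag (s.next i))) = i
    rw [s.next_dag_next, s.dag_dag]
  have h1 : δ * s.nextPerm ^ a * δ⁻¹ = s.nextPerm ^ (-a) := by
    rw [← conj_zpow, h, inv_zpow, zpow_neg]
  rw [cyc, cyc, ← h1]
  change _ = s.dag ((s.nextPerm ^ a) (s.dag (s.dag w)))
  rw [s.dag_dag]

theorem orbit_cyc (w : s.Vertex) (a : ℤ) : s.orbit (s.cyc w a) = s.orbit w := by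
  induction a with
  | zero => rfl
  | succ n ih => rw [← next_cyc, orbit_next, ih]
  | pred n ih => rw [← ih, ← orbit_next (s.cyc w (-n - 1)), next_cyc, sub_add_cancel]

theorem orbit_eq_iff (w i : s.Vertex) :
    s.orbit i = s.orbit w ↔ ∃ a, i = s.cyc w a ∨ i = s.dag (s.cyc w a) := by
  constructor
  · intro h
    have h1 : Relation.EqvGen (fun i j => j = s.next i ∨ j = s.dag i) i w := Quotient.exact h
    -- The vertices of the cycle and their duals are stable under both generating relations in
    -- either direction, so membership is constant along the equivalence.
    have key : ∀ x y, Relation.EqvGen (fun i j => j = s.next i ∨ j = s.dag i) x y →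
        ((∃ a, x = s.cyc w a ∨ x = s.dag (s.cyc w a)) ↔
          ∃ a, y = s.cyc w a ∨ y = s.dag (s.cyc w a)) := by
      intro x y hxy
      induction hxy with
      | rel x y h =>
        rcases h with rfl | rfl
        · constructor
          · rintro ⟨a, rfl | rfl⟩
            · exact ⟨a + 1, .inl (next_cyc w a)⟩
            · exact ⟨a - 1, .inr (by rw [dag_cyc, dag_cyc, next_cyc]; congr 1; ring)⟩
          · rintro ⟨a, h | h⟩
            · exact ⟨a - 1, .inl (next_injective (by rw [h, next_cyc, sub_add_cancel]))⟩
            · refine ⟨a + 1, .inr (next_injective ?_)⟩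
              rw [h, dag_cyc, dag_cyc, next_cyc]
              congr 1
              ring
        · constructor
          · rintro ⟨a, rfl | rfl⟩
            · exact ⟨a, .inr rfl⟩
            · exact ⟨a, .inl (s.dag_dag _)⟩
          · rintro ⟨a, h | h⟩
            · exact ⟨a, .inr (by rw [← h, s.dag_dag])⟩
            · exact ⟨a, .inl (by rw [← s.dag_dag x, h, s.dag_dag])⟩
      | refl x => rfl
      | symm x y _ h => exact h.symm
      | trans x y z _ _ h h' => exact h.trans h'
    exact (key i w h1).2 ⟨0, .inl rfl⟩
  · rintro ⟨a, rfl | rfl⟩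
    · exact orbit_cyc w a
    · rw [orbit_dag, orbit_cyc]

theorem exists_lt_cyc_eq (w : s.Vertex) (a : ℤ) : ∃ r : ℕ, r < s.len w ∧ s.cyc w a = s.cyc w r := by
  have h : 0 < (s.len w : ℤ) := by exact_mod_cast len_pos w
  refine ⟨(a % s.len w).toNat, ?_, ?_⟩
  · have := Int.emod_lt_of_pos a h
    have := Int.emod_nonneg a h.ne'
    omega
  · rw [Int.toNat_of_nonneg (Int.emod_nonneg a h.ne'), cyc_eq_iff]
    exact Int.dvd_self_sub_emod

/-- The vertices of an orbit that consists of a single cycle. -/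
theorem exists_lt_of_orbit_eq {w : s.Vertex} {t : ℤ} (ht : s.dag w = s.cyc w t) {i : s.Vertex}
    (h : s.orbit i = s.orbit w) : ∃ r : ℕ, r < s.len w ∧ i = s.cyc w r := by
  obtain ⟨a, rfl | rfl⟩ := (orbit_eq_iff w i).1 h
  · exact exists_lt_cyc_eq w a
  · rw [dag_cyc, ht, cyc_cyc]
    exact exists_lt_cyc_eq w _

/-- The hypothesis separates the cycle of `w` from its dual; the labels run once around the former.
-/
theorem nonempty_shapeCC {w : s.Vertex} (h : ∀ a, s.dag w ≠ s.cyc w a) :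
    ∃ p, Nonempty (s.ShapeCC (s.orbit w) p) := by
  obtain ⟨p, hp⟩ := Nat.exists_eq_succ_of_ne_zero (len_pos w).ne'
  have hp' : (s.len w : ℤ) = p + 1 := by rw [hp]; push_cast; ring
  refine ⟨p, ⟨⟨fun j => s.cyc w (j : ℕ), fun j => ?_, fun j j' hj => ?_, fun j j' hj => ?_,
    fun i => ?_⟩⟩⟩
  · rw [next_cyc, cyc_eq_iff, hp', Fin.val_add_one]
    split_ifs with hj
    · rw [hj, Fin.val_last]
      simp
    · simp
  · have h1 := (cyc_eq_iff_of_lt (by rw [hp', abs_lt]; omega)).1 hj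
    exact Fin.ext (by omega)
  · rw [dag_cyc] at hj
    refine h ((j' : ℕ) + (j : ℕ)) ?_
    rw [← cyc_cyc, ← hj, cyc_cyc, neg_add_cancel, cyc_zero]
  · rw [orbit_eq_iff]
    constructor
    · rintro ⟨a, h⟩
      obtain ⟨r, hr, ha⟩ := exists_lt_cyc_eq w a
      rw [ha] at h
      exact ⟨⟨r, by omega⟩, h⟩
    · rintro ⟨j, h⟩
      exact ⟨_, h⟩

/-- On indices modulo the length the involution is `a ↦ -a`. For length `2(p + 1)` it fixes exactly
`0` and `p + 1`; for length `2ℓ + 1` it fixes only `0` and exchanges `ℓ` and `ℓ + 1`, so that the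
arrow leaving `ℓ` is self-dual. -/
theorem nonempty_shape_of_fixed {w : s.Vertex} (h : s.dag w = w) :
    (∃ p, Nonempty (s.ShapeVV (s.orbit w) p)) ∨ ∃ ℓ, Nonempty (s.ShapeVE (s.orbit w) ℓ) := by
  have h0 : s.dag w = s.cyc w 0 := h
  have hpos := len_pos w
  have hd : ∀ a, s.dag (s.cyc w a) = s.cyc w (-a) := fun a => by rw [dag_cyc, h]
  have hmem : ∀ a, s.orbit (s.cyc w a) = s.orbit w := orbit_cyc w
  obtain ⟨ℓ, hℓ | hℓ⟩ := Nat.even_or_odd' (s.len w)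
  · obtain ⟨p, rfl⟩ := Nat.exists_eq_succ_of_ne_zero (show ℓ ≠ 0 by omega)
    have hℓ' : (s.len w : ℤ) = 2 * p + 2 := by rw [hℓ]; push_cast; ring
    refine .inl ⟨p, ⟨⟨fun j => s.cyc w (j : ℕ), fun j => ?_, fun j j' hj => ?_, fun j => ?_,
      fun j j' hj hj' => ?_, fun i => ?_⟩⟩⟩
    · rw [next_cyc, Fin.val_succ, Fin.val_castSucc, Nat.cast_succ]
    · have h1 := (cyc_eq_iff_of_lt (by rw [hℓ', abs_lt]; omega)).1 hj
      exact Fin.ext (by omega)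
    · rw [hd]
      constructor
      · intro hj
        by_cases hl : j = Fin.last (p + 1)
        · exact .inr hl
        · have hl' : (j : ℕ) < p + 1 := Fin.val_lt_last hl
          have h1 := (cyc_eq_iff_of_lt (by rw [hℓ', abs_lt]; omega)).1 hj
          exact .inl (Fin.ext (by rw [Fin.val_zero]; omega))
      · rintro (rfl | rfl)
        · simp
        · rw [cyc_eq_iff, hℓ', Fin.val_last]
          exact ⟨-1, by push_cast; ring⟩
    · rw [hd] at hj'
      have hlt : (j : ℕ) + j' < 2 * p + 2 := by
        have : (j : ℕ) ≠ j' := fun h => hj (Fin.ext h)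
        omega
      have h1 := (cyc_eq_iff_of_lt (by rw [hℓ', abs_lt]; omega)).1 hj'
      exact hj (Fin.ext (by omega))
    · constructor
      · intro hi
        obtain ⟨r, hr, rfl⟩ := exists_lt_of_orbit_eq h0 hi
        by_cases hr' : r < p + 2
        · exact ⟨⟨r, hr'⟩, .inl rfl⟩
        -- The indices beyond the labels are the negatives, modulo the length, of labels.
        · refine ⟨⟨2 * p + 2 - r, by omega⟩, .inr ?_⟩
          rw [hd, cyc_eq_iff, hℓ']
          exact ⟨1, by simp only; omega⟩
      · rintro ⟨j, rfl | rfl⟩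
        · exact hmem _
        · rw [orbit_dag, hmem]
  · have hℓ' : (s.len w : ℤ) = 2 * ℓ + 1 := by rw [hℓ]; push_cast; ring
    refine .inr ⟨ℓ, ⟨⟨fun j => s.cyc w (j : ℕ), fun j => ?_, ?_, fun j j' hj => ?_, fun j => ?_,
      fun j j' hj hj' => ?_, fun i => ?_⟩⟩⟩
    · rw [next_cyc, Fin.val_succ, Fin.val_castSucc, Nat.cast_succ]
    · rw [next_cyc, hd, cyc_eq_iff, hℓ', Fin.val_last]
      exact ⟨1, by ring⟩
    · have h1 := (cyc_eq_iff_of_lt (by rw [hℓ', abs_lt]; omega)).1 hj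
      exact Fin.ext (by omega)
    · rw [hd]
      constructor
      · intro hj
        have h1 := (cyc_eq_iff_of_lt (by rw [hℓ', abs_lt]; omega)).1 hj
        exact Fin.ext (by rw [Fin.val_zero]; omega)
      · rintro rfl
        simp
    · rw [hd] at hj'
      have h1 := (cyc_eq_iff_of_lt (by rw [hℓ', abs_lt]; omega)).1 hj'
      exact hj (Fin.ext (by omega))
    · constructor
      · intro hi
        obtain ⟨r, hr, rfl⟩ := exists_lt_of_orbit_eq h0 hi
        by_cases hr' : r < ℓ + 1
        · exact ⟨⟨r, hr'⟩, .inl rfl⟩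
        · refine ⟨⟨2 * ℓ + 1 - r, by omega⟩, .inr ?_⟩
          rw [hd, cyc_eq_iff, hℓ']
          exact ⟨1, by simp only; omega⟩
      · rintro ⟨j, rfl | rfl⟩
        · exact hmem _
        · rw [orbit_dag, hmem]

/-- The involution is now `a ↦ -1 - a`. Odd length `2ℓ + 1` would make `ℓ` a fixed index, so the
length is `2(p + 1)`, and the arrow from `p` to `p + 1` is the second self-dual one. -/
theorem nonempty_shapeEE {w : s.Vertex} (h : s.next (s.dag w) = w)
    (hw : ∀ i, s.orbit i = s.orbit w → s.dag i ≠ i) :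
    ∃ p, Nonempty (s.ShapeEE (s.orbit w) p) := by
  have h0 : s.dag w = s.cyc w (-1) := next_injective (by rw [h, next_cyc]; rfl)
  have hd : ∀ a, s.dag (s.cyc w a) = s.cyc w (-1 - a) := fun a => by
    rw [dag_cyc, h0, cyc_cyc, sub_eq_add_neg]
  have hmem : ∀ a, s.orbit (s.cyc w a) = s.orbit w := orbit_cyc w
  have hpos := len_pos w
  obtain ⟨ℓ, hℓ | hℓ⟩ := Nat.even_or_odd' (s.len w)
  swap
  · refine absurd ?_ (hw _ (hmem ℓ))
    rw [hd, cyc_eq_iff, hℓ]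
    exact ⟨-1, by push_cast; ring⟩
  obtain ⟨p, rfl⟩ := Nat.exists_eq_succ_of_ne_zero (show ℓ ≠ 0 by omega)
  have hℓ' : (s.len w : ℤ) = 2 * p + 2 := by rw [hℓ]; push_cast; ring
  refine ⟨p, ⟨⟨fun j => s.cyc w (j : ℕ), h, fun j => ?_, ?_, fun j j' hj => ?_,
    fun j j' hj' => ?_, fun i => ?_⟩⟩⟩
  · rw [next_cyc, Fin.val_succ, Fin.val_castSucc, Nat.cast_succ]
  · rw [next_cyc, hd, cyc_eq_iff, hℓ', Fin.val_last]
    exact ⟨1, by ring⟩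
  · have h1 := (cyc_eq_iff_of_lt (by rw [hℓ', abs_lt]; omega)).1 hj
    exact Fin.ext (by omega)
  · rw [hd] at hj'
    have h1 := (cyc_eq_iff_of_lt (by rw [hℓ', abs_lt]; omega)).1 hj'
    omega
  · constructor
    · intro hi
      obtain ⟨r, hr, rfl⟩ := exists_lt_of_orbit_eq h0 hi
      by_cases hr' : r < p + 1
      · exact ⟨⟨r, hr'⟩, .inl rfl⟩
      · refine ⟨⟨2 * p + 1 - r, by omega⟩, .inr ?_⟩
        rw [hd, cyc_eq_iff, hℓ']
        exact ⟨1, by simp only; omega⟩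
    · rintro ⟨j, rfl | rfl⟩
      · exact hmem _
      · rw [orbit_dag, hmem]

/-- If the cycle of `w` is its own dual, the involution acts on indices as `a ↦ t - a`. For `t = 2a`
the index `a` is fixed. For `t = 2a + 1` it exchanges `a` and `a + 1`, so `a + 1` as a new base
point has a self-dual incoming arrow. -/
theorem nonempty_shape (α : s.Orbit) :
    (∃ p, Nonempty (s.ShapeCC α p)) ∨ (∃ p, Nonempty (s.ShapeVV α p)) ∨
      (∃ ℓ, Nonempty (s.ShapeVE α ℓ)) ∨ (∃ p, Nonempty (s.ShapeEE α p)) := by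
  obtain ⟨w, rfl⟩ : ∃ w, s.orbit w = α := Quotient.exists_rep α
  by_cases h1 : ∃ i, s.orbit i = s.orbit w ∧ s.dag i = i
  · obtain ⟨i, hi, hd⟩ := h1
    rw [← hi]
    rcases nonempty_shape_of_fixed hd with h | h
    · exact .inr (.inl h)
    · exact .inr (.inr (.inl h))
  · by_cases h2 : ∃ t, s.dag w = s.cyc w t
    · obtain ⟨t, ht⟩ := h2
      have hd : ∀ a, s.dag (s.cyc w a) = s.cyc w (t - a) := fun a => by
        rw [dag_cyc, ht, cyc_cyc, sub_eq_add_neg]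
      obtain ⟨a, ha | ha⟩ := Int.even_or_odd' t
      · refine absurd ⟨s.cyc w a, orbit_cyc w a, ?_⟩ h1
        rw [hd, ha]
        congr 1
        ring
      · refine .inr (.inr (.inr ?_))
        rw [← orbit_cyc w (a + 1)]
        refine nonempty_shapeEE ?_ fun i hi hi' => h1 ⟨i, hi.trans (orbit_cyc w _), hi'⟩
        rw [hd, next_cyc, ha]
        congr 1
        ring
    · exact .inl (nonempty_shapeCC fun a ha => h2 ⟨a, ha⟩)

end Datum
end
end CyclicGrading

namespace CyclicGrading
noncomputable section
namespace Datum
variable {k : Type u} [Field k] {σk : k ≃+* k} {s : Datum k σk}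
namespace Choices
variable (C : s.Choices)

/-! ### The description of `H^α` and `g(ξ)^α` for each of the shapes -/

section

variable {R : Type u} [CommRing R] [Algebra s.k₀ R] {α : s.Orbit} {J : Type} {v : J → s.Vertex}

theorem homSummand_act (j j' : J) (h : s.next (v j) = v j') (g : s.Hα α R)
    (γ : ∀ j, C.AutR (v j) R) (hγ : ∀ j, C.IsComp g.1.toLinearMap (v j) (γ j).toLinearMap)
    {φ φ'} (hφ : ∀ (g₁ : C.AutR (v j) R) (g₂ : C.AutR (v j') R),
        C.IsComp g.1.toLinearMap _ g₁.toLinearMap → C.IsComp g.1.toLinearMap _ g₂.toLinearMap →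
        ∀ x, φ' (g₁ x) = g₂ (φ x)) : (C.homSummand v j j' h).act R γ φ φ' :=
  hφ _ _ (hγ j) (hγ j')

theorem outSummand_act (j : J) (h : s.next (v j) = s.dag (v j)) (g : s.Hα α R)
    (γ : ∀ j, C.AutR (v j) R) (hγ' : ∀ j, γ j ∈ C.GLD (v j) R)
    (hγ : ∀ j, C.IsComp g.1.toLinearMap (v j) (γ j).toLinearMap)
    {φ φ'} (hφ : ∀ (g₁ : C.AutR (v j) R) (g₂ : C.AutR (s.dag (v j)) R),
        C.IsComp g.1.toLinearMap _ g₁.toLinearMap → C.IsComp g.1.toLinearMap _ g₂.toLinearMap →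
        ∀ x, φ' (g₁ x) = g₂ (φ x)) : (C.outSummand v j h).act R γ φ φ' := by
  obtain ⟨T, hT, hT'⟩ := C.exists_isComp_of_mem_H g.2.1 (s.dag (v j))
  exact ⟨T, C.isContragredient_of_mem_H g.2.1 rfl (hγ' j) hT (hγ j) hT', hφ _ _ (hγ j) hT'⟩

theorem inSummand_act (j : J) (h : s.next (s.dag (v j)) = v j) (g : s.Hα α R)
    (γ : ∀ j, C.AutR (v j) R) (hγ' : ∀ j, γ j ∈ C.GLD (v j) R)
    (hγ : ∀ j, C.IsComp g.1.toLinearMap (v j) (γ j).toLinearMap)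
    {φ φ'} (hφ : ∀ (g₁ : C.AutR (s.dag (v j)) R) (g₂ : C.AutR (v j) R),
        C.IsComp g.1.toLinearMap _ g₁.toLinearMap → C.IsComp g.1.toLinearMap _ g₂.toLinearMap →
        ∀ x, φ' (g₁ x) = g₂ (φ x)) : (C.inSummand v j h).act R γ φ φ' := by
  obtain ⟨T, hT, hT'⟩ := C.exists_isComp_of_mem_H g.2.1 (s.dag (v j))
  exact ⟨T, C.isContragredient_of_mem_H g.2.1 rfl (hγ' j) hT (hγ j) hT', hφ _ _ hT' (hγ j)⟩

end

theorem isDescribedBy_shapeCC (α : s.Orbit) (p : ℕ) (q : s.ShapeCC α p) :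
    C.IsDescribedBy α q.v (fun j R _ _ => C.GLD (q.v j) R)
      (fun j : Fin (p + 1) => C.homSummand q.v j (j + 1) (q.arrow j)) := by
  refine C.isDescribedBy α q.v _ _ q.injective (fun j j' h => absurd h (q.dag_ne j j')) q.mem_iff
    (fun R _ _ j g => ⟨fun h => ⟨h, fun h' => absurd h' (q.dag_ne j j)⟩, fun h => h.1⟩)
    (fun e φ => ⟨fun h => ⟨h, fun h' => absurd h' (q.dag_ne e (e + 1))⟩, fun h => h.1⟩)
    q.injective (fun e e' h => absurd h (q.dag_ne _ _)) (fun i => ?_)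
    (fun e R _ _ g γ hγ' hγ φ φ' => C.homSummand_act e (e + 1) (q.arrow e) g γ hγ)
  rw [q.mem_iff]
  constructor
  · rintro ⟨j, h | h⟩
    · exact ⟨j, .inl h⟩
    -- The dual of the arrow `j - 1 → j` starts at the dual of `v j`; indices are cyclic.
    · refine ⟨j - 1, .inr ?_⟩
      change i = s.dag (q.v (j - 1 + 1))
      rwa [sub_add_cancel]
  · rintro ⟨e, h | h⟩
    · exact ⟨e, .inl h⟩
    · exact ⟨e + 1, .inr h⟩

theorem isDescribedBy_shapeVV (α : s.Orbit) (p : ℕ) (q : s.ShapeVV α p) :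
    C.IsDescribedBy α q.v
      (fun j R _ _ => if h : j = 0 ∨ j = Fin.last (p + 1)
        then C.Isom (q.v j) ((q.fixed_iff j).2 h) R else C.GLD (q.v j) R)
      (fun j : Fin (p + 1) => C.homSummand q.v j.castSucc j.succ (q.arrow j)) := by
  have hdag : ∀ j j', s.dag (q.v j) = q.v j' → j = j' := fun j j' h => by
    by_contra hj
    exact q.dag_ne j j' hj h
  refine C.isDescribedBy α q.v _ _ q.injective hdag q.mem_iff
    (fun R _ _ j g => ?_)
    (fun e φ => ⟨fun h => ⟨h, fun h' => absurd (hdag _ _ h') (Fin.castSucc_lt_succ).ne⟩,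
      fun h => h.1⟩)
    (q.injective.comp (Fin.castSucc_injective _)) (fun e e' h => ?_) (fun i => ?_)
    (fun e R _ _ g γ hγ' hγ φ φ' => C.homSummand_act e.castSucc e.succ (q.arrow e) g γ hγ)
  · split_ifs with h
    · exact ⟨fun hg => ⟨hg.1, fun _ => hg.2⟩, fun hg => ⟨hg.1, hg.2 ((q.fixed_iff j).2 h)⟩⟩
    · exact ⟨fun hg => ⟨hg, fun h' => absurd ((q.fixed_iff j).1 h') h⟩, fun hg => hg.1⟩
  · have h1 : e.succ = e'.castSucc := hdag _ _ h
    -- The dual of the arrow `e` starts at the dual of `v (e + 1)`. If that were a listed source, `v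
    -- (e + 1)` would be self-dual, but its index is neither first nor last.
    have h2 : s.dag (q.v e.succ) = q.v e.succ := h.trans (congrArg q.v h1.symm)
    rcases (q.fixed_iff _).1 h2 with h3 | h3
    · exact absurd h3 (Fin.succ_ne_zero e)
    · rw [h1] at h3
      exact absurd h3 (Fin.castSucc_lt_last e').ne
  · rw [q.mem_iff]
    constructor
    · rintro ⟨j, h | h⟩
      -- The last vertex is no listed source; being self-dual, it is the source of the dual of the
      -- last arrow.
      · by_cases hj : j = Fin.last (p + 1)
        · refine ⟨Fin.last p, .inr ?_⟩
          change i = s.dag (q.v (Fin.last p).succ)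
          rw [Fin.succ_last, ← hj, (q.fixed_iff j).2 (.inr hj), h]
        · exact ⟨j.castPred hj, .inl (by rw [h]; rfl)⟩
      · by_cases hj : j = 0
        · refine ⟨0, .inl ?_⟩
          rw [h, (q.fixed_iff j).2 (.inl hj), hj]
          rfl
        · obtain ⟨e, rfl⟩ := Fin.exists_succ_eq.2 hj
          exact ⟨e, .inr h⟩
    · rintro ⟨e, h | h⟩
      · exact ⟨e.castSucc, .inl h⟩
      · exact ⟨e.succ, .inr h⟩

theorem isDescribedBy_shapeVE (α : s.Orbit) (ℓ : ℕ) (q : s.ShapeVE α ℓ) :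
    C.IsDescribedBy α q.v
      (fun j R _ _ => if h : j = 0
        then C.Isom (q.v j) ((q.fixed_iff j).2 h) R else C.GLD (q.v j) R)
      (Sum.elim
        (fun j : Fin ℓ => C.homSummand q.v j.castSucc j.succ (q.arrow j))
        (fun _ : Unit => C.outSummand q.v (Fin.last ℓ) q.arrow_last)) := by
  have hdag : ∀ j j', s.dag (q.v j) = q.v j' → j = j' := fun j j' h => by
    by_contra hj
    exact q.dag_ne j j' hj h
  refine C.isDescribedBy α q.v _ _ q.injective hdag q.mem_iff (fun R _ _ j g => ?_) ?_ ?_ ?_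
    (fun i => ?_) ?_
  · split_ifs with h
    · exact ⟨fun hg => ⟨hg.1, fun _ => hg.2⟩, fun hg => ⟨hg.1, hg.2 ((q.fixed_iff j).2 h)⟩⟩
    · exact ⟨fun hg => ⟨hg, fun h' => absurd ((q.fixed_iff j).1 h') h⟩, fun hg => hg.1⟩
  · rintro (e | e) φ
    · exact ⟨fun h => ⟨h, fun h' => absurd (hdag _ _ h') (Fin.castSucc_lt_succ).ne⟩, fun h => h.1⟩
    · exact ⟨fun h => ⟨h.1, fun _ => h⟩, fun h => h.2 rfl⟩
  · rintro (e | e) (e' | e') h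
    · exact congrArg _ (Fin.castSucc_injective _ (q.injective h))
    · exact absurd (q.injective h) (Fin.castSucc_lt_last e).ne
    · exact absurd (q.injective h).symm (Fin.castSucc_lt_last e').ne
    · rfl
  · rintro (e | e) (e' | e') h
    · have h1 : e.succ = e'.castSucc := hdag _ _ h
      have h2 : s.dag (q.v e.succ) = q.v e.succ := h.trans (congrArg q.v h1.symm)
      exact absurd ((q.fixed_iff _).1 h2) (Fin.succ_ne_zero e)
    · have h1 : e.succ = Fin.last ℓ := hdag _ _ h
      have h2 : s.dag (q.v e.succ) = q.v e.succ := h.trans (congrArg q.v h1.symm)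
      exact absurd ((q.fixed_iff _).1 h2) (Fin.succ_ne_zero e)
    · have h1 : q.v (Fin.last ℓ) = q.v e'.castSucc := by rw [← s.dag_dag (q.v (Fin.last ℓ))]; exact h
      exact absurd (q.injective h1).symm (Fin.castSucc_lt_last e').ne
    · rfl
  · rw [q.mem_iff]
    constructor
    · rintro ⟨j, h | h⟩
      · by_cases hj : j = Fin.last ℓ
        · exact ⟨.inr (), .inl (by rw [h, hj]; rfl)⟩
        · exact ⟨.inl (j.castPred hj), .inl (by rw [h]; rfl)⟩
      · by_cases hj : j = 0
        · rw [(q.fixed_iff j).2 hj] at h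
          -- The self-dual vertex `v 0` is a listed source; for `ℓ = 0` it is that of the self-dual
          -- arrow, a loop.
          by_cases hj : j = Fin.last ℓ
          · exact ⟨.inr (), .inl (by rw [h, hj]; rfl)⟩
          · exact ⟨.inl (j.castPred hj), .inl (by rw [h]; rfl)⟩
        · obtain ⟨e, rfl⟩ := Fin.exists_succ_eq.2 hj
          exact ⟨.inl e, .inr h⟩
    · rintro ⟨e | e, h | h⟩
      · exact ⟨e.castSucc, .inl h⟩
      · exact ⟨e.succ, .inr h⟩
      · exact ⟨Fin.last ℓ, .inl h⟩
      · exact ⟨Fin.last ℓ, .inl (by rw [h]; exact s.dag_dag _)⟩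
  · rintro (e | e) R _ _ g γ hγ' hγ φ φ'
    · exact C.homSummand_act e.castSucc e.succ (q.arrow e) g γ hγ
    · exact C.outSummand_act (Fin.last ℓ) q.arrow_last g γ hγ' hγ

theorem isDescribedBy_shapeEE (α : s.Orbit) (p : ℕ) (q : s.ShapeEE α p) :
    C.IsDescribedBy α q.v (fun j R _ _ => C.GLD (q.v j) R)
      (Sum.elim
        (fun _ : Unit => C.inSummand q.v 0 q.arrow_first)
        (Sum.elim
          (fun j : Fin p => C.homSummand q.v j.castSucc j.succ (q.arrow j))
          (fun _ : Unit => C.outSummand q.v (Fin.last p) q.arrow_last))) := by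
  refine C.isDescribedBy α q.v _ _ q.injective (fun j j' h => absurd h (q.dag_ne j j')) q.mem_iff
    (fun R _ _ j g => ⟨fun h => ⟨h, fun h' => absurd h' (q.dag_ne j j)⟩, fun h => h.1⟩)
    ?_ ?_ ?_ (fun i => ?_) ?_
  · rintro (e | e | e) φ
    · exact ⟨fun h => ⟨h.1, fun _ => h⟩, fun h => h.2 (s.dag_dag _)⟩
    · exact ⟨fun h => ⟨h, fun h' => absurd h' (q.dag_ne _ _)⟩, fun h => h.1⟩
    · exact ⟨fun h => ⟨h.1, fun _ => h⟩, fun h => h.2 rfl⟩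
  · rintro (e | e | e) (e' | e' | e') h
    · rfl
    · exact absurd h (q.dag_ne _ _)
    · exact absurd h (q.dag_ne _ _)
    · exact absurd h.symm (q.dag_ne _ _)
    · exact congrArg (Sum.inr ∘ Sum.inl) (Fin.castSucc_injective _ (q.injective h))
    · exact absurd (q.injective h) (Fin.castSucc_lt_last e).ne
    · exact absurd h.symm (q.dag_ne _ _)
    · exact absurd (q.injective h).symm (Fin.castSucc_lt_last e').ne
    · rfl
  · have hdd : ∀ j j', s.dag (q.v j) = s.dag (q.v j') → j = j' := fun j j' h =>
      q.injective (by rw [← s.dag_dag (q.v j), h, s.dag_dag])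
    have hdd' : ∀ j j', s.dag (s.dag (q.v j)) = q.v j' → j = j' := fun j j' h =>
      q.injective (by rw [← h, s.dag_dag])
    rintro (e | e | e) (e' | e' | e') h
    · rfl
    · exact absurd h (q.dag_ne _ _)
    · exact absurd h (q.dag_ne _ _)
    · exact absurd (hdd _ _ h) (Fin.succ_ne_zero e)
    · exact absurd h (q.dag_ne _ _)
    · exact absurd h (q.dag_ne _ _)
    · exact absurd ((s.dag_dag _).symm.trans h).symm (q.dag_ne 0 (Fin.last p))
    · exact absurd (hdd' _ _ h).symm (Fin.castSucc_lt_last e').ne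
    · rfl
  · rw [q.mem_iff]
    constructor
    · rintro ⟨j, h | h⟩
      · by_cases hj : j = Fin.last p
        · exact ⟨.inr (.inr ()), .inl (by rw [h, hj]; rfl)⟩
        · exact ⟨.inr (.inl (j.castPred hj)), .inl (by rw [h]; rfl)⟩
      -- The dual of `v 0` is the source of the self-dual arrow into `v 0`.
      · by_cases hj : j = 0
        · exact ⟨.inl (), .inl (by rw [h, hj]; rfl)⟩
        · obtain ⟨e, rfl⟩ := Fin.exists_succ_eq.2 hj
          exact ⟨.inr (.inl e), .inr h⟩
    · rintro ⟨e | e | e, h | h⟩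
      · exact ⟨0, .inr h⟩
      · exact ⟨0, .inr h⟩
      · exact ⟨e.castSucc, .inl h⟩
      · exact ⟨e.succ, .inr h⟩
      · exact ⟨Fin.last p, .inl h⟩
      · exact ⟨Fin.last p, .inl (by rw [h]; exact s.dag_dag _)⟩
  · rintro (e | e | e) R _ _ g γ hγ' hγ φ φ'
    · exact C.inSummand_act 0 q.arrow_first g γ hγ' hγ
    · exact C.homSummand_act e.castSucc e.succ (q.arrow e) g γ hγ
    · exact C.outSummand_act (Fin.last p) q.arrow_last g γ hγ' hγ

end Choices
end Datum
end
end CyclicGrading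

/-! ### The theorem -/

theorem mainTheorem1 {k : Type u} [Field k] {σk : k ≃+* k} :
    -- the quiver with its involution depends only on `m/n`, `β`, `Nm(c)`, `Nm(ξ)` (and `k`, `σ|_k`)
    (∀ s₁ s₂ : CyclicGrading.Datum k σk, s₁.r = s₂.r → s₁.β = s₂.β → s₁.Nc = s₂.Nc →
      s₁.Nξ = s₂.Nξ → ∃ f : s₁.Vertex ≃ s₂.Vertex,
        ∀ i, f (s₁.next i) = s₂.next (f i) ∧ f (s₁.dag i) = s₂.dag (f i)) ∧
    ∀ s : CyclicGrading.Datum k σk,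
      -- `H` is the product of the `H^α`, and `g(ξ)` is the direct sum of the `g(ξ)^α`
      (∃ Φ : ∀ (R : Type u) [CommRing R] [Algebra s.k₀ R], s.H R ≃* ∀ α : s.Orbit, s.Hα α R,
        ∀ (R : Type u) [CommRing R] [Algebra s.k₀ R] (g : s.H R) (i : s.Vertex),
          ∀ v ∈ s.isotypic i, (Φ R g (s.orbit i)).1 ((1 : R) ⊗ₜ[s.k₀] v) = g.1 (1 ⊗ₜ v)) ∧
      (∃ Ψ : s.gξ ≃ₗ[s.k₀] ∀ α : s.Orbit, s.gξα α,
        ∀ (φ : s.gξ) (i : s.Vertex), ∀ v ∈ s.isotypic i, (Ψ φ (s.orbit i)).1 v = φ.1 v) ∧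
      -- every orbit of components has one of the four shapes
      (∀ α : s.Orbit, (∃ p, Nonempty (s.ShapeCC α p)) ∨ (∃ p, Nonempty (s.ShapeVV α p)) ∨
        (∃ ℓ, Nonempty (s.ShapeVE α ℓ)) ∨ (∃ p, Nonempty (s.ShapeEE α p))) ∧
      -- simple modules, pairings and isomorphisms `η_e` as required exist; for all such choices:
      Nonempty s.Choices ∧
      ∀ (C : s.Choices) (α : s.Orbit),
        (∀ (p : ℕ) (q : s.ShapeCC α p),
          C.IsDescribedBy α q.v (fun j R _ _ => C.GLD (q.v j) R)
            (fun j : Fin (p + 1) => C.homSummand q.v j (j + 1) (q.arrow j))) ∧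
        (∀ (p : ℕ) (q : s.ShapeVV α p),
          C.IsDescribedBy α q.v
            (fun j R _ _ => if h : j = 0 ∨ j = Fin.last (p + 1)
              then C.Isom (q.v j) ((q.fixed_iff j).2 h) R else C.GLD (q.v j) R)
            (fun j : Fin (p + 1) => C.homSummand q.v j.castSucc j.succ (q.arrow j))) ∧
        (∀ (ℓ : ℕ) (q : s.ShapeVE α ℓ),
          C.IsDescribedBy α q.v
            (fun j R _ _ => if h : j = 0
              then C.Isom (q.v j) ((q.fixed_iff j).2 h) R else C.GLD (q.v j) R)
            (Sum.elim
              (fun j : Fin ℓ => C.homSummand q.v j.castSucc j.succ (q.arrow j))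
              (fun _ : Unit => C.outSummand q.v (Fin.last ℓ) q.arrow_last))) ∧
        (∀ (p : ℕ) (q : s.ShapeEE α p),
          C.IsDescribedBy α q.v (fun j R _ _ => C.GLD (q.v j) R)
            (Sum.elim
              (fun _ : Unit => C.inSummand q.v 0 q.arrow_first)
              (Sum.elim
                (fun j : Fin p => C.homSummand q.v j.castSucc j.succ (q.arrow j))
                (fun _ : Unit => C.outSummand q.v (Fin.last p) q.arrow_last)))) := by
  refine ⟨fun s₁ s₂ hr hβ hc hξ => CyclicGrading.Datum.exists_vertex_equiv hr hβ hc hξ, fun s => ?_⟩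
  -- The decomposition of `H` does not mention the choices, but it is built from components on the
  -- `M_i`, so one choice is fixed for it.
  obtain ⟨C⟩ := s.nonempty_choices
  exact ⟨C.exists_H_equiv_isotypic, s.exists_gξ_equiv, CyclicGrading.Datum.nonempty_shape, ⟨C⟩,
    fun C α => ⟨C.isDescribedBy_shapeCC α, C.isDescribedBy_shapeVV α, C.isDescribedBy_shapeVE α,
      C.isDescribedBy_shapeEE α⟩⟩
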